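/- **Setting.** Let $N\ge 2$ and let $\phi:(0,\infty)\to(0,\infty)$ be $C^1$, $\Phi(t)=\int_0^{|t|}\phi(s)s\,ds$. Assume: $(\phi(t)t)'>0$ for $t>0$; there are $l,m\in(1,N)$ with $l\le m<l^*=\frac{Nl}{N-l}$ and $l\le \frac{\phi(t)t^2}{\Phi(t)}\le m$ for $t>0$; $\phi(t)/t^{m-2}$ is nonincreasing on $(0,\infty)$; $\phi$ is monotone; and $|\phi'(t)t|\le c\,\phi(t)$ for $t>0$, for some $c>0$. Put $\gamma=m$ if $\Phi(t)\ge|t|^m$ for all $t\in\mathbb R$ and $\gamma=l$ otherwise, $\gamma^*=\frac{N\gamma}{N-\gamma}$, and let $\Phi_*$ be the inverse function of $t\mapsto\int_0^t \Phi^{-1}(s)s^{-1-1/N}ds$. Let $r,b:(0,\infty)\to[0,\infty)$ be $C^1$ and nondecreasing, $R(t)=\int_0^{|t|}r(s)s\,ds$, $B(t)=\int_0^{|t|}b(s)s\,ds$, with $|r'(t)t|\le \bar c\,r(t)$, $|b'(t)t|\le\tilde c\,b(t)$, $r_1\le \frac{r(t)t^2}{R(t)}\le r_2$ and $b_1\le\frac{b(t)t^2}{B(t)}\le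 b_2$ for $t>0$, where $\bar c,\tilde c,r_1,r_2>0$ and $b_1,b_2\in(1,\gamma^*)$, and $$\limsup_{t\to0^+}\tfrac{R(t)}{\Phi(t)}<\infty,\quad \lim_{t\to\infty}\tfrac{R(t)}{\Phi_*(t)}=0,\quad \limsup_{t\to0^+}\tfrac{B(t)}{\Phi(t)}<\infty,\quad \lim_{t\to\infty}\tfrac{B(t)}{\Phi_*(t)}=0 .$$ Let $f\in C^1(\mathbb R)$ vanish on $(-\infty,0)$, with $$\lim_{t\to0^+}\frac{f'(t)}{(r(t)t)'}=0,\qquad \limsup_{t\to\infty}\frac{|f'(t)|}{(b(t)t)'}<\infty,$$ with $0<\theta F(t)\le f(t)t$ for all $t>0$ and some $\theta>m$, where $F(t)=\int_0^tf$, and with $f(t)/t^{m-1}$ strictly increasing on $(0,\infty)$. Let $V:\mathbb R^N\to\mathbb R$ be continuous with $V_0=\inf V>0$, and let $\Omega\subset\mathbb R^N$ be open and bounded with $\inf_\Omega V<\min_{\partial\Omega}V$. Let $a,k>0$ satisfy $k>\frac{\theta-l}{\theta-m}\cdot\frac ml$ and $\frac{f(a)}{\phi(a)a}=\frac{V_0}{k}$.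 Put $\widehat f(s)=f(s)$ for $s\le a$ and $\widehat f(s)=\frac{V_0}{k}\phi(s)s$ for $s>a$. Let $0<t_0<a<t_1$ and let $\eta\in C^1([t_0,t_1])$ satisfy $\eta\le\widehat f$ on $[t_0,t_1]$, $\eta=\widehat f$ and $\eta'=\widehat f\,'$ at $t_0$ and at $t_1$, and $\frac{\eta(s)}{\phi(s)s}$ nondecreasing on $[t_0,t_1]$. Put $\widetilde f=\eta$ on $[t_0,t_1]$ and $\widetilde f=\widehat f$ elsewhere, $g(x,s)=f(s)$ if $x\in\Omega$ and $g(x,s)=\widetilde f(s)$ if $x\notin\Omega$, and $G(x,s)=\int_0^sg(x,t)\,dt$. For $\epsilon>0$ let $X_\epsilon=\{u\in W^{1,\Phi}(\mathbb R^N):\int V(\epsilon x)\Phi(|u|)\,dx<\infty\}$ with the norm $\|u\|_\epsilon=\|\nabla u\|_\Phi+\|u\|_{\Phi,V_\epsilon}$, where $\|\cdot\|_\Phi$ is the Luxemburg norm for $dx$ and $\|\cdot\|_{\Phi,V_\epsilon}$ the one for $V(\epsilon x)\,dx$, and let $$J_\epsilon(u)=\int_{\mathbb R^N}\Phi(|\nabla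 u|)\,dx+\int_{\mathbb R^N}V(\epsilon x)\Phi(|u|)\,dx-\int_{\mathbb R^N}G(\epsilon x,u)\,dx .$$ Let $L_\epsilon(u)=J_\epsilon'(u)u$ and $\mathcal N_\epsilon=\{u\in X_\epsilon\setminus\{0\}:L_\epsilon(u)=0\}$. Let $d_0=\inf_{\alpha}\max_{t\in[0,1]}E_0(\alpha(t))$ be the mountain pass level of $$E_0(u)=\int_{\mathbb R^N}\Phi(|\nabla u|)\,dx+V_0\int_{\mathbb R^N}\Phi(|u|)\,dx-\int_{\mathbb R^N}F(u)\,dx$$ on $Y=W^{1,\Phi}(\mathbb R^N)$ with the norm $\|\nabla u\|_\Phi+V_0\|u\|_\Phi$, where $\alpha$ runs over the continuous paths $[0,1]\to Y$ with $\alpha(0)=0$ and $E_0(\alpha(1))<0$. **Proposition.** For every $\epsilon>0$: 0. $J_\epsilon$ and $L_\epsilon$ are of class $C^1$ on $X_\epsilon$, and $L_\epsilon'(u)\ne0$ for $u\in\mathcal N_\epsilon$ (so $\mathcal N_\epsilon$ is a $C^1$ manifold with tangent space $\ker L_\epsilon'(u)$ at $u$). 1. $J_\epsilon$ satisfies the Palais–Smale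 condition: for every $c\in\mathbb R$, every sequence $(u_n)$ in $X_\epsilon$ with $J_\epsilon(u_n)\to c$ and $\|J_\epsilon'(u_n)\|\to0$ has a subsequence that converges in $X_\epsilon$. 2. For every $c\in(0,d_0+1)$, the restriction of $J_\epsilon$ to $\mathcal N_\epsilon$ satisfies $(PS)_c$: every sequence $(u_n)$ in $\mathcal N_\epsilon$ with $J_\epsilon(u_n)\to c$ and $\big\|J_\epsilon'(u_n)|_{\ker L_\epsilon'(u_n)}\big\|\to0$ has a subsequence that converges in $X_\epsilon$ to a point of $\mathcal N_\epsilon$. 3. If $u\in\mathcal N_\epsilon$ is a critical point of the restriction of $J_\epsilon$ to $\mathcal N_\epsilon$, that is, $J_\epsilon'(u)=0$ on $\ker L_\epsilon'(u)$, then $J_\epsilon'(u)=0$ on $X_\epsilon$. -/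

import Mathlib

open MeasureTheory Set Filter Topology

namespace OrliczNehari

/-! ### N-functions and Sobolev conjugates -/

/-- The even function `Φ(t) = ∫₀^{|t|} φ(s) s ds` generated by `φ`. Only the values of `φ` on
`(0, ∞)` matter. It is also used to build `R` from `r` and `B` from `b`. -/
noncomputable def nFun (φ : ℝ → ℝ) (t : ℝ) : ℝ := ∫ s in (0 : ℝ)..|t|, φ s * s

/-- The inverse of a bijection `h : [0, ∞) → [0, ∞)`. -/
noncomputable def halfLineInv (h : ℝ → ℝ) : ℝ → ℝ := Function.invFunOn h (Ici 0)

/-- `G_Φ(t) = ∫₀ᵗ Φ⁻¹(s) / s^{1 + 1/N} ds`. -/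
noncomputable def sobolevPrimitive (N : ℕ) (Φ : ℝ → ℝ) (t : ℝ) : ℝ :=
  ∫ s in (0 : ℝ)..t, halfLineInv Φ s / s ^ (1 + 1 / (N : ℝ))

/-- The Sobolev conjugate function `Φ_*`, the inverse function of `G_Φ` (extended evenly). -/
noncomputable def sobolevConj (N : ℕ) (Φ : ℝ → ℝ) (t : ℝ) : ℝ :=
  halfLineInv (sobolevPrimitive N Φ) |t|

/-- The assumptions on `φ : (0, ∞) → (0, ∞)`, with exponents `l ≤ m` in `(1, N)`. -/
structure PhiAssumptions (N : ℕ) (φ : ℝ → ℝ) (l m : ℝ) : Prop where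
  contDiffOn : ContDiffOn ℝ 1 φ (Ioi 0)
  pos : ∀ t > 0, 0 < φ t
  deriv_pos : ∀ t > 0, 0 < deriv (fun s => φ s * s) t
  one_lt_l : 1 < l
  l_le_m : l ≤ m
  m_lt_dim : m < N
  m_lt_conj : m < N * l / (N - l)
  ratio_lower : ∀ t > 0, l ≤ φ t * t ^ 2 / nFun φ t
  ratio_upper : ∀ t > 0, φ t * t ^ 2 / nFun φ t ≤ m
  antitone_quot : AntitoneOn (fun t => φ t / t ^ (m - 2)) (Ioi 0)
  monotone_or : MonotoneOn φ (Ioi 0) ∨ AntitoneOn φ (Ioi 0)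
  deriv_bound : ∃ c > 0, ∀ t > 0, |deriv φ t * t| ≤ c * φ t

namespace PhiAssumptions

variable {N : ℕ} {φ : ℝ → ℝ} {l m : ℝ}

theorem differentiableAt (h : PhiAssumptions N φ l m) {t : ℝ} (ht : 0 < t) :
    DifferentiableAt ℝ φ t :=
  (h.contDiffOn.differentiableOn one_ne_zero).differentiableAt (Ioi_mem_nhds ht)

theorem strictMonoOn_mul (h : PhiAssumptions N φ l m) :
    StrictMonoOn (fun s => φ s * s) (Ioi 0) := by
  refine strictMonoOn_of_deriv_pos (convex_Ioi 0) ?_ ?_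
  · exact h.contDiffOn.continuousOn.mul continuousOn_id
  · intro t ht
    rw [interior_Ioi] at ht
    exact h.deriv_pos t ht

/-- `φ(s) s` extended by zero to the left of the origin. -/
noncomputable def mulExt (φ : ℝ → ℝ) (s : ℝ) : ℝ := if 0 < s then φ s * s else 0

theorem mulExt_mono (h : PhiAssumptions N φ l m) : Monotone (mulExt φ) := by
  intro s t hst
  unfold mulExt
  split_ifs with h1 h2 h2
  · exact h.strictMonoOn_mul.monotoneOn h1 h2 hst
  · exact absurd (h1.trans_le hst) h2
  · exact (mul_pos (h.pos t h2) h2).le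
  · exact le_rfl

theorem mulExt_nonneg (h : PhiAssumptions N φ l m) (s : ℝ) : 0 ≤ mulExt φ s := by
  unfold mulExt
  split_ifs with h1
  · exact (mul_pos (h.pos s h1) h1).le
  · exact le_rfl

theorem mulExt_int (h : PhiAssumptions N φ l m) (a b : ℝ) :
    IntervalIntegrable (mulExt φ) volume a b := h.mulExt_mono.intervalIntegrable

theorem nFun_eq (t : ℝ) : nFun φ t = ∫ s in (0 : ℝ)..|t|, mulExt φ s := by
  unfold nFun
  refine intervalIntegral.integral_congr_ae (Eventually.of_forall fun s hs => ?_)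
  rw [uIoc_of_le (abs_nonneg t)] at hs
  simp [mulExt, hs.1]

theorem nFun_zero : nFun φ 0 = 0 := by simp [nFun]

theorem nFun_nonneg (h : PhiAssumptions N φ l m) (t : ℝ) : 0 ≤ nFun φ t := by
  rw [nFun_eq]
  exact intervalIntegral.integral_nonneg (abs_nonneg t) fun s _ => h.mulExt_nonneg s

theorem nFun_mono (h : PhiAssumptions N φ l m) {s t : ℝ} (hst : |s| ≤ |t|) :
    nFun φ s ≤ nFun φ t := by
  rw [nFun_eq, nFun_eq]
  exact intervalIntegral.integral_mono_interval le_rfl (abs_nonneg s) hst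
    (Eventually.of_forall fun x => h.mulExt_nonneg x) (h.mulExt_int _ _)

theorem nFun_pos (h : PhiAssumptions N φ l m) {t : ℝ} (ht : 0 < t) : 0 < nFun φ t := by
  rw [nFun_eq, abs_of_pos ht]
  refine intervalIntegral.intervalIntegral_pos_of_pos_on (h.mulExt_int _ _) (fun x hx => ?_) ht
  simp only [mulExt, hx.1, if_true]
  exact mul_pos (h.pos x hx.1) hx.1

theorem measurable_nFun (h : PhiAssumptions N φ l m) : Measurable (nFun φ) := by
  have h1 : Continuous fun t : ℝ => ∫ s in (0 : ℝ)..t, mulExt φ s :=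
    intervalIntegral.continuous_primitive h.mulExt_int 0
  have : nFun φ = fun t => ∫ s in (0 : ℝ)..|t|, mulExt φ s := funext fun t => nFun_eq t
  rw [this]
  exact (h1.comp continuous_abs).measurable

theorem convexOn_nFun (h : PhiAssumptions N φ l m) : ConvexOn ℝ (Ici 0) (nFun φ) := by
  have h1 : ConvexOn ℝ (Ici 0) fun t : ℝ => ∫ s in (0 : ℝ)..t, mulExt φ s := by
    have hd : ∀ t > 0, HasDerivAt (fun t : ℝ => ∫ s in (0 : ℝ)..t, mulExt φ s) (mulExt φ t) t := by
      intro t ht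
      refine intervalIntegral.integral_hasDerivAt_right (h.mulExt_int _ _)
        h.mulExt_mono.measurable.stronglyMeasurable.stronglyMeasurableAtFilter ?_
      have : (fun s => φ s * s) =ᶠ[𝓝 t] mulExt φ := by
        filter_upwards [Ioi_mem_nhds ht] with s hs
        have hs' : 0 < s := hs
        simp [mulExt, hs']
      exact ((h.differentiableAt ht).continuousAt.mul continuousAt_id).congr this
    refine MonotoneOn.convexOn_of_deriv (convex_Ici 0)
      (intervalIntegral.continuous_primitive h.mulExt_int 0).continuousOn ?_ ?_
    · intro t ht
      rw [interior_Ici] at ht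
      exact (hd t ht).differentiableAt.differentiableWithinAt
    · intro s hs t ht hst
      rw [interior_Ici] at hs ht
      rw [(hd s hs).deriv, (hd t ht).deriv]
      exact h.mulExt_mono hst
  refine h1.congr fun t ht => ?_
  have ht' : 0 ≤ t := ht
  simp only [nFun_eq, abs_of_nonneg ht']

/-- The doubling condition. -/
theorem nFun_two_mul (h : PhiAssumptions N φ l m) {t : ℝ} (ht : 0 ≤ t) :
    nFun φ (2 * t) ≤ 2 ^ m * nFun φ t := by
  have key : ∀ s, mulExt φ (2 * s) ≤ 2 ^ m / 2 * mulExt φ s := by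
    intro s
    by_cases hs : 0 < s
    · have hs2 : 0 < 2 * s := by linarith
      have h1 := h.antitone_quot (mem_Ioi.2 hs) (mem_Ioi.2 hs2) (by linarith)
      simp only [mulExt, hs, hs2, if_true]
      have e1 : (2 * s) ^ (m - 2) = 2 ^ (m - 2) * s ^ (m - 2) :=
        Real.mul_rpow (by norm_num) hs.le
      have e2 : (2 : ℝ) ^ (m - 2) = 2 ^ m / 4 := by
        rw [Real.rpow_sub (by norm_num)]; norm_num
      have hp : 0 < s ^ (m - 2) := Real.rpow_pos_of_pos hs _
      have hp2 : (0 : ℝ) < 2 ^ m := Real.rpow_pos_of_pos (by norm_num) _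
      simp only [e1, e2] at h1
      rw [div_le_div_iff₀ (by positivity) hp] at h1
      have h2 : φ (2 * s) ≤ φ s * (2 ^ m / 4) := by
        refine le_of_mul_le_mul_right ?_ hp
        linarith
      nlinarith
    · have hs2 : ¬ 0 < 2 * s := by linarith
      simp [mulExt, hs, hs2]
  rw [nFun_eq, nFun_eq, abs_of_nonneg ht, abs_of_nonneg (by linarith : (0 : ℝ) ≤ 2 * t)]
  have e : ∫ s in (0 : ℝ)..2 * t, mulExt φ s = 2 * ∫ s in (0 : ℝ)..t, mulExt φ (2 * s) := by
    rw [intervalIntegral.integral_comp_mul_left (mulExt φ) two_ne_zero]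
    simp
  rw [e]
  have i2 : IntervalIntegrable (fun s => mulExt φ (2 * s)) volume 0 t := by
    refine Monotone.intervalIntegrable fun a b hab => h.mulExt_mono ?_
    linarith
  have := intervalIntegral.integral_mono_on ht i2 ((h.mulExt_int 0 t).const_mul (2 ^ m / 2))
    fun s _ => key s
  rw [intervalIntegral.integral_const_mul] at this
  linarith

theorem nFun_mul_le (h : PhiAssumptions N φ l m) {a t : ℝ} (ha : 0 ≤ a) (ha1 : a ≤ 1)
    (ht : 0 ≤ t) : nFun φ (a * t) ≤ a * nFun φ t := by
  have := h.convexOn_nFun.2 (mem_Ici.2 ht) (mem_Ici.2 le_rfl) ha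
    (by linarith : (0 : ℝ) ≤ 1 - a) (by ring)
  simpa [nFun_zero] using this

end PhiAssumptions

/-! ### Orlicz classes and the Luxemburg norm -/

section Luxemburg

variable {α F : Type*} [MeasurableSpace α] [NormedAddCommGroup F]

/-- The modular `∫ Φ(|u|) dμ`, as an extended nonnegative number. -/
noncomputable def modular (Φ : ℝ → ℝ) (μ : Measure α) (u : α → F) : ENNReal :=
  ∫⁻ x, ENNReal.ofReal (Φ ‖u x‖) ∂μ

/-- Membership in the Orlicz space `L^Φ(μ)`: `∫ Φ(|u| / λ) dμ < ∞` for some `λ > 0`. -/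
def MemOrlicz (Φ : ℝ → ℝ) (μ : Measure α) (u : α → F) : Prop :=
  ∃ c > (0 : ℝ), ∫⁻ x, ENNReal.ofReal (Φ (‖u x‖ / c)) ∂μ < ⊤

/-- The Luxemburg norm `inf {λ > 0 : ∫ Φ(|u| / λ) dμ ≤ 1}`. -/
noncomputable def luxNorm (Φ : ℝ → ℝ) (μ : Measure α) (u : α → F) : ℝ :=
  sInf {c : ℝ | 0 < c ∧ ∫⁻ x, ENNReal.ofReal (Φ (‖u x‖ / c)) ∂μ ≤ 1}

variable {N : ℕ} {φ : ℝ → ℝ} {l m : ℝ} {μ : Measure α} {u v : α → F}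

theorem modular_congr {Φ : ℝ → ℝ} (h : u =ᵐ[μ] v) : modular Φ μ u = modular Φ μ v :=
  lintegral_congr_ae (h.mono fun x hx => by simp only [hx])

theorem luxNorm_congr {Φ : ℝ → ℝ} (h : u =ᵐ[μ] v) : luxNorm Φ μ u = luxNorm Φ μ v := by
  have : ∀ c : ℝ, ∫⁻ x, ENNReal.ofReal (Φ (‖u x‖ / c)) ∂μ
      = ∫⁻ x, ENNReal.ofReal (Φ (‖v x‖ / c)) ∂μ := fun c =>
    lintegral_congr_ae (h.mono fun x hx => by simp only [hx])
  simp only [luxNorm, this]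

theorem modular_two_mul (h : PhiAssumptions N φ l m) {g : α → ℝ} (hg : ∀ x, 0 ≤ g x)
    (hfin : ∫⁻ x, ENNReal.ofReal (nFun φ (g x)) ∂μ < ⊤) :
    ∫⁻ x, ENNReal.ofReal (nFun φ (2 * g x)) ∂μ < ⊤ := by
  have hle : ∀ x, ENNReal.ofReal (nFun φ (2 * g x))
      ≤ ENNReal.ofReal (2 ^ m) * ENNReal.ofReal (nFun φ (g x)) := fun x => by
    rw [← ENNReal.ofReal_mul (by positivity)]
    exact ENNReal.ofReal_le_ofReal (h.nFun_two_mul (hg x))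
  refine (lintegral_mono hle).trans_lt ?_
  rw [lintegral_const_mul' _ _ ENNReal.ofReal_ne_top]
  exact ENNReal.mul_lt_top ENNReal.ofReal_lt_top hfin

theorem modular_mul (h : PhiAssumptions N φ l m) {g : α → ℝ} (hg : ∀ x, 0 ≤ g x)
    (hfin : ∫⁻ x, ENNReal.ofReal (nFun φ (g x)) ∂μ < ⊤) (c : ℝ) :
    ∫⁻ x, ENNReal.ofReal (nFun φ (c * g x)) ∂μ < ⊤ := by
  have hpow : ∀ n : ℕ, ∫⁻ x, ENNReal.ofReal (nFun φ (2 ^ n * g x)) ∂μ < ⊤ := by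
    intro n
    induction n with
    | zero => simpa using hfin
    | succ n ih =>
      have := modular_two_mul h (g := fun x => 2 ^ n * g x)
        (fun x => mul_nonneg (by positivity) (hg x)) ih
      simpa only [pow_succ', mul_assoc] using this
  obtain ⟨n, hn⟩ := pow_unbounded_of_one_lt |c| (one_lt_two : (1 : ℝ) < 2)
  refine (lintegral_mono fun x => ?_).trans_lt (hpow n)
  refine ENNReal.ofReal_le_ofReal (h.nFun_mono ?_)
  rw [abs_mul, abs_mul]
  refine mul_le_mul_of_nonneg_right ?_ (abs_nonneg _)
  rw [abs_of_pos (by positivity : (0 : ℝ) < 2 ^ n)]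
  exact hn.le

theorem memOrlicz_iff (h : PhiAssumptions N φ l m) :
    MemOrlicz (nFun φ) μ u ↔ modular (nFun φ) μ u < ⊤ := by
  constructor
  · rintro ⟨c, hc, hfin⟩
    have := modular_mul h (fun x => div_nonneg (norm_nonneg (u x)) hc.le) hfin c
    simpa only [mul_div_cancel₀ _ hc.ne', modular] using this
  · intro hfin
    exact ⟨1, one_pos, by simpa [modular] using hfin⟩

theorem modular_add (h : PhiAssumptions N φ l m) (hu : AEStronglyMeasurable u μ)
    (hfu : modular (nFun φ) μ u < ⊤) (hfv : modular (nFun φ) μ v < ⊤) :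
    modular (nFun φ) μ (u + v) < ⊤ := by
  have hu2 := modular_two_mul h (fun x => norm_nonneg (u x)) hfu
  have hv2 := modular_two_mul h (fun x => norm_nonneg (v x)) hfv
  have hle : ∀ x, ENNReal.ofReal (nFun φ ‖(u + v) x‖)
      ≤ ENNReal.ofReal (nFun φ (2 * ‖u x‖)) + ENNReal.ofReal (nFun φ (2 * ‖v x‖)) := by
    intro x
    have hn : ‖u x + v x‖ ≤ ‖u x‖ + ‖v x‖ := norm_add_le _ _
    rw [← ENNReal.ofReal_add (h.nFun_nonneg _) (h.nFun_nonneg _)]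
    refine ENNReal.ofReal_le_ofReal ?_
    have hu0 := norm_nonneg (u x)
    have hv0 := norm_nonneg (v x)
    rcases le_total ‖u x‖ ‖v x‖ with hc | hc
    · have := h.nFun_mono (s := ‖(u + v) x‖) (t := 2 * ‖v x‖) (by
        rw [abs_of_nonneg (norm_nonneg _), abs_of_nonneg (by linarith), Pi.add_apply]; linarith)
      linarith [h.nFun_nonneg (2 * ‖u x‖)]
    · have := h.nFun_mono (s := ‖(u + v) x‖) (t := 2 * ‖u x‖) (by
        rw [abs_of_nonneg (norm_nonneg _), abs_of_nonneg (by linarith), Pi.add_apply]; linarith)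
      linarith [h.nFun_nonneg (2 * ‖v x‖)]
  refine (lintegral_mono hle).trans_lt ?_
  rw [lintegral_add_left']
  · exact ENNReal.add_lt_top.2 ⟨hu2, hv2⟩
  · exact (h.measurable_nFun.comp_aemeasurable
      (hu.norm.aemeasurable.const_mul 2)).ennreal_ofReal

theorem modular_smul [NormedSpace ℝ F] (h : PhiAssumptions N φ l m) (c : ℝ)
    (hfu : modular (nFun φ) μ u < ⊤) : modular (nFun φ) μ (c • u) < ⊤ := by
  have := modular_mul h (fun x => norm_nonneg (u x)) hfu |c|
  simpa [modular, norm_smul] using this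

theorem luxSet_bddBelow {Φ : ℝ → ℝ} :
    BddBelow {c : ℝ | 0 < c ∧ ∫⁻ x, ENNReal.ofReal (Φ (‖u x‖ / c)) ∂μ ≤ 1} :=
  ⟨0, fun _ hc => hc.1.le⟩

theorem luxNorm_nonneg {Φ : ℝ → ℝ} : 0 ≤ luxNorm Φ μ u :=
  Real.sInf_nonneg fun _ hc => hc.1.le

theorem luxSet_nonempty (h : PhiAssumptions N φ l m) (hfu : modular (nFun φ) μ u < ⊤) :
    {c : ℝ | 0 < c ∧ ∫⁻ x, ENNReal.ofReal (nFun φ (‖u x‖ / c)) ∂μ ≤ 1}.Nonempty := by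
  set M := (modular (nFun φ) μ u).toReal with hM
  have hM0 : 0 ≤ M := ENNReal.toReal_nonneg
  have hc : 0 < M + 1 := by linarith
  refine ⟨M + 1, hc, ?_⟩
  have hle : ∀ x, ENNReal.ofReal (nFun φ (‖u x‖ / (M + 1)))
      ≤ ENNReal.ofReal (M + 1)⁻¹ * ENNReal.ofReal (nFun φ ‖u x‖) := fun x => by
    rw [← ENNReal.ofReal_mul (by positivity), div_eq_inv_mul]
    exact ENNReal.ofReal_le_ofReal
      (h.nFun_mul_le (by positivity) (inv_le_one_of_one_le₀ (by linarith)) (norm_nonneg _))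
  refine (lintegral_mono hle).trans ?_
  rw [lintegral_const_mul' _ _ ENNReal.ofReal_ne_top]
  change ENNReal.ofReal (M + 1)⁻¹ * modular (nFun φ) μ u ≤ 1
  rw [← ENNReal.ofReal_toReal hfu.ne, ← ENNReal.ofReal_mul (by positivity), ← hM]
  refine ENNReal.ofReal_le_one.2 ?_
  rw [inv_mul_le_iff₀ hc]
  linarith

theorem luxNorm_add_le (h : PhiAssumptions N φ l m) (hu : AEStronglyMeasurable u μ)
    (hfu : modular (nFun φ) μ u < ⊤) (hfv : modular (nFun φ) μ v < ⊤) :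
    luxNorm (nFun φ) μ (u + v) ≤ luxNorm (nFun φ) μ u + luxNorm (nFun φ) μ v := by
  have key : ∀ a b : ℝ, (0 < a ∧ ∫⁻ x, ENNReal.ofReal (nFun φ (‖u x‖ / a)) ∂μ ≤ 1) →
      (0 < b ∧ ∫⁻ x, ENNReal.ofReal (nFun φ (‖v x‖ / b)) ∂μ ≤ 1) →
      luxNorm (nFun φ) μ (u + v) ≤ a + b := by
    rintro a b ⟨ha, hia⟩ ⟨hb, hib⟩
    have hab : 0 < a + b := by linarith
    refine csInf_le luxSet_bddBelow ⟨hab, ?_⟩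
    have hle : ∀ x, ENNReal.ofReal (nFun φ (‖(u + v) x‖ / (a + b)))
        ≤ ENNReal.ofReal (a / (a + b)) * ENNReal.ofReal (nFun φ (‖u x‖ / a))
          + ENNReal.ofReal (b / (a + b)) * ENNReal.ofReal (nFun φ (‖v x‖ / b)) := by
      intro x
      rw [← ENNReal.ofReal_mul (by positivity), ← ENNReal.ofReal_mul (by positivity),
        ← ENNReal.ofReal_add (mul_nonneg (by positivity) (h.nFun_nonneg _))
          (mul_nonneg (by positivity) (h.nFun_nonneg _))]
      refine ENNReal.ofReal_le_ofReal ?_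
      have hcv : nFun φ ((a / (a + b)) • (‖u x‖ / a) + (b / (a + b)) • (‖v x‖ / b))
          ≤ (a / (a + b)) • nFun φ (‖u x‖ / a) + (b / (a + b)) • nFun φ (‖v x‖ / b) :=
        h.convexOn_nFun.2 (mem_Ici.2 (by positivity)) (mem_Ici.2 (by positivity))
          (by positivity) (by positivity) (by field_simp)
      simp only [smul_eq_mul] at hcv
      refine le_trans (h.nFun_mono ?_) hcv
      have e : a / (a + b) * (‖u x‖ / a) + b / (a + b) * (‖v x‖ / b)
          = (‖u x‖ + ‖v x‖) / (a + b) := by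
        field_simp
      rw [e, abs_of_nonneg (by positivity), abs_of_nonneg (by positivity)]
      gcongr
      exact norm_add_le _ _
    refine (lintegral_mono hle).trans ?_
    rw [lintegral_add_left']
    · rw [lintegral_const_mul' _ _ ENNReal.ofReal_ne_top,
        lintegral_const_mul' _ _ ENNReal.ofReal_ne_top]
      calc _ ≤ ENNReal.ofReal (a / (a + b)) * 1 + ENNReal.ofReal (b / (a + b)) * 1 := by gcongr
        _ = 1 := by
          rw [mul_one, mul_one, ← ENNReal.ofReal_add (by positivity) (by positivity),
            ← add_div, div_self hab.ne', ENNReal.ofReal_one]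
    · exact ((h.measurable_nFun.comp_aemeasurable
        (hu.norm.aemeasurable.div_const a)).ennreal_ofReal).const_mul _
  have h1 : ∀ b : ℝ, (0 < b ∧ ∫⁻ x, ENNReal.ofReal (nFun φ (‖v x‖ / b)) ∂μ ≤ 1) →
      luxNorm (nFun φ) μ (u + v) - b ≤ luxNorm (nFun φ) μ u := fun b hb =>
    le_csInf (luxSet_nonempty h hfu) fun a ha => by linarith [key a b ha hb]
  have h2 : luxNorm (nFun φ) μ (u + v) - luxNorm (nFun φ) μ u ≤ luxNorm (nFun φ) μ v :=
    le_csInf (luxSet_nonempty h hfv) fun b hb => by linarith [h1 b hb]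
  linarith

theorem luxNorm_zero {Φ : ℝ → ℝ} (hΦ : Φ 0 = 0) : luxNorm Φ μ (0 : α → F) = 0 := by
  have : {c : ℝ | 0 < c ∧ ∫⁻ x, ENNReal.ofReal (Φ (‖(0 : α → F) x‖ / c)) ∂μ ≤ 1} = Ioi 0 := by
    ext c
    simp [hΦ]
  rw [luxNorm, this, csInf_Ioi]

theorem luxNorm_smul_le [NormedSpace ℝ F] (h : PhiAssumptions N φ l m) {c : ℝ} (hc : c ≠ 0)
    (hfu : modular (nFun φ) μ u < ⊤) :
    luxNorm (nFun φ) μ (c • u) ≤ |c| * luxNorm (nFun φ) μ u := by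
  have hc' : 0 < |c| := abs_pos.2 hc
  rw [← div_le_iff₀' hc']
  refine le_csInf (luxSet_nonempty h hfu) fun a ha => ?_
  rw [div_le_iff₀' hc']
  refine csInf_le luxSet_bddBelow ⟨mul_pos hc' ha.1, ?_⟩
  have : ∀ x, ‖(c • u) x‖ / (|c| * a) = ‖u x‖ / a := fun x => by
    rw [Pi.smul_apply, norm_smul, Real.norm_eq_abs, mul_div_mul_left _ _ hc'.ne']
  simpa only [this] using ha.2

theorem luxNorm_smul [NormedSpace ℝ F] (h : PhiAssumptions N φ l m) (c : ℝ)
    (hfu : modular (nFun φ) μ u < ⊤) :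
    luxNorm (nFun φ) μ (c • u) = |c| * luxNorm (nFun φ) μ u := by
  rcases eq_or_ne c 0 with rfl | hc
  · rw [zero_smul, luxNorm_zero PhiAssumptions.nFun_zero, abs_zero, zero_mul]
  · refine le_antisymm (luxNorm_smul_le h hc hfu) ?_
    have := luxNorm_smul_le h (inv_ne_zero hc) (modular_smul h c hfu)
    rw [inv_smul_smul₀ hc, abs_inv] at this
    rwa [le_inv_mul_iff₀ (abs_pos.2 hc)] at this

theorem ae_eq_zero_of_luxNorm (h : PhiAssumptions N φ l m) (hu : AEStronglyMeasurable u μ)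
    (hfu : modular (nFun φ) μ u < ⊤) (h0 : luxNorm (nFun φ) μ u = 0) : u =ᵐ[μ] 0 := by
  have hle : ∀ δ : ℝ, 0 < δ → δ ≤ 1 → modular (nFun φ) μ u ≤ ENNReal.ofReal δ := by
    intro δ hδ hδ1
    obtain ⟨c, ⟨hc, hi⟩, hcδ⟩ := exists_lt_of_csInf_lt (luxSet_nonempty h hfu)
      (by rw [← luxNorm, h0]; exact hδ : sInf _ < δ)
    have hp : ∀ x, ENNReal.ofReal (nFun φ ‖u x‖)
        ≤ ENNReal.ofReal c * ENNReal.ofReal (nFun φ (‖u x‖ / c)) := fun x => by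
      rw [← ENNReal.ofReal_mul hc.le]
      refine ENNReal.ofReal_le_ofReal ?_
      have := h.nFun_mul_le hc.le (by linarith) (div_nonneg (norm_nonneg (u x)) hc.le)
      rwa [mul_div_cancel₀ _ hc.ne'] at this
    refine (lintegral_mono hp).trans ?_
    rw [lintegral_const_mul' _ _ ENNReal.ofReal_ne_top]
    calc _ ≤ ENNReal.ofReal c * 1 := by gcongr
      _ ≤ ENNReal.ofReal δ := by rw [mul_one]; exact ENNReal.ofReal_le_ofReal hcδ.le
  have hz : modular (nFun φ) μ u = 0 := by
    by_contra hne
    have hpos : 0 < (modular (nFun φ) μ u).toReal := ENNReal.toReal_pos hne hfu.ne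
    have := hle (min 1 ((modular (nFun φ) μ u).toReal / 2)) (by positivity) (min_le_left _ _)
    have h3 := ENNReal.toReal_mono ENNReal.ofReal_ne_top this
    rw [ENNReal.toReal_ofReal (by positivity)] at h3
    linarith [min_le_right 1 ((modular (nFun φ) μ u).toReal / 2)]
  have hm : AEMeasurable (fun x => ENNReal.ofReal (nFun φ ‖u x‖)) μ :=
    (h.measurable_nFun.comp_aemeasurable hu.norm.aemeasurable).ennreal_ofReal
  rw [modular, lintegral_eq_zero_iff' hm] at hz
  filter_upwards [hz] with x hx
  by_contra hne
  have hpos := h.nFun_pos (norm_pos_iff.2 hne)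
  have hx' : nFun φ ‖u x‖ ≤ 0 := ENNReal.ofReal_eq_zero.1 hx
  linarith

end Luxemburg

/-! ### Orlicz–Sobolev spaces -/

/-- `w` is the weak gradient of `u` on `ℝ^N`, both being locally integrable:
`∫ u ∂_v ψ = - ∫ (w · v) ψ` for all test functions `ψ` and all directions `v`. -/
def HasWeakGradient {N : ℕ} (u : EuclideanSpace ℝ (Fin N) → ℝ)
    (w : EuclideanSpace ℝ (Fin N) → EuclideanSpace ℝ (Fin N)) : Prop :=
  LocallyIntegrable u ∧ LocallyIntegrable w ∧
    ∀ (ψ : EuclideanSpace ℝ (Fin N) → ℝ) (v : EuclideanSpace ℝ (Fin N)),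
      ContDiff ℝ (⊤ : ℕ∞) ψ → HasCompactSupport ψ →
      ∫ x, u x * fderiv ℝ ψ x v = - ∫ x, inner ℝ (w x) v * ψ x

section WeakGradient

variable {N : ℕ} {u u' : EuclideanSpace ℝ (Fin N) → ℝ}
  {w w' : EuclideanSpace ℝ (Fin N) → EuclideanSpace ℝ (Fin N)}

theorem HasWeakGradient.congr (h : HasWeakGradient u w) (hu : u =ᵐ[volume] u')
    (hw : w =ᵐ[volume] w') : HasWeakGradient u' w' := by
  refine ⟨h.1.congr hu, h.2.1.congr hw, fun ψ v hψ hc => ?_⟩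
  have e1 : ∫ x, u' x * fderiv ℝ ψ x v = ∫ x, u x * fderiv ℝ ψ x v :=
    integral_congr_ae (hu.mono fun x hx => by simp only [hx])
  have e2 : ∫ x, inner ℝ (w' x) v * ψ x = ∫ x, inner ℝ (w x) v * ψ x :=
    integral_congr_ae (hw.mono fun x hx => by simp only [hx])
  rw [e1, e2]
  exact h.2.2 ψ v hψ hc

theorem integrable_mul_test {g ψ : EuclideanSpace ℝ (Fin N) → ℝ} (hg : LocallyIntegrable g)
    (hψ : Continuous ψ) (hc : HasCompactSupport ψ) : Integrable fun x => g x * ψ x := by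
  simpa only [smul_eq_mul, mul_comm] using hg.integrable_smul_left_of_hasCompactSupport hψ hc

theorem continuous_fderiv_test {ψ : EuclideanSpace ℝ (Fin N) → ℝ}
    (hψ : ContDiff ℝ (⊤ : ℕ∞) ψ) (v : EuclideanSpace ℝ (Fin N)) :
    Continuous fun x => fderiv ℝ ψ x v :=
  (hψ.continuous_fderiv (by simp)).clm_apply continuous_const

theorem locallyIntegrable_inner (hw : LocallyIntegrable w) (v : EuclideanSpace ℝ (Fin N)) :
    LocallyIntegrable fun x => inner ℝ (w x) v := by
  intro x
  obtain ⟨s, hs, hi⟩ := hw x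
  exact ⟨s, hs, hi.inner_const v⟩

theorem HasWeakGradient.add (h : HasWeakGradient u w) (h' : HasWeakGradient u' w') :
    HasWeakGradient (u + u') (w + w') := by
  refine ⟨h.1.add h'.1, h.2.1.add h'.2.1, fun ψ v hψ hc => ?_⟩
  have hd := continuous_fderiv_test hψ v
  have hdc : HasCompactSupport fun x => fderiv ℝ ψ x v := hc.fderiv_apply ℝ v
  simp only [Pi.add_apply, inner_add_left, add_mul]
  rw [integral_add (integrable_mul_test h.1 hd hdc) (integrable_mul_test h'.1 hd hdc),
    integral_add (integrable_mul_test (locallyIntegrable_inner h.2.1 v) hψ.continuous hc)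
      (integrable_mul_test (locallyIntegrable_inner h'.2.1 v) hψ.continuous hc),
    h.2.2 ψ v hψ hc, h'.2.2 ψ v hψ hc]
  ring

theorem HasWeakGradient.smul (h : HasWeakGradient u w) (c : ℝ) :
    HasWeakGradient (c • u) (c • w) := by
  refine ⟨h.1.smul c, h.2.1.smul c, fun ψ v hψ hc => ?_⟩
  simp only [Pi.smul_apply, smul_eq_mul, inner_smul_left, mul_assoc, integral_const_mul,
    h.2.2 ψ v hψ hc]
  simp

theorem HasWeakGradient.zero : HasWeakGradient (0 : EuclideanSpace ℝ (Fin N) → ℝ) 0 :=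
  ⟨locallyIntegrable_zero, locallyIntegrable_zero, fun ψ v _ _ => by simp⟩

end WeakGradient

/-- The data of a weighted Orlicz–Sobolev space: the function `φ`, a continuous positive weight
`w` on `ℝ^N` and a positive constant `κ` used in the norm. -/
structure SpaceData (N : ℕ) where
  φ : ℝ → ℝ
  l : ℝ
  m : ℝ
  hφ : PhiAssumptions N φ l m
  w : EuclideanSpace ℝ (Fin N) → ℝ
  w_cont : Continuous w
  w_pos : ∀ x, 0 < w x
  κ : ℝ
  κ_pos : 0 < κ

namespace SpaceData

variable {N : ℕ}

/-- `Φ(t) = ∫₀^{|t|} φ(s) s ds`. -/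
noncomputable def Φ (D : SpaceData N) : ℝ → ℝ := nFun D.φ

/-- The measure `w(x) dx`. -/
noncomputable def wMeasure (D : SpaceData N) : Measure (EuclideanSpace ℝ (Fin N)) :=
  volume.withDensity fun x => ENNReal.ofReal (D.w x)

theorem wMeasure_ac (D : SpaceData N) : D.wMeasure ≪ volume :=
  withDensity_absolutelyContinuous volume _

/-- The space `{u ∈ W^{1,Φ}(ℝ^N) : ∫ w(x) Φ(|u|) dx < ∞}`. An element is recorded as the pair
`(u, ∇u)` of the function and its weak gradient, both up to equality almost everywhere;
`u ∈ W^{1,Φ}` means that `u` and `∇u` belong to `L^Φ`. -/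
noncomputable def submodule (D : SpaceData N) : Submodule ℝ
    ((EuclideanSpace ℝ (Fin N) →ₘ[volume] ℝ) ×
      (EuclideanSpace ℝ (Fin N) →ₘ[volume] EuclideanSpace ℝ (Fin N))) where
  carrier := {p | HasWeakGradient p.1 p.2 ∧ MemOrlicz D.Φ volume p.1 ∧
    MemOrlicz D.Φ volume p.2 ∧ modular D.Φ D.wMeasure p.1 < ⊤}
  zero_mem' := by
    have h1 : ((0 : EuclideanSpace ℝ (Fin N) →ₘ[volume] ℝ) : EuclideanSpace ℝ (Fin N) → ℝ)
        =ᵐ[volume] 0 := AEEqFun.coeFn_zero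
    have h2 : ((0 : EuclideanSpace ℝ (Fin N) →ₘ[volume] EuclideanSpace ℝ (Fin N)) :
        EuclideanSpace ℝ (Fin N) → EuclideanSpace ℝ (Fin N)) =ᵐ[volume] 0 := AEEqFun.coeFn_zero
    have hz : nFun D.φ 0 = 0 := PhiAssumptions.nFun_zero
    refine ⟨HasWeakGradient.zero.congr h1.symm h2.symm, ?_, ?_, ?_⟩
    · refine (memOrlicz_iff D.hφ).2 ?_
      change modular (nFun D.φ) volume
        ((0 : EuclideanSpace ℝ (Fin N) →ₘ[volume] ℝ) : EuclideanSpace ℝ (Fin N) → ℝ) < ⊤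
      rw [modular_congr h1]
      simp [modular, hz]
    · refine (memOrlicz_iff D.hφ).2 ?_
      change modular (nFun D.φ) volume
        ((0 : EuclideanSpace ℝ (Fin N) →ₘ[volume] EuclideanSpace ℝ (Fin N)) :
          EuclideanSpace ℝ (Fin N) → EuclideanSpace ℝ (Fin N)) < ⊤
      rw [modular_congr h2]
      simp [modular, hz]
    · change modular (nFun D.φ) D.wMeasure
        ((0 : EuclideanSpace ℝ (Fin N) →ₘ[volume] ℝ) : EuclideanSpace ℝ (Fin N) → ℝ) < ⊤
      rw [modular_congr (D.wMeasure_ac.ae_le h1)]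
      simp [modular, hz]
  add_mem' := by
    rintro p q ⟨hp1, hp2, hp3, hp4⟩ ⟨hq1, hq2, hq3, hq4⟩
    have h1 : ((p + q).1 : EuclideanSpace ℝ (Fin N) → ℝ) =ᵐ[volume] p.1 + q.1 :=
      AEEqFun.coeFn_add _ _
    have h2 : ((p + q).2 : EuclideanSpace ℝ (Fin N) → EuclideanSpace ℝ (Fin N))
        =ᵐ[volume] p.2 + q.2 := AEEqFun.coeFn_add _ _
    simp only [Φ, memOrlicz_iff D.hφ] at hp2 hp3 hp4 hq2 hq3 hq4
    refine ⟨(hp1.add hq1).congr h1.symm h2.symm, ?_, ?_, ?_⟩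
    · simp only [Φ, memOrlicz_iff D.hφ]
      rw [modular_congr h1]
      exact modular_add D.hφ p.1.aestronglyMeasurable hp2 hq2
    · simp only [Φ, memOrlicz_iff D.hφ]
      rw [modular_congr h2]
      exact modular_add D.hφ p.2.aestronglyMeasurable hp3 hq3
    · simp only [Φ]
      rw [modular_congr (D.wMeasure_ac.ae_le h1)]
      exact modular_add D.hφ p.1.stronglyMeasurable.aestronglyMeasurable hp4 hq4
  smul_mem' := by
    rintro c p ⟨hp1, hp2, hp3, hp4⟩
    have h1 : ((c • p).1 : EuclideanSpace ℝ (Fin N) → ℝ) =ᵐ[volume] c • p.1 :=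
      AEEqFun.coeFn_smul _ _
    have h2 : ((c • p).2 : EuclideanSpace ℝ (Fin N) → EuclideanSpace ℝ (Fin N))
        =ᵐ[volume] c • p.2 := AEEqFun.coeFn_smul _ _
    simp only [Φ, memOrlicz_iff D.hφ] at hp2 hp3 hp4
    refine ⟨(hp1.smul c).congr h1.symm h2.symm, ?_, ?_, ?_⟩
    · simp only [Φ, memOrlicz_iff D.hφ]
      rw [modular_congr h1]
      exact modular_smul D.hφ c hp2
    · simp only [Φ, memOrlicz_iff D.hφ]
      rw [modular_congr h2]
      exact modular_smul D.hφ c hp3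
    · simp only [Φ]
      rw [modular_congr (D.wMeasure_ac.ae_le h1)]
      exact modular_smul D.hφ c hp4

/-- The weighted Orlicz–Sobolev space as a type. -/
def Space (D : SpaceData N) : Type := D.submodule

noncomputable instance (D : SpaceData N) : AddCommGroup D.Space :=
  inferInstanceAs (AddCommGroup D.submodule)

noncomputable instance (D : SpaceData N) : Module ℝ D.Space :=
  inferInstanceAs (Module ℝ D.submodule)

/-- The underlying function of an element of the space. -/
noncomputable def fn {D : SpaceData N} (u : D.Space) : EuclideanSpace ℝ (Fin N) → ℝ := u.1.1

/-- The weak gradient of an element of the space. -/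
noncomputable def grad {D : SpaceData N} (u : D.Space) :
    EuclideanSpace ℝ (Fin N) → EuclideanSpace ℝ (Fin N) := u.1.2

/-- The norm `‖u‖ = ‖∇u‖_Φ + κ ‖u‖_{Φ,w}`, with Luxemburg norms on the right. -/
noncomputable instance (D : SpaceData N) : Norm D.Space where
  norm u := luxNorm D.Φ volume (grad u) + D.κ * luxNorm D.Φ D.wMeasure (fn u)

theorem norm_def {D : SpaceData N} (u : D.Space) :
    ‖u‖ = luxNorm D.Φ volume (grad u) + D.κ * luxNorm D.Φ D.wMeasure (fn u) := rfl

theorem fn_add {D : SpaceData N} (u v : D.Space) : fn (u + v) =ᵐ[volume] fn u + fn v :=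
  AEEqFun.coeFn_add _ _

theorem grad_add {D : SpaceData N} (u v : D.Space) : grad (u + v) =ᵐ[volume] grad u + grad v :=
  AEEqFun.coeFn_add _ _

theorem fn_smul {D : SpaceData N} (c : ℝ) (u : D.Space) : fn (c • u) =ᵐ[volume] c • fn u :=
  AEEqFun.coeFn_smul _ _

theorem grad_smul {D : SpaceData N} (c : ℝ) (u : D.Space) :
    grad (c • u) =ᵐ[volume] c • grad u :=
  AEEqFun.coeFn_smul _ _

theorem ac_wMeasure (D : SpaceData N) : volume ≪ D.wMeasure :=
  withDensity_absolutelyContinuous' D.w_cont.measurable.ennreal_ofReal.aemeasurable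
    (Eventually.of_forall fun x => (ENNReal.ofReal_pos.2 (D.w_pos x)).ne')

theorem modular_grad {D : SpaceData N} (u : D.Space) :
    modular (nFun D.φ) volume (grad u) < ⊤ :=
  (memOrlicz_iff D.hφ).1 u.2.2.2.1

theorem modular_fn {D : SpaceData N} (u : D.Space) :
    modular (nFun D.φ) D.wMeasure (fn u) < ⊤ := u.2.2.2.2

theorem normCore (D : SpaceData N) : NormedSpace.Core ℝ D.Space where
  norm_nonneg u := add_nonneg luxNorm_nonneg (mul_nonneg D.κ_pos.le luxNorm_nonneg)
  norm_smul c u := by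
    rw [norm_def, norm_def, luxNorm_congr (grad_smul c u),
      luxNorm_congr (D.wMeasure_ac.ae_le (fn_smul c u)), Φ,
      luxNorm_smul D.hφ c (modular_grad u), luxNorm_smul D.hφ c (modular_fn u), Real.norm_eq_abs]
    ring
  norm_triangle u v := by
    rw [norm_def, norm_def, norm_def, luxNorm_congr (grad_add u v),
      luxNorm_congr (D.wMeasure_ac.ae_le (fn_add u v)), Φ]
    have h1 := luxNorm_add_le D.hφ u.1.2.aestronglyMeasurable (modular_grad u) (modular_grad v)
    have h2 := luxNorm_add_le D.hφ
      (u.1.1.stronglyMeasurable.aestronglyMeasurable (μ := D.wMeasure))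
      (modular_fn u) (modular_fn v)
    have h3 := mul_le_mul_of_nonneg_left h2 D.κ_pos.le
    change luxNorm (nFun D.φ) volume (grad u + grad v) ≤ _ at h1
    change D.κ * luxNorm (nFun D.φ) D.wMeasure (fn u + fn v) ≤ _ at h3
    rw [mul_add] at h3
    change _ ≤ luxNorm (nFun D.φ) volume (grad u) + luxNorm (nFun D.φ) volume (grad v) at h1
    change _ ≤ D.κ * luxNorm (nFun D.φ) D.wMeasure (fn u)
      + D.κ * luxNorm (nFun D.φ) D.wMeasure (fn v) at h3
    linarith
  norm_eq_zero_iff u := by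
    constructor
    · intro h0
      rw [norm_def, Φ] at h0
      have n1 : 0 ≤ luxNorm (nFun D.φ) volume (grad u) := luxNorm_nonneg
      have n2 : 0 ≤ luxNorm (nFun D.φ) D.wMeasure (fn u) := luxNorm_nonneg
      have n3 := mul_nonneg D.κ_pos.le n2
      have z1 : luxNorm (nFun D.φ) volume (grad u) = 0 := by linarith
      have z2 : luxNorm (nFun D.φ) D.wMeasure (fn u) = 0 := by
        have : D.κ * luxNorm (nFun D.φ) D.wMeasure (fn u) = 0 := by linarith
        exact (mul_eq_zero.1 this).resolve_left D.κ_pos.ne'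
      have e1 : grad u =ᵐ[volume] 0 :=
        ae_eq_zero_of_luxNorm D.hφ u.1.2.aestronglyMeasurable (modular_grad u) z1
      have e2 : fn u =ᵐ[volume] 0 := D.ac_wMeasure.ae_le
        (ae_eq_zero_of_luxNorm D.hφ u.1.1.stronglyMeasurable.aestronglyMeasurable
          (modular_fn u) z2)
      refine Subtype.ext (Prod.ext ?_ ?_)
      · exact AEEqFun.ext (e2.trans AEEqFun.coeFn_zero.symm)
      · exact AEEqFun.ext (e1.trans AEEqFun.coeFn_zero.symm)
    · rintro rfl
      have e1 : grad (0 : D.Space) =ᵐ[volume] 0 := AEEqFun.coeFn_zero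
      have e2 : fn (0 : D.Space) =ᵐ[volume] 0 := AEEqFun.coeFn_zero
      rw [norm_def, luxNorm_congr e1, luxNorm_congr (D.wMeasure_ac.ae_le e2), Φ,
        luxNorm_zero PhiAssumptions.nFun_zero, luxNorm_zero PhiAssumptions.nFun_zero]
      simp

noncomputable instance (D : SpaceData N) : NormedAddCommGroup D.Space :=
  NormedAddCommGroup.ofCore D.normCore

noncomputable instance (D : SpaceData N) : NormedSpace ℝ D.Space :=
  NormedSpace.ofCore D.normCore

end SpaceData

/-! ### Assumptions on the nonlinearity, the potential and the penalization -/

/-- `γ = m` if `Φ(t) ≥ |t|^m` for all `t`, and `γ = l` otherwise. -/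
noncomputable def gammaExp (φ : ℝ → ℝ) (l m : ℝ) : ℝ :=
  open Classical in if ∀ t : ℝ, |t| ^ m ≤ nFun φ t then m else l

/-- The assumptions common to `r` and `b`, written for a function `r` on `(0, ∞)` with primitive
`R(t) = ∫₀^{|t|} r(s) s ds`; `r₁`, `r₂` are the bounds of `r(t) t² / R(t)`. -/
structure GrowthAssumptions (N : ℕ) (φ r : ℝ → ℝ) (r₁ r₂ : ℝ) : Prop where
  contDiffOn : ContDiffOn ℝ 1 r (Ioi 0)
  nonneg : ∀ t > 0, 0 ≤ r t
  mono : MonotoneOn r (Ioi 0)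
  deriv_bound : ∃ c > 0, ∀ t > 0, |deriv r t * t| ≤ c * r t
  ratio_lower : ∀ t > 0, r₁ ≤ r t * t ^ 2 / nFun r t
  ratio_upper : ∀ t > 0, r t * t ^ 2 / nFun r t ≤ r₂
  near_zero : ∃ C, ∀ᶠ t in 𝓝[>] (0 : ℝ), nFun r t / nFun φ t ≤ C
  at_infinity : Tendsto (fun t => nFun r t / sobolevConj N (nFun φ) t) atTop (𝓝 0)

/-- The assumptions on `r`. -/
def RAssumptions (N : ℕ) (φ r : ℝ → ℝ) : Prop :=
  ∃ r₁ > 0, ∃ r₂ > 0, GrowthAssumptions N φ r r₁ r₂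

/-- The assumptions on `b`: the bounds lie in `(1, γ*)`, `γ* = N γ / (N - γ)`. -/
def BAssumptions (N : ℕ) (φ : ℝ → ℝ) (l m : ℝ) (b : ℝ → ℝ) : Prop :=
  ∃ b₁ ∈ Ioo 1 (N * gammaExp φ l m / (N - gammaExp φ l m)),
    ∃ b₂ ∈ Ioo 1 (N * gammaExp φ l m / (N - gammaExp φ l m)), GrowthAssumptions N φ b b₁ b₂

/-- The assumptions on `f`, with `F(t) = ∫₀ᵗ f`. -/
structure FAssumptions (r b : ℝ → ℝ) (m : ℝ) (f : ℝ → ℝ) (θ : ℝ) : Prop where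
  contDiff : ContDiff ℝ 1 f
  eq_zero : ∀ t < 0, f t = 0
  near_zero : Tendsto (fun t => deriv f t / deriv (fun s => r s * s) t) (𝓝[>] 0) (𝓝 0)
  at_infinity : ∃ C, ∀ᶠ t in atTop, |deriv f t| / deriv (fun s => b s * s) t ≤ C
  m_lt_theta : m < θ
  primitive_pos : ∀ t > 0, 0 < θ * ∫ s in (0 : ℝ)..t, f s
  superlinear : ∀ t > 0, θ * (∫ s in (0 : ℝ)..t, f s) ≤ f t * t
  strictMono_quot : StrictMonoOn (fun t => f t / t ^ (m - 1)) (Ioi 0)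

/-- The assumptions on the potential `V`: it is continuous with positive infimum `V₀`, and `Ω` is
an open bounded set with `inf_Ω V < min_{∂Ω} V`. -/
structure PotentialAssumptions {N : ℕ} (V : EuclideanSpace ℝ (Fin N) → ℝ) (V₀ : ℝ)
    (Ω : Set (EuclideanSpace ℝ (Fin N))) : Prop where
  continuous : Continuous V
  isGLB : IsGLB (range V) V₀
  pos : 0 < V₀
  isOpen : IsOpen Ω
  isBounded : Bornology.IsBounded Ω
  inf_lt : ∃ x ∈ Ω, ∀ y ∈ frontier Ω, V x < V y

/-- `f̂ = f` on `(-∞, a]` and `f̂(s) = (V₀ / k) φ(s) s` for `s > a`. -/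
noncomputable def fHat (φ f : ℝ → ℝ) (V₀ k a : ℝ) (s : ℝ) : ℝ :=
  open Classical in if s ≤ a then f s else V₀ / k * φ s * s

/-- `f̃ = η` on `[t₀, t₁]` and `f̃ = f̂` elsewhere. -/
noncomputable def fTilde (φ f : ℝ → ℝ) (V₀ k a t₀ t₁ : ℝ) (η : ℝ → ℝ) (s : ℝ) : ℝ :=
  open Classical in if s ∈ Icc t₀ t₁ then η s else fHat φ f V₀ k a s

/-- The penalized nonlinearity: `g(x, s) = f(s)` for `x ∈ Ω` and `g(x, s) = f̃(s)` otherwise. -/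
noncomputable def gPen {N : ℕ} (Ω : Set (EuclideanSpace ℝ (Fin N))) (φ f : ℝ → ℝ)
    (V₀ k a t₀ t₁ : ℝ) (η : ℝ → ℝ) (x : EuclideanSpace ℝ (Fin N)) (s : ℝ) : ℝ :=
  open Classical in if x ∈ Ω then f s else fTilde φ f V₀ k a t₀ t₁ η s

/-- The assumptions on the parameters `k`, `a`, `t₀ < a < t₁` and on the gluing function `η`. -/
structure PenalizationAssumptions (φ f : ℝ → ℝ) (l m θ V₀ k a t₀ t₁ : ℝ) (η : ℝ → ℝ) :
    Prop where
  k_large : (θ - l) / (θ - m) * (m / l) < k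
  a_eq : f a / (φ a * a) = V₀ / k
  t₀_pos : 0 < t₀
  t₀_lt : t₀ < a
  lt_t₁ : a < t₁
  contDiffOn : ContDiffOn ℝ 1 η (Icc t₀ t₁)
  le_fHat : ∀ s ∈ Icc t₀ t₁, η s ≤ fHat φ f V₀ k a s
  eq_t₀ : η t₀ = fHat φ f V₀ k a t₀
  eq_t₁ : η t₁ = fHat φ f V₀ k a t₁
  deriv_t₀ : derivWithin η (Icc t₀ t₁) t₀ = deriv (fHat φ f V₀ k a) t₀
  deriv_t₁ : derivWithin η (Icc t₀ t₁) t₁ = deriv (fHat φ f V₀ k a) t₁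
  mono_quot : MonotoneOn (fun s => η s / (φ s * s)) (Icc t₀ t₁)

/-! ### The spaces and the energy functionals -/

section Functionals

variable {N : ℕ} {φ : ℝ → ℝ} {l m : ℝ} {V : EuclideanSpace ℝ (Fin N) → ℝ} {V₀ : ℝ}
  {Ω : Set (EuclideanSpace ℝ (Fin N))}

/-- The data of `X_ε = {u ∈ W^{1,Φ} : ∫ V(εx) Φ(|u|) dx < ∞}`, whose norm is
`‖∇u‖_Φ + ‖u‖_{Φ,V_ε}`. -/
noncomputable def xData (hφ : PhiAssumptions N φ l m) (hV : PotentialAssumptions V V₀ Ω)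
    (ε : ℝ) : SpaceData N where
  φ := φ
  l := l
  m := m
  hφ := hφ
  w := fun x => V (ε • x)
  w_cont := hV.continuous.comp (continuous_const_smul ε)
  w_pos := fun _ => hV.pos.trans_le (hV.isGLB.1 (mem_range_self _))
  κ := 1
  κ_pos := one_pos

/-- The data of `Y = W^{1,Φ}`, whose norm is `‖∇u‖_Φ + V₀ ‖u‖_Φ`. -/
noncomputable def yData (hφ : PhiAssumptions N φ l m) (hV : PotentialAssumptions V V₀ Ω) :
    SpaceData N where
  φ := φ
  l := l
  m := m
  hφ := hφ
  w := fun _ => 1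
  w_cont := continuous_const
  w_pos := fun _ => one_pos
  κ := V₀
  κ_pos := hV.pos

/-- `J_ε(u) = ∫ Φ(|∇u|) + ∫ V(εx) Φ(|u|) - ∫ G(εx, u)` on `X_ε`, with `G(x, s) = ∫₀ˢ g(x, t) dt`. -/
noncomputable def energyJ (hφ : PhiAssumptions N φ l m) (hV : PotentialAssumptions V V₀ Ω)
    (ε : ℝ) (g : EuclideanSpace ℝ (Fin N) → ℝ → ℝ) (u : (xData hφ hV ε).Space) : ℝ :=
  (∫ x, nFun φ ‖SpaceData.grad u x‖) + (∫ x, V (ε • x) * nFun φ |SpaceData.fn u x|)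
    - ∫ x, ∫ t in (0 : ℝ)..SpaceData.fn u x, g (ε • x) t

/-- `E₀(u) = ∫ Φ(|∇u|) + V₀ ∫ Φ(|u|) - ∫ F(u)` on `Y`. -/
noncomputable def energyE₀ (hφ : PhiAssumptions N φ l m) (hV : PotentialAssumptions V V₀ Ω)
    (f : ℝ → ℝ) (u : (yData hφ hV).Space) : ℝ :=
  (∫ x, nFun φ ‖SpaceData.grad u x‖) + V₀ * (∫ x, nFun φ |SpaceData.fn u x|)
    - ∫ x, ∫ t in (0 : ℝ)..SpaceData.fn u x, f t

end Functionals

/-! ### Critical point theory -/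

section CriticalPoints

variable {X : Type*} [NormedAddCommGroup X] [NormedSpace ℝ X]

/-- The mountain pass level `inf_γ max_{t ∈ [0,1]} E(γ(t))` over the continuous paths `γ` with
`γ(0) = 0` and `E(γ(1)) < 0`. -/
noncomputable def mountainPassLevel (E : X → ℝ) : ℝ :=
  sInf {c | ∃ γ : C(unitInterval, X), γ 0 = 0 ∧ E (γ 1) < 0 ∧
    IsGreatest (range fun t => E (γ t)) c}

/-- `L(v) = J'(v) v`. -/
noncomputable def nehariFn (J : X → ℝ) (v : X) : ℝ := fderiv ℝ J v v

/-- The Nehari manifold `{u ≠ 0 : J'(u) u = 0}`. -/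
def nehari (J : X → ℝ) : Set X := {u | u ≠ 0 ∧ nehariFn J u = 0}

/-- The restriction of `J'(u)` to the tangent space `ker L'(u)` of the Nehari manifold at `u`. -/
noncomputable def tangentialDeriv (J : X → ℝ) (u : X) :
    LinearMap.ker (fderiv ℝ (nehariFn J) u : X →ₗ[ℝ] ℝ) →L[ℝ] ℝ :=
  (fderiv ℝ J u).comp (Submodule.subtypeL _)

/-- The condition `(PS)_c`: if `J(uₙ) → c` and `‖J'(uₙ)‖ → 0`, then a subsequence converges. -/
def PalaisSmaleAt (J : X → ℝ) (c : ℝ) : Prop :=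
  ∀ u : ℕ → X, Tendsto (fun n => J (u n)) atTop (𝓝 c) →
    Tendsto (fun n => ‖fderiv ℝ J (u n)‖) atTop (𝓝 0) →
    ∃ (v : X) (σ : ℕ → ℕ), StrictMono σ ∧ Tendsto (u ∘ σ) atTop (𝓝 v)

/-- The condition `(PS)_c` for the restriction of `J` to its Nehari manifold, where the derivative
of the restriction is measured in the dual norm of the tangent space. -/
def NehariPalaisSmaleAt (J : X → ℝ) (c : ℝ) : Prop :=
  ∀ u : ℕ → X, (∀ n, u n ∈ nehari J) → Tendsto (fun n => J (u n)) atTop (𝓝 c) →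
    Tendsto (fun n => ‖tangentialDeriv J (u n)‖) atTop (𝓝 0) →
    ∃ v ∈ nehari J, ∃ σ : ℕ → ℕ, StrictMono σ ∧ Tendsto (u ∘ σ) atTop (𝓝 v)

end CriticalPoints

end OrliczNehari

/-! Write `L(u) = J'(u)u`. The argument is run for an abstract `Penalized` problem and uses neither
weak limits nor complementary Orlicz functions: all estimates rest on the power-type inequalities of
`YoungPair`, and compactness is obtained by showing that integrals over pairs of indices tend to
zero. Test functions are dense, so the delicate estimates are proved for them and transferred by
continuity of the derivatives.

Smoothness. `J` and `L` are sums of functionals `∫ h(x, Tu)` whose gradients grow like the density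
of a function `M` for which `T` maps the unit ball to a set of bounded modular; such functionals are
`C¹` (`NemytskiiData.exists_hasFDerivAt`). For the gradient and potential terms `M = Φ`. For the
nonlinear term `M = Φ + t^q`, where the growth of `f` provides a subcritical `q ∈ [m, γ*)` and the
embedding follows from the Gagliardo–Nirenberg–Sobolev inequality applied to a truncation of `u`
that vanishes at small values (`modularMap_fn_add_rpow`).

Palais–Smale. Outside the bounded set only `l G ≤ g s` is available instead of `θ G ≤ g s`, but
there `g ≤ (V₀/k) φ(s) s`, and the lower bound on `k` leaves a positive multiple of the modulars in
`J - L/θ` (`exists_mul_norm_le`); so the sequences are bounded. Testing an almost critical `u` with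
`(1 - η)u`, where `η` is a wide cutoff, shows that `Φ(|u|)` has uniformly small tails
(`exists_integral_tail_le`). Together with local compactness this gives `∫ (g(u_i) - g(u_j))(u_i -
u_j) → 0`. The identity `fderiv_energy_sub` then forces the integrals of the monotonicity gaps of
`φ(|x|)x` to zero, and its `(S₊)` property yields strong convergence
(`exists_subseq_modular_of_monoGap`).

Nehari manifold. The point is to keep `L'(u)u` away from zero. By the monotonicity of
`φ(t)/t^{m-2}`, `f(t)/t^{m-1}` and `f̃(t)/(φ(t)t)`, the quantity `m L(u) - L'(u)u` is the integral
of a nonnegative function (`integral_nehariGap`). Strictness is quantitative only where `u` takes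
values in a certain short interval `[x, y] ⊂ (0, t₀)`. So if `L(u_n)` and `L'(u_n)u_n` tend to zero
along a bounded sequence, the slabs `{x ≤ u_n ≤ y}` have measure tending to zero. A Sobolev function
cannot jump across a slab: the `W^{1,1}` inequality for a smooth step of `u_n` shows that `{u_n ≥
y}` has measure tending to zero as well (`tendsto_measure_superlevel`). Below `t₀` the nonlinearity
is dominated by the potential term, so `L(u_n) → 0` forces `u_n → 0` (`tendsto_zero_of_nehari`). For
a constant sequence this says `L'(u)u ≠ 0` on the Nehari manifold; for a sequence on it with `J(u_n)
→ c > 0` it contradicts `J(0) = 0`, so `|L'(u_n)u_n|` is bounded below. As `J'(u)u = 0` there, the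
full derivative is controlled by the tangential one (`norm_fderiv_le_of_nehari`), which reduces the
constrained statements to the free ones. -/

namespace OrliczNehari

/-! ### Functions of power type and Young-type inequalities -/

/-- A function `M` on `[0, ∞)` with nondecreasing density `a`, both of power type between
`p > 1` and `q`. -/
structure YoungPair (a M : ℝ → ℝ) (p q : ℝ) : Prop where
  one_lt : 1 < p
  p_le_q : p ≤ q
  zero : M 0 = 0
  pos : ∀ t, 0 < t → 0 < M t
  a_nonneg : ∀ t, 0 ≤ t → 0 ≤ a t
  a_mono : MonotoneOn a (Ici 0)
  mono : MonotoneOn M (Ici 0)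
  measurable : Measurable M
  lower : ∀ t, 0 ≤ t → p * M t ≤ a t * t
  upper : ∀ t, 0 ≤ t → a t * t ≤ q * M t
  scale_le : ∀ c t, 0 ≤ c → c ≤ 1 → 0 ≤ t → M (c * t) ≤ c ^ p * M t
  scale_ge : ∀ c t, 1 ≤ c → 0 ≤ t → M (c * t) ≤ c ^ q * M t

/-- The bounds on `a(t) t` say that `M(s) s^{-p}` is nondecreasing and `M(s) s^{-q}` is
nonincreasing; the scalings compare their values at `c t` and `t`. -/
theorem scale_of_hasDerivAt {a M : ℝ → ℝ} {p q : ℝ} (hd : ∀ t, 0 < t → HasDerivAt M (a t) t)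
    (hlow : ∀ t, 0 < t → p * M t ≤ a t * t) (hup : ∀ t, 0 < t → a t * t ≤ q * M t) :
    (∀ c t, 0 < c → c ≤ 1 → 0 < t → M (c * t) ≤ c ^ p * M t) ∧
      (∀ c t, 1 ≤ c → 0 < t → M (c * t) ≤ c ^ q * M t) := by
  have hder : ∀ r t : ℝ, 0 < t → HasDerivAt (fun s => M s * s ^ (-r))
      (t ^ (-r - 1) * (a t * t - r * M t)) t := by
    intro r t ht
    have h1 := (hd t ht).mul (Real.hasDerivAt_rpow_const (p := -r) (Or.inl ht.ne'))
    refine h1.congr_deriv ?_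
    have : t ^ (-r) = t ^ (-r - 1) * t := by
      rw [Real.rpow_sub_one ht.ne']; field_simp
    rw [this]; ring
  constructor
  · intro c t hc hc1 ht
    have hmono : MonotoneOn (fun s => M s * s ^ (-p)) (Ioi 0) := by
      refine monotoneOn_of_deriv_nonneg (convex_Ioi 0)
        (fun s hs => (hder p s hs).continuousAt.continuousWithinAt) ?_ ?_ <;>
        rw [interior_Ioi]
      · exact fun s hs => (hder p s hs).differentiableAt.differentiableWithinAt
      · intro s hs
        rw [(hder p s hs).deriv]
        exact mul_nonneg (Real.rpow_nonneg (le_of_lt hs) _) (by linarith [hlow s hs])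
    have h := hmono (mem_Ioi.2 (mul_pos hc ht)) (mem_Ioi.2 ht) (by nlinarith)
    simp only at h
    rw [Real.mul_rpow hc.le ht.le, ← mul_assoc] at h
    have h2 := le_of_mul_le_mul_right h (Real.rpow_pos_of_pos ht _)
    rw [Real.rpow_neg hc.le, ← div_eq_mul_inv, div_le_iff₀ (Real.rpow_pos_of_pos hc _)] at h2
    linarith
  · intro c t hc ht
    have hc0 : 0 < c := by linarith
    have hmono : AntitoneOn (fun s => M s * s ^ (-q)) (Ioi 0) := by
      refine antitoneOn_of_deriv_nonpos (convex_Ioi 0)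
        (fun s hs => (hder q s hs).continuousAt.continuousWithinAt) ?_ ?_ <;>
        rw [interior_Ioi]
      · exact fun s hs => (hder q s hs).differentiableAt.differentiableWithinAt
      · intro s hs
        rw [(hder q s hs).deriv]
        exact mul_nonpos_of_nonneg_of_nonpos (Real.rpow_nonneg (le_of_lt hs) _)
          (by linarith [hup s hs])
    have h := hmono (mem_Ioi.2 ht) (mem_Ioi.2 (mul_pos hc0 ht)) (by nlinarith)
    simp only at h
    rw [Real.mul_rpow hc0.le ht.le, ← mul_assoc] at h
    have h2 := le_of_mul_le_mul_right h (Real.rpow_pos_of_pos ht _)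
    rw [Real.rpow_neg hc0.le, ← div_eq_mul_inv, div_le_iff₀ (Real.rpow_pos_of_pos hc0 _)] at h2
    linarith

namespace PhiAssumptions

variable {N : ℕ} {φ : ℝ → ℝ} {l m : ℝ}

theorem mulExt_of_pos {t : ℝ} (ht : 0 < t) : mulExt φ t = φ t * t := if_pos ht

theorem mulExt_of_nonpos {t : ℝ} (ht : t ≤ 0) : mulExt φ t = 0 := if_neg ht.not_gt

theorem hasDerivAt_nFun (h : PhiAssumptions N φ l m) {t : ℝ} (ht : 0 < t) :
    HasDerivAt (nFun φ) (φ t * t) t := by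
  have h0 : HasDerivAt (fun t : ℝ => ∫ s in (0 : ℝ)..t, mulExt φ s) (mulExt φ t) t := by
    refine intervalIntegral.integral_hasDerivAt_right (h.mulExt_int _ _)
      h.mulExt_mono.measurable.stronglyMeasurable.stronglyMeasurableAtFilter ?_
    have : (fun s => φ s * s) =ᶠ[𝓝 t] mulExt φ := by
      filter_upwards [Ioi_mem_nhds ht] with s hs
      exact (mulExt_of_pos hs).symm
    exact ((h.differentiableAt ht).continuousAt.mul continuousAt_id).congr this
  rw [mulExt_of_pos ht] at h0
  refine h0.congr_of_eventuallyEq ?_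
  filter_upwards [Ioi_mem_nhds ht] with s hs
  rw [nFun_eq, abs_of_pos hs]

theorem l_mul_le (h : PhiAssumptions N φ l m) {t : ℝ} (ht : 0 < t) :
    l * nFun φ t ≤ φ t * t * t := by
  have := h.ratio_lower t ht
  rw [le_div_iff₀ (h.nFun_pos ht)] at this
  nlinarith

theorem le_m_mul (h : PhiAssumptions N φ l m) {t : ℝ} (ht : 0 < t) :
    φ t * t * t ≤ m * nFun φ t := by
  have := h.ratio_upper t ht
  rw [div_le_iff₀ (h.nFun_pos ht)] at this
  nlinarith

theorem youngPair (h : PhiAssumptions N φ l m) : YoungPair (mulExt φ) (nFun φ) l m := by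
  have hs := scale_of_hasDerivAt (a := fun t => φ t * t) (fun t ht => h.hasDerivAt_nFun ht)
    (fun t ht => h.l_mul_le ht) (fun t ht => h.le_m_mul ht)
  have hm : 0 < m := by linarith [h.one_lt_l, h.l_le_m]
  have hl : 0 < l := by linarith [h.one_lt_l]
  refine ⟨h.one_lt_l, h.l_le_m, nFun_zero, fun t ht => h.nFun_pos ht, fun t _ => h.mulExt_nonneg t,
    h.mulExt_mono.monotoneOn _, fun s hs t _ hst => h.nFun_mono ?_, h.measurable_nFun, ?_, ?_, ?_, ?_⟩
  · have hs' : 0 ≤ s := hs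
    rwa [abs_of_nonneg hs', abs_of_nonneg (hs'.trans hst)]
  · intro t ht
    rcases ht.eq_or_lt with rfl | ht
    · simp [nFun_zero]
    · rw [mulExt_of_pos ht]; exact h.l_mul_le ht
  · intro t ht
    rcases ht.eq_or_lt with rfl | ht
    · simp [nFun_zero]
    · rw [mulExt_of_pos ht]; exact h.le_m_mul ht
  · intro c t hc hc1 ht
    rcases ht.eq_or_lt with rfl | ht
    · simp [nFun_zero]
    rcases hc.eq_or_lt with rfl | hc
    · simp [nFun_zero, Real.zero_rpow hl.ne']
    exact hs.1 c t hc hc1 ht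
  · intro c t hc ht
    rcases ht.eq_or_lt with rfl | ht
    · simp [nFun_zero]
    exact hs.2 c t hc ht

end PhiAssumptions

theorem youngPair_rpow {q : ℝ} (hq : 1 < q) :
    YoungPair (fun t => q * t ^ (q - 1)) (fun t => t ^ q) q q := by
  have hq0 : 0 < q := by linarith
  have e : ∀ t : ℝ, 0 ≤ t → q * t ^ (q - 1) * t = q * t ^ q := by
    intro t ht
    rcases ht.eq_or_lt with rfl | ht
    · simp [Real.zero_rpow hq0.ne']
    · rw [mul_assoc, ← Real.rpow_add_one ht.ne']; simp
  refine ⟨hq, le_rfl, Real.zero_rpow hq0.ne', fun t ht => Real.rpow_pos_of_pos ht _,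
    fun t ht => mul_nonneg hq0.le (Real.rpow_nonneg ht _), ?_, ?_, by fun_prop,
    fun t ht => (e t ht).ge, fun t ht => (e t ht).le,
    fun c t hc _ ht => (Real.mul_rpow hc ht).le,
    fun c t hc ht => (Real.mul_rpow (by linarith) ht).le⟩
  · intro s hs t _ hst
    have hs' : 0 ≤ s := hs
    dsimp only
    gcongr
  · intro s hs t _ hst
    have hs' : 0 ≤ s := hs
    dsimp only
    gcongr

namespace YoungPair

variable {a M a' M' : ℝ → ℝ} {p q p' q' : ℝ}

theorem nonneg (Y : YoungPair a M p q) {t : ℝ} (ht : 0 ≤ t) : 0 ≤ M t := by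
  rcases ht.eq_or_lt with rfl | ht
  · exact Y.zero.ge
  · exact (Y.pos t ht).le

theorem q_pos (Y : YoungPair a M p q) : 0 < q := by linarith [Y.one_lt, Y.p_le_q]

theorem add (Y : YoungPair a M p q) (Y' : YoungPair a' M' p' q') :
    YoungPair (fun t => a t + a' t) (fun t => M t + M' t) (min p p') (max q q') := by
  have hpq : min p p' ≤ max q q' := (min_le_left _ _).trans (Y.p_le_q.trans (le_max_left _ _))
  refine ⟨lt_min Y.one_lt Y'.one_lt, hpq, by simp [Y.zero, Y'.zero],
    fun t ht => add_pos (Y.pos t ht) (Y'.pos t ht),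
    fun t ht => add_nonneg (Y.a_nonneg t ht) (Y'.a_nonneg t ht),
    Y.a_mono.add Y'.a_mono, Y.mono.add Y'.mono, Y.measurable.add Y'.measurable, ?_, ?_, ?_, ?_⟩
  · intro t ht
    have h1 := mul_le_mul_of_nonneg_right (min_le_left p p') (Y.nonneg ht)
    have h2 := mul_le_mul_of_nonneg_right (min_le_right p p') (Y'.nonneg ht)
    linarith [Y.lower t ht, Y'.lower t ht]
  · intro t ht
    have h1 := mul_le_mul_of_nonneg_right (le_max_left q q') (Y.nonneg ht)
    have h2 := mul_le_mul_of_nonneg_right (le_max_right q q') (Y'.nonneg ht)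
    linarith [Y.upper t ht, Y'.upper t ht]
  · intro c t hc hc1 ht
    rcases hc.eq_or_lt with rfl | hc
    · simp only [zero_mul, Y.zero, Y'.zero, add_zero]
      exact mul_nonneg (Real.rpow_nonneg le_rfl _) (add_nonneg (Y.nonneg ht) (Y'.nonneg ht))
    have h1 := mul_le_mul_of_nonneg_right
      (Real.rpow_le_rpow_of_exponent_ge hc hc1 (min_le_left p p')) (Y.nonneg ht)
    have h2 := mul_le_mul_of_nonneg_right
      (Real.rpow_le_rpow_of_exponent_ge hc hc1 (min_le_right p p')) (Y'.nonneg ht)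
    linarith [Y.scale_le c t hc.le hc1 ht, Y'.scale_le c t hc.le hc1 ht]
  · intro c t hc ht
    have h1 := mul_le_mul_of_nonneg_right
      (Real.rpow_le_rpow_of_exponent_le hc (le_max_left q q')) (Y.nonneg ht)
    have h2 := mul_le_mul_of_nonneg_right
      (Real.rpow_le_rpow_of_exponent_le hc (le_max_right q q')) (Y'.nonneg ht)
    linarith [Y.scale_ge c t hc ht, Y'.scale_ge c t hc ht]

theorem scale_le_mul (Y : YoungPair a M p q) {c t : ℝ} (hc : 0 ≤ c) (hc1 : c ≤ 1) (ht : 0 ≤ t) :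
    M (c * t) ≤ c * M t := by
  refine (Y.scale_le c t hc hc1 ht).trans (mul_le_mul_of_nonneg_right ?_ (Y.nonneg ht))
  rcases hc.eq_or_lt with rfl | hc
  · rw [Real.zero_rpow (by linarith [Y.one_lt])]
  · simpa using Real.rpow_le_rpow_of_exponent_ge hc hc1 Y.one_lt.le

theorem add_le (Y : YoungPair a M p q) {s t : ℝ} (hs : 0 ≤ s) (ht : 0 ≤ t) :
    M (s + t) ≤ 2 ^ q * (M s + M t) := by
  have h2 : (0 : ℝ) < 2 ^ q := Real.rpow_pos_of_pos (by norm_num) _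
  rcases le_total s t with h | h
  · have h1 := Y.mono (mem_Ici.2 (add_nonneg hs ht)) (mem_Ici.2 (by linarith : 0 ≤ 2 * t))
      (by linarith)
    have h3 := Y.scale_ge 2 t (by norm_num) ht
    nlinarith [mul_nonneg h2.le (Y.nonneg hs)]
  · have h1 := Y.mono (mem_Ici.2 (add_nonneg hs ht)) (mem_Ici.2 (by linarith : 0 ≤ 2 * s))
      (by linarith)
    have h3 := Y.scale_ge 2 s (by norm_num) hs
    nlinarith [mul_nonneg h2.le (Y.nonneg ht)]

/-- A substitute for Young's inequality that needs no complementary function: the smaller of `s`,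
`t` is replaced by the larger one, using that `a` is monotone. -/
theorem a_mul_le (Y : YoungPair a M p q) {s t : ℝ} (hs : 0 ≤ s) (ht : 0 ≤ t) :
    a s * t ≤ q * (M s + M t) := by
  have hq := Y.q_pos
  rcases le_total t s with h | h
  · have h1 := mul_le_mul_of_nonneg_left h (Y.a_nonneg s hs)
    nlinarith [Y.upper s hs, mul_nonneg hq.le (Y.nonneg ht)]
  · have h1 := mul_le_mul_of_nonneg_right (Y.a_mono hs ht h) ht
    nlinarith [Y.upper t ht, mul_nonneg hq.le (Y.nonneg hs)]

/-- The part of Young's inequality where the second factor dominates. -/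
theorem a_mul_le_of_lt (Y : YoungPair a M p q) {K s t : ℝ} (hK : 1 ≤ K) (hs : 0 ≤ s)
    (h : K * s ≤ t) : a s * t ≤ q * K ^ (1 - p) * M t := by
  have hK0 : 0 < K := by linarith
  have ht : 0 ≤ t := (mul_nonneg hK0.le hs).trans h
  have hst : s ≤ K⁻¹ * t := by rw [le_inv_mul_iff₀ hK0]; exact h
  have ht' : 0 ≤ K⁻¹ * t := by positivity
  -- Replacing `s` by `t / K` is allowed by monotonicity of `a`; the gain `K^{-p}` in `M(t / K) ≤
  -- K^{-p} M(t)` then beats the factor `K` because `p > 1`.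
  have h1 := mul_le_mul_of_nonneg_right (Y.a_mono hs ht' hst) ht
  have h2 := Y.upper (K⁻¹ * t) ht'
  have h3 := Y.scale_le K⁻¹ t (by positivity) (inv_le_one_of_one_le₀ hK) ht
  have e : K ^ (1 - p) = K * K⁻¹ ^ p := by
    rw [Real.rpow_sub hK0, Real.rpow_one, Real.inv_rpow hK0.le]; rfl
  have e2 : a (K⁻¹ * t) * t = K * (a (K⁻¹ * t) * (K⁻¹ * t)) := by field_simp
  rw [e]
  calc a s * t ≤ K * (a (K⁻¹ * t) * (K⁻¹ * t)) := by rw [← e2]; exact h1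
    _ ≤ K * (q * (K⁻¹ ^ p * M t)) := by
        exact mul_le_mul_of_nonneg_left
          (h2.trans (mul_le_mul_of_nonneg_left h3 Y.q_pos.le)) hK0.le
    _ = _ := by ring

theorem exists_rpow_lt (Y : YoungPair a M p q) {δ C : ℝ} (hδ : 0 < δ) :
    ∃ K : ℝ, 1 ≤ K ∧ C * K ^ (1 - p) ≤ δ := by
  have h := (tendsto_rpow_neg_atTop (y := p - 1) (by linarith [Y.one_lt])).const_mul C
  rw [mul_zero] at h
  obtain ⟨K, h1, h2⟩ := ((h.eventually (gt_mem_nhds hδ)).and (eventually_ge_atTop 1)).exists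
  exact ⟨K, h2, by rw [show 1 - p = -(p - 1) by ring]; exact h1.le⟩

/-- Split according to whether `K s ≤ t`: if so, the coefficient `q K^{1-p}` is at most `δ`;
otherwise `a(s) t ≤ K a(s) s`. -/
theorem a_mul_le_eps (Y : YoungPair a M p q) {δ : ℝ} (hδ : 0 < δ) :
    ∃ K : ℝ, 0 ≤ K ∧ ∀ s t, 0 ≤ s → 0 ≤ t → a s * t ≤ K * M s + δ * M t := by
  obtain ⟨K, hK, h⟩ := Y.exists_rpow_lt (C := q) hδ
  refine ⟨K * q, mul_nonneg (by linarith) Y.q_pos.le, fun s t hs ht => ?_⟩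
  rcases le_total (K * s) t with hc | hc
  · have h1 := Y.a_mul_le_of_lt hK hs hc
    have h2 := mul_le_mul_of_nonneg_right h (Y.nonneg ht)
    have h3 := mul_nonneg (mul_nonneg (by linarith : 0 ≤ K) Y.q_pos.le) (Y.nonneg hs)
    linarith
  · have h1 := mul_le_mul_of_nonneg_left hc (Y.a_nonneg s hs)
    have h2 := mul_le_mul_of_nonneg_left (Y.upper s hs) (by linarith : 0 ≤ K)
    have h3 := mul_nonneg hδ.le (Y.nonneg ht)
    nlinarith

/-- For `t ≥ δ` the scaling `M(δ) ≤ (δ/t) M(t)` bounds `t` by a multiple of `M(t)`. This is how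
modular bounds become `L¹` bounds on sets of finite measure. -/
theorem le_add_mul (Y : YoungPair a M p q) {δ : ℝ} (hδ : 0 < δ) {t : ℝ} (ht : 0 ≤ t) :
    t ≤ δ + δ / M δ * M t := by
  have hM := Y.pos δ hδ
  rcases le_total t δ with h | h
  · have := mul_nonneg (div_nonneg hδ.le hM.le) (Y.nonneg ht)
    linarith
  · have ht0 : 0 < t := by linarith
    have h1 := Y.scale_le_mul (c := δ / t) (t := t) (by positivity) ((div_le_one ht0).2 h) ht
    rw [div_mul_cancel₀ _ ht0.ne'] at h1
    have : t * M δ ≤ δ * M t := by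
      rw [div_mul_eq_mul_div, le_div_iff₀ ht0] at h1
      linarith
    rw [div_mul_eq_mul_div]
    have : t ≤ δ * M t / M δ := by rwa [le_div_iff₀ hM]
    linarith

end YoungPair

/-! ### Modulars and convergence in modular -/

section Modular

variable {α E : Type*} [MeasurableSpace α] [NormedAddCommGroup E] {μ : Measure α}
  {a M : ℝ → ℝ} {p q : ℝ} {u v : α → E}

theorem YoungPair.aemeasurable (Y : YoungPair a M p q) (hu : AEStronglyMeasurable u μ) :
    AEMeasurable (fun x => ENNReal.ofReal (M ‖u x‖)) μ :=
  (Y.measurable.comp_aemeasurable hu.norm.aemeasurable).ennreal_ofReal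

theorem YoungPair.modular_add_le (Y : YoungPair a M p q) (hu : AEStronglyMeasurable u μ) :
    modular M μ (u + v) ≤ ENNReal.ofReal (2 ^ q) * (modular M μ u + modular M μ v) := by
  unfold modular
  rw [← lintegral_add_left' (Y.aemeasurable hu), ← lintegral_const_mul' _ _ ENNReal.ofReal_ne_top]
  refine lintegral_mono fun x => ?_
  rw [← ENNReal.ofReal_add (Y.nonneg (norm_nonneg _)) (Y.nonneg (norm_nonneg _)),
    ← ENNReal.ofReal_mul (by positivity)]
  refine ENNReal.ofReal_le_ofReal (le_trans ?_ (Y.add_le (norm_nonneg _) (norm_nonneg _)))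
  exact Y.mono (norm_nonneg _) (add_nonneg (norm_nonneg _) (norm_nonneg _)) (norm_add_le _ _)

theorem YoungPair.modular_le_of_le (Y : YoungPair a M p q) {c : ℝ} (hc : 1 ≤ c) {F : Type*}
    [NormedAddCommGroup F] {w : α → F}
    (h : ∀ᵐ x ∂μ, ‖u x‖ ≤ c * ‖w x‖) : modular M μ u ≤ ENNReal.ofReal (c ^ q) * modular M μ w := by
  unfold modular
  rw [← lintegral_const_mul' _ _ ENNReal.ofReal_ne_top]
  refine lintegral_mono_ae (h.mono fun x hx => ?_)
  rw [← ENNReal.ofReal_mul (by positivity)]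
  refine ENNReal.ofReal_le_ofReal (le_trans ?_ (Y.scale_ge c _ hc (norm_nonneg _)))
  exact Y.mono (norm_nonneg _) (mul_nonneg (by linarith) (norm_nonneg _)) hx

theorem YoungPair.modular_mono (Y : YoungPair a M p q) {F : Type*}
    [NormedAddCommGroup F] {w : α → F}
    (h : ∀ᵐ x ∂μ, ‖u x‖ ≤ ‖w x‖) : modular M μ u ≤ modular M μ w :=
  lintegral_mono_ae (h.mono fun _ hx =>
    ENNReal.ofReal_le_ofReal (Y.mono (norm_nonneg _) (norm_nonneg _) hx))

theorem YoungPair.modular_smul_le [NormedSpace ℝ E] (Y : YoungPair a M p q) {c : ℝ}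
    (hc1 : |c| ≤ 1) :
    modular M μ (c • u) ≤ ENNReal.ofReal |c| * modular M μ u := by
  unfold modular
  rw [← lintegral_const_mul' _ _ ENNReal.ofReal_ne_top]
  refine lintegral_mono fun x => ?_
  rw [← ENNReal.ofReal_mul (abs_nonneg c), Pi.smul_apply, norm_smul, Real.norm_eq_abs]
  exact ENNReal.ofReal_le_ofReal (Y.scale_le_mul (abs_nonneg c) hc1 (norm_nonneg _))

theorem YoungPair.modular_smul_le_rpow [NormedSpace ℝ E] (Y : YoungPair a M p q) {c : ℝ}
    (hc1 : 1 ≤ |c|) :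
    modular M μ (c • u) ≤ ENNReal.ofReal (|c| ^ q) * modular M μ u :=
  Y.modular_le_of_le hc1 (Eventually.of_forall fun x => by
    rw [Pi.smul_apply, norm_smul, Real.norm_eq_abs])

/-- Dominated convergence to zero, with a dominating function perturbed by functions whose
integrals tend to zero. -/
theorem tendsto_lintegral_zero_of_le_add {f e : ℕ → α → ENNReal} {G : α → ENNReal}
    (hf : ∀ n, AEMeasurable (f n) μ) (hG : AEMeasurable G μ)
    (hlim : ∀ᵐ x ∂μ, Tendsto (fun n => f n x) atTop (𝓝 0)) (hGi : ∫⁻ x, G x ∂μ ≠ ⊤)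
    (hle : ∀ n, ∀ᵐ x ∂μ, f n x ≤ G x + e n x)
    (he : Tendsto (fun n => ∫⁻ x, e n x ∂μ) atTop (𝓝 0)) :
    Tendsto (fun n => ∫⁻ x, f n x ∂μ) atTop (𝓝 0) := by
  -- Since `f ≤ min f G + e`, only the minimum has to converge, and it is dominated by `G`.
  have h1 : Tendsto (fun n => ∫⁻ x, min (f n x) (G x) ∂μ) atTop (𝓝 (∫⁻ _, 0 ∂μ)) := by
    refine tendsto_lintegral_of_dominated_convergence' G (fun n => (hf n).min hG)
      (fun n => Eventually.of_forall fun x => min_le_right _ _) hGi ?_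
    filter_upwards [hlim] with x hx
    exact tendsto_of_tendsto_of_tendsto_of_le_of_le tendsto_const_nhds hx
      (fun _ => zero_le) (fun n => min_le_left _ _)
  rw [lintegral_zero] at h1
  have h2 := h1.add he
  rw [add_zero] at h2
  refine tendsto_of_tendsto_of_tendsto_of_le_of_le tendsto_const_nhds h2
    (fun _ => zero_le) (fun n => ?_)
  dsimp only
  rw [← lintegral_add_left' ((hf n).min hG)]
  refine lintegral_mono_ae ((hle n).mono fun x hx => ?_)
  rcases le_total (f n x) (G x) with h | h
  · rw [min_eq_left h]; exact le_self_add
  · rw [min_eq_right h]; exact hx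

/-- Convergence in modular implies convergence almost everywhere along a subsequence. -/
theorem YoungPair.exists_subseq_ae (Y : YoungPair a M p q) {w : ℕ → α → E}
    (hw : ∀ n, AEStronglyMeasurable (w n) μ)
    (h : Tendsto (fun n => modular M μ (w n - u)) atTop (𝓝 0)) (hu : AEStronglyMeasurable u μ) :
    ∃ σ : ℕ → ℕ, StrictMono σ ∧ ∀ᵐ x ∂μ, Tendsto (fun n => w (σ n) x) atTop (𝓝 (u x)) := by
  -- Markov's inequality for `M(‖w_n - u‖)` at the level `M δ` turns modular convergence into
  -- convergence in measure.
  have hm : TendstoInMeasure μ w atTop u := by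
    rw [tendstoInMeasure_iff_norm]
    intro δ hδ
    have hMδ := Y.pos δ hδ
    have h3 : Tendsto (fun n => modular M μ (w n - u) / ENNReal.ofReal (M δ)) atTop (𝓝 0) := by
      have := ENNReal.Tendsto.div_const h (b := ENNReal.ofReal (M δ))
        (Or.inr (ENNReal.ofReal_pos.2 hMδ).ne')
      simpa using this
    refine tendsto_of_tendsto_of_tendsto_of_le_of_le tendsto_const_nhds h3
      (fun _ => zero_le) (fun n => ?_)
    have := meas_ge_le_lintegral_div (Y.aemeasurable ((hw n).sub hu))
      (ε := ENNReal.ofReal (M δ)) (ENNReal.ofReal_pos.2 hMδ).ne' ENNReal.ofReal_ne_top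
    refine le_trans (measure_mono fun x hx => ?_) this
    exact ENNReal.ofReal_le_ofReal (Y.mono hδ.le (norm_nonneg _) hx)
  exact hm.exists_seq_tendsto_ae

end Modular

end OrliczNehari

namespace OrliczNehari

/-! ### Integral functionals of class C¹ -/

section Nemytskii

variable {X : Type*} [NormedAddCommGroup X] [NormedSpace ℝ X]
  {α E : Type*} [MeasurableSpace α] [NormedAddCommGroup E] {μ : Measure α}
  {a M : ℝ → ℝ} {p q : ℝ}

/-- A linear map (up to null sets) from a normed space to functions, bounded from the unit ball
to a modular. -/
structure ModularMap [NormedSpace ℝ E] (T : X → α → E) (M : ℝ → ℝ) (μ : Measure α) : Prop where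
  aesm : ∀ u, AEStronglyMeasurable (T u) μ
  add : ∀ u v, T (u + v) =ᵐ[μ] T u + T v
  smul : ∀ (c : ℝ) u, T (c • u) =ᵐ[μ] c • T u
  bound : ∃ C : NNReal, ∀ u, ‖u‖ < 1 → modular M μ (T u) ≤ C

namespace ModularMap

variable [NormedSpace ℝ E] {T : X → α → E}

theorem map_zero (hT : ModularMap T M μ) : T 0 =ᵐ[μ] 0 := by
  have := hT.smul 0 0
  simpa using this

theorem map_sub (hT : ModularMap T M μ) (u v : X) : T (u - v) =ᵐ[μ] T u - T v := by
  have h1 := hT.add u ((-1 : ℝ) • v)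
  have h2 := hT.smul (-1) v
  filter_upwards [h1, h2] with x h1 h2
  rw [sub_eq_add_neg u v, ← neg_one_smul ℝ v, h1, Pi.add_apply, h2, Pi.sub_apply]
  simp [sub_eq_add_neg]

/-- Every vector is a dilation of one in the open unit ball, and the upper scaling of `M` with
exponent `q` pays for the dilation. -/
theorem bounded (hT : ModularMap T M μ) (Y : YoungPair a M p q) (R : ℝ) :
    ∃ C : NNReal, ∀ u, ‖u‖ ≤ R → modular M μ (T u) ≤ C := by
  obtain ⟨C, hC⟩ := hT.bound
  have hR : 1 ≤ |R| + 1 := by linarith [abs_nonneg R]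
  have hR' : 1 ≤ abs (|R| + 1) := hR.trans (le_abs_self _)
  refine ⟨(abs (|R| + 1) ^ q).toNNReal * C, fun u hu => ?_⟩
  have hu' : ‖(|R| + 1)⁻¹ • u‖ < 1 := by
    rw [norm_smul, Real.norm_eq_abs, abs_inv, abs_of_pos (by linarith),
      inv_mul_lt_iff₀ (by linarith)]
    linarith [le_abs_self R]
  have h2 := hT.smul (|R| + 1) ((|R| + 1)⁻¹ • u)
  rw [smul_inv_smul₀ (by linarith)] at h2
  rw [modular_congr h2]
  refine (Y.modular_smul_le_rpow hR').trans ?_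
  rw [ENNReal.coe_mul]
  exact mul_le_mul' le_rfl (hC _ hu')

theorem finite (hT : ModularMap T M μ) (Y : YoungPair a M p q) (u : X) :
    modular M μ (T u) < ⊤ := by
  obtain ⟨C, hC⟩ := hT.bounded Y ‖u‖
  exact (hC u le_rfl).trans_lt ENNReal.coe_lt_top

/-- Since `M(c t) ≤ c M(t)` for `c ≤ 1`, the modular decays linearly with the norm. The factor in `c
= 2‖u‖` places `u / (2‖u‖)` strictly inside the unit ball, as `bound` requires. -/
theorem small (hT : ModularMap T M μ) (Y : YoungPair a M p q) :
    ∃ C : NNReal, ∀ u, ‖u‖ ≤ 1 / 2 → modular M μ (T u) ≤ ENNReal.ofReal (2 * ‖u‖) * C := by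
  obtain ⟨C, hC⟩ := hT.bound
  refine ⟨C, fun u hu => ?_⟩
  rcases eq_or_ne u 0 with rfl | h0
  · rw [modular_congr hT.map_zero]
    simp [modular, Y.zero]
  have hn : 0 < ‖u‖ := norm_pos_iff.2 h0
  have hu' : ‖(2 * ‖u‖)⁻¹ • u‖ < 1 := by
    rw [norm_smul, Real.norm_eq_abs, abs_inv, abs_of_pos (by linarith),
      inv_mul_lt_iff₀ (by linarith)]
    linarith
  have h2 := hT.smul (2 * ‖u‖) ((2 * ‖u‖)⁻¹ • u)
  rw [smul_inv_smul₀ (by linarith)] at h2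
  rw [modular_congr h2]
  have ha : |2 * ‖u‖| = 2 * ‖u‖ := abs_of_pos (by linarith)
  refine (Y.modular_smul_le (by rw [ha]; linarith)).trans ?_
  rw [ha]
  exact mul_le_mul' le_rfl (hC _ hu')

theorem tendsto_zero (hT : ModularMap T M μ) (Y : YoungPair a M p q) {ι : Type*} {L : Filter ι}
    {w : ι → X} (h : Tendsto w L (𝓝 0)) : Tendsto (fun n => modular M μ (T (w n))) L (𝓝 0) := by
  obtain ⟨C, hC⟩ := hT.small Y
  have hn : Tendsto (fun n => ‖w n‖) L (𝓝 0) := by simpa using h.norm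
  have h1 : Tendsto (fun n => ENNReal.ofReal (2 * ‖w n‖) * C) L (𝓝 0) := by
    have := ENNReal.Tendsto.mul_const (b := (C : ENNReal))
      (ENNReal.tendsto_ofReal (hn.const_mul 2)) (Or.inr ENNReal.coe_ne_top)
    simpa using this
  refine tendsto_of_tendsto_of_tendsto_of_le_of_le' tendsto_const_nhds h1
    (Eventually.of_forall fun _ => zero_le) ?_
  filter_upwards [hn.eventually (ge_mem_nhds (by norm_num : (0 : ℝ) < 1 / 2))] with n hn
  exact hC _ hn

theorem tendsto_sub (hT : ModularMap T M μ) (Y : YoungPair a M p q) {ι : Type*} {L : Filter ι}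
    {w : ι → X} {u : X} (h : Tendsto w L (𝓝 u)) :
    Tendsto (fun n => modular M μ (T (w n) - T u)) L (𝓝 0) := by
  have h1 := hT.tendsto_zero Y (tendsto_sub_nhds_zero_iff.2 h)
  refine h1.congr fun n => modular_congr (hT.map_sub _ _)

end ModularMap

theorem YoungPair.integrable (Y : YoungPair a M p q) {w : α → E} (hw : AEStronglyMeasurable w μ)
    (h : modular M μ w < ⊤) : Integrable (fun x => M ‖w x‖) μ :=
  (lintegral_ofReal_ne_top_iff_integrable
    (Y.measurable.comp_aemeasurable hw.norm.aemeasurable).aestronglyMeasurable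
    (Eventually.of_forall fun _ => Y.nonneg (norm_nonneg _))).1 h.ne

theorem YoungPair.integral_eq (Y : YoungPair a M p q) {w : α → E}
    (hw : AEStronglyMeasurable w μ) : ∫ x, M ‖w x‖ ∂μ = (modular M μ w).toReal :=
  integral_eq_lintegral_of_nonneg_ae (Eventually.of_forall fun _ => Y.nonneg (norm_nonneg _))
    (Y.measurable.comp_aemeasurable hw.norm.aemeasurable).aestronglyMeasurable

theorem abs_le_of_unit_ball (L : X →ₗ[ℝ] ℝ) {B : ℝ} (h : ∀ v, ‖v‖ < 1 → |L v| ≤ B)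
    (v : X) : |L v| ≤ 2 * B * ‖v‖ := by
  rcases eq_or_ne v 0 with rfl | h0
  · simp
  have hn : 0 < ‖v‖ := norm_pos_iff.2 h0
  have hu' : ‖(2 * ‖v‖)⁻¹ • v‖ < 1 := by
    rw [norm_smul, Real.norm_eq_abs, abs_inv, abs_of_pos (by linarith),
      inv_mul_lt_iff₀ (by linarith)]
    linarith
  have := h _ hu'
  rw [map_smul, smul_eq_mul, abs_mul, abs_inv, abs_of_pos (by linarith : 0 < 2 * ‖v‖),
    inv_mul_le_iff₀ (by linarith)] at this
  linarith

/-- A functional with continuous Gateaux derivative is Fréchet differentiable. -/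
theorem hasFDerivAt_of_gateaux {I : X → ℝ} {D : X → X →L[ℝ] ℝ} (hD : Continuous D)
    (hG : ∀ u v, ∀ t : ℝ, HasDerivAt (fun t : ℝ => I (u + t • v)) (D (u + t • v) v) t) (u : X) :
    HasFDerivAt I (D u) u := by
  rw [hasFDerivAt_iff_isLittleO_nhds_zero, Asymptotics.isLittleO_iff]
  intro ε hε
  obtain ⟨δ, hδ, hb⟩ := Metric.continuousAt_iff.1 hD.continuousAt ε hε
  filter_upwards [Metric.ball_mem_nhds (0 : X) hδ] with v hv
  rw [mem_ball_zero_iff] at hv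
  -- The mean value inequality is applied to `t ↦ I(u + t v) - t D(u)v` on `[0, 1]`, whose
  -- derivative is at most `ε ‖v‖` by continuity of `D` at `u`.
  have hd : ∀ t ∈ Icc (0 : ℝ) 1, HasDerivWithinAt (fun t : ℝ => I (u + t • v) - t * D u v)
      (D (u + t • v) v - D u v) (Icc 0 1) t := fun t _ =>
    ((hG u v t).sub (by simpa using (hasDerivAt_id t).mul_const (D u v))).hasDerivWithinAt
  have := norm_image_sub_le_of_norm_deriv_le_segment_01' hd (C := ε * ‖v‖) (fun t ht => by
    have h1 : dist (u + t • v) u < δ := by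
      rw [dist_eq_norm, add_sub_cancel_left, norm_smul, Real.norm_eq_abs, abs_of_nonneg ht.1]
      nlinarith [norm_nonneg v, ht.2]
    have h2 := hb h1
    rw [dist_eq_norm] at h2
    rw [← sub_apply]
    exact (ContinuousLinearMap.le_opNorm _ _).trans (by gcongr))
  simp only [one_smul, one_mul, zero_smul, add_zero, zero_mul, sub_zero] at this
  rwa [sub_right_comm] at this

variable [InnerProductSpace ℝ E]

/-- An integrand `h` with gradient `H` (in the second variable) of growth `a`. -/
structure NemytskiiData (μ : Measure α) (a : ℝ → ℝ) (h : α → E → ℝ) (H : α → E → E) :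
    Prop where
  zero : ∀ x, h x 0 = 0
  hasFDerivAt : ∀ x e, HasFDerivAt (h x) (innerSL ℝ (H x e)) e
  cont : ∀ x, Continuous (H x)
  bound : ∃ C, 0 ≤ C ∧ ∀ x e, ‖H x e‖ ≤ C * a ‖e‖
  aesm : ∀ u : α → E, AEStronglyMeasurable u μ → AEStronglyMeasurable (fun x => h x (u x)) μ
  aesm_grad : ∀ u : α → E, AEStronglyMeasurable u μ →
    AEStronglyMeasurable (fun x => H x (u x)) μ

namespace NemytskiiData

variable {h : α → E → ℝ} {H : α → E → E} {T : X → α → E}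

theorem abs_inner_le (hN : NemytskiiData μ a h H) (Y : YoungPair a M p q) :
    ∃ C, 0 ≤ C ∧ ∀ x e v, |inner ℝ (H x e) v| ≤ C * (M ‖e‖ + M ‖v‖) := by
  obtain ⟨C, hC, hb⟩ := hN.bound
  refine ⟨C * q, mul_nonneg hC Y.q_pos.le, fun x e v => ?_⟩
  calc |inner ℝ (H x e) v| ≤ ‖H x e‖ * ‖v‖ := abs_real_inner_le_norm _ _
    _ ≤ C * a ‖e‖ * ‖v‖ := by gcongr; exact hb x e
    _ = C * (a ‖e‖ * ‖v‖) := by ring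
    _ ≤ C * (q * (M ‖e‖ + M ‖v‖)) := by
        exact mul_le_mul_of_nonneg_left (Y.a_mul_le (norm_nonneg _) (norm_nonneg _)) hC
    _ = _ := by ring

/-- On the ball of radius `‖e‖` the gradient is at most `C a(‖e‖)`, because `a` is monotone; the
mean value inequality from the origin then gives `C a(‖e‖) ‖e‖`. -/
theorem abs_le (hN : NemytskiiData μ a h H) (Y : YoungPair a M p q) :
    ∃ C, 0 ≤ C ∧ ∀ x e, |h x e| ≤ C * M ‖e‖ := by
  obtain ⟨C, hC, hb⟩ := hN.bound
  refine ⟨C * q, mul_nonneg hC Y.q_pos.le, fun x e => ?_⟩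
  have h1 := (convex_closedBall (0 : E) ‖e‖).norm_image_sub_le_of_norm_hasFDerivWithin_le
    (f := h x) (f' := fun e => innerSL ℝ (H x e)) (C := C * a ‖e‖) (x := 0) (y := e)
    (fun y _ => (hN.hasFDerivAt x y).hasFDerivWithinAt) (fun y hy => by
      rw [innerSL_apply_norm]
      refine (hb x y).trans ?_
      gcongr
      rw [mem_closedBall_zero_iff] at hy
      exact Y.a_mono (norm_nonneg _) (norm_nonneg _) hy) (by simp) (by simp)
  rw [hN.zero, sub_zero, sub_zero, Real.norm_eq_abs] at h1
  calc |h x e| ≤ C * (a ‖e‖ * ‖e‖) := by linarith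
    _ ≤ C * (q * M ‖e‖) := mul_le_mul_of_nonneg_left (Y.upper _ (norm_nonneg _)) hC
    _ = _ := by ring

theorem integrable_inner (hN : NemytskiiData μ a h H) (Y : YoungPair a M p q) {u v : α → E}
    (hu : AEStronglyMeasurable u μ) (hv : AEStronglyMeasurable v μ)
    (hfu : modular M μ u < ⊤) (hfv : modular M μ v < ⊤) :
    Integrable (fun x => inner ℝ (H x (u x)) (v x)) μ := by
  obtain ⟨C, hC, hb⟩ := hN.abs_inner_le Y
  exact (((Y.integrable hu hfu).add (Y.integrable hv hfv)).const_mul C).mono'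
    ((hN.aesm_grad u hu).inner hv) (Eventually.of_forall fun x => hb x _ _)

theorem integrable (hN : NemytskiiData μ a h H) (Y : YoungPair a M p q) {u : α → E}
    (hu : AEStronglyMeasurable u μ) (hfu : modular M μ u < ⊤) :
    Integrable (fun x => h x (u x)) μ := by
  obtain ⟨C, hC, hb⟩ := hN.abs_le Y
  exact ((Y.integrable hu hfu).const_mul C).mono' (hN.aesm u hu)
    (Eventually.of_forall fun x => hb x _)

theorem hasDerivAt_line (hN : NemytskiiData μ a h H) (Y : YoungPair a M p q) {u v : α → E}
    (hu : AEStronglyMeasurable u μ) (hv : AEStronglyMeasurable v μ)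
    (hfu : modular M μ u < ⊤) (hfv : modular M μ v < ⊤) (t : ℝ) :
    HasDerivAt (fun t : ℝ => ∫ x, h x (u x + t • v x) ∂μ)
      (∫ x, inner ℝ (H x (u x + t • v x)) (v x) ∂μ) t := by
  obtain ⟨C, hC, hb⟩ := hN.abs_inner_le Y
  -- This bounds every parameter in the unit ball around `t`, so that one dominating function serves
  -- them all.
  set c : ℝ := |t| + 1 with hc
  have hc1 : 1 ≤ c := by rw [hc]; linarith [abs_nonneg t]
  have hc' : 1 ≤ |c| := hc1.trans (le_abs_self _)
  have haes : ∀ s : ℝ, AEStronglyMeasurable (fun x => u x + s • v x) μ :=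
    fun s => hu.add (hv.const_smul s)
  have hfin : ∀ s : ℝ, |s| ≤ c → modular M μ (fun x => u x + s • v x) < ⊤ := by
    intro s hs
    refine (Y.modular_add_le (v := s • v) hu).trans_lt
      (ENNReal.mul_lt_top ENNReal.ofReal_lt_top (ENNReal.add_lt_top.2 ⟨hfu, ?_⟩))
    refine (Y.modular_le_of_le (w := v) hc1 (Eventually.of_forall fun x => ?_)).trans_lt
      (ENNReal.mul_lt_top ENNReal.ofReal_lt_top hfv)
    rw [Pi.smul_apply, norm_smul, Real.norm_eq_abs]
    gcongr
  have hdom : Integrable (fun x => C * (2 ^ q * (M ‖u x‖ + c ^ q * M ‖v x‖) + M ‖v x‖)) μ :=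
    ((((Y.integrable hu hfu).add ((Y.integrable hv hfv).const_mul _)).const_mul _).add
      (Y.integrable hv hfv)).const_mul C
  refine (hasDerivAt_integral_of_dominated_loc_of_deriv_le
    (F := fun t x => h x (u x + t • v x)) (F' := fun t x => inner ℝ (H x (u x + t • v x)) (v x))
    (Metric.ball_mem_nhds t one_pos) (Eventually.of_forall fun s => hN.aesm _ (haes s))
    (hN.integrable Y (haes t) (hfin t (by rw [hc]; linarith)))
    ((hN.aesm_grad _ (haes t)).inner hv) (Eventually.of_forall fun x s hs => ?_) hdom
    (Eventually.of_forall fun x s hs => ?_)).2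
  · rw [Real.norm_eq_abs]
    have hs' : |s| ≤ c := by
      have h1 : |s - t| < 1 := hs
      have h2 : |s| - |t| ≤ |s - t| := abs_sub_abs_le_abs_sub s t
      rw [hc]; linarith
    refine (hb x _ _).trans (mul_le_mul_of_nonneg_left (add_le_add ?_ le_rfl) hC)
    have hcv : 0 ≤ c * ‖v x‖ := by positivity
    refine le_trans (Y.mono (norm_nonneg _) (add_nonneg (norm_nonneg (u x)) hcv) ?_) ?_
    · refine (norm_add_le _ _).trans (add_le_add le_rfl ?_)
      rw [norm_smul, Real.norm_eq_abs]
      gcongr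
    · refine (Y.add_le (norm_nonneg _) hcv).trans ?_
      gcongr
      exact Y.scale_ge c _ hc1 (norm_nonneg _)
  · have h1 : HasDerivAt (fun s : ℝ => u x + s • v x) (v x) s := by
      simpa using ((hasDerivAt_id s).smul_const (v x)).const_add (u x)
    exact (hN.hasFDerivAt x (u x + s • v x)).comp_hasDerivAt s h1

/-- For `v` in the unit ball the pairing is bounded by the modulars of `T u` and `T v`. Homogeneity
in `v` turns this into continuity, with an operator norm bounded on bounded sets of `u`. -/
theorem exists_deriv (hN : NemytskiiData μ a h H) (Y : YoungPair a M p q)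
    (hT : ModularMap T M μ) :
    ∃ D : X → X →L[ℝ] ℝ, (∀ u v, D u v = ∫ x, inner ℝ (H x (T u x)) (T v x) ∂μ) ∧
      ∀ R, ∃ K, ∀ u, ‖u‖ ≤ R → ‖D u‖ ≤ K := by
  obtain ⟨C, hC, hb⟩ := hN.abs_inner_le Y
  obtain ⟨C₀, hC₀⟩ := hT.bound
  have hint : ∀ u v, Integrable (fun x => inner ℝ (H x (T u x)) (T v x)) μ := fun u v =>
    hN.integrable_inner Y (hT.aesm u) (hT.aesm v) (hT.finite Y u) (hT.finite Y v)
  let L : X → X →ₗ[ℝ] ℝ := fun u =>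
    { toFun := fun v => ∫ x, inner ℝ (H x (T u x)) (T v x) ∂μ
      map_add' := fun v w => by
        rw [← integral_add (hint u v) (hint u w)]
        refine integral_congr_ae ((hT.add v w).mono fun x hx => ?_)
        simp only [hx, Pi.add_apply, inner_add_right]
      map_smul' := fun c v => by
        rw [RingHom.id_apply, smul_eq_mul, ← integral_const_mul]
        refine integral_congr_ae ((hT.smul c v).mono fun x hx => ?_)
        simp only [hx, Pi.smul_apply, inner_smul_right] }
  have hL : ∀ u v, ‖v‖ < 1 → |L u v| ≤ C * ((modular M μ (T u)).toReal + C₀) := by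
    intro u v hv
    have i1 := Y.integrable (hT.aesm u) (hT.finite Y u)
    have i2 := Y.integrable (hT.aesm v) (hT.finite Y v)
    calc |L u v| ≤ ∫ x, C * (M ‖T u x‖ + M ‖T v x‖) ∂μ := by
          refine (norm_integral_le_integral_norm
            (fun x => inner ℝ (H x (T u x)) (T v x))).trans ?_
          exact integral_mono (hint u v).norm ((i1.add i2).const_mul C) fun x => hb x _ _
      _ = C * ((modular M μ (T u)).toReal + (modular M μ (T v)).toReal) := by
          rw [integral_const_mul, integral_add i1 i2, Y.integral_eq (hT.aesm u),
            Y.integral_eq (hT.aesm v)]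
      _ ≤ _ := by
          gcongr
          have := ENNReal.toReal_mono ENNReal.coe_ne_top (hC₀ v hv)
          simpa using this
  refine ⟨fun u => (L u).mkContinuous _ (fun v => abs_le_of_unit_ball (L u) (hL u) v),
    fun u v => rfl, fun R => ?_⟩
  obtain ⟨C₁, hC₁⟩ := hT.bounded Y R
  refine ⟨2 * (C * (C₁ + C₀)), fun u hu => ?_⟩
  refine (LinearMap.mkContinuous_norm_le _ (by positivity) _).trans ?_
  have := ENNReal.toReal_mono ENNReal.coe_ne_top (hC₁ u hu)
  simp only [ENNReal.coe_toReal] at this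
  gcongr

/-- The convergence has to be uniform for `v` in the unit ball. Let `Δ` be the difference of the
gradients and `s = ‖T w_n‖ + ‖T u‖`. Where `‖T v‖ ≥ K s`, the product `Δ ‖T v‖` is at most a
multiple of `K^{1-p} M(‖T v‖)`, whose integral is small for large `K` uniformly in `v`. Elsewhere it
is at most `K Δ s`, which does not involve `v` and tends to zero in `L¹` by perturbed dominated
convergence. -/
theorem tendsto_deriv (hN : NemytskiiData μ a h H) (Y : YoungPair a M p q)
    (hT : ModularMap T M μ) {D : X → X →L[ℝ] ℝ}
    (hD : ∀ u v, D u v = ∫ x, inner ℝ (H x (T u x)) (T v x) ∂μ) {w : ℕ → X} {u : X}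
    (hw : Tendsto w atTop (𝓝 u))
    (hae : ∀ᵐ x ∂μ, Tendsto (fun n => T (w n) x) atTop (𝓝 (T u x))) :
    Tendsto (fun n => D (w n)) atTop (𝓝 (D u)) := by
  obtain ⟨C, hC, hb⟩ := hN.bound
  obtain ⟨C₀, hC₀⟩ := hT.bound
  have hq := Y.q_pos
  set Δ : ℕ → α → ℝ := fun n x => ‖H x (T (w n) x) - H x (T u x)‖ with hΔ
  set s : ℕ → α → ℝ := fun n x => ‖T (w n) x‖ + ‖T u x‖ with hs
  have hs0 : ∀ n x, 0 ≤ s n x := fun n x => by positivity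
  have hΔm : ∀ n, AEStronglyMeasurable (Δ n) μ := fun n =>
    ((hN.aesm_grad _ (hT.aesm _)).sub (hN.aesm_grad _ (hT.aesm _))).norm
  have hΔle : ∀ n x, Δ n x ≤ 2 * C * a (s n x) := by
    intro n x
    have h1 := Y.a_mono (norm_nonneg (T (w n) x)) (hs0 n x) (by simp [hs])
    have h2 := Y.a_mono (norm_nonneg (T u x)) (hs0 n x) (by simp [hs])
    calc Δ n x ≤ ‖H x (T (w n) x)‖ + ‖H x (T u x)‖ := norm_sub_le _ _
      _ ≤ C * a ‖T (w n) x‖ + C * a ‖T u x‖ := add_le_add (hb _ _) (hb _ _)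
      _ ≤ C * a (s n x) + C * a (s n x) := by gcongr
      _ = _ := by ring
  have hms : ∀ n x, M (s n x) ≤ 2 ^ q * (2 ^ q * M ‖T u x‖) + 2 ^ q * M ‖(T (w n) - T u) x‖ := by
    intro n x
    have h0 : 0 ≤ 2 * ‖T u x‖ := by positivity
    have h1 : s n x ≤ 2 * ‖T u x‖ + ‖(T (w n) - T u) x‖ := by
      have : ‖T (w n) x‖ ≤ ‖T u x‖ + ‖(T (w n) - T u) x‖ := by
        have := norm_add_le (T u x) (T (w n) x - T u x)
        rwa [add_sub_cancel] at this
      simp only [hs]; linarith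
    calc M (s n x) ≤ M (2 * ‖T u x‖ + ‖(T (w n) - T u) x‖) :=
          Y.mono (hs0 n x) (add_nonneg h0 (norm_nonneg _)) h1
      _ ≤ 2 ^ q * (M (2 * ‖T u x‖) + M ‖(T (w n) - T u) x‖) := Y.add_le h0 (norm_nonneg _)
      _ ≤ 2 ^ q * (2 ^ q * M ‖T u x‖ + M ‖(T (w n) - T u) x‖) := by
          gcongr; exact Y.scale_ge 2 _ (by norm_num) (norm_nonneg _)
      _ = _ := by ring
  have hmod := hT.tendsto_sub Y hw
  have key : ∀ K : ℝ, 1 ≤ K →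
      Tendsto (fun n => ∫⁻ x, ENNReal.ofReal (K * Δ n x * s n x) ∂μ) atTop (𝓝 0) := by
    intro K hK
    have hfm : ∀ n, AEMeasurable (fun x => ENNReal.ofReal (K * Δ n x * s n x)) μ := fun n =>
      (((hΔm n).aemeasurable.const_mul K).mul
        (((hT.aesm _).norm.aemeasurable).add (hT.aesm _).norm.aemeasurable)).ennreal_ofReal
    refine tendsto_lintegral_zero_of_le_add
      (G := fun x => ENNReal.ofReal (K * (2 * C) * q * 2 ^ q * 2 ^ q) *
        ENNReal.ofReal (M ‖T u x‖))
      (e := fun n x => ENNReal.ofReal (K * (2 * C) * q * 2 ^ q) *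
        ENNReal.ofReal (M ‖(T (w n) - T u) x‖)) hfm
      ((Y.aemeasurable (hT.aesm u)).const_mul _) ?_ ?_ (fun n => Eventually.of_forall fun x => ?_) ?_
    · filter_upwards [hae] with x hx
      have h1 : Tendsto (fun n => Δ n x) atTop (𝓝 0) := by
        have := (((hN.cont x).tendsto (T u x)).comp hx).sub_const (H x (T u x))
        rw [sub_self] at this
        simpa using this.norm
      have h2 : Tendsto (fun n => s n x) atTop (𝓝 (‖T u x‖ + ‖T u x‖)) := hx.norm.add_const _
      have := ENNReal.tendsto_ofReal ((h1.const_mul K).mul h2)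
      simpa using this
    · rw [lintegral_const_mul' _ _ ENNReal.ofReal_ne_top]
      exact (ENNReal.mul_lt_top ENNReal.ofReal_lt_top (hT.finite Y u)).ne
    · have hK0 : 0 ≤ K := by linarith
      rw [← ENNReal.ofReal_mul (by positivity), ← ENNReal.ofReal_mul (by positivity),
        ← ENNReal.ofReal_add (mul_nonneg (by positivity) (Y.nonneg (norm_nonneg _)))
          (mul_nonneg (by positivity) (Y.nonneg (norm_nonneg _)))]
      refine ENNReal.ofReal_le_ofReal ?_
      calc K * Δ n x * s n x ≤ K * (2 * C * a (s n x)) * s n x := by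
            exact mul_le_mul_of_nonneg_right (mul_le_mul_of_nonneg_left (hΔle n x) hK0) (hs0 n x)
        _ = K * (2 * C) * (a (s n x) * s n x) := by ring
        _ ≤ K * (2 * C) * (q * M (s n x)) := 
            mul_le_mul_of_nonneg_left (Y.upper _ (hs0 n x)) (by positivity)
        _ ≤ K * (2 * C) * (q * (2 ^ q * (2 ^ q * M ‖T u x‖)
              + 2 ^ q * M ‖(T (w n) - T u) x‖)) := by gcongr; exact hms n x
        _ = _ := by ring
    · simp_rw [lintegral_const_mul' _ _ ENNReal.ofReal_ne_top]
      have := ENNReal.Tendsto.const_mul (a := ENNReal.ofReal (K * (2 * C) * q * 2 ^ q)) hmod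
        (Or.inr ENNReal.ofReal_ne_top)
      simpa [modular] using this
  -- The second alternative keeps the real-valued bound meaningful when the integral is infinite; it
  -- is excluded for large `n`.
  have hdiff : ∀ K, 1 ≤ K → ∀ n v, ‖v‖ < 1 → |(D (w n) - D u) v| ≤
      (∫⁻ x, ENNReal.ofReal (K * Δ n x * s n x) ∂μ + ENNReal.ofReal (2 * C * q * K ^ (1 - p)) * C₀).toReal
      ∨ ∫⁻ x, ENNReal.ofReal (K * Δ n x * s n x) ∂μ = ⊤ := by
    intro K hK n v hv
    by_cases htop : ∫⁻ x, ENNReal.ofReal (K * Δ n x * s n x) ∂μ = ⊤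
    · exact Or.inr htop
    left
    have hint : ∀ u, Integrable (fun x => inner ℝ (H x (T u x)) (T v x)) μ := fun u =>
      hN.integrable_inner Y (hT.aesm u) (hT.aesm v) (hT.finite Y u) (hT.finite Y v)
    have e : (D (w n) - D u) v = ∫ x, inner ℝ (H x (T (w n) x) - H x (T u x)) (T v x) ∂μ := by
      rw [sub_apply, hD, hD, ← integral_sub (hint _) (hint _)]
      simp only [inner_sub_left]
    rw [e, ← Real.norm_eq_abs]
    refine (norm_integral_le_lintegral_norm _).trans ?_
    refine ENNReal.toReal_mono (ENNReal.add_ne_top.2 ⟨htop,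
      (ENNReal.mul_lt_top ENNReal.ofReal_lt_top ENNReal.coe_lt_top).ne⟩) ?_
    calc ∫⁻ x, ENNReal.ofReal ‖inner ℝ (H x (T (w n) x) - H x (T u x)) (T v x)‖ ∂μ
        ≤ ∫⁻ x, (ENNReal.ofReal (K * Δ n x * s n x)
          + ENNReal.ofReal (2 * C * q * K ^ (1 - p)) * ENNReal.ofReal (M ‖T v x‖)) ∂μ := by
          refine lintegral_mono fun x => ?_
          rw [← ENNReal.ofReal_mul (by positivity),
            ← ENNReal.ofReal_add (mul_nonneg (by positivity) (hs0 n x))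
              (mul_nonneg (by positivity) (Y.nonneg (norm_nonneg _)))]
          refine ENNReal.ofReal_le_ofReal ((abs_real_inner_le_norm _ _).trans ?_)
          change Δ n x * ‖T v x‖ ≤ _
          have hΔ0 : 0 ≤ Δ n x := norm_nonneg _
          rcases le_total (K * s n x) ‖T v x‖ with hc | hc
          · have h1 := Y.a_mul_le_of_lt hK (hs0 n x) hc
            have h2 : 0 ≤ K * Δ n x * s n x := mul_nonneg (by positivity) (hs0 n x)
            have h3 := mul_le_mul_of_nonneg_right (hΔle n x) (norm_nonneg (T v x))
            have h4 := mul_le_mul_of_nonneg_left h1 (by positivity : 0 ≤ 2 * C)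
            linarith
          · have h1 := mul_le_mul_of_nonneg_left hc hΔ0
            have h2 : 0 ≤ 2 * C * q * K ^ (1 - p) * M ‖T v x‖ :=
              mul_nonneg (by positivity) (Y.nonneg (norm_nonneg _))
            linarith
      _ = ∫⁻ x, ENNReal.ofReal (K * Δ n x * s n x) ∂μ
          + ENNReal.ofReal (2 * C * q * K ^ (1 - p)) * modular M μ (T v) := by
          rw [lintegral_add_right', lintegral_const_mul' _ _ ENNReal.ofReal_ne_top]
          · rfl
          · exact (Y.aemeasurable (hT.aesm v)).const_mul _
      _ ≤ _ := by gcongr; exact hC₀ v hv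
  rw [tendsto_iff_norm_sub_tendsto_zero, Metric.tendsto_atTop]
  intro ε hε
  -- First `K` is fixed, then `n`. The two contributions of `ε / 8` on the unit ball are doubled by
  -- `abs_le_of_unit_ball`, so the norm is at most `ε / 2`.
  obtain ⟨K, hK, hKε⟩ := Y.exists_rpow_lt (C := 2 * C * q * C₀) (δ := ε / 8) (by positivity)
  have hev := (key K hK).eventually
    (gt_mem_nhds (ENNReal.ofReal_pos.2 (by positivity : (0 : ℝ) < ε / 8)))
  obtain ⟨n₀, hn₀⟩ := eventually_atTop.1 hev
  refine ⟨n₀, fun n hn => ?_⟩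
  have hlt := hn₀ n hn
  rw [Real.dist_0_eq_abs, abs_norm]
  have hB : ∀ v, ‖v‖ < 1 → |((D (w n) - D u : X →L[ℝ] ℝ) : X →ₗ[ℝ] ℝ) v| ≤ ε / 4 := by
    intro v hv
    rcases hdiff K hK n v hv with h1 | h1
    · refine h1.trans ?_
      have h2 : ∫⁻ x, ENNReal.ofReal (K * Δ n x * s n x) ∂μ
          + ENNReal.ofReal (2 * C * q * K ^ (1 - p)) * C₀ ≤ ENNReal.ofReal (ε / 4) := by
        rw [show ε / 4 = ε / 8 + ε / 8 by ring, ENNReal.ofReal_add (by positivity) (by positivity)]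
        refine add_le_add hlt.le ?_
        rw [← ENNReal.ofReal_coe_nnreal, ← ENNReal.ofReal_mul (by positivity)]
        exact ENNReal.ofReal_le_ofReal (by linarith)
      have := ENNReal.toReal_mono ENNReal.ofReal_ne_top h2
      rwa [ENNReal.toReal_ofReal (by positivity)] at this
    · rw [h1] at hlt
      simp at hlt
  have := ContinuousLinearMap.opNorm_le_bound (D (w n) - D u) (M := 2 * (ε / 4)) (by positivity)
    (fun v => abs_le_of_unit_ball _ hB v)
  linarith

/-- Integral functionals of power-type growth are continuously differentiable. -/
theorem exists_hasFDerivAt (hN : NemytskiiData μ a h H) (Y : YoungPair a M p q)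
    (hT : ModularMap T M μ) :
    ∃ D : X → X →L[ℝ] ℝ, (∀ u v, D u v = ∫ x, inner ℝ (H x (T u x)) (T v x) ∂μ) ∧
      (∀ u, HasFDerivAt (fun u => ∫ x, h x (T u x) ∂μ) (D u) u) ∧ Continuous D ∧
      ∀ R, ∃ K, ∀ u, ‖u‖ ≤ R → ‖D u‖ ≤ K := by
  obtain ⟨D, hD, hb⟩ := hN.exists_deriv Y hT
  have hcont : Continuous D := by
    rw [continuous_iff_seqContinuous]
    intro w u hw
    -- Modular convergence yields convergence almost everywhere only along subsequences, which is
    -- enough since the limit `D u` is prescribed.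
    refine tendsto_of_subseq_tendsto fun ns hns => ?_
    have hw' := hw.comp hns
    obtain ⟨σ, hσ, hae⟩ := Y.exists_subseq_ae (w := fun n => T (w (ns n)))
      (fun n => hT.aesm _) (hT.tendsto_sub Y hw') (hT.aesm u)
    exact ⟨σ, hN.tendsto_deriv Y hT hD (hw'.comp hσ.tendsto_atTop) hae⟩
  refine ⟨D, hD, hasFDerivAt_of_gateaux hcont fun u v t => ?_, hcont, hb⟩
  have hlin : ∀ t : ℝ, T (u + t • v) =ᵐ[μ] fun x => T u x + t • T v x := fun t => by
    filter_upwards [hT.add u (t • v), hT.smul t v] with x h1 h2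
    rw [h1, Pi.add_apply, h2, Pi.smul_apply]
  have h1 := hN.hasDerivAt_line Y (hT.aesm u) (hT.aesm v) (hT.finite Y u) (hT.finite Y v) t
  have e : ∀ t : ℝ, ∫ x, h x (T (u + t • v) x) ∂μ = ∫ x, h x (T u x + t • T v x) ∂μ := fun t =>
    integral_congr_ae ((hlin t).mono fun x hx => by simp only [hx])
  simp only [e]
  refine h1.congr_deriv ?_
  rw [hD]
  exact integral_congr_ae ((hlin t).mono fun x hx => by simp only [hx])

end NemytskiiData

end Nemytskii

end OrliczNehari

namespace OrliczNehari

/-! ### Luxemburg norm versus modular -/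

section Lux

variable {α F : Type*} [MeasurableSpace α] [NormedAddCommGroup F] {N : ℕ} {φ : ℝ → ℝ} {l m : ℝ}
  {μ : Measure α} {u : α → F}

theorem modular_le_one_of_luxNorm_lt_one (h : PhiAssumptions N φ l m)
    (hfu : modular (nFun φ) μ u < ⊤) (hu : luxNorm (nFun φ) μ u < 1) :
    modular (nFun φ) μ u ≤ 1 := by
  obtain ⟨c, ⟨hc, hi⟩, hc1⟩ := exists_lt_of_csInf_lt (luxSet_nonempty h hfu) hu
  refine (lintegral_mono fun x => ENNReal.ofReal_le_ofReal (h.nFun_mono ?_)).trans hi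
  rw [abs_norm, abs_of_nonneg (by positivity)]
  exact le_div_self (norm_nonneg _) hc hc1.le

/-- Dividing by `c ≤ 1` multiplies the modular by at most `c^{-m}`. This doubling property makes
modular convergence imply norm convergence. -/
theorem luxNorm_le_of_modular_le (h : PhiAssumptions N φ l m) {c : ℝ} (hc : 0 < c) (hc1 : c ≤ 1)
    (hu : modular (nFun φ) μ u ≤ ENNReal.ofReal (c ^ m)) : luxNorm (nFun φ) μ u ≤ c := by
  refine csInf_le luxSet_bddBelow ⟨hc, ?_⟩
  have hle : ∀ x, ENNReal.ofReal (nFun φ (‖u x‖ / c))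
      ≤ ENNReal.ofReal (c⁻¹ ^ m) * ENNReal.ofReal (nFun φ ‖u x‖) := fun x => by
    rw [← ENNReal.ofReal_mul (by positivity), div_eq_inv_mul]
    exact ENNReal.ofReal_le_ofReal
      (h.youngPair.scale_ge _ _ ((one_le_inv₀ hc).2 hc1) (norm_nonneg _))
  refine (lintegral_mono hle).trans ?_
  rw [lintegral_const_mul' _ _ ENNReal.ofReal_ne_top]
  refine (mul_le_mul' le_rfl hu).trans ?_
  rw [← ENNReal.ofReal_mul (by positivity), ← Real.mul_rpow (by positivity) hc.le,
    inv_mul_cancel₀ hc.ne', Real.one_rpow, ENNReal.ofReal_one]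

theorem luxNorm_le_one_add (h : PhiAssumptions N φ l m) (hfu : modular (nFun φ) μ u < ⊤) :
    luxNorm (nFun φ) μ u ≤ 1 + (modular (nFun φ) μ u).toReal := by
  set M := (modular (nFun φ) μ u).toReal with hM
  have hM0 : 0 ≤ M := ENNReal.toReal_nonneg
  have hc : 0 < 1 + M := by linarith
  refine csInf_le luxSet_bddBelow ⟨hc, ?_⟩
  have hle : ∀ x, ENNReal.ofReal (nFun φ (‖u x‖ / (1 + M)))
      ≤ ENNReal.ofReal (1 + M)⁻¹ * ENNReal.ofReal (nFun φ ‖u x‖) := fun x => by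
    rw [← ENNReal.ofReal_mul (by positivity), div_eq_inv_mul]
    exact ENNReal.ofReal_le_ofReal
      (h.nFun_mul_le (by positivity) (inv_le_one_of_one_le₀ (by linarith)) (norm_nonneg _))
  refine (lintegral_mono hle).trans ?_
  rw [lintegral_const_mul' _ _ ENNReal.ofReal_ne_top]
  change ENNReal.ofReal (1 + M)⁻¹ * modular (nFun φ) μ u ≤ 1
  rw [← ENNReal.ofReal_toReal hfu.ne, ← ENNReal.ofReal_mul (by positivity), ← hM]
  refine ENNReal.ofReal_le_one.2 ?_
  rw [inv_mul_le_iff₀ hc]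
  linarith

theorem tendsto_luxNorm_zero (h : PhiAssumptions N φ l m) {ι : Type*} {L : Filter ι}
    {w : ι → α → F} (hw : Tendsto (fun n => modular (nFun φ) μ (w n)) L (𝓝 0)) :
    Tendsto (fun n => luxNorm (nFun φ) μ (w n)) L (𝓝 0) := by
  rw [Metric.tendsto_nhds]
  intro ε hε
  have hc : 0 < min 1 (ε / 2) := by positivity
  filter_upwards [hw.eventually (gt_mem_nhds
    (ENNReal.ofReal_pos.2 (Real.rpow_pos_of_pos hc m)))] with n hn
  rw [Real.dist_0_eq_abs, abs_of_nonneg luxNorm_nonneg]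
  have := luxNorm_le_of_modular_le h hc (min_le_left _ _) hn.le
  linarith [min_le_right 1 (ε / 2)]

theorem YoungPair.tendsto_comp_zero {a M : ℝ → ℝ} {p q : ℝ} (Y : YoungPair a M p q) {ι : Type*}
    {L : Filter ι} {w : ι → F} (h : Tendsto w L (𝓝 0)) :
    Tendsto (fun n => ENNReal.ofReal (M ‖w n‖)) L (𝓝 0) := by
  have hn : Tendsto (fun n => ‖w n‖) L (𝓝 0) := by simpa using h.norm
  have h1 : Tendsto (fun n => ENNReal.ofReal (‖w n‖ * M 1)) L (𝓝 0) := by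
    have := ENNReal.tendsto_ofReal (hn.mul_const (M 1))
    simpa using this
  refine tendsto_of_tendsto_of_tendsto_of_le_of_le' tendsto_const_nhds h1
    (Eventually.of_forall fun _ => zero_le) ?_
  filter_upwards [hn.eventually (ge_mem_nhds one_pos)] with n hn
  refine ENNReal.ofReal_le_ofReal ?_
  have := Y.scale_le_mul (norm_nonneg (w n)) hn zero_le_one
  rwa [mul_one] at this

theorem YoungPair.locallyIntegrable {a M : ℝ → ℝ} {p q : ℝ} (Y : YoungPair a M p q)
    {w : EuclideanSpace ℝ (Fin N) → F} (hw : AEStronglyMeasurable w)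
    (hfin : modular M volume w < ⊤) : LocallyIntegrable w := by
  have h1 : LocallyIntegrable fun x => 1 + 1 / M 1 * M ‖w x‖ :=
    (locallyIntegrable_const (1 : ℝ)).add
      ((Y.integrable hw hfin).const_mul (1 / M 1)).locallyIntegrable
  refine h1.mono hw (Eventually.of_forall fun x => ?_)
  rw [Real.norm_eq_abs]
  exact (Y.le_add_mul one_pos (norm_nonneg (w x))).trans (le_abs_self _)

end Lux

/-! ### Mollification -/

section Mollifier

variable {N : ℕ} {F : Type*} [NormedAddCommGroup F] [NormedSpace ℝ F]

/-- A sequence of bump functions whose supports shrink to the origin. -/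
noncomputable def shrinkingBump (N n : ℕ) : ContDiffBump (0 : EuclideanSpace ℝ (Fin N)) where
  rIn := 1 / (2 * (n + 1))
  rOut := 1 / (n + 1)
  rIn_pos := by positivity
  rIn_lt_rOut := by
    have : (0 : ℝ) < n + 1 := by positivity
    exact one_div_lt_one_div_of_lt this (by linarith)

noncomputable def mollifier (N n : ℕ) : EuclideanSpace ℝ (Fin N) → ℝ :=
  (shrinkingBump N n).normed volume

/-- The mollification of a function. -/
noncomputable def mollify (n : ℕ) (w : EuclideanSpace ℝ (Fin N) → F) :
    EuclideanSpace ℝ (Fin N) → F :=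
  convolution (mollifier N n) w (ContinuousLinearMap.lsmul ℝ ℝ) volume

theorem mollifier_nonneg (n : ℕ) (x : EuclideanSpace ℝ (Fin N)) : 0 ≤ mollifier N n x :=
  (shrinkingBump N n).nonneg_normed x

theorem contDiff_mollifier (N n : ℕ) : ContDiff ℝ (⊤ : ℕ∞) (mollifier N n) :=
  (shrinkingBump N n).contDiff_normed

theorem hasCompactSupport_mollifier (N n : ℕ) : HasCompactSupport (mollifier N n) :=
  (shrinkingBump N n).hasCompactSupport_normed

theorem integral_mollifier (N n : ℕ) : ∫ x, mollifier N n x = 1 :=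
  (shrinkingBump N n).integral_normed

theorem mollifier_eq_zero {n : ℕ} {x : EuclideanSpace ℝ (Fin N)} (hx : 1 / ((n : ℝ) + 1) ≤ ‖x‖) :
    mollifier N n x = 0 := by
  rw [← Function.notMem_support, mollifier, ContDiffBump.support_normed_eq, mem_ball_zero_iff]
  exact not_lt.2 hx

theorem mollify_apply (n : ℕ) (w : EuclideanSpace ℝ (Fin N) → F) (x : EuclideanSpace ℝ (Fin N)) :
    mollify n w x = ∫ t, mollifier N n (x - t) • w t :=
  convolution_lsmul_swap

theorem integrable_mollify {w : EuclideanSpace ℝ (Fin N) → F} (hw : LocallyIntegrable w) (n : ℕ)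
    (x : EuclideanSpace ℝ (Fin N)) : Integrable fun t => mollifier N n (x - t) • w t := by
  refine hw.integrable_smul_left_of_hasCompactSupport
    ((contDiff_mollifier N n).continuous.comp (continuous_const.sub continuous_id)) ?_
  exact (hasCompactSupport_mollifier N n).comp_homeomorph (Homeomorph.subLeft x)

theorem continuous_mollify {w : EuclideanSpace ℝ (Fin N) → F} (hw : LocallyIntegrable w) (n : ℕ) :
    Continuous (mollify n w) :=
  (hasCompactSupport_mollifier N n).continuous_convolution_left _
    (contDiff_mollifier N n).continuous hw

theorem contDiff_mollify {w : EuclideanSpace ℝ (Fin N) → F} (hw : LocallyIntegrable w) (n : ℕ) :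
    ContDiff ℝ (⊤ : ℕ∞) (mollify n w) :=
  (hasCompactSupport_mollifier N n).contDiff_convolution_left _ (contDiff_mollifier N n) hw

theorem ae_tendsto_mollify [FiniteDimensional ℝ F] {w : EuclideanSpace ℝ (Fin N) → F}
    (hw : LocallyIntegrable w) :
    ∀ᵐ x, Tendsto (fun n => mollify n w x) atTop (𝓝 (w x)) := by
  have : CompleteSpace F := FiniteDimensional.complete ℝ F
  refine ContDiffBump.ae_convolution_tendsto_right_of_locallyIntegrable (K := 2)
    (tendsto_one_div_add_atTop_nhds_zero_nat) (Eventually.of_forall fun n => ?_) hw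
  change 1 / ((n : ℝ) + 1) ≤ 2 * (1 / (2 * (n + 1)))
  apply le_of_eq
  field_simp

theorem integral_mollifier_sub (n : ℕ) (x : EuclideanSpace ℝ (Fin N)) :
    ∫ t, mollifier N n (x - t) = 1 := by
  rw [integral_sub_left_eq_self (mollifier N n) volume x, integral_mollifier]

theorem norm_mollify_le {w : EuclideanSpace ℝ (Fin N) → F} (n : ℕ) (x : EuclideanSpace ℝ (Fin N)) :
    ‖mollify n w x‖ ≤ mollify n (fun t => ‖w t‖) x := by
  rw [mollify_apply, mollify_apply]
  refine (norm_integral_le_integral_norm _).trans (le_of_eq ?_)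
  refine integral_congr_ae (Eventually.of_forall fun t => ?_)
  simp only [norm_smul, Real.norm_eq_abs, abs_of_nonneg (mollifier_nonneg n _), smul_eq_mul]

/-- The supporting line of `Φ` at `s`, from which Jensen's inequality is read off below. It follows
by integrating the monotone density between `s` and `t`. -/
theorem nFun_tangent {φ : ℝ → ℝ} {l m : ℝ} (h : PhiAssumptions N φ l m) {s t : ℝ} (hs : 0 ≤ s)
    (ht : 0 ≤ t) :
    nFun φ s + PhiAssumptions.mulExt φ s * (t - s) ≤ nFun φ t := by
  rw [PhiAssumptions.nFun_eq, PhiAssumptions.nFun_eq, abs_of_nonneg hs, abs_of_nonneg ht]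
  have e := intervalIntegral.integral_add_adjacent_intervals (h.mulExt_int 0 s) (h.mulExt_int s t)
  rw [← e]
  refine add_le_add le_rfl ?_
  rcases le_total s t with hst | hst
  · have := intervalIntegral.integral_mono_on hst
      (intervalIntegrable_const (c := PhiAssumptions.mulExt φ s)) (h.mulExt_int s t)
      (fun x hx => h.mulExt_mono hx.1)
    simpa [mul_comm] using this
  · have := intervalIntegral.integral_mono_on hst (h.mulExt_int t s)
      (intervalIntegrable_const (c := PhiAssumptions.mulExt φ s))
      (fun x hx => h.mulExt_mono hx.2)
    rw [intervalIntegral.integral_symm]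
    simp only [intervalIntegral.integral_const, smul_eq_mul] at this
    linarith

/-- Jensen's inequality for the mollifier as a probability density: the supporting line at `s =
‖mollify n w x‖` is averaged. Its slope is nonnegative and the average of `‖w‖` is at least `s`. -/
theorem nFun_norm_mollify_le {φ : ℝ → ℝ} {l m : ℝ} (h : PhiAssumptions N φ l m)
    {w : EuclideanSpace ℝ (Fin N) → F} (hw : LocallyIntegrable w)
    (hi : LocallyIntegrable fun x => nFun φ ‖w x‖) (n : ℕ) (x : EuclideanSpace ℝ (Fin N)) :
    nFun φ ‖mollify n w x‖ ≤ mollify n (fun t => nFun φ ‖w t‖) x := by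
  set s := ‖mollify n w x‖ with hs
  have i0 : Integrable fun t => mollifier N n (x - t) • (1 : ℝ) :=
    integrable_mollify (locallyIntegrable_const 1) n x
  have i1 := integrable_mollify (w := fun t => ‖w t‖) (fun y => (hw y).norm) n x
  have i2 := integrable_mollify hi n x
  have h1 : s ≤ ∫ t, mollifier N n (x - t) • ‖w t‖ := by
    have := norm_mollify_le (w := w) n x
    rwa [mollify_apply n (fun t => ‖w t‖)] at this
  rw [mollify_apply n (fun t => nFun φ ‖w t‖)]
  have e : ∫ t, (mollifier N n (x - t) • (1 : ℝ)) * (nFun φ s - PhiAssumptions.mulExt φ s * s)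
      + PhiAssumptions.mulExt φ s * (mollifier N n (x - t) • ‖w t‖)
      = nFun φ s + PhiAssumptions.mulExt φ s * ((∫ t, mollifier N n (x - t) • ‖w t‖) - s) := by
    rw [integral_add (i0.mul_const _) (i1.const_mul _), integral_mul_const, integral_const_mul]
    simp only [smul_eq_mul, mul_one, integral_mollifier_sub]
    ring
  have h2 : nFun φ s ≤ nFun φ s
      + PhiAssumptions.mulExt φ s * ((∫ t, mollifier N n (x - t) • ‖w t‖) - s) := by
    have := mul_nonneg (h.mulExt_nonneg s) (sub_nonneg.2 h1)
    linarith
  rw [← e] at h2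
  refine h2.trans (integral_mono ((i0.mul_const _).add (i1.const_mul _)) i2 fun t => ?_)
  have h3 := mul_le_mul_of_nonneg_left (nFun_tangent h (norm_nonneg (mollify n w x))
    (norm_nonneg (w t))) (mollifier_nonneg n (x - t))
  simp only [smul_eq_mul]
  rw [← hs] at h3
  linarith

/-- Scheffé's argument: as the integrals agree, `|g - G|` has twice the integral of the positive
part of `G - g`, and the latter is dominated by `G`. -/
theorem tendsto_lintegral_abs_sub_of_integral_eq {α : Type*} [MeasurableSpace α] {μ : Measure α}
    {g : ℕ → α → ℝ} {G : α → ℝ} (hg : ∀ n, Integrable (g n) μ) (hG : Integrable G μ)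
    (hg0 : ∀ n x, 0 ≤ g n x) (hG0 : ∀ x, 0 ≤ G x) (he : ∀ n, ∫ x, g n x ∂μ = ∫ x, G x ∂μ)
    (hlim : ∀ᵐ x ∂μ, Tendsto (fun n => g n x) atTop (𝓝 (G x))) :
    Tendsto (fun n => ∫⁻ x, ENNReal.ofReal |g n x - G x| ∂μ) atTop (𝓝 0) := by
  have h1 : Tendsto (fun n => ∫ x, max (G x - g n x) 0 ∂μ) atTop (𝓝 (∫ _, (0 : ℝ) ∂μ)) := by
    refine tendsto_integral_of_dominated_convergence G
      (fun n => ((hG.sub (hg n)).pos_part).aestronglyMeasurable) hG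
      (fun n => Eventually.of_forall fun x => ?_) ?_
    · rw [Real.norm_eq_abs, abs_of_nonneg (le_max_right _ _)]
      exact max_le (by linarith [hg0 n x]) (hG0 x)
    · filter_upwards [hlim] with x hx
      have := (hx.const_sub (G x)).max (tendsto_const_nhds (x := (0 : ℝ)))
      simpa using this
  have h2 : ∀ n, ∫ x, |g n x - G x| ∂μ = 2 * ∫ x, max (G x - g n x) 0 ∂μ := by
    intro n
    have e : ∀ x, |g n x - G x| = 2 * max (G x - g n x) 0 - (G x - g n x) := by
      intro x
      rcases le_total (g n x) (G x) with h | h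
      · rw [abs_of_nonpos (by linarith), max_eq_left (by linarith)]; ring
      · rw [abs_of_nonneg (by linarith), max_eq_right (by linarith)]; ring
    have i1 : Integrable (fun x => G x - g n x) μ := hG.sub (hg n)
    simp only [e]
    rw [integral_sub (i1.pos_part.const_mul 2) i1,
      integral_const_mul, integral_sub hG (hg n), he n]
    ring
  have h3 : ∀ n, ∫⁻ x, ENNReal.ofReal |g n x - G x| ∂μ
      = ENNReal.ofReal (2 * ∫ x, max (G x - g n x) 0 ∂μ) := fun n => by
    rw [← h2 n]
    exact (ofReal_integral_eq_lintegral_ofReal ((hg n).sub hG).abs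
      (Eventually.of_forall fun x => abs_nonneg _)).symm
  simp only [h3]
  have := ENNReal.tendsto_ofReal (h1.const_mul 2)
  simpa using this

/-- Mollifications converge in modular. -/
theorem tendsto_modular_mollify [FiniteDimensional ℝ F] {φ : ℝ → ℝ} {l m : ℝ}
    (h : PhiAssumptions N φ l m)
    {w : EuclideanSpace ℝ (Fin N) → F} (hw : AEStronglyMeasurable w)
    (hfin : modular (nFun φ) volume w < ⊤) :
    Tendsto (fun n => modular (nFun φ) volume (mollify n w - w)) atTop (𝓝 0) := by
  have Y := h.youngPair
  have hli := Y.locallyIntegrable hw hfin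
  have hGi := Y.integrable hw hfin
  have hg0 : ∀ n x, 0 ≤ mollify n (fun t => nFun φ ‖w t‖) x := fun n x => by
    rw [mollify_apply]
    exact integral_nonneg fun t => mul_nonneg (mollifier_nonneg n _) (h.nFun_nonneg _)
  have hmi : ∀ n, Integrable (mollifier N n) := fun n => (shrinkingBump N n).integrable_normed
  -- The mollifications of `Φ(‖w‖)` have the integral of `Φ(‖w‖)`, so they converge in `L¹`. By
  -- Jensen's inequality `Φ(‖mollify n w - w‖)` is then dominated by a multiple of `Φ(‖w‖)` up to an
  -- error tending to zero in `L¹`.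
  have hS := tendsto_lintegral_abs_sub_of_integral_eq
    (g := fun n => mollify n (fun t => nFun φ ‖w t‖)) (G := fun t => nFun φ ‖w t‖) (μ := volume)
    (fun n => (hmi n).integrable_convolution _ hGi) hGi hg0 (fun x => h.nFun_nonneg _)
    (fun n => by
      have := integral_convolution (ContinuousLinearMap.lsmul ℝ ℝ) (hmi n) hGi
      rw [integral_mollifier] at this
      simpa [mollify] using this)
    (ae_tendsto_mollify hGi.locallyIntegrable)
  have hmm : ∀ n, AEStronglyMeasurable (mollify n w - w) volume := fun n =>
    (continuous_mollify hli n).aestronglyMeasurable.sub hw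
  refine tendsto_lintegral_zero_of_le_add
    (G := fun x => ENNReal.ofReal (2 ^ m * 2) * ENNReal.ofReal (nFun φ ‖w x‖))
    (e := fun n x => ENNReal.ofReal (2 ^ m) * ENNReal.ofReal
      |mollify n (fun t => nFun φ ‖w t‖) x - nFun φ ‖w x‖|)
    (fun n => Y.aemeasurable (hmm n)) ((Y.aemeasurable hw).const_mul _) ?_ ?_
    (fun n => Eventually.of_forall fun x => ?_) ?_
  · filter_upwards [ae_tendsto_mollify hli] with x hx
    exact Y.tendsto_comp_zero (tendsto_sub_nhds_zero_iff.2 hx)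
  · rw [lintegral_const_mul' _ _ ENNReal.ofReal_ne_top]
    exact (ENNReal.mul_lt_top ENNReal.ofReal_lt_top hfin).ne
  · have hw0 := h.nFun_nonneg ‖w x‖
    rw [← ENNReal.ofReal_mul (by positivity), ← ENNReal.ofReal_mul (by positivity),
      ← ENNReal.ofReal_add (by positivity) (by positivity)]
    refine ENNReal.ofReal_le_ofReal ?_
    have h1 : nFun φ ‖(mollify n w - w) x‖ ≤ nFun φ (‖mollify n w x‖ + ‖w x‖) :=
      Y.mono (norm_nonneg _) (add_nonneg (norm_nonneg _) (norm_nonneg _)) (norm_sub_le _ _)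
    have h2 := Y.add_le (norm_nonneg (mollify n w x)) (norm_nonneg (w x))
    have h3 := nFun_norm_mollify_le h hli hGi.locallyIntegrable n x
    have h4 := le_abs_self (mollify n (fun t => nFun φ ‖w t‖) x - nFun φ ‖w x‖)
    have h5 : nFun φ ‖mollify n w x‖ + nFun φ ‖w x‖ ≤ 2 * nFun φ ‖w x‖
      + |mollify n (fun t => nFun φ ‖w t‖) x - nFun φ ‖w x‖| := by linarith
    have h6 := mul_le_mul_of_nonneg_left h5 (by positivity : (0 : ℝ) ≤ 2 ^ m)
    linarith
  · simp_rw [lintegral_const_mul' _ _ ENNReal.ofReal_ne_top]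
    have := ENNReal.Tendsto.const_mul (a := ENNReal.ofReal (2 ^ m)) hS
      (Or.inr ENNReal.ofReal_ne_top)
    simpa using this

theorem inner_gradient {u : EuclideanSpace ℝ (Fin N) → ℝ} (x e : EuclideanSpace ℝ (Fin N)) :
    inner ℝ (gradient u x) e = fderiv ℝ u x e := by
  rw [← toDual_gradient]; rfl

/-- The definition of the weak gradient is tested with `t ↦ mollifier N n (x - t)`; the sign
produced by the reflection cancels the one of the integration by parts. -/
theorem gradient_mollify {u : EuclideanSpace ℝ (Fin N) → ℝ}
    {w : EuclideanSpace ℝ (Fin N) → EuclideanSpace ℝ (Fin N)} (h : HasWeakGradient u w) (n : ℕ)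
    (x : EuclideanSpace ℝ (Fin N)) : gradient (mollify n u) x = mollify n w x := by
  refine ext_inner_right ℝ fun e => ?_
  have hρ := contDiff_mollifier N n
  have h1 : HasFDerivAt (mollify n u) _ x :=
    (hasCompactSupport_mollifier N n).hasFDerivAt_convolution_left
      (ContinuousLinearMap.lsmul ℝ ℝ) (hρ.of_le (by exact_mod_cast le_top)) h.1 x
  rw [inner_gradient, h1.fderiv, convolution_eq_swap]
  have hci : Integrable fun t => ((ContinuousLinearMap.lsmul ℝ ℝ).precompL
      (EuclideanSpace ℝ (Fin N))) (fderiv ℝ (mollifier N n) (x - t)) (u t) := by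
    have hce : ConvolutionExists (fderiv ℝ (mollifier N n)) u ((ContinuousLinearMap.lsmul ℝ
      ℝ).precompL (EuclideanSpace ℝ (Fin N))) volume :=
      ((hasCompactSupport_mollifier N n).fderiv (𝕜 := ℝ)).convolutionExists_left
      _ (hρ.continuous_fderiv (by simp)) h.1
    exact convolutionExistsAt_iff_integrable_swap.1 (hce x)
  rw [ContinuousLinearMap.integral_apply hci]
  have hψ : ContDiff ℝ (⊤ : ℕ∞) fun t => mollifier N n (x - t) := hρ.comp (contDiff_const.sub contDiff_id)
  have hψc : HasCompactSupport fun t => mollifier N n (x - t) :=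
    (hasCompactSupport_mollifier N n).comp_homeomorph (Homeomorph.subLeft x)
  have h2 := h.2.2 _ e hψ hψc
  have h3 : ∀ t, fderiv ℝ (fun t => mollifier N n (x - t)) t e
      = - fderiv ℝ (mollifier N n) (x - t) e := by
    intro t
    have hd : HasFDerivAt (mollifier N n) (fderiv ℝ (mollifier N n) (x - t)) (x - t) :=
      (hρ.differentiable (by simp) _).hasFDerivAt
    have hs : HasFDerivAt (fun t : EuclideanSpace ℝ (Fin N) => x - t)
        (-ContinuousLinearMap.id ℝ (EuclideanSpace ℝ (Fin N))) t := (hasFDerivAt_id t).const_sub x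
    have hc : HasFDerivAt (fun t => mollifier N n (x - t)) _ t := hd.comp t hs
    rw [hc.fderiv]
    simp
  simp only [h3, mul_neg, integral_neg, neg_inj] at h2
  rw [mollify_apply]
  have h4 : inner ℝ (∫ t, mollifier N n (x - t) • w t) e
      = ∫ t, inner ℝ (w t) e * mollifier N n (x - t) := by
    rw [real_inner_comm, ← integral_inner (integrable_mollify h.2.1 n x) e]
    refine integral_congr_ae (Eventually.of_forall fun t => ?_)
    simp only [inner_smul_right]
    rw [real_inner_comm, mul_comm]
  rw [h4, ← h2]
  refine integral_congr_ae (Eventually.of_forall fun t => ?_)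
  simp [ContinuousLinearMap.precompL_apply, mul_comm]

end Mollifier

end OrliczNehari

namespace OrliczNehari

/-! ### Smooth cutoff functions -/

section Cutoff

variable {N : ℕ}

/-- The fixed bump function from which all cutoffs are obtained by scaling. -/
noncomputable def unitBump (N : ℕ) : ContDiffBump (0 : EuclideanSpace ℝ (Fin N)) where
  rIn := 1
  rOut := 2
  rIn_pos := one_pos
  rIn_lt_rOut := one_lt_two

/-- A smooth function equal to `1` on the ball of radius `R` and to `0` off the ball of radius
`2 R`. -/
noncomputable def cutoff (R : ℝ) (x : EuclideanSpace ℝ (Fin N)) : ℝ := unitBump N (R⁻¹ • x)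

theorem contDiff_cutoff (R : ℝ) : ContDiff ℝ (⊤ : ℕ∞) (cutoff R : EuclideanSpace ℝ (Fin N) → ℝ) :=
  (unitBump N).contDiff.comp (contDiff_const_smul _)

theorem cutoff_nonneg (R : ℝ) (x : EuclideanSpace ℝ (Fin N)) : 0 ≤ cutoff R x :=
  (unitBump N).nonneg

theorem cutoff_le_one (R : ℝ) (x : EuclideanSpace ℝ (Fin N)) : cutoff R x ≤ 1 :=
  (unitBump N).le_one

theorem cutoff_eq_one {R : ℝ} (hR : 0 < R) {x : EuclideanSpace ℝ (Fin N)} (hx : ‖x‖ ≤ R) :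
    cutoff R x = 1 := by
  refine (unitBump N).one_of_mem_closedBall ?_
  rw [mem_closedBall_zero_iff, norm_smul, Real.norm_eq_abs, abs_inv, abs_of_pos hR,
    inv_mul_le_iff₀ hR]
  simpa [unitBump] using hx

theorem cutoff_eq_zero {R : ℝ} (hR : 0 < R) {x : EuclideanSpace ℝ (Fin N)} (hx : 2 * R ≤ ‖x‖) :
    cutoff R x = 0 := by
  refine (unitBump N).zero_of_le_dist ?_
  rw [dist_zero_right, norm_smul, Real.norm_eq_abs, abs_inv, abs_of_pos hR,
    le_inv_mul_iff₀ hR]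
  change R * 2 ≤ _
  linarith

theorem hasCompactSupport_cutoff {R : ℝ} (hR : 0 < R) :
    HasCompactSupport (cutoff R : EuclideanSpace ℝ (Fin N) → ℝ) :=
  HasCompactSupport.intro (isCompact_closedBall 0 (2 * R)) fun x hx => by
    rw [mem_closedBall_zero_iff, not_le] at hx
    exact cutoff_eq_zero hR hx.le

theorem norm_gradient {u : EuclideanSpace ℝ (Fin N) → ℝ} (x : EuclideanSpace ℝ (Fin N)) :
    ‖gradient u x‖ = ‖fderiv ℝ u x‖ := by
  rw [← toDual_gradient, LinearIsometryEquiv.norm_map]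

theorem exists_norm_gradient_cutoff_le (N : ℕ) :
    ∃ C, 0 ≤ C ∧ ∀ R > 0, ∀ x : EuclideanSpace ℝ (Fin N), ‖gradient (cutoff R) x‖ ≤ C / R := by
  have hs : ContDiff ℝ (⊤ : ℕ∞) (unitBump N : EuclideanSpace ℝ (Fin N) → ℝ) :=
    (unitBump N).contDiff
  obtain ⟨C, hC⟩ := ((unitBump N).hasCompactSupport.fderiv (𝕜 := ℝ)).exists_bound_of_continuous
    (hs.continuous_fderiv (by simp))
  refine ⟨C, (norm_nonneg _).trans (hC 0), fun R hR x => ?_⟩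
  have hd : HasFDerivAt (cutoff R : EuclideanSpace ℝ (Fin N) → ℝ) _ x :=
    (hs.differentiable (by simp) _).hasFDerivAt.comp x
      ((R⁻¹ • ContinuousLinearMap.id ℝ (EuclideanSpace ℝ (Fin N))).hasFDerivAt)
  rw [norm_gradient, hd.fderiv, ContinuousLinearMap.comp_smul, ContinuousLinearMap.comp_id,
    norm_smul, Real.norm_eq_abs, abs_inv, abs_of_pos hR, div_eq_inv_mul]
  gcongr
  exact hC _

end Cutoff

section Weak

variable {N : ℕ} {u : EuclideanSpace ℝ (Fin N) → ℝ}
  {w : EuclideanSpace ℝ (Fin N) → EuclideanSpace ℝ (Fin N)}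

theorem inner_gradient_mul {η ψ : EuclideanSpace ℝ (Fin N) → ℝ} (hη : ContDiff ℝ (⊤ : ℕ∞) η)
    (hψ : ContDiff ℝ (⊤ : ℕ∞) ψ) (x v : EuclideanSpace ℝ (Fin N)) :
    fderiv ℝ (fun y => η y * ψ y) x v = η x * fderiv ℝ ψ x v + ψ x * fderiv ℝ η x v := by
  have h1 := (hη.differentiable (by simp) x).hasFDerivAt
  have h2 := (hψ.differentiable (by simp) x).hasFDerivAt
  rw [(h1.fun_mul h2).fderiv]
  simp

theorem continuous_gradient (hu : ContDiff ℝ 1 u) : Continuous (gradient u) :=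
  (InnerProductSpace.toDual ℝ _).symm.continuous.comp (hu.continuous_fderiv one_ne_zero)

theorem gradient_mul {η ψ : EuclideanSpace ℝ (Fin N) → ℝ} (hη : ContDiff ℝ (⊤ : ℕ∞) η)
    (hψ : ContDiff ℝ (⊤ : ℕ∞) ψ) (x : EuclideanSpace ℝ (Fin N)) :
    gradient (fun y => η y * ψ y) x = η x • gradient ψ x + ψ x • gradient η x := by
  refine ext_inner_right ℝ fun e => ?_
  rw [inner_add_left, real_inner_smul_left, real_inner_smul_left, inner_gradient, inner_gradient,
    inner_gradient, inner_gradient_mul hη hψ]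

theorem hasCompactSupport_gradient (hc : HasCompactSupport u) :
    HasCompactSupport (gradient u) := by
  have := (hc.fderiv (𝕜 := ℝ)).comp_left (g := (InnerProductSpace.toDual ℝ
    (EuclideanSpace ℝ (Fin N))).symm) (map_zero _)
  exact this

/-- The weak gradient of `u` is tested with `η ψ`, and the classical product rule for `η ψ` moves
the derivative of `η` to the other side. -/
theorem HasWeakGradient.smooth_mul (h : HasWeakGradient u w) {η : EuclideanSpace ℝ (Fin N) → ℝ}
    (hη : ContDiff ℝ (⊤ : ℕ∞) η) :
    HasWeakGradient (fun x => η x * u x) (fun x => η x • w x + u x • gradient η x) := by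
  have hg := continuous_gradient (hη.of_le (by exact_mod_cast le_top) : ContDiff ℝ 1 η)
  have hL : ∀ {F : Type} [NormedAddCommGroup F] [NormedSpace ℝ F]
      {z : EuclideanSpace ℝ (Fin N) → ℝ} {y : EuclideanSpace ℝ (Fin N) → F},
      Continuous z → LocallyIntegrable y → LocallyIntegrable fun x => z x • y x := by
    intro F _ _ z y hz hy
    have := (hy.locallyIntegrableOn univ).continuousOn_smul (isOpen_univ.isLocallyClosed)
      hz.continuousOn
    exact locallyIntegrableOn_univ.1 this
  have hR : LocallyIntegrable fun x => u x • gradient η x := by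
    have := (h.1.locallyIntegrableOn univ).smul_continuousOn (isOpen_univ.isLocallyClosed)
      hg.continuousOn
    exact locallyIntegrableOn_univ.1 this
  refine ⟨hL hη.continuous h.1, (hL hη.continuous h.2.1).add hR, fun ψ v hψ hc => ?_⟩
  have hc' : HasCompactSupport fun y => η y * ψ y := hc.mul_left
  have h1 := h.2.2 (fun y => η y * ψ y) v (hη.mul hψ) hc'
  have hd := continuous_fderiv_test hψ v
  have hdc : HasCompactSupport fun x => fderiv ℝ ψ x v := hc.fderiv_apply ℝ v
  have hηd := continuous_fderiv_test hη v
  have i1 : Integrable fun x => u x * (η x * fderiv ℝ ψ x v) :=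
    integrable_mul_test h.1 (hη.continuous.mul hd) hdc.mul_left
  have i2 : Integrable fun x => u x * (ψ x * fderiv ℝ η x v) :=
    integrable_mul_test h.1 (hψ.continuous.mul hηd) hc.mul_right
  have i3 : Integrable fun x => inner ℝ (w x) v * (η x * ψ x) :=
    integrable_mul_test (locallyIntegrable_inner h.2.1 v) (hη.continuous.mul hψ.continuous) hc'
  simp only [inner_gradient_mul hη hψ, mul_add] at h1
  rw [integral_add i1 i2] at h1
  have e1 : ∫ x, η x * u x * fderiv ℝ ψ x v = ∫ x, u x * (η x * fderiv ℝ ψ x v) :=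
    integral_congr_ae (Eventually.of_forall fun x => by dsimp only; ring)
  have e2 : ∫ x, inner ℝ (η x • w x + u x • gradient η x) v * ψ x
      = ∫ x, inner ℝ (w x) v * (η x * ψ x) + u x * (ψ x * fderiv ℝ η x v) :=
    integral_congr_ae (Eventually.of_forall fun x => by
      dsimp only
      rw [inner_add_left, real_inner_smul_left, real_inner_smul_left, inner_gradient]; ring)
  rw [e1, e2, integral_add i3 i2]
  linarith

theorem hasWeakGradient_of_contDiff (hu : ContDiff ℝ (⊤ : ℕ∞) u) :
    HasWeakGradient u (gradient u) := by
  have hg := continuous_gradient (hu.of_le (by exact_mod_cast le_top) : ContDiff ℝ 1 u)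
  refine ⟨hu.continuous.locallyIntegrable, hg.locallyIntegrable, fun ψ v hψ hc => ?_⟩
  have hd := continuous_fderiv_test hψ v
  have hud := continuous_fderiv_test hu v
  have hdc : HasCompactSupport fun x => fderiv ℝ ψ x v := hc.fderiv_apply ℝ v
  simp only [inner_gradient]
  exact integral_mul_fderiv_eq_neg_fderiv_mul_of_integrable
    ((hud.mul hψ.continuous).integrable_of_hasCompactSupport hc.mul_left)
    ((hu.continuous.mul hd).integrable_of_hasCompactSupport hdc.mul_left)
    ((hu.continuous.mul hψ.continuous).integrable_of_hasCompactSupport hc.mul_left)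
    (fun x _ => hu.differentiable (by simp) x) (fun x _ => hψ.differentiable (by simp) x)

end Weak

namespace SpaceData

variable {N : ℕ} {D : SpaceData N}

theorem modular_wMeasure {u : EuclideanSpace ℝ (Fin N) → ℝ} (hu : AEStronglyMeasurable u volume) :
    modular (nFun D.φ) D.wMeasure u
      = ∫⁻ x, ENNReal.ofReal (D.w x) * ENNReal.ofReal (nFun D.φ ‖u x‖) :=
  lintegral_withDensity_eq_lintegral_mul₀' D.w_cont.measurable.ennreal_ofReal.aemeasurable
    ((D.hφ.youngPair.aemeasurable hu).mono_ac D.wMeasure_ac)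

theorem aesm_fn (u : D.Space) : AEStronglyMeasurable (fn u) volume := u.1.1.aestronglyMeasurable

theorem aesm_grad (u : D.Space) : AEStronglyMeasurable (grad u) volume :=
  u.1.2.aestronglyMeasurable

theorem modular_volume_le {w₀ : ℝ} (hw₀ : 0 < w₀) (hw : ∀ x, w₀ ≤ D.w x)
    {u : EuclideanSpace ℝ (Fin N) → ℝ} (hu : AEStronglyMeasurable u volume) :
    modular (nFun D.φ) volume u ≤ ENNReal.ofReal w₀⁻¹ * modular (nFun D.φ) D.wMeasure u := by
  rw [modular_wMeasure hu, ← lintegral_const_mul' _ _ ENNReal.ofReal_ne_top]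
  refine lintegral_mono fun x => ?_
  have h0 := D.hφ.nFun_nonneg ‖u x‖
  rw [← ENNReal.ofReal_mul (D.w_pos x).le, ← ENNReal.ofReal_mul (by positivity)]
  refine ENNReal.ofReal_le_ofReal ?_
  rw [le_inv_mul_iff₀ hw₀]
  exact mul_le_mul_of_nonneg_right (hw x) h0

theorem modularMap_grad (hκ : D.κ = 1) :
    ModularMap (grad : D.Space → _) (nFun D.φ) volume where
  aesm := aesm_grad
  add := grad_add
  smul := grad_smul
  bound := ⟨1, fun u hu => by
    refine modular_le_one_of_luxNorm_lt_one D.hφ (modular_grad u) ?_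
    rw [norm_def, hκ, one_mul] at hu
    change luxNorm (nFun D.φ) volume (grad u) + luxNorm (nFun D.φ) D.wMeasure (fn u) < 1 at hu
    have : 0 ≤ luxNorm (nFun D.φ) D.wMeasure (fn u) := luxNorm_nonneg
    linarith⟩

theorem modularMap_fn (hκ : D.κ = 1) :
    ModularMap (fn : D.Space → _) (nFun D.φ) D.wMeasure where
  aesm u := (aesm_fn u).mono_ac D.wMeasure_ac
  add u v := D.wMeasure_ac.ae_le (fn_add u v)
  smul c u := D.wMeasure_ac.ae_le (fn_smul c u)
  bound := ⟨1, fun u hu => by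
    refine modular_le_one_of_luxNorm_lt_one D.hφ (modular_fn u) ?_
    rw [norm_def, hκ, one_mul] at hu
    change luxNorm (nFun D.φ) volume (grad u) + luxNorm (nFun D.φ) D.wMeasure (fn u) < 1 at hu
    have : 0 ≤ luxNorm (nFun D.φ) volume (grad u) := luxNorm_nonneg
    linarith⟩

theorem modularMap_fn_volume (hκ : D.κ = 1) {w₀ : ℝ} (hw₀ : 0 < w₀) (hw : ∀ x, w₀ ≤ D.w x) :
    ModularMap (fn : D.Space → _) (nFun D.φ) volume where
  aesm := aesm_fn
  add := fn_add
  smul := fn_smul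
  bound := by
    obtain ⟨C, hC⟩ := (modularMap_fn hκ).bound
    refine ⟨w₀⁻¹.toNNReal * C, fun u hu => (modular_volume_le hw₀ hw (aesm_fn u)).trans ?_⟩
    rw [ENNReal.coe_mul]
    exact mul_le_mul' le_rfl (hC u hu)

theorem norm_le_two_add (hκ : D.κ = 1) (u : D.Space) :
    ‖u‖ ≤ 2 + (modular (nFun D.φ) volume (grad u)).toReal
      + (modular (nFun D.φ) D.wMeasure (fn u)).toReal := by
  rw [norm_def, hκ, one_mul]
  have h1 := luxNorm_le_one_add D.hφ (modular_grad u)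
  have h2 := luxNorm_le_one_add D.hφ (modular_fn u)
  change luxNorm (nFun D.φ) volume (grad u) + luxNorm (nFun D.φ) D.wMeasure (fn u) ≤ _
  linarith

theorem tendsto_norm_zero (hκ : D.κ = 1) {ι : Type*} {L : Filter ι} {U : ι → D.Space}
    (h1 : Tendsto (fun n => modular (nFun D.φ) volume (grad (U n))) L (𝓝 0))
    (h2 : Tendsto (fun n => modular (nFun D.φ) D.wMeasure (fn (U n))) L (𝓝 0)) :
    Tendsto U L (𝓝 0) := by
  rw [tendsto_zero_iff_norm_tendsto_zero]
  have := (tendsto_luxNorm_zero D.hφ h1).add (tendsto_luxNorm_zero D.hφ h2)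
  rw [add_zero] at this
  refine this.congr fun n => ?_
  rw [norm_def, hκ, one_mul]; rfl

theorem tendsto_of_modular (hκ : D.κ = 1) {ι : Type*} {L : Filter ι} {U : ι → D.Space}
    {V : D.Space}
    (h1 : Tendsto (fun n => modular (nFun D.φ) volume (grad (U n) - grad V)) L (𝓝 0))
    (h2 : Tendsto (fun n => modular (nFun D.φ) D.wMeasure (fn (U n) - fn V)) L (𝓝 0)) :
    Tendsto U L (𝓝 V) := by
  rw [← tendsto_sub_nhds_zero_iff]
  refine tendsto_norm_zero hκ (h1.congr fun n => modular_congr ?_)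
    (h2.congr fun n => modular_congr ?_)
  · exact ((modularMap_grad hκ).map_sub _ _).symm
  · exact ((modularMap_fn hκ).map_sub _ _).symm

/-- Functions of finite modular with a weak gradient of finite modular are elements of the
space. -/
theorem exists_mk {w₀ : ℝ} (hw₀ : 0 < w₀) (hw : ∀ x, w₀ ≤ D.w x)
    {u : EuclideanSpace ℝ (Fin N) → ℝ}
    {w : EuclideanSpace ℝ (Fin N) → EuclideanSpace ℝ (Fin N)} (hu : AEStronglyMeasurable u volume)
    (hwm : AEStronglyMeasurable w volume) (h : HasWeakGradient u w)
    (h1 : modular (nFun D.φ) volume w < ⊤) (h2 : modular (nFun D.φ) D.wMeasure u < ⊤) :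
    ∃ U : D.Space, fn U =ᵐ[volume] u ∧ grad U =ᵐ[volume] w := by
  have e1 := AEEqFun.coeFn_mk u hu
  have e2 := AEEqFun.coeFn_mk w hwm
  refine ⟨⟨(AEEqFun.mk u hu, AEEqFun.mk w hwm), h.congr e1.symm e2.symm, ?_, ?_, ?_⟩, e1, e2⟩
  · refine (memOrlicz_iff D.hφ).2 ?_
    rw [modular_congr e1]
    exact (modular_volume_le hw₀ hw hu).trans_lt (ENNReal.mul_lt_top ENNReal.ofReal_lt_top h2)
  · refine (memOrlicz_iff D.hφ).2 ?_
    rw [modular_congr e2]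
    exact h1
  · change modular (nFun D.φ) D.wMeasure _ < ⊤
    rw [modular_congr (D.wMeasure_ac.ae_le e1)]
    exact h2

theorem wMeasure_lt_top_of_isCompact {K : Set (EuclideanSpace ℝ (Fin N))} (hK : IsCompact K) :
    D.wMeasure K < ⊤ := by
  obtain ⟨C, hC⟩ := hK.exists_bound_of_continuousOn D.w_cont.continuousOn
  rw [wMeasure, withDensity_apply _ hK.measurableSet]
  refine (setLIntegral_mono (g := fun _ => ENNReal.ofReal C) measurable_const
    fun x hx => ENNReal.ofReal_le_ofReal ((le_abs_self _).trans (hC x hx))).trans_lt ?_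
  rw [setLIntegral_const]
  exact ENNReal.mul_lt_top ENNReal.ofReal_lt_top hK.measure_lt_top

theorem modular_lt_top_of_continuous {F : Type*} [NormedAddCommGroup F] {N' : ℕ} {φ : ℝ → ℝ}
    {l m : ℝ} (h : PhiAssumptions N' φ l m) {v : EuclideanSpace ℝ (Fin N) → F} (hv : Continuous v)
    (hc : HasCompactSupport v) {μ : Measure (EuclideanSpace ℝ (Fin N))}
    (hμ : ∀ K, IsCompact K → μ K < ⊤) : modular (nFun φ) μ v < ⊤ := by
  obtain ⟨C, hC⟩ := hc.exists_bound_of_continuous hv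
  have hle : ∀ x, ENNReal.ofReal (nFun φ ‖v x‖)
      ≤ (tsupport v).indicator (fun _ => ENNReal.ofReal (nFun φ C)) x := by
    intro x
    by_cases hx : x ∈ tsupport v
    · rw [indicator_of_mem hx]
      exact ENNReal.ofReal_le_ofReal (h.youngPair.mono (norm_nonneg _)
        ((norm_nonneg _).trans (hC x)) (hC x))
    · rw [indicator_of_notMem hx, image_eq_zero_of_notMem_tsupport hx, norm_zero,
        PhiAssumptions.nFun_zero, ENNReal.ofReal_zero]
  refine (lintegral_mono hle).trans_lt ?_
  rw [lintegral_indicator (isClosed_tsupport v).measurableSet, setLIntegral_const]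
  exact ENNReal.mul_lt_top ENNReal.ofReal_lt_top (hμ _ hc)

/-- `U` is the element of the space given by the test function `v`. -/
structure IsTest (U : D.Space) (v : EuclideanSpace ℝ (Fin N) → ℝ) : Prop where
  contDiff : ContDiff ℝ (⊤ : ℕ∞) v
  hasCompactSupport : HasCompactSupport v
  fn_eq : fn U =ᵐ[volume] v
  grad_eq : grad U =ᵐ[volume] gradient v

theorem exists_isTest {w₀ : ℝ} (hw₀ : 0 < w₀) (hw : ∀ x, w₀ ≤ D.w x)
    {v : EuclideanSpace ℝ (Fin N) → ℝ} (hv : ContDiff ℝ (⊤ : ℕ∞) v) (hc : HasCompactSupport v) :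
    ∃ U : D.Space, IsTest U v := by
  have hg := continuous_gradient (hv.of_le (by exact_mod_cast le_top) : ContDiff ℝ 1 v)
  obtain ⟨U, h1, h2⟩ := exists_mk hw₀ hw hv.continuous.aestronglyMeasurable
    hg.aestronglyMeasurable (hasWeakGradient_of_contDiff hv)
    (modular_lt_top_of_continuous D.hφ hg (hasCompactSupport_gradient hc)
      fun K hK => hK.measure_lt_top)
    (modular_lt_top_of_continuous D.hφ hv.continuous hc
      fun K hK => wMeasure_lt_top_of_isCompact hK)
  exact ⟨U, hv, hc, h1, h2⟩

theorem hasWeakGradient (U : D.Space) : HasWeakGradient (fn U) (grad U) := U.2.1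

/-- Truncation by cutoff functions converges. -/
theorem exists_tendsto_cutoff (hκ : D.κ = 1) {w₀ : ℝ} (hw₀ : 0 < w₀) (hw : ∀ x, w₀ ≤ D.w x)
    (U : D.Space) : ∃ W : ℕ → D.Space, Tendsto W atTop (𝓝 U) ∧
      ∀ n, fn (W n) =ᵐ[volume] fun x => cutoff ((n : ℝ) + 1) x * fn U x := by
  have Y := D.hφ.youngPair
  obtain ⟨C, hC, hCR⟩ := exists_norm_gradient_cutoff_le N
  have hR : ∀ n : ℕ, (0 : ℝ) < n + 1 := fun n => by positivity
  have hR1 : ∀ n : ℕ, (1 : ℝ) ≤ n + 1 := fun n => by linarith [Nat.cast_nonneg (α := ℝ) n]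
  set w : ℕ → EuclideanSpace ℝ (Fin N) → EuclideanSpace ℝ (Fin N) := fun n x =>
    cutoff ((n : ℝ) + 1) x • grad U x + fn U x • gradient (cutoff ((n : ℝ) + 1)) x with hwdef
  have hgc : ∀ n : ℕ, Continuous
      (gradient (cutoff ((n : ℝ) + 1) : EuclideanSpace ℝ (Fin N) → ℝ)) := fun n =>
    continuous_gradient ((contDiff_cutoff _).of_le (by exact_mod_cast le_top))
  have hwm : ∀ n, AEStronglyMeasurable (w n) volume := fun n =>
    ((contDiff_cutoff _).continuous.aestronglyMeasurable.smul (aesm_grad U)).add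
      ((aesm_fn U).smul (hgc n).aestronglyMeasurable)
  have hum : ∀ n : ℕ, AEStronglyMeasurable (fun x => cutoff ((n : ℝ) + 1) x * fn U x) volume :=
    fun n => (contDiff_cutoff _).continuous.aestronglyMeasurable.mul (aesm_fn U)
  have hfv : modular (nFun D.φ) volume (fn U) < ⊤ :=
    (modular_volume_le hw₀ hw (aesm_fn U)).trans_lt
      (ENNReal.mul_lt_top ENNReal.ofReal_lt_top (modular_fn U))
  -- The radii are at least one, so the cutoff gradients are bounded by `C`; the larger constant `C
  -- + 1` is used because `modular_le_of_le` needs a factor at least one.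
  have hgrad : ∀ (n : ℕ) x, ‖gradient (cutoff ((n : ℝ) + 1)) x‖ ≤ C + 1 := fun n x =>
    (hCR _ (hR n) x).trans ((div_le_self hC (hR1 n)).trans (by linarith))
  have hsum : modular (nFun D.φ) volume (fun x => ‖grad U x‖ + (C + 1) * ‖fn U x‖) < ⊤ := by
    refine (Y.modular_add_le (u := fun x => ‖grad U x‖) (v := fun x => (C + 1) * ‖fn U x‖)
      (aesm_grad U).norm).trans_lt (ENNReal.mul_lt_top ENNReal.ofReal_lt_top
      (ENNReal.add_lt_top.2 ⟨?_, ?_⟩))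
    · exact (Y.modular_mono (Eventually.of_forall fun x => by simp)).trans_lt (modular_grad U)
    · refine (Y.modular_le_of_le (c := C + 1) (w := fn U) (by linarith)
        (Eventually.of_forall fun x => ?_)).trans_lt (ENNReal.mul_lt_top ENNReal.ofReal_lt_top hfv)
      rw [norm_mul, norm_norm, Real.norm_of_nonneg (by linarith)]
  have hnn : ∀ x, ‖‖grad U x‖ + (C + 1) * ‖fn U x‖‖ = ‖grad U x‖ + (C + 1) * ‖fn U x‖ :=
    fun x => Real.norm_of_nonneg (by positivity)
  have hex : ∀ n : ℕ, ∃ W : D.Space, fn W =ᵐ[volume] (fun x => cutoff ((n : ℝ) + 1) x * fn U x) ∧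
      grad W =ᵐ[volume] w n := by
    intro n
    refine exists_mk hw₀ hw (hum n) (hwm n) ((hasWeakGradient U).smooth_mul (contDiff_cutoff _))
      ((Y.modular_mono (Eventually.of_forall fun x => ?_)).trans_lt hsum)
      ((Y.modular_mono (Eventually.of_forall fun x => ?_)).trans_lt (modular_fn U))
    · rw [hnn]
      refine (norm_add_le _ _).trans ?_
      rw [norm_smul, norm_smul, Real.norm_of_nonneg (cutoff_nonneg _ _), mul_comm (C + 1)]
      exact add_le_add (mul_le_of_le_one_left (norm_nonneg _) (cutoff_le_one _ _))
        (mul_le_mul_of_nonneg_left (hgrad n x) (norm_nonneg _))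
    · rw [norm_mul, Real.norm_of_nonneg (cutoff_nonneg _ _)]
      exact mul_le_of_le_one_left (norm_nonneg _) (cutoff_le_one _ _)
  choose W hW1 hW2 using hex
  have hcut : ∀ x : EuclideanSpace ℝ (Fin N),
      ∀ᶠ n : ℕ in atTop, cutoff ((n : ℝ) + 1) x = 1 := by
    intro x
    obtain ⟨n₀, hn₀⟩ := exists_nat_ge ‖x‖
    filter_upwards [eventually_ge_atTop n₀] with n hn
    refine cutoff_eq_one (hR n) (hn₀.trans ?_)
    have : (n₀ : ℝ) ≤ n := by exact_mod_cast hn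
    linarith
  refine ⟨W, tendsto_of_modular hκ ?_ ?_, hW1⟩
  · have e : ∀ n, modular (nFun D.φ) volume (grad (W n) - grad U)
        = modular (nFun D.φ) volume (w n - grad U) := fun n =>
      modular_congr ((hW2 n).sub (EventuallyEq.refl _ _))
    simp only [e]
    refine tendsto_lintegral_zero_of_le_add
      (G := fun x => ENNReal.ofReal (nFun D.φ ‖‖grad U x‖ + (C + 1) * ‖fn U x‖‖))
      (e := fun _ _ => 0) (fun n => Y.aemeasurable ((hwm n).sub (aesm_grad U)))
      (Y.aemeasurable ((aesm_grad U).norm.add ((aesm_fn U).norm.const_mul _)))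
      (Eventually.of_forall fun x => Y.tendsto_comp_zero ?_) hsum.ne
      (fun n => Eventually.of_forall fun x => ?_) (by simp)
    · have h1 : Tendsto (fun n : ℕ => fn U x • gradient (cutoff ((n : ℝ) + 1)) x) atTop (𝓝 0) := by
        have h2 : Tendsto (fun n : ℕ => gradient (cutoff ((n : ℝ) + 1)) x) atTop (𝓝 0) := by
          refine squeeze_zero_norm (fun n => hCR _ (hR n) x) ?_
          have := tendsto_one_div_add_atTop_nhds_zero_nat (𝕜 := ℝ) |>.const_mul C
          simpa [div_eq_mul_inv] using this
        simpa using h2.const_smul (fn U x)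
      refine h1.congr' ?_
      filter_upwards [hcut x] with n hn
      simp only [hwdef, Pi.sub_apply, hn, one_smul]
      abel
    · rw [add_zero]
      refine ENNReal.ofReal_le_ofReal (Y.mono (norm_nonneg _) (norm_nonneg _) ?_)
      rw [hnn]
      have e2 : (w n - grad U) x = (cutoff ((n : ℝ) + 1) x - 1) • grad U x
          + fn U x • gradient (cutoff ((n : ℝ) + 1)) x := by
        simp only [hwdef, Pi.sub_apply, sub_smul, one_smul]; abel
      rw [e2]
      refine (norm_add_le _ _).trans ?_
      rw [norm_smul, norm_smul, mul_comm (C + 1)]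
      refine add_le_add (mul_le_of_le_one_left (norm_nonneg _) ?_)
        (mul_le_mul_of_nonneg_left (hgrad n x) (norm_nonneg _))
      rw [Real.norm_eq_abs, abs_le]
      constructor <;> linarith [cutoff_nonneg ((n : ℝ) + 1) x, cutoff_le_one ((n : ℝ) + 1) x]
  · have e : ∀ n, modular (nFun D.φ) D.wMeasure (fn (W n) - fn U)
        = modular (nFun D.φ) D.wMeasure ((fun x => cutoff ((n : ℝ) + 1) x * fn U x) - fn U) :=
      fun n => modular_congr (((hW1 n).filter_mono D.wMeasure_ac.ae_le).sub (EventuallyEq.refl _ _))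
    simp only [e]
    have hfm : AEStronglyMeasurable (fn U) D.wMeasure := (aesm_fn U).mono_ac D.wMeasure_ac
    refine tendsto_lintegral_zero_of_le_add
      (G := fun x => ENNReal.ofReal (nFun D.φ ‖fn U x‖))
      (e := fun _ _ => 0)
      (fun n => Y.aemeasurable (((hum n).mono_ac D.wMeasure_ac).sub hfm))
      (Y.aemeasurable hfm)
      (Eventually.of_forall fun x => Y.tendsto_comp_zero ?_) (modular_fn U).ne
      (fun n => Eventually.of_forall fun x => ?_) (by simp)
    · refine tendsto_const_nhds.congr' ?_
      filter_upwards [hcut x] with n hn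
      simp [hn]
    · rw [add_zero]
      refine ENNReal.ofReal_le_ofReal (Y.mono (norm_nonneg _) (norm_nonneg _) ?_)
      have e2 : ((fun x => cutoff ((n : ℝ) + 1) x * fn U x) - fn U) x
          = (cutoff ((n : ℝ) + 1) x - 1) * fn U x := by
        simp only [Pi.sub_apply]; ring
      rw [e2, norm_mul]
      refine mul_le_of_le_one_left (norm_nonneg _) ?_
      rw [Real.norm_eq_abs, abs_le]
      constructor <;> linarith [cutoff_nonneg ((n : ℝ) + 1) x, cutoff_le_one ((n : ℝ) + 1) x]

/-- Elements with bounded support are limits of test functions. -/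
theorem exists_test_tendsto_of_support (hκ : D.κ = 1) {w₀ : ℝ} (hw₀ : 0 < w₀)
    (hw : ∀ x, w₀ ≤ D.w x) (U : D.Space) {R : ℝ}
    (hU : ∀ᵐ x, R ≤ ‖x‖ → fn U x = 0) : ∃ (W : ℕ → D.Space) (v : ℕ → _),
      (∀ n, IsTest (W n) (v n)) ∧ Tendsto W atTop (𝓝 U) := by
  have hfv : modular (nFun D.φ) volume (fn U) < ⊤ :=
    (modular_volume_le hw₀ hw (aesm_fn U)).trans_lt
      (ENNReal.mul_lt_top ENNReal.ofReal_lt_top (modular_fn U))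
  have hwg := hasWeakGradient U
  have hzero : ∀ (n : ℕ) (x : EuclideanSpace ℝ (Fin N)), R + 1 < ‖x‖ →
      mollify n (fn U) x = 0 := by
    intro n x hx
    rw [mollify_apply]
    refine integral_eq_zero_of_ae (hU.mono fun t ht => ?_)
    by_cases hR : R ≤ ‖t‖
    · simp [ht hR]
    · have h1 : 1 / ((n : ℝ) + 1) ≤ ‖x - t‖ := by
        have h2 : 1 / ((n : ℝ) + 1) ≤ 1 := by
          rw [div_le_one (by positivity)]; linarith [Nat.cast_nonneg (α := ℝ) n]
        have h3 := norm_sub_norm_le x t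
        linarith
      simp [mollifier_eq_zero h1]
  have hc : ∀ n, HasCompactSupport (mollify n (fn U)) := fun n =>
    HasCompactSupport.intro (isCompact_closedBall 0 (R + 1)) fun x hx => by
      rw [mem_closedBall_zero_iff, not_le] at hx
      exact hzero n x hx
  choose W hW using fun n => exists_isTest (D := D) hw₀ hw (contDiff_mollify hwg.1 n) (hc n)
  refine ⟨W, _, hW, tendsto_of_modular hκ ?_ ?_⟩
  · refine (tendsto_modular_mollify D.hφ (aesm_grad U) (modular_grad U)).congr fun n =>
      modular_congr (EventuallyEq.sub ?_ (EventuallyEq.refl _ _))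
    refine EventuallyEq.trans (Eventually.of_forall fun x => ?_) (hW n).grad_eq.symm
    exact (gradient_mollify hwg n x).symm
  -- The mollifications and their limit vanish off a fixed ball, on which the weight is bounded, so
  -- the unweighted convergence suffices.
  · obtain ⟨C, hC⟩ := (isCompact_closedBall (0 : EuclideanSpace ℝ (Fin N))
      (R + 1)).exists_bound_of_continuousOn D.w_cont.continuousOn
    have h0 := ENNReal.Tendsto.const_mul (a := ENNReal.ofReal C)
      (tendsto_modular_mollify D.hφ (aesm_fn U) hfv) (Or.inr ENNReal.ofReal_ne_top)
    rw [mul_zero] at h0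
    refine tendsto_of_tendsto_of_tendsto_of_le_of_le tendsto_const_nhds h0
      (fun _ => zero_le) fun n => ?_
    dsimp only
    have hm := (continuous_mollify hwg.1 n).aestronglyMeasurable (μ := volume)
    rw [modular_congr (D.wMeasure_ac.ae_le ((hW n).fn_eq.sub (EventuallyEq.refl _ (fn U)))),
      modular_wMeasure (hm.sub (aesm_fn U)), modular,
      ← lintegral_const_mul' _ _ ENNReal.ofReal_ne_top]
    refine lintegral_mono_ae (hU.mono fun x hx => ?_)
    by_cases hR : ‖x‖ ≤ R + 1
    · gcongr
      exact (le_abs_self _).trans (hC x (mem_closedBall_zero_iff.2 hR))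
    · rw [not_le] at hR
      rw [Pi.sub_apply, hzero n x hR, hx (by linarith), sub_zero, norm_zero,
        PhiAssumptions.nFun_zero]
      simp

/-- Test functions are dense. -/
theorem exists_test_approx (hκ : D.κ = 1) {w₀ : ℝ} (hw₀ : 0 < w₀) (hw : ∀ x, w₀ ≤ D.w x)
    (U : D.Space) {S : Set D.Space} (hS : S ∈ 𝓝 U) : ∃ V ∈ S, ∃ v, IsTest V v := by
  obtain ⟨W, hWU, hW⟩ := exists_tendsto_cutoff hκ hw₀ hw U
  have hS' := eventually_mem_nhds_iff.2 hS
  obtain ⟨n, hn⟩ := (hWU.eventually hS').exists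
  have hsupp : ∀ᵐ x, 2 * ((n : ℝ) + 1) ≤ ‖x‖ → fn (W n) x = 0 :=
    (hW n).mono fun x hx hR => by
      rw [hx]; dsimp only; rw [cutoff_eq_zero (by positivity) hR, zero_mul]
  obtain ⟨Z, v, hZ, hlim⟩ := exists_test_tendsto_of_support hκ hw₀ hw (W n) hsupp
  obtain ⟨k, hk⟩ := (hlim.eventually hn).exists
  exact ⟨Z k, hk, v k, hZ k⟩

end SpaceData

end OrliczNehari

namespace OrliczNehari

/-! ### The Sobolev embedding -/

/-- A smooth function vanishing near the origin and equal to the identity far from it. -/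
noncomputable def truncId (s : ℝ) : ℝ := s * Real.smoothTransition (s ^ 2 - 1)

theorem contDiff_truncId : ContDiff ℝ 1 truncId :=
  contDiff_id.mul (Real.smoothTransition.contDiff.comp ((contDiff_id.pow 2).sub contDiff_const))

theorem truncId_eq_zero {s : ℝ} (hs : |s| ≤ 1) : truncId s = 0 := by
  rw [truncId, Real.smoothTransition.zero_of_nonpos, mul_zero]
  have := (sq_le_one_iff_abs_le_one s).2 hs
  linarith

theorem truncId_eq_self {s : ℝ} (hs : 2 ≤ |s|) : truncId s = s := by
  rw [truncId, Real.smoothTransition.one_of_one_le, mul_one]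
  have : 2 * 2 ≤ |s| * |s| := mul_le_mul hs hs (by norm_num) (abs_nonneg _)
  rw [abs_mul_abs_self] at this
  nlinarith

theorem exists_abs_deriv_truncId_le :
    ∃ C, 0 ≤ C ∧ (∀ s, |deriv truncId s| ≤ C) ∧ ∀ s, |s| < 1 → deriv truncId s = 0 := by
  obtain ⟨C, hC⟩ := (isCompact_Icc (a := (-3 : ℝ)) (b := 3)).exists_bound_of_continuousOn
    (contDiff_truncId.continuous_deriv le_rfl).continuousOn
  refine ⟨max C 1, le_max_of_le_right zero_le_one, fun s => ?_, fun s hs => ?_⟩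
  · by_cases hs : |s| ≤ 3
    · exact (hC s (abs_le.1 hs)).trans (le_max_left _ _)
    · rw [not_le] at hs
      have : truncId =ᶠ[𝓝 s] id := by
        filter_upwards [continuous_abs.continuousAt.eventually (lt_mem_nhds hs)] with y hy
        exact truncId_eq_self (by linarith)
      rw [this.deriv_eq, deriv_id, abs_one]
      exact le_max_right _ _
  · have : truncId =ᶠ[𝓝 s] fun _ => 0 := by
      filter_upwards [continuous_abs.continuousAt.eventually (gt_mem_nhds hs)] with y hy
      exact truncId_eq_zero hy.le
    rw [this.deriv_eq, deriv_const]

section Sobolev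

variable {N : ℕ} {φ : ℝ → ℝ} {l m γ : ℝ}

/-- The Gagliardo–Nirenberg–Sobolev inequality in integrated form. -/
theorem exists_lintegral_rpow_le_of_gradient (hγ1 : 1 ≤ γ) (hγN : γ < N) (B : NNReal) :
    ∃ K : NNReal, ∀ v : EuclideanSpace ℝ (Fin N) → ℝ, ContDiff ℝ 1 v → HasCompactSupport v →
      ∫⁻ x, ENNReal.ofReal (‖fderiv ℝ v x‖ ^ γ) ≤ B →
      ∫⁻ x, ENNReal.ofReal (|v x| ^ (N * γ / (N - γ))) ≤ K := by
  have hγ0 : 0 < γ := by linarith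
  have hN : (0 : ℝ) < N := by linarith
  have hs : 0 < N * γ / (N - γ) := div_pos (mul_pos hN hγ0) (by linarith)
  set s := N * γ / (N - γ) with hsdef
  set p : NNReal := ⟨γ, hγ0.le⟩ with hp
  set p' : NNReal := ⟨s, hs.le⟩ with hp'
  have hpp : (p' : ℝ)⁻¹ = (p : ℝ)⁻¹ - (Module.finrank ℝ (EuclideanSpace ℝ (Fin N)) : ℝ)⁻¹ := by
    rw [finrank_euclideanSpace_fin]
    change s⁻¹ = γ⁻¹ - (N : ℝ)⁻¹
    rw [hsdef]
    field_simp
  set C := SNormLESNormFDerivOfEqConst ℝ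
    (volume : Measure (EuclideanSpace ℝ (Fin N))) p with hC
  refine ⟨(C * B ^ (1 / γ)) ^ s, fun v hv hc hB => ?_⟩
  have hgns := eLpNorm_le_eLpNorm_fderiv_of_eq
    (volume : Measure (EuclideanSpace ℝ (Fin N))) hv hc (p := p) (p' := p')
    (by exact_mod_cast hγ1)
    (by rw [finrank_euclideanSpace_fin]; exact_mod_cast hN) hpp
  have hp0 : p ≠ 0 := fun h => hγ0.ne' (congrArg NNReal.toReal h)
  have hp0' : p' ≠ 0 := fun h => hs.ne' (congrArg NNReal.toReal h)
  have e1 := eLpNorm_nnreal_pow_eq_lintegral (f := v) (μ := volume) hp0'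
  have e2 := eLpNorm_nnreal_pow_eq_lintegral (f := fderiv ℝ v) (μ := volume) hp0
  have e3 : ∀ x, ENNReal.ofReal (|v x| ^ s) = ‖v x‖ₑ ^ (p' : ℝ) := fun x => by
    rw [← ENNReal.ofReal_rpow_of_nonneg (abs_nonneg _) hs.le, ← Real.norm_eq_abs, ofReal_norm]; rfl
  have e4 : ∀ x, ENNReal.ofReal (‖fderiv ℝ v x‖ ^ γ) = ‖fderiv ℝ v x‖ₑ ^ (p : ℝ) := fun x => by
    rw [← ENNReal.ofReal_rpow_of_nonneg (norm_nonneg _) hγ0.le, ofReal_norm]; rfl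
  simp only [e4] at hB
  simp only [e3]
  rw [← e2] at hB
  rw [← e1]
  have h1 : eLpNorm (fderiv ℝ v) p volume ≤ (B : ENNReal) ^ (1 / γ) := by
    rw [one_div, ENNReal.le_rpow_inv_iff hγ0]; exact hB
  have h2 := hgns.trans (mul_le_mul' le_rfl h1)
  refine (ENNReal.rpow_le_rpow h2 hs.le).trans (le_of_eq ?_)
  rw [ENNReal.coe_rpow_of_nonneg _ hs.le, ENNReal.coe_mul,
    ENNReal.coe_rpow_of_nonneg _ (by positivity)]

/-- The bound `t^γ ≤ C (1 + Φ(t))` cannot be integrated over the whole space because of the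
constant. But the gradient of `truncId v` vanishes where `|v| < 1`, and elsewhere the constant is at
most `Φ(|v|) / Φ(1)`. Hence the `γ`-th power of that gradient is controlled by the two modulars, and
the Sobolev inequality applies to `truncId v`. -/
theorem exists_lintegral_truncId_le (h : PhiAssumptions N φ l m) (hγ1 : 1 ≤ γ) (hγN : γ < N)
    (hγΦ : ∃ C, 0 ≤ C ∧ ∀ t, 0 ≤ t → t ^ γ ≤ C * (1 + nFun φ t)) (A : NNReal) :
    ∃ K : NNReal, ∀ v : EuclideanSpace ℝ (Fin N) → ℝ, ContDiff ℝ 1 v → HasCompactSupport v →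
      modular (nFun φ) volume v ≤ A → modular (nFun φ) volume (gradient v) ≤ A →
      ∫⁻ x, ENNReal.ofReal (|truncId (v x)| ^ (N * γ / (N - γ))) ≤ K := by
  have hγ0 : 0 < γ := by linarith
  have Y := h.youngPair
  obtain ⟨C, hC, hCΦ⟩ := hγΦ
  obtain ⟨C', hC', hd, hd0⟩ := exists_abs_deriv_truncId_le
  have h1 := h.nFun_pos one_pos
  set c : ℝ := C' ^ γ * C * (1 / nFun φ 1 + 1) with hc
  have hc0 : 0 ≤ c := by positivity
  obtain ⟨K, hK⟩ := exists_lintegral_rpow_le_of_gradient (N := N) hγ1 hγN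
    (c.toNNReal * (A + A))
  refine ⟨K, fun v hv hcs hA hA' => hK (fun x => truncId (v x)) (contDiff_truncId.comp hv)
    (hcs.comp_left (truncId_eq_zero (by simp))) ?_⟩
  have hpt : ∀ x, ENNReal.ofReal (‖fderiv ℝ (fun x => truncId (v x)) x‖ ^ γ)
      ≤ ENNReal.ofReal c * (ENNReal.ofReal (nFun φ ‖v x‖)
        + ENNReal.ofReal (nFun φ ‖gradient v x‖)) := by
    intro x
    have n1 := h.nFun_nonneg ‖v x‖
    have n2 := h.nFun_nonneg ‖gradient v x‖
    rw [← ENNReal.ofReal_add n1 n2, ← ENNReal.ofReal_mul hc0]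
    refine ENNReal.ofReal_le_ofReal ?_
    have hf : HasFDerivAt (fun x => truncId (v x)) (deriv truncId (v x) • fderiv ℝ v x) x :=
      ((contDiff_truncId.differentiable one_ne_zero (v x)).hasDerivAt).comp_hasFDerivAt x
        (hv.differentiable one_ne_zero x).hasFDerivAt
    rw [hf.fderiv, norm_smul, ← norm_gradient]
    by_cases hx : |v x| < 1
    · rw [hd0 _ hx, norm_zero, zero_mul, Real.zero_rpow hγ0.ne']
      positivity
    · rw [not_lt] at hx
      have h2 : nFun φ 1 ≤ nFun φ ‖v x‖ := Y.mono (mem_Ici.2 zero_le_one) (norm_nonneg _) hx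
      have h3 : 1 ≤ 1 / nFun φ 1 * nFun φ ‖v x‖ := by
        rw [div_mul_eq_mul_div, one_mul, le_div_iff₀ h1]; linarith
      have h4 := hCΦ _ (norm_nonneg (gradient v x))
      calc (‖deriv truncId (v x)‖ * ‖gradient v x‖) ^ γ
          ≤ (C' * ‖gradient v x‖) ^ γ := by gcongr; exact hd _
        _ = C' ^ γ * ‖gradient v x‖ ^ γ := Real.mul_rpow hC' (norm_nonneg _)
        _ ≤ C' ^ γ * (C * (1 + nFun φ ‖gradient v x‖)) := by gcongr
        _ ≤ C' ^ γ * (C * ((1 / nFun φ 1 + 1) * (nFun φ ‖v x‖ + nFun φ ‖gradient v x‖))) := by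
            have h5 : 0 ≤ 1 / nFun φ 1 * nFun φ ‖gradient v x‖ := by positivity
            gcongr
            nlinarith
        _ = _ := by rw [hc]; ring
  refine (lintegral_mono hpt).trans ?_
  rw [lintegral_const_mul' _ _ ENNReal.ofReal_ne_top,
    lintegral_add_left' (Y.aemeasurable hv.continuous.aestronglyMeasurable)]
  rw [ENNReal.coe_mul, ENNReal.coe_add]
  exact mul_le_mul' le_rfl (add_le_add hA hA')

namespace SpaceData

variable {D : SpaceData N}

theorem IsTest.modular_fn_le {U : D.Space} {v : EuclideanSpace ℝ (Fin N) → ℝ}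
    (hU : IsTest U v) : modular (nFun D.φ) volume v = modular (nFun D.φ) volume (fn U) :=
  modular_congr hU.fn_eq.symm

theorem IsTest.modular_grad_le {U : D.Space} {v : EuclideanSpace ℝ (Fin N) → ℝ}
    (hU : IsTest U v) :
    modular (nFun D.φ) volume (gradient v) = modular (nFun D.φ) volume (grad U) :=
  modular_congr hU.grad_eq.symm

theorem IsTest.contDiff_one {U : D.Space} {v : EuclideanSpace ℝ (Fin N) → ℝ}
    (hU : IsTest U v) : ContDiff ℝ 1 v := hU.contDiff.of_le (by exact_mod_cast le_top)

/-- The bound for test functions passes to the limit by density and Fatou's lemma along an almost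
everywhere convergent subsequence. The approximations lie within distance one, whence the radius `R
+ 1`. -/
theorem exists_lintegral_truncId_fn_le (hκ : D.κ = 1) {w₀ : ℝ} (hw₀ : 0 < w₀)
    (hw : ∀ x, w₀ ≤ D.w x) (hγ1 : 1 ≤ γ) (hγN : γ < N)
    (hγΦ : ∃ C, 0 ≤ C ∧ ∀ t, 0 ≤ t → t ^ γ ≤ C * (1 + nFun D.φ t)) (R : ℝ) :
    ∃ K : NNReal, ∀ U : D.Space, ‖U‖ ≤ R →
      ∫⁻ x, ENNReal.ofReal (|truncId (fn U x)| ^ (N * γ / (N - γ))) ≤ K := by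
  have Y := D.hφ.youngPair
  have hTf := modularMap_fn_volume hκ hw₀ hw
  obtain ⟨A₁, hA₁⟩ := hTf.bounded Y (R + 1)
  obtain ⟨A₂, hA₂⟩ := (modularMap_grad hκ).bounded Y (R + 1)
  obtain ⟨K, hK⟩ := exists_lintegral_truncId_le D.hφ hγ1 hγN hγΦ (max A₁ A₂)
  refine ⟨K, fun U hU => ?_⟩
  have hex : ∀ n : ℕ, ∃ V : D.Space, (∃ v, IsTest V v) ∧ dist V U < 1 / ((n : ℝ) + 1) := by
    intro n
    obtain ⟨V, hV, hv⟩ := exists_test_approx hκ hw₀ hw U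
      (Metric.ball_mem_nhds U (by positivity : 0 < 1 / ((n : ℝ) + 1)))
    exact ⟨V, hv, hV⟩
  choose V hv hVU using hex
  choose v hv using hv
  have hlim : Tendsto V atTop (𝓝 U) := by
    rw [tendsto_iff_dist_tendsto_zero]
    exact squeeze_zero (fun _ => dist_nonneg) (fun n => (hVU n).le)
      tendsto_one_div_add_atTop_nhds_zero_nat
  have hVR : ∀ n, ‖V n‖ ≤ R + 1 := by
    intro n
    have h1 : 1 / ((n : ℝ) + 1) ≤ 1 := by
      rw [div_le_one (by positivity)]; linarith [Nat.cast_nonneg (α := ℝ) n]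
    have h2 := hVU n
    rw [dist_eq_norm] at h2
    have h3 := norm_add_le (V n - U) U
    rw [sub_add_cancel] at h3
    linarith
  obtain ⟨σ, hσ, hae⟩ := Y.exists_subseq_ae (fun n => aesm_fn (V n)) (hTf.tendsto_sub Y hlim)
    (aesm_fn U)
  have hcont : Continuous fun s : ℝ => ENNReal.ofReal (|truncId s| ^ (N * γ / (N - γ))) := by
    refine ENNReal.continuous_ofReal.comp (Continuous.rpow_const
      (continuous_abs.comp contDiff_truncId.continuous) fun s => Or.inr ?_)
    exact div_nonneg (mul_nonneg (by linarith) (by linarith)) (by linarith)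
  have hKn : ∀ n, ∫⁻ x, ENNReal.ofReal (|truncId (fn (V n) x)| ^ (N * γ / (N - γ))) ≤ K := by
    intro n
    have e : ∫⁻ x, ENNReal.ofReal (|truncId (fn (V n) x)| ^ (N * γ / (N - γ)))
        = ∫⁻ x, ENNReal.ofReal (|truncId (v n x)| ^ (N * γ / (N - γ))) :=
      lintegral_congr_ae ((hv n).fn_eq.mono fun x hx => by simp only [hx])
    rw [e]
    refine hK _ (hv n).contDiff_one (hv n).hasCompactSupport ?_ ?_
    · rw [(hv n).modular_fn_le]
      exact (hA₁ _ (hVR n)).trans (by exact_mod_cast le_max_left _ _)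
    · rw [(hv n).modular_grad_le]
      exact (hA₂ _ (hVR n)).trans (by exact_mod_cast le_max_right _ _)
  have hle : ∫⁻ x, ENNReal.ofReal (|truncId (fn U x)| ^ (N * γ / (N - γ)))
      ≤ ∫⁻ x, liminf (fun n => ENNReal.ofReal
        (|truncId (fn (V (σ n)) x)| ^ (N * γ / (N - γ)))) atTop := by
    refine lintegral_mono_ae (hae.mono fun x hx => ?_)
    exact ((hcont.tendsto _).comp hx).liminf_eq.ge
  refine hle.trans ((lintegral_liminf_le' fun n =>
    hcont.measurable.comp_aemeasurable (aesm_fn _).aemeasurable).trans ?_)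
  exact liminf_le_of_frequently_le' (Frequently.of_forall fun n => hKn (σ n))

/-- The embedding of the space into the class of the Young function `Φ(t) + t^q`. -/
theorem modularMap_fn_add_rpow (hκ : D.κ = 1) {w₀ : ℝ} (hw₀ : 0 < w₀)
    (hw : ∀ x, w₀ ≤ D.w x) (hγ1 : 1 ≤ γ) (hγN : γ < N)
    (hγΦ : ∃ C, 0 ≤ C ∧ ∀ t, 0 ≤ t → t ^ γ ≤ C * (1 + nFun D.φ t)) {q : ℝ} (hmq : D.m ≤ q)
    (hq : q ≤ N * γ / (N - γ)) :
    ModularMap (fn : D.Space → _) (fun t => nFun D.φ t + t ^ q) volume where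
  aesm := aesm_fn
  add := fn_add
  smul := fn_smul
  bound := by
    have Y := D.hφ.youngPair
    obtain ⟨K, hK⟩ := exists_lintegral_truncId_fn_le hκ hw₀ hw hγ1 hγN hγΦ 1
    obtain ⟨C, hC⟩ := (modularMap_fn_volume hκ hw₀ hw).bound
    have hM := D.hφ.nFun_pos two_pos
    have hq1 : 1 ≤ q := by linarith [D.hφ.one_lt_l, D.hφ.l_le_m]
    set c : ℝ := 1 + 2 ^ q / nFun D.φ 2 * 1 with hc
    -- For `|s| ≥ 2` the truncation is the identity and the critical power dominates `|s|^q`; for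
    -- `|s| ≤ 2` the lower bound of `Φ` by a multiple of `|s|^m`, with `q ≥ m`, dominates `|s|^q`.
    have hpt : ∀ s : ℝ, nFun D.φ ‖s‖ + ‖s‖ ^ q ≤
        (1 + 2 ^ q / nFun D.φ 2) * nFun D.φ ‖s‖ + |truncId s| ^ (N * γ / (N - γ)) := by
      intro s
      rw [Real.norm_eq_abs]
      have h0 := D.hφ.nFun_nonneg |s|
      have h0' : 0 ≤ 2 ^ q / nFun D.φ 2 * nFun D.φ |s| := by positivity
      rcases le_total 2 |s| with h | h
      · rw [truncId_eq_self h]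
        have := Real.rpow_le_rpow_of_exponent_le (by linarith : 1 ≤ |s|) hq
        linarith
      · have h1 := Y.scale_ge (2 / |s|) |s|
        have h2 : |s| ^ q ≤ 2 ^ q / nFun D.φ 2 * nFun D.φ |s| := by
          rcases (abs_nonneg s).eq_or_lt with h3 | h3
          · rw [← h3, Real.zero_rpow (by linarith), PhiAssumptions.nFun_zero, mul_zero]
          · have h4 := h1 ((one_le_div h3).2 h) h3.le
            rw [div_mul_cancel₀ _ h3.ne'] at h4
            have h5 : (2 / |s|) ^ D.m ≤ (2 / |s|) ^ q :=
              Real.rpow_le_rpow_of_exponent_le ((one_le_div h3).2 h) hmq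
            have h6 := h4.trans (mul_le_mul_of_nonneg_right h5 h0)
            rw [Real.div_rpow (by norm_num) h3.le, div_mul_eq_mul_div,
              le_div_iff₀ (Real.rpow_pos_of_pos h3 _)] at h6
            rw [div_mul_eq_mul_div, le_div_iff₀ hM]
            linarith
        have h7 : 0 ≤ |truncId s| ^ (N * γ / (N - γ)) := by positivity
        linarith
    refine ⟨(1 + 2 ^ q / nFun D.φ 2).toNNReal * C + K, fun u hu => ?_⟩
    have hc0 : 0 ≤ 1 + 2 ^ q / nFun D.φ 2 := by positivity
    calc modular (fun t => nFun D.φ t + t ^ q) volume (fn u)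
        ≤ ∫⁻ x, (ENNReal.ofReal (1 + 2 ^ q / nFun D.φ 2) * ENNReal.ofReal (nFun D.φ ‖fn u x‖)
          + ENNReal.ofReal (|truncId (fn u x)| ^ (N * γ / (N - γ)))) := by
          refine lintegral_mono fun x => ?_
          rw [← ENNReal.ofReal_mul hc0, ← ENNReal.ofReal_add
            (mul_nonneg hc0 (D.hφ.nFun_nonneg _)) (by positivity)]
          exact ENNReal.ofReal_le_ofReal (hpt _)
      _ = ENNReal.ofReal (1 + 2 ^ q / nFun D.φ 2) * modular (nFun D.φ) volume (fn u)
          + ∫⁻ x, ENNReal.ofReal (|truncId (fn u x)| ^ (N * γ / (N - γ))) := by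
          rw [lintegral_add_left' ((Y.aemeasurable (aesm_fn u)).const_mul _),
            lintegral_const_mul' _ _ ENNReal.ofReal_ne_top]
          rfl
      _ ≤ _ := by
          rw [ENNReal.coe_add, ENNReal.coe_mul]
          exact add_le_add (mul_le_mul' le_rfl (hC u hu)) (hK u hu.le)

end SpaceData

/-- Interpolation between linear growth and the critical power. -/
theorem exists_le_truncId_add_mul (h : PhiAssumptions N φ l m) {q s δ : ℝ} (hmq : m ≤ q)
    (hqs : q < s) (hδ : 0 < δ) :
    ∃ K, 0 ≤ K ∧ ∀ t, nFun φ |t| + |t| ^ q ≤ δ * |truncId t| ^ s + K * |t| := by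
  have Y := h.youngPair
  have hq1 : 1 < q := by linarith [h.one_lt_l, h.l_le_m]
  have Y2 := Y.add (youngPair_rpow hq1)
  have hlim := (tendsto_rpow_neg_atTop (y := s - q) (by linarith)).const_mul (nFun φ 1 + 1)
  rw [mul_zero] at hlim
  -- Beyond `T` the growth of order `t^q` is at most the fraction `δ` of `t^s`; below `T` the
  -- function lies under its chord from the origin. Taking `T ≥ 2` makes the truncation the identity
  -- beyond `T`.
  obtain ⟨T, hT1, hT2⟩ := ((hlim.eventually (gt_mem_nhds hδ)).and (eventually_ge_atTop 2)).exists
  have hT0 : 0 < T := by linarith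
  have hMT : 0 ≤ nFun φ T + T ^ q := Y2.nonneg hT0.le
  refine ⟨(nFun φ T + T ^ q) / T, by positivity, fun t => ?_⟩
  rcases le_total |t| T with ht | ht
  · have h1 := Y2.scale_le_mul (c := |t| / T) (t := T) (by positivity) ((div_le_one hT0).2 ht)
      hT0.le
    rw [div_mul_cancel₀ _ hT0.ne'] at h1
    have h2 : 0 ≤ δ * |truncId t| ^ s := by positivity
    have h3 : |t| / T * (nFun φ T + T ^ q) = (nFun φ T + T ^ q) / T * |t| := by ring
    linarith
  · rw [truncId_eq_self (hT2.trans ht)]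
    have ht0 : 0 < |t| := by linarith
    have h1 := Y.scale_ge |t| 1 (by linarith) zero_le_one
    rw [mul_one] at h1
    have h2 : |t| ^ m ≤ |t| ^ q := Real.rpow_le_rpow_of_exponent_le (by linarith) hmq
    have h3 : |t| ^ q = |t| ^ (-(s - q)) * |t| ^ s := by
      rw [← Real.rpow_add ht0]; congr 1; ring
    have h4 : |t| ^ (-(s - q)) ≤ T ^ (-(s - q)) :=
      Real.rpow_le_rpow_of_nonpos hT0 ht (by linarith)
    have h5 := (h.nFun_pos one_pos).le
    have h6 : 0 ≤ (nFun φ T + T ^ q) / T * |t| := by positivity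
    calc nFun φ |t| + |t| ^ q ≤ (nFun φ 1 + 1) * |t| ^ q := by nlinarith
      _ = (nFun φ 1 + 1) * |t| ^ (-(s - q)) * |t| ^ s := by rw [h3]; ring
      _ ≤ (nFun φ 1 + 1) * T ^ (-(s - q)) * |t| ^ s := by gcongr
      _ ≤ δ * |t| ^ s := by gcongr
      _ ≤ _ := by linarith

theorem gammaExp_eq_or (φ : ℝ → ℝ) (l m : ℝ) :
    (gammaExp φ l m = m ∧ ∀ t : ℝ, |t| ^ m ≤ nFun φ t) ∨ gammaExp φ l m = l := by
  unfold gammaExp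
  split_ifs with h
  · exact Or.inl ⟨rfl, h⟩
  · exact Or.inr rfl

theorem one_lt_gammaExp (h : PhiAssumptions N φ l m) : 1 < gammaExp φ l m := by
  rcases gammaExp_eq_or φ l m with ⟨e, -⟩ | e <;> rw [e] <;> linarith [h.one_lt_l, h.l_le_m]

theorem gammaExp_lt (h : PhiAssumptions N φ l m) : gammaExp φ l m < N := by
  rcases gammaExp_eq_or φ l m with ⟨e, -⟩ | e <;> rw [e] <;> linarith [h.m_lt_dim, h.l_le_m]

theorem m_lt_conj_gammaExp (h : PhiAssumptions N φ l m) :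
    m < N * gammaExp φ l m / (N - gammaExp φ l m) := by
  rcases gammaExp_eq_or φ l m with ⟨e, -⟩ | e <;> rw [e]
  · have h1 := h.m_lt_dim
    have h2 : 0 < m := by linarith [h.one_lt_l, h.l_le_m]
    rw [lt_div_iff₀ (by linarith)]
    nlinarith
  · exact h.m_lt_conj

/-- If `γ = m` this is the condition defining the case; if `γ = l` it is the lower growth `Φ(t) ≥
Φ(1) t^l` for `t ≥ 1`. -/
theorem rpow_gammaExp_le (h : PhiAssumptions N φ l m) :
    ∃ C, 0 ≤ C ∧ ∀ t, 0 ≤ t → t ^ gammaExp φ l m ≤ C * (1 + nFun φ t) := by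
  have h1 := h.nFun_pos one_pos
  rcases gammaExp_eq_or φ l m with ⟨e, hm⟩ | e <;> rw [e]
  · refine ⟨1, zero_le_one, fun t ht => ?_⟩
    have := hm t
    rw [abs_of_nonneg ht] at this
    linarith
  · refine ⟨1 + 1 / nFun φ 1, by positivity, fun t ht => ?_⟩
    have h0 := h.nFun_nonneg t
    have hl := h.one_lt_l
    rcases le_total t 1 with h2 | h2
    · have h3 : t ^ l ≤ 1 := Real.rpow_le_one ht h2 (by linarith)
      have h4 : 0 ≤ 1 / nFun φ 1 := by positivity
      nlinarith [mul_nonneg h4 h0]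
    · have ht0 : 0 < t := by linarith
      have h3 := h.youngPair.scale_le t⁻¹ t (by positivity) (inv_le_one_of_one_le₀ h2) ht
      rw [inv_mul_cancel₀ ht0.ne', Real.inv_rpow ht, inv_mul_eq_div,
        le_div_iff₀ (Real.rpow_pos_of_pos ht0 _)] at h3
      have h4 : t ^ l ≤ 1 / nFun φ 1 * nFun φ t := by
        rw [div_mul_eq_mul_div, le_div_iff₀ h1]; linarith
      have h5 : 0 ≤ 1 / nFun φ 1 := by positivity
      nlinarith

end Sobolev

end OrliczNehari

namespace OrliczNehari

/-! ### The nonlinearities -/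

theorem deriv_nonneg_of_monotoneOn_Ioi {u : ℝ → ℝ} (h : MonotoneOn u (Ioi 0)) {t : ℝ}
    (ht : 0 < t) : 0 ≤ deriv u t := by
  rw [← derivWithin_of_isOpen isOpen_Ioi ht]
  exact h.derivWithin_nonneg

namespace GrowthAssumptions

variable {N : ℕ} {φ r : ℝ → ℝ} {r₁ r₂ : ℝ}

theorem pos (h : GrowthAssumptions N φ r r₁ r₂) (hr₁ : 0 < r₁) {t : ℝ} (ht : 0 < t) :
    0 < r t := by
  refine lt_of_le_of_ne (h.nonneg t ht) fun h0 => ?_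
  have := h.ratio_lower t ht
  rw [← h0] at this
  simp at this
  linarith

theorem nFun_pos (h : GrowthAssumptions N φ r r₁ r₂) (hr₁ : 0 < r₁) {t : ℝ} (ht : 0 < t) :
    0 < nFun r t := by
  have h1 := h.ratio_lower t ht
  by_contra hc
  have := div_nonpos_of_nonneg_of_nonpos (mul_nonneg (h.nonneg t ht) (sq_nonneg t)) (not_lt.1 hc)
  linarith

theorem mul_sq_le (h : GrowthAssumptions N φ r r₁ r₂) (hr₁ : 0 < r₁) {t : ℝ} (ht : 0 < t) :
    r t * t ^ 2 ≤ r₂ * nFun r t := by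
  have := h.ratio_upper t ht
  rwa [div_le_iff₀ (h.nFun_pos hr₁ ht)] at this

theorem differentiableAt (h : GrowthAssumptions N φ r r₁ r₂) {t : ℝ} (ht : 0 < t) :
    DifferentiableAt ℝ r t :=
  (h.contDiffOn.differentiableOn one_ne_zero).differentiableAt (Ioi_mem_nhds ht)

theorem le_deriv_mul (h : GrowthAssumptions N φ r r₁ r₂) {t : ℝ} (ht : 0 < t) :
    r t ≤ deriv (fun s => r s * s) t := by
  have hd : HasDerivAt (fun s => r s * s) _ t :=
    (h.differentiableAt ht).hasDerivAt.mul (hasDerivAt_id t)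
  have e : deriv (fun s => r s * s) t = deriv r t * t + r t := by
    rw [hd.deriv]; simp
  rw [e]
  have := mul_nonneg (deriv_nonneg_of_monotoneOn_Ioi h.mono ht) ht.le
  linarith

theorem exists_deriv_mul_le (h : GrowthAssumptions N φ r r₁ r₂) :
    ∃ C, 0 ≤ C ∧ ∀ t > 0, deriv (fun s => r s * s) t ≤ C * r t := by
  obtain ⟨c, hc, hb⟩ := h.deriv_bound
  refine ⟨c + 1, by positivity, fun t ht => ?_⟩
  have hd : HasDerivAt (fun s => r s * s) _ t :=
    (h.differentiableAt ht).hasDerivAt.mul (hasDerivAt_id t)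
  have e : deriv (fun s => r s * s) t = deriv r t * t + r t := by
    rw [hd.deriv]; simp
  rw [e]
  linarith [le_abs_self (deriv r t * t), hb t ht]

theorem hasDerivAt_nFun (h : GrowthAssumptions N φ r r₁ r₂) {t : ℝ} (ht : 0 < t) :
    HasDerivAt (nFun r) (r t * t) t := by
  set R := PhiAssumptions.mulExt r with hR
  have hmono : Monotone R := by
    intro x y hxy
    simp only [hR, PhiAssumptions.mulExt]
    split_ifs with h1 h2 h2
    · exact mul_le_mul (h.mono h1 h2 hxy) hxy (le_of_lt h1) (h.nonneg y h2)
    · exact absurd (h1.trans_le hxy) h2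
    · exact mul_nonneg (h.nonneg y h2) h2.le
    · exact le_rfl
  have h0 : HasDerivAt (fun t : ℝ => ∫ s in (0 : ℝ)..t, R s) (R t) t := by
    refine intervalIntegral.integral_hasDerivAt_right hmono.intervalIntegrable
      hmono.measurable.stronglyMeasurable.stronglyMeasurableAtFilter ?_
    have : (fun s => r s * s) =ᶠ[𝓝 t] R := by
      filter_upwards [Ioi_mem_nhds ht] with s hs
      exact (PhiAssumptions.mulExt_of_pos hs).symm
    exact ((h.differentiableAt ht).continuousAt.mul continuousAt_id).congr this
  rw [hR, PhiAssumptions.mulExt_of_pos ht] at h0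
  refine h0.congr_of_eventuallyEq ?_
  filter_upwards [Ioi_mem_nhds ht] with s hs
  rw [PhiAssumptions.nFun_eq, abs_of_pos hs]

theorem exists_mul_le_rpow (h : GrowthAssumptions N φ r r₁ r₂) (hr₁ : 0 < r₁) :
    ∃ C, 0 ≤ C ∧ ∀ t, 1 ≤ t → r t * t ≤ C * t ^ (r₂ - 1) := by
  -- Only the upper half of the scaling lemma is used, so the trivial exponent `p = 0` is supplied
  -- for the lower one.
  have hs := (scale_of_hasDerivAt (a := fun t => r t * t) (M := nFun r) (p := 0) (q := r₂)
    (fun t ht => h.hasDerivAt_nFun ht)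
    (fun t ht => by
      rw [zero_mul]
      exact mul_nonneg (mul_nonneg (h.nonneg t ht) ht.le) ht.le)
    (fun t ht => by have := h.mul_sq_le hr₁ ht; nlinarith)).2
  have hr₂ : 0 < r₂ := by
    have := (h.ratio_lower 1 one_pos).trans (h.ratio_upper 1 one_pos)
    linarith
  refine ⟨r₂ * nFun r 1, mul_nonneg hr₂.le (h.nFun_pos hr₁ one_pos).le, fun t ht => ?_⟩
  have ht0 : 0 < t := by linarith
  have h1 := hs t 1 ht one_pos
  rw [mul_one] at h1
  have h2 := h.mul_sq_le hr₁ ht0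
  rw [Real.rpow_sub_one ht0.ne', ← mul_div_assoc, le_div_iff₀ ht0]
  calc r t * t * t = r t * t ^ 2 := by ring
    _ ≤ r₂ * nFun r t := h2
    _ ≤ r₂ * (t ^ r₂ * nFun r 1) := mul_le_mul_of_nonneg_left h1 hr₂.le
    _ = _ := by ring

end GrowthAssumptions

/-- A `C¹` nonlinearity vanishing on `(-∞, 0]` whose growth is controlled by `A`. -/
structure IsAdmissible (A p : ℝ → ℝ) : Prop where
  contDiff : ContDiff ℝ 1 p
  zero : ∀ s ≤ 0, p s = 0
  bound : ∃ C, 0 ≤ C ∧ ∀ s > 0, |p s| ≤ C * A s ∧ |deriv p s * s| ≤ C * A s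

theorem IsAdmissible.hasDerivAt {A p : ℝ → ℝ} (h : IsAdmissible A p) (s : ℝ) :
    HasDerivAt p (deriv p s) s := (h.contDiff.differentiable one_ne_zero s).hasDerivAt

theorem IsAdmissible.deriv_eq_zero {A p : ℝ → ℝ} (h : IsAdmissible A p) {s : ℝ} (hs : s < 0) :
    deriv p s = 0 := by
  have : p =ᶠ[𝓝 s] fun _ => 0 := by
    filter_upwards [Iio_mem_nhds hs] with y hy
    exact h.zero y (le_of_lt hy)
  rw [this.deriv_eq, deriv_const]

/-- The density of `Φ(t) + t^q`. -/
noncomputable def sumDensity (φ : ℝ → ℝ) (q t : ℝ) : ℝ :=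
  PhiAssumptions.mulExt φ t + q * t ^ (q - 1)

theorem youngPair_sum {N : ℕ} {φ : ℝ → ℝ} {l m q : ℝ} (h : PhiAssumptions N φ l m) (hmq : m ≤ q) :
    YoungPair (sumDensity φ q) (fun t => nFun φ t + t ^ q) (min l q) (max m q) :=
  h.youngPair.add (youngPair_rpow (by linarith [h.one_lt_l, h.l_le_m]))

theorem mulExt_le_sumDensity {φ : ℝ → ℝ} {q t : ℝ} (hq : 0 ≤ q) (ht : 0 ≤ t) :
    PhiAssumptions.mulExt φ t ≤ sumDensity φ q t :=
  le_add_of_nonneg_right (mul_nonneg hq (Real.rpow_nonneg ht _))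

/-- On compact subsets of `(0, ∞)` continuous functions are bounded by the density. -/
theorem exists_abs_mul_le_of_continuousOn {N : ℕ} {φ : ℝ → ℝ} {l m q : ℝ}
    (h : PhiAssumptions N φ l m) (hq : 0 ≤ q) {x y : ℝ} (hx : 0 < x) {d : ℝ → ℝ}
    (hd : ContinuousOn d (Icc x y)) :
    ∃ C, 0 ≤ C ∧ ∀ s ∈ Icc x y, |d s| ≤ C * sumDensity φ q s := by
  obtain ⟨C, hC⟩ := isCompact_Icc.exists_bound_of_continuousOn hd
  have hA : 0 < PhiAssumptions.mulExt φ x := by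
    rw [PhiAssumptions.mulExt_of_pos hx]; exact mul_pos (h.pos x hx) hx
  refine ⟨|C| / PhiAssumptions.mulExt φ x, by positivity, fun s hs => ?_⟩
  have h1 : PhiAssumptions.mulExt φ x ≤ sumDensity φ q s :=
    (h.mulExt_mono hs.1).trans (mulExt_le_sumDensity hq (hx.le.trans hs.1))
  have h2 := (hC s hs).trans (le_abs_self C)
  rw [Real.norm_eq_abs] at h2
  rw [div_mul_eq_mul_div, le_div_iff₀ hA]
  exact mul_le_mul h2 h1 hA.le (abs_nonneg _)

namespace FAssumptions

variable {N : ℕ} {φ r b f : ℝ → ℝ} {l m θ : ℝ}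

theorem hasDerivAt (hf : FAssumptions r b m f θ) (t : ℝ) : HasDerivAt f (deriv f t) t :=
  (hf.contDiff.differentiable one_ne_zero t).hasDerivAt

theorem zero (hf : FAssumptions r b m f θ) : ∀ s ≤ 0, f s = 0 := by
  intro s hs
  rcases hs.lt_or_eq with h | rfl
  · exact hf.eq_zero s h
  · have h1 : Tendsto f (𝓝[<] 0) (𝓝 (f 0)) :=
      (hf.contDiff.continuous.tendsto 0).mono_left nhdsWithin_le_nhds
    have h2 : Tendsto f (𝓝[<] 0) (𝓝 0) := by
      refine tendsto_const_nhds.congr' ?_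
      filter_upwards [self_mem_nhdsWithin] with t ht
      exact (hf.eq_zero t ht).symm
    exact tendsto_nhds_unique h1 h2

theorem pos (hf : FAssumptions r b m f θ) {t : ℝ} (ht : 0 < t) : 0 < f t := by
  have h := (hf.primitive_pos t ht).trans_le (hf.superlinear t ht)
  exact (pos_iff_pos_of_mul_pos h).2 ht

theorem nonneg (hf : FAssumptions r b m f θ) (t : ℝ) : 0 ≤ f t := by
  rcases le_or_gt t 0 with h | h
  · rw [hf.zero t h]
  · exact (hf.pos h).le

theorem hasDerivAt_quot (hf : FAssumptions r b m f θ) {t : ℝ} (ht : 0 < t) :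
    HasDerivAt (fun t => f t / t ^ (m - 1)) ((deriv f t * t - (m - 1) * f t) / t ^ m) t := by
  have h1 := (hf.hasDerivAt t).div (Real.hasDerivAt_rpow_const (p := m - 1) (Or.inl ht.ne'))
    (Real.rpow_pos_of_pos ht _).ne'
  refine h1.congr_deriv ?_
  have hp := Real.rpow_pos_of_pos ht (m - 1)
  have e1 : t ^ m = t ^ (m - 1) * t := by rw [Real.rpow_sub_one ht.ne']; field_simp
  have e2 : t ^ (m - 1 - 1) = t ^ (m - 1) / t := Real.rpow_sub_one ht.ne' _
  rw [e1, e2]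
  field_simp

theorem mul_le_deriv_mul (hf : FAssumptions r b m f θ) {t : ℝ} (ht : 0 < t) :
    (m - 1) * f t ≤ deriv f t * t := by
  have h1 := deriv_nonneg_of_monotoneOn_Ioi hf.strictMono_quot.monotoneOn ht
  rw [(hf.hasDerivAt_quot ht).deriv] at h1
  have hp := Real.rpow_pos_of_pos ht m
  have := mul_nonneg h1 hp.le
  rw [div_mul_cancel₀ _ hp.ne'] at this
  linarith

/-- The strict monotonicity of `f(t) / t^{m-1}` is uniform on some interval near the origin. -/
theorem exists_Icc_strict (hf : FAssumptions r b m f θ) {β : ℝ} (hβ : 0 < β) :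
    ∃ x y κ : ℝ, 0 < x ∧ x < y ∧ y < β ∧ 0 < κ ∧
      ∀ t ∈ Icc x y, κ ≤ deriv f t * t ^ 2 - (m - 1) * f t * t := by
  -- If the derivative of `f(t) / t^{m-1}` were nowhere positive on `(0, β)`, the quotient would be
  -- nonincreasing there. Continuity of `f'` then spreads the strict inequality from one point to an
  -- interval.
  have hex : ∃ s ∈ Ioo 0 β, 0 < deriv f s * s - (m - 1) * f s := by
    by_contra hc
    push Not at hc
    have hanti : AntitoneOn (fun t => f t / t ^ (m - 1)) (Ioo 0 β) := by
      refine antitoneOn_of_deriv_nonpos (convex_Ioo 0 β)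
        (fun s hs => (hf.hasDerivAt_quot hs.1).continuousAt.continuousWithinAt) ?_ ?_ <;>
        rw [interior_Ioo]
      · exact fun s hs => (hf.hasDerivAt_quot hs.1).differentiableAt.differentiableWithinAt
      · intro s hs
        rw [(hf.hasDerivAt_quot hs.1).deriv]
        exact div_nonpos_of_nonpos_of_nonneg (hc s hs) (Real.rpow_nonneg hs.1.le _)
    have h1 : β / 3 ∈ Ioo 0 β := ⟨by linarith, by linarith⟩
    have h2 : β / 2 ∈ Ioo 0 β := ⟨by linarith, by linarith⟩
    have h3 := hanti h1 h2 (by linarith)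
    have h4 := hf.strictMono_quot (mem_Ioi.2 h1.1) (mem_Ioi.2 h2.1) (by linarith)
    exact absurd h4 (not_lt.2 h3)
  obtain ⟨s, hs, hpos⟩ := hex
  set D : ℝ → ℝ := fun t => deriv f t * t ^ 2 - (m - 1) * f t * t with hD
  have hDc : Continuous D :=
    ((hf.contDiff.continuous_deriv le_rfl).mul (continuous_pow 2)).sub
      ((continuous_const.mul hf.contDiff.continuous).mul continuous_id)
  have hDs : 0 < D s := by
    have e : D s = (deriv f s * s - (m - 1) * f s) * s := by simp only [hD]; ring
    rw [e]; exact mul_pos hpos hs.1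
  have hev : ∀ᶠ t in 𝓝 s, D s / 2 < D t :=
    hDc.continuousAt.eventually (lt_mem_nhds (by linarith))
  obtain ⟨δ, hδ, hball⟩ := Metric.eventually_nhds_iff.1 hev
  have hβs : 0 < β - s := by linarith [hs.2]
  refine ⟨s, s + min (δ / 2) ((β - s) / 2), D s / 2, hs.1, ?_, ?_, by linarith, fun t ht => ?_⟩
  · have : 0 < min (δ / 2) ((β - s) / 2) := by positivity
    linarith
  · linarith [min_le_right (δ / 2) ((β - s) / 2)]
  · refine (hball ?_).le
    rw [Real.dist_eq, abs_of_nonneg (by linarith [ht.1])]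
    linarith [ht.2, min_le_left (δ / 2) ((β - s) / 2)]

/-- Near zero `|f'|` is at most `(r t)'`, hence a multiple of `r`, and `r t²` is bounded by
multiples of `R` and then of `Φ`. Near infinity `|f'|` is bounded by a multiple of `b`, and `b t` by
one of `t^{b₂ - 1}`. In between compactness is enough. The bound on `f` itself follows from `(m - 1)
f ≤ f' t`. The exponent `q = max m b₂` is subcritical since both entries are. -/
theorem exists_growth (hφ : PhiAssumptions N φ l m) (hr : RAssumptions N φ r)
    (hb : BAssumptions N φ l m b) (hf : FAssumptions r b m f θ) :
    ∃ q, m ≤ q ∧ q < N * gammaExp φ l m / (N - gammaExp φ l m) ∧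
      IsAdmissible (sumDensity φ q) f := by
  obtain ⟨r₁, hr₁, r₂, hr₂, hR⟩ := hr
  obtain ⟨b₁, hb₁, b₂, hb₂, hB⟩ := hb
  have hb₁' : 0 < b₁ := by linarith [hb₁.1]
  have hm1 : 1 < m := by linarith [hφ.one_lt_l, hφ.l_le_m]
  have hl := hφ.one_lt_l
  set q := max m b₂ with hq
  have hmq : m ≤ q := le_max_left _ _
  have hq0 : 0 ≤ q := by linarith
  have hA0 : ∀ s > 0, 0 ≤ sumDensity φ q s := fun s hs =>
    (hφ.mulExt_nonneg s).trans (mulExt_le_sumDensity hq0 hs.le)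
  have hder : ∃ C, 0 ≤ C ∧ ∀ s > 0, |deriv f s * s| ≤ C * sumDensity φ q s := by
    obtain ⟨C₁, hC₁, hd₁⟩ := hR.exists_deriv_mul_le
    obtain ⟨C₂, hC₂⟩ := hR.near_zero
    have hev1 : ∀ᶠ t in 𝓝[>] (0 : ℝ), |deriv f t / deriv (fun s => r s * s) t| < 1 := by
      have := hf.near_zero.abs
      rw [abs_zero] at this
      exact this.eventually (gt_mem_nhds one_pos)
    obtain ⟨x, hx, hsmall⟩ : ∃ x > 0, ∀ t, 0 < t → t < x →
        |deriv f t / deriv (fun s => r s * s) t| < 1 ∧ nFun r t / nFun φ t ≤ C₂ := by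
      have := (hev1.and hC₂)
      obtain ⟨x, hx, hsub⟩ := mem_nhdsGT_iff_exists_Ioo_subset.1 this
      exact ⟨x, hx, fun t h1 h2 => hsub ⟨h1, h2⟩⟩
    obtain ⟨C₃, hC₃, hd₃⟩ := hB.exists_deriv_mul_le
    obtain ⟨C₄, hC₄⟩ := hf.at_infinity
    obtain ⟨C₅, hC₅, hd₅⟩ := hB.exists_mul_le_rpow hb₁'
    obtain ⟨y, hy⟩ := eventually_atTop.1 hC₄
    obtain ⟨C₆, hC₆, hd₆⟩ := exists_abs_mul_le_of_continuousOn hφ hq0 (x := x / 2)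
      (y := max y 1) (by linarith : 0 < x / 2) (d := fun s => deriv f s * s)
      ((hf.contDiff.continuous_deriv le_rfl).mul continuous_id).continuousOn
    refine ⟨C₁ * (r₂ * |C₂|) + (|C₄| * C₃ * C₅) + C₆, by positivity, fun s hs => ?_⟩
    have hAs := hA0 s hs
    rcases lt_or_ge s (x / 2) with h1 | h1
    · obtain ⟨hs1, hs2⟩ := hsmall s hs (by linarith)
      have hrs := hR.pos hr₁ hs
      have hds := hrs.trans_le (hR.le_deriv_mul hs)
      rw [abs_div, abs_of_pos hds, div_lt_one hds] at hs1
      have hΦ := hφ.nFun_pos hs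
      rw [div_le_iff₀ hΦ] at hs2
      have h3 := hR.mul_sq_le hr₁ hs
      have h4 : nFun φ s ≤ PhiAssumptions.mulExt φ s * s := by
        have := hφ.youngPair.lower s hs.le
        nlinarith
      have h5 : r s * s ^ 2 ≤ r₂ * (|C₂| * (sumDensity φ q s * s)) := by
        have h6 := mulExt_le_sumDensity (φ := φ) hq0 hs.le
        calc r s * s ^ 2 ≤ r₂ * nFun r s := h3
          _ ≤ r₂ * (|C₂| * nFun φ s) := by
              gcongr
              exact hs2.trans (mul_le_mul_of_nonneg_right (le_abs_self _) hΦ.le)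
          _ ≤ _ := by
              gcongr
              exact h4.trans (mul_le_mul_of_nonneg_right h6 hs.le)
      have h7 : r s * s ≤ r₂ * |C₂| * sumDensity φ q s := by
        refine le_of_mul_le_mul_right ?_ hs
        calc r s * s * s = r s * s ^ 2 := by ring
          _ ≤ _ := h5
          _ = _ := by ring
      calc |deriv f s * s| = |deriv f s| * s := by rw [abs_mul, abs_of_pos hs]
        _ ≤ (C₁ * r s) * s := by gcongr; exact hs1.le.trans (hd₁ s hs)
        _ = C₁ * (r s * s) := by ring
        _ ≤ C₁ * (r₂ * |C₂| * sumDensity φ q s) := by gcongr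
        _ ≤ _ := by
            have : 0 ≤ (|C₄| * C₃ * C₅ + C₆) * sumDensity φ q s := by positivity
            linarith
    rcases le_or_gt s (max y 1) with h2 | h2
    · have := hd₆ s ⟨h1, h2⟩
      have h3 : 0 ≤ (C₁ * (r₂ * |C₂|) + |C₄| * C₃ * C₅) * sumDensity φ q s := by positivity
      linarith
    · have hs1 : 1 ≤ s := (le_max_right y 1).trans h2.le
      have h3 := hy s ((le_max_left y 1).trans h2.le)
      have hbs := hB.pos hb₁' hs
      have hds := hbs.trans_le (hB.le_deriv_mul hs)
      rw [div_le_iff₀ hds] at h3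
      have h4 : s ^ (b₂ - 1) ≤ s ^ (q - 1) :=
        Real.rpow_le_rpow_of_exponent_le hs1 (by linarith [le_max_right m b₂])
      have h5 : s ^ (q - 1) ≤ sumDensity φ q s := by
        have h6 : 0 ≤ s ^ (q - 1) := Real.rpow_nonneg hs.le _
        have h7 := hφ.mulExt_nonneg s
        have h8 : 1 ≤ q := by linarith
        unfold sumDensity
        nlinarith
      calc |deriv f s * s| = |deriv f s| * s := by rw [abs_mul, abs_of_pos hs]
        _ ≤ (|C₄| * (C₃ * b s)) * s := by
            gcongr
            refine h3.trans (mul_le_mul (le_abs_self _) (hd₃ s hs) hds.le (abs_nonneg _))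
        _ = |C₄| * C₃ * (b s * s) := by ring
        _ ≤ |C₄| * C₃ * (C₅ * sumDensity φ q s) := by
            have := (hd₅ s hs1).trans (mul_le_mul_of_nonneg_left (h4.trans h5) hC₅)
            gcongr
        _ ≤ _ := by
            have : 0 ≤ (C₁ * (r₂ * |C₂|) + C₆) * sumDensity φ q s := by positivity
            linarith
  obtain ⟨C, hC, hd⟩ := hder
  refine ⟨q, hmq, max_lt (m_lt_conj_gammaExp hφ) hb₂.2, hf.contDiff, hf.zero,
    C * (1 / (m - 1) + 1), ?_, fun s hs => ⟨?_, ?_⟩⟩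
  · have : 0 < m - 1 := by linarith
    positivity
  · have h0 : 0 < m - 1 := by linarith
    have h1 := hf.mul_le_deriv_mul hs
    have h2 := (le_abs_self _).trans (hd s hs)
    rw [abs_of_pos (hf.pos hs)]
    have h3 : f s ≤ 1 / (m - 1) * (C * sumDensity φ q s) := by
      rw [div_mul_eq_mul_div, le_div_iff₀ h0]; linarith
    have h4 : 0 ≤ C * sumDensity φ q s := mul_nonneg hC (hA0 s hs)
    linarith
  · have h0 : 0 < m - 1 := by linarith
    have h4 : 0 ≤ 1 / (m - 1) * (C * sumDensity φ q s) :=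
      mul_nonneg (by positivity) (mul_nonneg hC (hA0 s hs))
    linarith [hd s hs]

end FAssumptions

end OrliczNehari

/-! ### The truncated nonlinearity -/

namespace OrliczNehari

/-- A function that is differentiable in a punctured neighbourhood, with a derivative that extends
continuously, is differentiable. -/
theorem hasDerivAt_of_eventually_ne {p d : ℝ → ℝ} {x : ℝ}
    (hd : ∀ᶠ y in 𝓝[≠] x, HasDerivAt p (d y) y) (hp : Continuous p) (hc : Continuous d) :
    HasDerivAt p (d x) x := by
  rw [← nhdsLT_sup_nhdsGT, eventually_sup] at hd
  have hR : HasDerivWithinAt p (d x) (Ici x) x := by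
    refine hasDerivWithinAt_Ici_of_tendsto_deriv (s := {y | HasDerivAt p (d y) y})
      (fun y hy => (HasDerivAt.differentiableAt hy).differentiableWithinAt)
      hp.continuousWithinAt hd.2 ?_
    refine ((hc.tendsto x).mono_left nhdsWithin_le_nhds).congr' ?_
    filter_upwards [hd.2] with y hy
    exact hy.deriv.symm
  have hL : HasDerivWithinAt p (d x) (Iic x) x := by
    refine hasDerivWithinAt_Iic_of_tendsto_deriv (s := {y | HasDerivAt p (d y) y})
      (fun y hy => (HasDerivAt.differentiableAt hy).differentiableWithinAt)
      hp.continuousWithinAt hd.1 ?_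
    refine ((hc.tendsto x).mono_left nhdsWithin_le_nhds).congr' ?_
    filter_upwards [hd.1] with y hy
    exact hy.deriv.symm
  simpa using hL.union hR

namespace PhiAssumptions

variable {N : ℕ} {φ : ℝ → ℝ} {l m : ℝ}

theorem hasDerivAt_mul (h : PhiAssumptions N φ l m) {t : ℝ} (ht : 0 < t) :
    HasDerivAt (fun s => φ s * s) (deriv φ t * t + φ t) t := by
  have := (h.differentiableAt ht).hasDerivAt.mul (hasDerivAt_id t)
  simpa using! this

theorem continuousOn_deriv (h : PhiAssumptions N φ l m) : ContinuousOn (deriv φ) (Ioi 0) :=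
  h.contDiffOn.continuousOn_deriv_of_isOpen isOpen_Ioi le_rfl

/-- The infinitesimal form of the monotonicity of `φ(t) / t^{m-2}`; it gives the sign of the
gradient and potential terms in `m L(u) - L'(u)u`. -/
theorem deriv_mul_le (h : PhiAssumptions N φ l m) {t : ℝ} (ht : 0 < t) :
    deriv φ t * t ≤ (m - 2) * φ t := by
  have hd := (h.differentiableAt ht).hasDerivAt.div
    (Real.hasDerivAt_rpow_const (p := m - 2) (Or.inl ht.ne')) (Real.rpow_pos_of_pos ht _).ne'
  have hneg : MonotoneOn (fun s => -(φ s / s ^ (m - 2))) (Ioi 0) := h.antitone_quot.neg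
  have h1 := deriv_nonneg_of_monotoneOn_Ioi hneg ht
  have hd' : HasDerivAt (fun s => -(φ s / s ^ (m - 2))) _ t := hd.neg
  rw [hd'.deriv] at h1
  have hp := Real.rpow_pos_of_pos ht (m - 2)
  have e2 : t ^ (m - 2 - 1) = t ^ (m - 2) / t := Real.rpow_sub_one ht.ne' _
  rw [e2, neg_nonneg, div_nonpos_iff] at h1
  have h2 : 0 < (t ^ (m - 2)) ^ 2 := by positivity
  rcases h1 with ⟨_, h3⟩ | ⟨h3, _⟩
  · linarith
  · have e : deriv φ t * t ^ (m - 2) - φ t * ((m - 2) * (t ^ (m - 2) / t))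
        = (deriv φ t * t - (m - 2) * φ t) * (t ^ (m - 2) / t) := by
      field_simp
    rw [e] at h3
    have h4 : 0 < t ^ (m - 2) / t := by positivity
    have := nonpos_of_mul_nonpos_left h3 h4
    linarith

end PhiAssumptions

namespace PenalizationAssumptions

variable {N : ℕ} {φ f r b η : ℝ → ℝ} {l m θ V₀ k a t₀ t₁ : ℝ}

theorem one_lt_k (hη : PenalizationAssumptions φ f l m θ V₀ k a t₀ t₁ η)
    (hφ : PhiAssumptions N φ l m) (hθ : m < θ) : 1 < k := by
  have hl := hφ.one_lt_l
  have hlm := hφ.l_le_m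
  refine lt_of_le_of_lt ?_ hη.k_large
  have h1 : 1 ≤ (θ - l) / (θ - m) := by rw [le_div_iff₀ (by linarith)]; linarith
  have h2 : 1 ≤ m / l := by rw [le_div_iff₀ (by linarith)]; linarith
  nlinarith

theorem t₀_lt_t₁ (hη : PenalizationAssumptions φ f l m θ V₀ k a t₀ t₁ η) : t₀ < t₁ :=
  hη.t₀_lt.trans hη.lt_t₁

theorem fTilde_of_mem {s : ℝ} (hs : s ∈ Icc t₀ t₁) : fTilde φ f V₀ k a t₀ t₁ η s = η s :=
  if_pos hs

theorem fTilde_of_le (hη : PenalizationAssumptions φ f l m θ V₀ k a t₀ t₁ η) {s : ℝ}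
    (hs : s ≤ t₀) : fTilde φ f V₀ k a t₀ t₁ η s = f s := by
  have ha : s ≤ a := hs.trans hη.t₀_lt.le
  rcases hs.lt_or_eq with h | rfl
  · rw [fTilde, if_neg fun hc => absurd hc.1 (not_le.2 h), fHat, if_pos ha]
  · rw [fTilde_of_mem ⟨le_rfl, hη.t₀_lt_t₁.le⟩, hη.eq_t₀, fHat, if_pos ha]

theorem fTilde_of_ge (hη : PenalizationAssumptions φ f l m θ V₀ k a t₀ t₁ η) {s : ℝ}
    (hs : t₁ ≤ s) : fTilde φ f V₀ k a t₀ t₁ η s = V₀ / k * φ s * s := by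
  have ha : ¬ s ≤ a := not_le.2 (hη.lt_t₁.trans_le hs)
  rcases hs.lt_or_eq with h | rfl
  · rw [fTilde, if_neg fun hc => absurd hc.2 (not_le.2 h), fHat, if_neg ha]
  · rw [fTilde_of_mem ⟨hη.t₀_lt_t₁.le, le_rfl⟩, hη.eq_t₁, fHat, if_neg ha]

/-- The derivative of the truncated nonlinearity. -/
noncomputable def fTildeDeriv (φ f : ℝ → ℝ) (V₀ k t₀ t₁ : ℝ) (η : ℝ → ℝ) (s : ℝ) : ℝ :=
  deriv f (min s t₀)
    + (derivWithin η (Icc t₀ t₁) (max t₀ (min s t₁)) - derivWithin η (Icc t₀ t₁) t₀)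
    + (V₀ / k * (deriv φ (max s t₁) * max s t₁ + φ (max s t₁))
      - V₀ / k * (deriv φ t₁ * t₁ + φ t₁))

/-- A formula without cases: each piece is evaluated at a clamped argument and its value at the
junction is subtracted. Continuity becomes a matter of composition, and `fTildeDeriv` has the same
shape for the same reason. -/
theorem fTilde_eq (hη : PenalizationAssumptions φ f l m θ V₀ k a t₀ t₁ η) (s : ℝ) :
    fTilde φ f V₀ k a t₀ t₁ η s = f (min s t₀) + (η (max t₀ (min s t₁)) - η t₀)
      + (V₀ / k * (φ (max s t₁) * max s t₁) - V₀ / k * (φ t₁ * t₁)) := by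
  have h01 := hη.t₀_lt_t₁
  have e0 : η t₀ = f t₀ := by rw [← hη.fTilde_of_le le_rfl, fTilde_of_mem ⟨le_rfl, h01.le⟩]
  have e1 : η t₁ = V₀ / k * φ t₁ * t₁ := by
    rw [← hη.fTilde_of_ge le_rfl, fTilde_of_mem ⟨h01.le, le_rfl⟩]
  rcases le_total s t₀ with h | h
  · rw [hη.fTilde_of_le h, min_eq_left h, min_eq_left (h.trans h01.le), max_eq_left h,
      max_eq_right (h.trans h01.le)]
    ring
  rcases le_total s t₁ with h' | h'
  · rw [fTilde_of_mem ⟨h, h'⟩, min_eq_right h, min_eq_left h', max_eq_right h,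
      max_eq_right h', e0]
    ring
  · rw [hη.fTilde_of_ge h', min_eq_right h, min_eq_right h', max_eq_right h01.le,
      max_eq_left h', e0, e1]
    ring

theorem continuous_clamp_comp {p : ℝ → ℝ} (h01 : t₀ ≤ t₁) (hp : ContinuousOn p (Icc t₀ t₁)) :
    Continuous fun s => p (max t₀ (min s t₁)) :=
  hp.comp_continuous (continuous_const.max (continuous_id.min continuous_const))
    fun _ => ⟨le_max_left _ _, max_le h01 (min_le_right _ _)⟩

theorem continuous_max_comp {p : ℝ → ℝ} (h1 : 0 < t₁) (hp : ContinuousOn p (Ioi 0)) :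
    Continuous fun s => p (max s t₁) :=
  hp.comp_continuous (continuous_id.max continuous_const)
    fun _ => h1.trans_le (le_max_right _ _)

theorem t₁_pos (hη : PenalizationAssumptions φ f l m θ V₀ k a t₀ t₁ η) : 0 < t₁ :=
  hη.t₀_pos.trans hη.t₀_lt_t₁

theorem continuous_fTilde (hη : PenalizationAssumptions φ f l m θ V₀ k a t₀ t₁ η)
    (hφ : PhiAssumptions N φ l m) (hf : FAssumptions r b m f θ) :
    Continuous (fTilde φ f V₀ k a t₀ t₁ η) := by
  rw [funext hη.fTilde_eq]
  refine ((hf.contDiff.continuous.comp (continuous_id.min continuous_const)).add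
    ((continuous_clamp_comp hη.t₀_lt_t₁.le hη.contDiffOn.continuousOn).sub
      continuous_const)).add ((continuous_const.mul ?_).sub continuous_const)
  exact continuous_max_comp (p := fun s => φ s * s) hη.t₁_pos
    (hφ.contDiffOn.continuousOn.mul continuousOn_id)

theorem continuous_fTildeDeriv (hη : PenalizationAssumptions φ f l m θ V₀ k a t₀ t₁ η)
    (hφ : PhiAssumptions N φ l m) (hf : FAssumptions r b m f θ) :
    Continuous (fTildeDeriv φ f V₀ k t₀ t₁ η) := by
  refine (((hf.contDiff.continuous_deriv le_rfl).comp (continuous_id.min continuous_const)).add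
    ((continuous_clamp_comp (p := derivWithin η (Icc t₀ t₁)) hη.t₀_lt_t₁.le
      (hη.contDiffOn.continuousOn_derivWithin (uniqueDiffOn_Icc hη.t₀_lt_t₁) le_rfl)).sub
      continuous_const)).add ((continuous_const.mul ?_).sub continuous_const)
  exact continuous_max_comp (p := fun s => deriv φ s * s + φ s) hη.t₁_pos
    ((hφ.continuousOn_deriv.mul continuousOn_id).add hφ.contDiffOn.continuousOn)

theorem fTildeDeriv_of_ge (hη : PenalizationAssumptions φ f l m θ V₀ k a t₀ t₁ η)
    (hφ : PhiAssumptions N φ l m) {s : ℝ} (hs : t₁ ≤ s) :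
    fTildeDeriv φ f V₀ k t₀ t₁ η s = V₀ / k * (deriv φ s * s + φ s) := by
  have h01 := hη.t₀_lt_t₁
  have e0 : derivWithin η (Icc t₀ t₁) t₀ = deriv f t₀ := by
    rw [hη.deriv_t₀]
    refine EventuallyEq.deriv_eq ?_
    filter_upwards [Iio_mem_nhds hη.t₀_lt] with y hy
    exact if_pos (le_of_lt hy)
  have e1 : derivWithin η (Icc t₀ t₁) t₁ = V₀ / k * (deriv φ t₁ * t₁ + φ t₁) := by
    rw [hη.deriv_t₁]
    have : fHat φ f V₀ k a =ᶠ[𝓝 t₁] fun s => V₀ / k * (φ s * s) := by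
      filter_upwards [Ioi_mem_nhds hη.lt_t₁] with s hs
      rw [fHat, if_neg (not_le.2 hs)]; ring
    rw [this.deriv_eq]
    exact ((hφ.hasDerivAt_mul hη.t₁_pos).const_mul _).deriv
  rw [fTildeDeriv, min_eq_right (h01.le.trans hs), min_eq_right hs, max_eq_right h01.le,
    max_eq_left hs, e0, e1]
  ring

theorem fTildeDeriv_of_le (hη : PenalizationAssumptions φ f l m θ V₀ k a t₀ t₁ η) {s : ℝ}
    (hs : s ≤ t₀) : fTildeDeriv φ f V₀ k t₀ t₁ η s = deriv f s := by
  have h01 := hη.t₀_lt_t₁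
  rw [fTildeDeriv, min_eq_left hs, min_eq_left (hs.trans h01.le), max_eq_left hs,
    max_eq_right (hs.trans h01.le)]
  ring

theorem fTildeDeriv_of_mem (hη : PenalizationAssumptions φ f l m θ V₀ k a t₀ t₁ η) {s : ℝ}
    (hs : s ∈ Icc t₀ t₁) : fTildeDeriv φ f V₀ k t₀ t₁ η s = derivWithin η (Icc t₀ t₁) s := by
  have e0 : derivWithin η (Icc t₀ t₁) t₀ = deriv f t₀ := by
    rw [hη.deriv_t₀]
    refine EventuallyEq.deriv_eq ?_
    filter_upwards [Iio_mem_nhds hη.t₀_lt] with y hy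
    exact if_pos (le_of_lt hy)
  rw [fTildeDeriv, min_eq_right hs.1, min_eq_left hs.2, max_eq_right hs.1, max_eq_right hs.2, e0]
  ring

/-- Off the junctions the pieces are differentiated separately. At the junctions the derivative is
the limit of nearby derivatives: the matching conditions make one continuous function `fTildeDeriv`
agree with the derivative of every piece. -/
theorem hasDerivAt_fTilde (hη : PenalizationAssumptions φ f l m θ V₀ k a t₀ t₁ η)
    (hφ : PhiAssumptions N φ l m) (hf : FAssumptions r b m f θ) (s : ℝ) :
    HasDerivAt (fTilde φ f V₀ k a t₀ t₁ η) (fTildeDeriv φ f V₀ k t₀ t₁ η s) s := by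
  have h01 := hη.t₀_lt_t₁
  have key : ∀ y, y ≠ t₀ → y ≠ t₁ →
      HasDerivAt (fTilde φ f V₀ k a t₀ t₁ η) (fTildeDeriv φ f V₀ k t₀ t₁ η y) y := by
    intro y hy0 hy1
    rcases lt_or_gt_of_ne hy0 with h | h
    · rw [hη.fTildeDeriv_of_le h.le]
      refine (hf.hasDerivAt y).congr_of_eventuallyEq ?_
      filter_upwards [Iio_mem_nhds h] with s hs
      exact hη.fTilde_of_le (le_of_lt hs)
    rcases lt_or_gt_of_ne hy1 with h' | h'
    · rw [hη.fTildeDeriv_of_mem ⟨h.le, h'.le⟩]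
      have h1 := (hη.contDiffOn.differentiableOn one_ne_zero y ⟨h.le, h'.le⟩).hasDerivWithinAt
      refine (h1.hasDerivAt (Icc_mem_nhds h h')).congr_of_eventuallyEq ?_
      filter_upwards [Icc_mem_nhds h h'] with s hs
      exact fTilde_of_mem hs
    · rw [hη.fTildeDeriv_of_ge hφ h'.le]
      refine ((hφ.hasDerivAt_mul (hη.t₁_pos.trans h')).const_mul _).congr_of_eventuallyEq ?_
      filter_upwards [Ioi_mem_nhds h'] with s hs
      rw [hη.fTilde_of_ge (le_of_lt hs)]; ring
  refine hasDerivAt_of_eventually_ne ?_ (hη.continuous_fTilde hφ hf)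
    (hη.continuous_fTildeDeriv hφ hf)
  have hev : ∀ t : ℝ, ∀ᶠ y in 𝓝[≠] s, y ≠ t := fun t => by
    rcases eq_or_ne s t with rfl | h
    · exact self_mem_nhdsWithin
    · exact nhdsWithin_le_nhds (isOpen_ne.mem_nhds h)
  filter_upwards [hev t₀, hev t₁] with y h0 h1 using key y h0 h1

theorem deriv_fTilde (hη : PenalizationAssumptions φ f l m θ V₀ k a t₀ t₁ η)
    (hφ : PhiAssumptions N φ l m) (hf : FAssumptions r b m f θ) :
    deriv (fTilde φ f V₀ k a t₀ t₁ η) = fTildeDeriv φ f V₀ k t₀ t₁ η :=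
  funext fun s => (hη.hasDerivAt_fTilde hφ hf s).deriv

theorem contDiff_fTilde (hη : PenalizationAssumptions φ f l m θ V₀ k a t₀ t₁ η)
    (hφ : PhiAssumptions N φ l m) (hf : FAssumptions r b m f θ) :
    ContDiff ℝ 1 (fTilde φ f V₀ k a t₀ t₁ η) := by
  rw [contDiff_one_iff_deriv, hη.deriv_fTilde hφ hf]
  exact ⟨fun s => (hη.hasDerivAt_fTilde hφ hf s).differentiableAt, hη.continuous_fTildeDeriv hφ hf⟩

/-- On `(0, t₀]` the quotient is `f(s) / s^{m-1}` divided by `φ(s) / s^{m-2}`, an increasing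
function over a nonincreasing one. On `[t₀, t₁]` it is the hypothesis on `η`, and beyond `t₁` it is
the constant `V₀ / k`. -/
theorem monotoneOn_fTilde_quot (hη : PenalizationAssumptions φ f l m θ V₀ k a t₀ t₁ η)
    (hφ : PhiAssumptions N φ l m) (hf : FAssumptions r b m f θ) :
    MonotoneOn (fun s => fTilde φ f V₀ k a t₀ t₁ η s / (φ s * s)) (Ioi 0) := by
  have h01 := hη.t₀_lt_t₁
  have h0 := hη.t₀_pos
  have h1 : MonotoneOn (fun s => fTilde φ f V₀ k a t₀ t₁ η s / (φ s * s)) (Ioc 0 t₀) := by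
    intro x hx y hy hxy
    dsimp only
    rw [hη.fTilde_of_le hx.2, hη.fTilde_of_le hy.2]
    have e : ∀ s > 0, f s / (φ s * s) = f s / s ^ (m - 1) * (φ s / s ^ (m - 2))⁻¹ := by
      intro s hs
      have e1 : s ^ (m - 1) = s ^ (m - 2) * s := by
        rw [← Real.rpow_add_one hs.ne']; ring_nf
      have := hφ.pos s hs
      have := Real.rpow_pos_of_pos hs (m - 2)
      rw [e1]
      field_simp
    rw [e x hx.1, e y hy.1]
    have hxp := div_pos (hφ.pos x hx.1) (Real.rpow_pos_of_pos hx.1 (m - 2))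
    have hyp := div_pos (hφ.pos y hy.1) (Real.rpow_pos_of_pos hy.1 (m - 2))
    have hfm := hf.strictMono_quot.monotoneOn (mem_Ioi.2 hx.1) (mem_Ioi.2 hy.1) hxy
    have hpa := hφ.antitone_quot (mem_Ioi.2 hx.1) (mem_Ioi.2 hy.1) hxy
    exact mul_le_mul hfm (inv_anti₀ hyp hpa) (inv_nonneg.2 hxp.le)
      (div_nonneg (hf.nonneg y) (Real.rpow_nonneg hy.1.le _))
  have h2 : MonotoneOn (fun s => fTilde φ f V₀ k a t₀ t₁ η s / (φ s * s)) (Icc t₀ t₁) := by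
    refine hη.mono_quot.congr fun s hs => ?_
    dsimp only
    rw [fTilde_of_mem hs]
  have h3 : MonotoneOn (fun s => fTilde φ f V₀ k a t₀ t₁ η s / (φ s * s)) (Ici t₁) := by
    refine (monotoneOn_const (c := V₀ / k)).congr fun s hs => ?_
    have hs0 : 0 < s := hη.t₁_pos.trans_le hs
    have := hφ.pos s hs0
    dsimp only
    rw [hη.fTilde_of_ge hs]
    field_simp
  have h12 := h1.union_right h2 ⟨⟨h0, le_rfl⟩, fun x hx => hx.2⟩ (isLeast_Icc h01.le)
  rw [Ioc_union_Icc_eq_Ioc h0 h01.le] at h12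
  have h123 := h12.union_right h3 ⟨⟨hη.t₁_pos, le_rfl⟩, fun x hx => hx.2⟩ isLeast_Ici
  rwa [Ioc_union_Ici_eq_Ioi hη.t₁_pos] at h123

/-- A nondecreasing quotient is at most its eventual value `V₀ / k`. -/
theorem fTilde_le (hη : PenalizationAssumptions φ f l m θ V₀ k a t₀ t₁ η)
    (hφ : PhiAssumptions N φ l m) (hf : FAssumptions r b m f θ) {s : ℝ} (hs : 0 < s) :
    fTilde φ f V₀ k a t₀ t₁ η s ≤ V₀ / k * (φ s * s) := by
  have hm := hη.monotoneOn_fTilde_quot hφ hf (mem_Ioi.2 hs)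
    (mem_Ioi.2 (hs.trans_le (le_max_left s t₁))) (le_max_left s t₁)
  have hp := mul_pos (hφ.pos s hs) hs
  have hs1 : 0 < max s t₁ := hs.trans_le (le_max_left s t₁)
  have := hφ.pos _ hs1
  dsimp only at hm
  rw [hη.fTilde_of_ge (le_max_right s t₁), mul_assoc,
    mul_div_cancel_right₀ _ (mul_pos this hs1).ne', div_le_iff₀ hp] at hm
  exact hm

theorem fTilde_nonneg (hη : PenalizationAssumptions φ f l m θ V₀ k a t₀ t₁ η)
    (hφ : PhiAssumptions N φ l m) (hf : FAssumptions r b m f θ) (s : ℝ) :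
    0 ≤ fTilde φ f V₀ k a t₀ t₁ η s := by
  rcases le_total s t₀ with h | h
  · rw [hη.fTilde_of_le h]; exact hf.nonneg s
  · have hs : 0 < s := hη.t₀_pos.trans_le h
    have h1 := hη.monotoneOn_fTilde_quot hφ hf (mem_Ioi.2 hη.t₀_pos) (mem_Ioi.2 hs) h
    have hp := mul_pos (hφ.pos s hs) hs
    dsimp only at h1
    rw [hη.fTilde_of_le le_rfl] at h1
    have h2 := (div_nonneg (hf.nonneg t₀)
      (mul_nonneg (hφ.pos t₀ hη.t₀_pos).le hη.t₀_pos.le)).trans h1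
    have := mul_nonneg h2 hp.le
    rwa [div_mul_cancel₀ _ hp.ne'] at this

/-- The monotonicity of `f̃(s) / (φ(s) s)` in terms of derivatives. -/
theorem fTilde_mul_le_deriv (hη : PenalizationAssumptions φ f l m θ V₀ k a t₀ t₁ η)
    (hφ : PhiAssumptions N φ l m) (hf : FAssumptions r b m f θ) {s : ℝ} (hs : 0 < s) :
    fTilde φ f V₀ k a t₀ t₁ η s * (deriv φ s * s + φ s)
      ≤ deriv (fTilde φ f V₀ k a t₀ t₁ η) s * (φ s * s) := by
  have hp := mul_pos (hφ.pos s hs) hs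
  have h1 := deriv_nonneg_of_monotoneOn_Ioi (hη.monotoneOn_fTilde_quot hφ hf) hs
  have h2 : HasDerivAt (fun s => fTilde φ f V₀ k a t₀ t₁ η s / (φ s * s)) _ s :=
    (hη.hasDerivAt_fTilde hφ hf s).div (hφ.hasDerivAt_mul hs) hp.ne'
  rw [h2.deriv] at h1
  have h3 := mul_nonneg h1 (by positivity : (0 : ℝ) ≤ (φ s * s) ^ 2)
  rw [div_mul_cancel₀ _ (by positivity)] at h3
  rw [hη.deriv_fTilde hφ hf]
  linarith

/-- `F̃(s) ≤ f̃(s) s / l`. -/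
theorem integral_fTilde_le (hη : PenalizationAssumptions φ f l m θ V₀ k a t₀ t₁ η)
    (hφ : PhiAssumptions N φ l m) (hf : FAssumptions r b m f θ) {s : ℝ} (hs : 0 < s) :
    l * ∫ t in (0 : ℝ)..s, fTilde φ f V₀ k a t₀ t₁ η t ≤ fTilde φ f V₀ k a t₀ t₁ η s * s := by
  set p := fTilde φ f V₀ k a t₀ t₁ η with hpdef
  have hps := mul_pos (hφ.pos s hs) hs
  have hl : 0 < l := by linarith [hφ.one_lt_l]
  -- By monotonicity of the quotient `f̃(t) ≤ c φ(t) t` on `(0, s]`. Integration gives `c Φ(s)`, and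
  -- `l Φ(s) ≤ φ(s) s²`.
  set c := p s / (φ s * s) with hc
  have hc0 : 0 ≤ c := div_nonneg (hη.fTilde_nonneg hφ hf s) hps.le
  have h1 : ∫ t in (0 : ℝ)..s, p t ≤ ∫ t in (0 : ℝ)..s, c * PhiAssumptions.mulExt φ t := by
    refine intervalIntegral.integral_mono_on hs.le
      ((hη.continuous_fTilde hφ hf).intervalIntegrable _ _)
      ((hφ.mulExt_int 0 s).const_mul c) fun t ht => ?_
    rcases ht.1.lt_or_eq with h0 | h0
    · have h2 := hη.monotoneOn_fTilde_quot hφ hf (mem_Ioi.2 h0) (mem_Ioi.2 hs) ht.2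
      dsimp only at h2
      rw [div_le_iff₀ (mul_pos (hφ.pos t h0) h0)] at h2
      rw [PhiAssumptions.mulExt_of_pos h0]
      exact h2
    · rw [← h0, hpdef, hη.fTilde_of_le hη.t₀_pos.le, hf.zero 0 le_rfl]
      exact mul_nonneg hc0 (hφ.mulExt_nonneg 0)
  rw [intervalIntegral.integral_const_mul] at h1
  have h2 : ∫ t in (0 : ℝ)..s, PhiAssumptions.mulExt φ t = nFun φ s := by
    rw [PhiAssumptions.nFun_eq, abs_of_pos hs]
  rw [h2] at h1
  have h3 := hφ.youngPair.lower s hs.le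
  rw [PhiAssumptions.mulExt_of_pos hs] at h3
  calc l * ∫ t in (0 : ℝ)..s, p t ≤ l * (c * nFun φ s) := mul_le_mul_of_nonneg_left h1 hl.le
    _ = c * (l * nFun φ s) := by ring
    _ ≤ c * (φ s * s * s) := mul_le_mul_of_nonneg_left h3 hc0
    _ = p s * s := by rw [hc, ← mul_assoc, div_mul_cancel₀ _ hps.ne']

theorem isAdmissible_fTilde (hη : PenalizationAssumptions φ f l m θ V₀ k a t₀ t₁ η)
    (hφ : PhiAssumptions N φ l m) (hf : FAssumptions r b m f θ) (hV : 0 < V₀) {q : ℝ}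
    (hmq : m ≤ q) (hq : IsAdmissible (sumDensity φ q) f) :
    IsAdmissible (sumDensity φ q) (fTilde φ f V₀ k a t₀ t₁ η) := by
  have hk : 0 < k := one_pos.trans (hη.one_lt_k hφ hf.m_lt_theta)
  have hν : 0 ≤ V₀ / k := (div_pos hV hk).le
  have hq0 : 0 ≤ q := by linarith [hφ.one_lt_l, hφ.l_le_m]
  have hA0 : ∀ s > 0, 0 ≤ sumDensity φ q s := fun s hs =>
    (hφ.mulExt_nonneg s).trans (mulExt_le_sumDensity hq0 hs.le)
  have hA1 : ∀ s > 0, φ s * s ≤ sumDensity φ q s := fun s hs => by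
    rw [← PhiAssumptions.mulExt_of_pos hs]; exact mulExt_le_sumDensity hq0 hs.le
  have hd : deriv (fTilde φ f V₀ k a t₀ t₁ η) = fTildeDeriv φ f V₀ k t₀ t₁ η :=
    hη.deriv_fTilde hφ hf
  obtain ⟨C₁, hC₁, h1⟩ := hq.bound
  obtain ⟨C₂, hC₂, h2⟩ := exists_abs_mul_le_of_continuousOn hφ hq0 (x := t₀) (y := t₁) hη.t₀_pos
    (d := fun s => fTildeDeriv φ f V₀ k t₀ t₁ η s * s)
    ((hη.continuous_fTildeDeriv hφ hf).mul continuous_id).continuousOn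
  obtain ⟨c, hc, h3⟩ := hφ.deriv_bound
  refine ⟨hη.contDiff_fTilde hφ hf, fun s hs => ?_,
    C₁ + C₂ + V₀ / k * (c + 1), by positivity, fun s hs => ?_⟩
  · rw [hη.fTilde_of_le (hs.trans hη.t₀_pos.le), hf.zero s hs]
  have hAs := hA0 s hs
  have hφs := hφ.pos s hs
  constructor
  · rw [abs_of_nonneg (hη.fTilde_nonneg hφ hf s)]
    have h4 := hη.fTilde_le hφ hf hs
    have h5 := mul_le_mul_of_nonneg_left (hA1 s hs) hν
    have h6 : 0 ≤ (C₁ + C₂ + V₀ / k * c) * sumDensity φ q s := by positivity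
    linarith
  · rw [hd]
    rcases le_total s t₀ with h | h
    · rw [hη.fTildeDeriv_of_le h]
      have h6 : 0 ≤ (C₂ + V₀ / k * (c + 1)) * sumDensity φ q s := by positivity
      linarith [(h1 s hs).2]
    rcases le_total s t₁ with h' | h'
    · have h6 : 0 ≤ (C₁ + V₀ / k * (c + 1)) * sumDensity φ q s := by positivity
      linarith [h2 s ⟨h, h'⟩]
    · rw [hη.fTildeDeriv_of_ge hφ h']
      have h7 : |deriv φ s * s + φ s| ≤ (c + 1) * φ s := by
        refine (abs_add_le _ _).trans ?_
        rw [abs_of_pos hφs]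
        linarith [h3 s hs]
      have h6 : 0 ≤ (C₁ + C₂) * sumDensity φ q s := by positivity
      calc |V₀ / k * (deriv φ s * s + φ s) * s|
          = V₀ / k * |deriv φ s * s + φ s| * s := by
            rw [abs_mul, abs_mul, abs_of_nonneg hν, abs_of_pos hs]
        _ ≤ V₀ / k * ((c + 1) * φ s) * s := by gcongr
        _ = V₀ / k * (c + 1) * (φ s * s) := by ring
        _ ≤ V₀ / k * (c + 1) * sumDensity φ q s :=
            mul_le_mul_of_nonneg_left (hA1 s hs) (by positivity)
        _ ≤ _ := by linarith

end PenalizationAssumptions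
end OrliczNehari

namespace OrliczNehari

/-! ### Radial and scalar integrands -/

section Integrands

variable {α E : Type*} [MeasurableSpace α] [NormedAddCommGroup E] [InnerProductSpace ℝ E]
  {μ : Measure α} {a M : ℝ → ℝ} {p q : ℝ}

theorem YoungPair.le_rpow (Y : YoungPair a M p q) {t : ℝ} (ht : 0 ≤ t) (h1 : t ≤ 1) :
    M t ≤ t ^ p * M 1 := by
  simpa using Y.scale_le t 1 ht h1 zero_le_one

theorem YoungPair.a_le_rpow (Y : YoungPair a M p q) {t : ℝ} (ht : 0 < t) (h1 : t ≤ 1) :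
    a t ≤ q * M 1 * t ^ (p - 1) := by
  have h2 := (Y.upper t ht.le).trans (mul_le_mul_of_nonneg_left (Y.le_rpow ht.le h1) Y.q_pos.le)
  have e : t ^ p = t ^ (p - 1) * t := by rw [Real.rpow_sub_one ht.ne']; field_simp
  rw [e] at h2
  refine le_of_mul_le_mul_right ?_ ht
  linarith

theorem YoungPair.tendsto_a (Y : YoungPair a M p q) : Tendsto a (𝓝[>] 0) (𝓝 0) := by
  have h1 : Tendsto (fun t : ℝ => q * M 1 * t ^ (p - 1)) (𝓝[>] 0) (𝓝 0) := by
    have : Tendsto (fun t : ℝ => t ^ (p - 1)) (𝓝[>] 0) (𝓝 (0 ^ (p - 1))) :=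
      ((Real.continuous_rpow_const (by linarith [Y.one_lt])).tendsto 0).mono_left
        nhdsWithin_le_nhds
    rw [Real.zero_rpow (by linarith [Y.one_lt])] at this
    simpa using this.const_mul (q * M 1)
  refine tendsto_of_tendsto_of_tendsto_of_le_of_le' tendsto_const_nhds h1 ?_ ?_
  · filter_upwards [self_mem_nhdsWithin] with t ht using Y.a_nonneg t (le_of_lt ht)
  · filter_upwards [Ioc_mem_nhdsGT one_pos] with t ht using Y.a_le_rpow ht.1 ht.2

/-- A radial integrand `P(|e|)` with gradient `d(|e|) e`. -/
theorem nemytskiiData_radial (Y : YoungPair a M p q) {P d : ℝ → ℝ}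
    (hPd : ∀ t > 0, HasDerivAt P (d t * t) t) (hdc : ContinuousOn d (Ioi 0))
    (hP : ∃ C, 0 ≤ C ∧ ∀ t, 0 ≤ t → |P t| ≤ C * M t)
    (hd : ∃ C, 0 ≤ C ∧ ∀ t > 0, |d t * t| ≤ C * a t) :
    NemytskiiData (E := E) μ a (fun _ e => P ‖e‖) (fun _ e => d ‖e‖ • e) := by
  obtain ⟨C, hC, hP⟩ := hP
  obtain ⟨C', hC', hd⟩ := hd
  have hP0 : P 0 = 0 := by
    have := hP 0 le_rfl
    rw [Y.zero, mul_zero] at this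
    exact abs_nonpos_iff.1 this
  have hbound : ∀ e : E, ‖d ‖e‖ • e‖ ≤ C' * a ‖e‖ := by
    intro e
    rcases eq_or_ne e 0 with rfl | he
    · simpa using mul_nonneg hC' (Y.a_nonneg 0 le_rfl)
    · have h0 : 0 < ‖e‖ := norm_pos_iff.2 he
      have := hd _ h0
      rw [abs_mul, abs_norm] at this
      rwa [norm_smul, Real.norm_eq_abs]
  have hder : ∀ e : E, HasFDerivAt (fun e => P ‖e‖) (innerSL ℝ (d ‖e‖ • e)) e := by
    intro e
    rcases eq_or_ne e 0 with rfl | he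
    · rw [smul_zero, _root_.map_zero, hasFDerivAt_iff_isLittleO_nhds_zero]
      simp only [zero_add, norm_zero, hP0, sub_zero, zero_apply]
      have hM1 : 0 < M 1 := Y.pos 1 one_pos
      -- At the origin `M(t) ≤ t^p M(1)` with `p > 1`, so the derivative there is zero although the
      -- norm is not differentiable.
      have hO : (fun e : E => P ‖e‖) =O[𝓝 0] fun e => ‖e‖ ^ p := by
        refine Asymptotics.IsBigO.of_bound (C * M 1) ?_
        filter_upwards [Metric.ball_mem_nhds (0 : E) one_pos] with e he
        rw [mem_ball_zero_iff] at he
        have h1 := Y.le_rpow (norm_nonneg e) he.le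
        rw [Real.norm_of_nonneg (Real.rpow_nonneg (norm_nonneg _) _), Real.norm_eq_abs]
        calc |P ‖e‖| ≤ C * M ‖e‖ := hP _ (norm_nonneg _)
          _ ≤ C * (‖e‖ ^ p * M 1) := by gcongr
          _ = _ := by ring
      have ho : (fun e : E => ‖e‖ ^ p) =o[𝓝 0] fun e => e := by
        rw [Asymptotics.isLittleO_iff]
        intro c hc
        have ht : Tendsto (fun e : E => ‖e‖ ^ (p - 1)) (𝓝 0) (𝓝 0) := by
          have h1 := ((Real.continuous_rpow_const (q := p - 1) (by linarith [Y.one_lt])).comp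
            (continuous_norm (E := E))).tendsto 0
          simpa [Real.zero_rpow (show p - 1 ≠ 0 by linarith [Y.one_lt]), Function.comp_def] using h1
        filter_upwards [ht.eventually (gt_mem_nhds hc)] with e he
        rw [Real.norm_of_nonneg (Real.rpow_nonneg (norm_nonneg _) _)]
        rcases eq_or_ne e 0 with rfl | h0
        · simp [Real.zero_rpow (show p ≠ 0 by linarith [Y.one_lt])]
        · have hn : 0 < ‖e‖ := norm_pos_iff.2 h0
          have e1 : ‖e‖ ^ p = ‖e‖ ^ (p - 1) * ‖e‖ := by
            rw [Real.rpow_sub_one hn.ne']; field_simp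
          rw [e1]
          gcongr
      exact hO.trans_isLittleO ho
    · have h0 : 0 < ‖e‖ := norm_pos_iff.2 he
      have hn : HasFDerivAt (fun e : E => ‖e‖) (‖e‖⁻¹ • innerSL ℝ e) e := by
        have h1 := (hasStrictFDerivAt_norm_sq e).hasFDerivAt.sqrt (by positivity)
        have e2 : (fun y : E => √(‖y‖ ^ 2)) = fun y => ‖y‖ :=
          funext fun y => Real.sqrt_sq (norm_nonneg y)
        rw [e2] at h1
        refine h1.congr_fderiv ?_
        rw [Real.sqrt_sq h0.le]
        ext v
        simp
        field_simp
      refine ((hPd _ h0).comp_hasFDerivAt e hn).congr_fderiv ?_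
      rw [map_smul, smul_smul]
      congr 1
      field_simp
  have hcont : Continuous fun e : E => d ‖e‖ • e := by
    rw [continuous_iff_continuousAt]
    intro e
    rcases eq_or_ne e 0 with rfl | he
    -- Continuity of the gradient at the origin comes from `a(t) → 0`; `d` itself may be unbounded
    -- there.
    · have hz : Tendsto (fun e : E => C' * a ‖e‖) (𝓝[≠] 0) (𝓝 0) := by
        have h1 : Tendsto (fun e : E => ‖e‖) (𝓝[≠] 0) (𝓝[>] 0) := tendsto_norm_nhdsNE_zero
        simpa using (Y.tendsto_a.comp h1).const_mul C'
      rw [continuousAt_iff_punctured_nhds, smul_zero]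
      exact squeeze_zero_norm hbound hz
    · have h0 : 0 < ‖e‖ := norm_pos_iff.2 he
      have h1 : ContinuousAt (fun e : E => d ‖e‖) e :=
        ContinuousAt.comp (f := fun e : E => ‖e‖) (hdc.continuousAt (Ioi_mem_nhds h0))
          continuous_norm.continuousAt
      exact h1.smul continuousAt_id
  exact ⟨fun _ => by simpa using hP0, fun _ => hder, fun _ => hcont, ⟨C', hC', fun _ => hbound⟩,
    fun u hu => (continuous_iff_continuousAt.2
      fun e => (hder e).continuousAt).comp_aestronglyMeasurable hu,
    fun u hu => hcont.comp_aestronglyMeasurable hu⟩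

open Classical in
theorem NemytskiiData.ite {h₁ h₂ : α → E → ℝ} {H₁ H₂ : α → E → E}
    (hN₁ : NemytskiiData μ a h₁ H₁) (hN₂ : NemytskiiData μ a h₂ H₂) {S : Set α}
    (hS : MeasurableSet S) (ha : ∀ t, 0 ≤ t → 0 ≤ a t) :
    NemytskiiData μ a (fun x e => if x ∈ S then h₁ x e else h₂ x e)
      (fun x e => if x ∈ S then H₁ x e else H₂ x e) := by
  obtain ⟨C₁, hC₁, hb₁⟩ := hN₁.bound
  obtain ⟨C₂, hC₂, hb₂⟩ := hN₂.bound
  refine ⟨fun x => ?_, fun x e => ?_, fun x => ?_, ⟨C₁ + C₂, by positivity, fun x e => ?_⟩,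
    fun u hu => ?_, fun u hu => ?_⟩
  · split_ifs
    exacts [hN₁.zero x, hN₂.zero x]
  · by_cases hx : x ∈ S <;> simp only [hx, if_true, if_false]
    exacts [hN₁.hasFDerivAt x e, hN₂.hasFDerivAt x e]
  · by_cases hx : x ∈ S <;> simp only [hx, if_true, if_false]
    exacts [hN₁.cont x, hN₂.cont x]
  · have h0 := ha _ (norm_nonneg e)
    have h1 := mul_nonneg hC₁ h0
    have h2 := mul_nonneg hC₂ h0
    split_ifs
    · linarith [hb₁ x e]
    · linarith [hb₂ x e]
  · exact AEStronglyMeasurable.piecewise hS (hN₁.aesm u hu).restrict (hN₂.aesm u hu).restrict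
  · exact AEStronglyMeasurable.piecewise hS (hN₁.aesm_grad u hu).restrict
      (hN₂.aesm_grad u hu).restrict

theorem IsAdmissible.abs_le {g : ℝ → ℝ} (hg : IsAdmissible a g) (ha : ∀ t, 0 ≤ t → 0 ≤ a t) :
    ∃ C, 0 ≤ C ∧ ∀ s, |g s| ≤ C * a |s| ∧ |deriv g s * s| ≤ C * a |s| := by
  obtain ⟨C, hC, hb⟩ := hg.bound
  refine ⟨C, hC, fun s => ?_⟩
  have h0 := mul_nonneg hC (ha _ (abs_nonneg s))
  rcases lt_trichotomy s 0 with h | rfl | h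
  · rw [hg.zero s h.le, hg.deriv_eq_zero h]
    simpa using h0
  · rw [hg.zero 0 le_rfl]
    simpa using h0
  · rw [abs_of_pos h]
    exact hb s h

theorem hasFDerivAt_innerSL {P : ℝ → ℝ} {d s : ℝ} (h : HasDerivAt P d s) :
    HasFDerivAt P (innerSL ℝ d) s := by
  refine h.hasFDerivAt.congr_fderiv ?_
  ext
  simp

/-- The integrand `∫₀ˢ g`. -/
theorem IsAdmissible.nemytskiiData_primitive {g : ℝ → ℝ} (hg : IsAdmissible a g)
    (ha : ∀ t, 0 ≤ t → 0 ≤ a t) :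
    NemytskiiData μ a (fun _ s => ∫ t in (0 : ℝ)..s, g t) (fun _ s => g s) := by
  have hc := hg.contDiff.continuous
  obtain ⟨C, hC, hb⟩ := hg.abs_le ha
  have hd : ∀ s, HasDerivAt (fun s => ∫ t in (0 : ℝ)..s, g t) (g s) s := fun s =>
    intervalIntegral.integral_hasDerivAt_right (hc.intervalIntegrable _ _)
      hc.stronglyMeasurable.stronglyMeasurableAtFilter hc.continuousAt
  exact ⟨fun _ => intervalIntegral.integral_same, fun _ s => hasFDerivAt_innerSL (hd s),
    fun _ => hc, ⟨C, hC, fun _ s => (hb s).1⟩,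
    fun u hu => (continuous_iff_continuousAt.2
      fun s => (hd s).continuousAt).comp_aestronglyMeasurable hu,
    fun u hu => hc.comp_aestronglyMeasurable hu⟩

/-- The integrand `g(s) s`. -/
theorem IsAdmissible.nemytskiiData_mul {g : ℝ → ℝ} (hg : IsAdmissible a g)
    (ha : ∀ t, 0 ≤ t → 0 ≤ a t) :
    NemytskiiData μ a (fun _ s => g s * s) (fun _ s => deriv g s * s + g s) := by
  have hc := hg.contDiff.continuous
  have hc' : Continuous fun s => deriv g s * s + g s :=
    ((hg.contDiff.continuous_deriv le_rfl).mul continuous_id).add hc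
  obtain ⟨C, hC, hb⟩ := hg.abs_le ha
  have hd : ∀ s, HasDerivAt (fun s => g s * s) (deriv g s * s + g s) s := fun s => by
    simpa using! (hg.hasDerivAt s).mul (hasDerivAt_id s)
  refine ⟨fun _ => mul_zero _, fun _ s => hasFDerivAt_innerSL (hd s),
    fun _ => hc', ⟨C + C, by positivity, fun _ s => ?_⟩,
    fun u hu => (hc.mul continuous_id).comp_aestronglyMeasurable hu,
    fun u hu => hc'.comp_aestronglyMeasurable hu⟩
  refine (norm_add_le _ _).trans ?_
  rw [add_mul]
  exact add_le_add (hb s).2 (hb s).1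

end Integrands

namespace PhiAssumptions

variable {N : ℕ} {φ : ℝ → ℝ} {l m : ℝ} {α E : Type*} [MeasurableSpace α] [NormedAddCommGroup E]
  [InnerProductSpace ℝ E] {μ : Measure α}

theorem nemytskiiData (h : PhiAssumptions N φ l m) :
    NemytskiiData (E := E) μ (mulExt φ) (fun _ e => nFun φ ‖e‖) (fun _ e => φ ‖e‖ • e) := by
  refine nemytskiiData_radial h.youngPair (fun t ht => h.hasDerivAt_nFun ht)
    h.contDiffOn.continuousOn ⟨1, zero_le_one, fun t _ => ?_⟩ ⟨1, zero_le_one, fun t ht => ?_⟩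
  · rw [one_mul, abs_of_nonneg (h.nFun_nonneg t)]
  · rw [one_mul, mulExt_of_pos ht, abs_of_pos (mul_pos (h.pos t ht) ht)]

theorem nemytskiiData_mul_sq (h : PhiAssumptions N φ l m) :
    NemytskiiData (E := E) μ (mulExt φ) (fun _ e => φ ‖e‖ * ‖e‖ ^ 2)
      (fun _ e => (deriv φ ‖e‖ * ‖e‖ + 2 * φ ‖e‖) • e) := by
  obtain ⟨c, hc, hb⟩ := h.deriv_bound
  refine nemytskiiData_radial (P := fun t => φ t * t ^ 2)
    (d := fun t => deriv φ t * t + 2 * φ t) h.youngPair (fun t ht => ?_)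
    ((h.continuousOn_deriv.mul continuousOn_id).add
      (continuousOn_const.mul h.contDiffOn.continuousOn))
    ⟨m, by linarith [h.one_lt_l, h.l_le_m], fun t ht => ?_⟩
    ⟨c + 2, by positivity, fun t ht => ?_⟩
  · refine ((h.differentiableAt ht).hasDerivAt.fun_mul (hasDerivAt_pow 2 t)).congr_deriv ?_
    push_cast
    ring
  · rcases ht.lt_or_eq with h0 | rfl
    · rw [abs_of_nonneg (mul_nonneg (h.pos t h0).le (sq_nonneg t))]
      have := h.le_m_mul h0
      linarith
    · simp [nFun_zero]
  · have hφt := h.pos t ht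
    rw [mulExt_of_pos ht, abs_mul, abs_of_pos ht]
    have : |deriv φ t * t + 2 * φ t| ≤ (c + 2) * φ t := by
      refine (abs_add_le _ _).trans ?_
      rw [abs_of_pos (by positivity : 0 < 2 * φ t)]
      linarith [hb t ht]
    calc _ ≤ (c + 2) * φ t * t := by gcongr
      _ = _ := by ring

end PhiAssumptions

/-! ### The abstract penalized problem and the derivatives of its functionals -/

/-- The nonlinearity equal to `f(s)` on `S` and to `p(s)` elsewhere. -/
noncomputable def gFun {α : Type*} (S : Set α) (f p : ℝ → ℝ) (x : α) (s : ℝ) : ℝ :=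
  open Classical in if x ∈ S then f s else p s

/-- The derivative of `gFun` with respect to `s`. -/
noncomputable def gDer {α : Type*} (S : Set α) (f p : ℝ → ℝ) (x : α) (s : ℝ) : ℝ :=
  gFun S (deriv f) (deriv p) x s

/-- A penalized problem: a weighted Orlicz–Sobolev space, the nonlinearity `f` on a bounded set
`S`, and the truncated nonlinearity `p` outside of `S`. -/
structure Penalized {N : ℕ} (D : SpaceData N) (S : Set (EuclideanSpace ℝ (Fin N)))
    (f p : ℝ → ℝ) (w₀ ν θ τ q γ : ℝ) : Prop where
  κ_eq : D.κ = 1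
  w₀_pos : 0 < w₀
  le_w : ∀ x, w₀ ≤ D.w x
  measurableSet : MeasurableSet S
  isBounded : Bornology.IsBounded S
  one_le_γ : 1 ≤ γ
  γ_lt : γ < N
  rpow_γ : ∃ C, 0 ≤ C ∧ ∀ t, 0 ≤ t → t ^ γ ≤ C * (1 + nFun D.φ t)
  m_le_q : D.m ≤ q
  q_lt : q < N * γ / (N - γ)
  adm_f : IsAdmissible (sumDensity D.φ q) f
  adm_p : IsAdmissible (sumDensity D.φ q) p
  m_lt_θ : D.m < θ
  p_nonneg : ∀ s, 0 ≤ p s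
  superlinear : ∀ s > 0, θ * (∫ t in (0 : ℝ)..s, f t) ≤ f s * s
  f_deriv : ∀ s > 0, (D.m - 1) * f s ≤ deriv f s * s
  ν_nonneg : 0 ≤ ν
  ν_lt : ν < w₀
  ν_small : (θ - D.l) * D.m * ν < (θ - D.m) * D.l * w₀
  p_le : ∀ s > 0, p s ≤ ν * (D.φ s * s)
  p_deriv : ∀ s > 0, p s * (deriv D.φ s * s + D.φ s) ≤ deriv p s * (D.φ s * s)
  p_integral : ∀ s > 0, D.l * (∫ t in (0 : ℝ)..s, p t) ≤ p s * s
  p_eq : ∀ s ≤ τ, p s = f s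
  strict : ∃ x y κ : ℝ, 0 < x ∧ x < y ∧ y < τ ∧ 0 < κ ∧
    ∀ t ∈ Icc x y, κ ≤ deriv f t * t ^ 2 - (D.m - 1) * f t * t

/-- The energy `∫ Φ(|∇u|) + ∫ w Φ(|u|) - ∫ G(x, u)`. -/
noncomputable def SpaceData.energy {N : ℕ} (D : SpaceData N)
    (g : EuclideanSpace ℝ (Fin N) → ℝ → ℝ) (u : D.Space) : ℝ :=
  (∫ x, nFun D.φ ‖SpaceData.grad u x‖) + (∫ x, D.w x * nFun D.φ |SpaceData.fn u x|)
    - ∫ x, ∫ t in (0 : ℝ)..SpaceData.fn u x, g x t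

theorem SpaceData.integral_wMeasure {N : ℕ} (D : SpaceData N)
    (g : EuclideanSpace ℝ (Fin N) → ℝ) : ∫ x, g x ∂D.wMeasure = ∫ x, D.w x * g x := by
  rw [SpaceData.wMeasure, integral_withDensity_eq_integral_toReal_smul
    D.w_cont.measurable.ennreal_ofReal (Eventually.of_forall fun _ => ENNReal.ofReal_lt_top)]
  refine integral_congr_ae (Eventually.of_forall fun x => ?_)
  dsimp only
  rw [ENNReal.toReal_ofReal (D.w_pos x).le, smul_eq_mul]

namespace Penalized

open SpaceData

variable {N : ℕ} {D : SpaceData N} {S : Set (EuclideanSpace ℝ (Fin N))} {f p : ℝ → ℝ}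
  {w₀ ν θ τ q γ : ℝ}

theorem youngPair_q (P : Penalized D S f p w₀ ν θ τ q γ) :
    YoungPair (sumDensity D.φ q) (fun t => nFun D.φ t + t ^ q) (min D.l q) (max D.m q) :=
  youngPair_sum D.hφ P.m_le_q

theorem modularMap_grad (P : Penalized D S f p w₀ ν θ τ q γ) :
    ModularMap (grad : D.Space → _) (nFun D.φ) volume := SpaceData.modularMap_grad P.κ_eq

theorem modularMap_fn (P : Penalized D S f p w₀ ν θ τ q γ) :
    ModularMap (fn : D.Space → _) (nFun D.φ) D.wMeasure := SpaceData.modularMap_fn P.κ_eq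

theorem modularMap_fn_volume (P : Penalized D S f p w₀ ν θ τ q γ) :
    ModularMap (fn : D.Space → _) (nFun D.φ) volume :=
  SpaceData.modularMap_fn_volume P.κ_eq P.w₀_pos P.le_w

theorem modularMap_fn_q (P : Penalized D S f p w₀ ν θ τ q γ) :
    ModularMap (fn : D.Space → _) (fun t => nFun D.φ t + t ^ q) volume :=
  SpaceData.modularMap_fn_add_rpow P.κ_eq P.w₀_pos P.le_w P.one_le_γ P.γ_lt P.rpow_γ P.m_le_q
    P.q_lt.le

theorem nemytskiiData_primitive (P : Penalized D S f p w₀ ν θ τ q γ) :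
    NemytskiiData volume (sumDensity D.φ q) (fun x s => ∫ t in (0 : ℝ)..s, gFun S f p x t)
      (gFun S f p) := by
  have h := NemytskiiData.ite (μ := volume) (P.adm_f.nemytskiiData_primitive
    P.youngPair_q.a_nonneg) (P.adm_p.nemytskiiData_primitive P.youngPair_q.a_nonneg)
    P.measurableSet P.youngPair_q.a_nonneg
  convert h using 3 with x s
  · simp only [gFun]
    split_ifs <;> rfl
  · rfl

theorem nemytskiiData_mul (P : Penalized D S f p w₀ ν θ τ q γ) :
    NemytskiiData volume (sumDensity D.φ q) (fun x s => gFun S f p x s * s)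
      (fun x s => gDer S f p x s * s + gFun S f p x s) := by
  have h := NemytskiiData.ite (μ := volume) (P.adm_f.nemytskiiData_mul
    P.youngPair_q.a_nonneg) (P.adm_p.nemytskiiData_mul P.youngPair_q.a_nonneg)
    P.measurableSet P.youngPair_q.a_nonneg
  convert h using 3 with x s x s
  · simp only [gFun]
    split_ifs <;> rfl
  · simp only [gDer, gFun]
    split_ifs <;> rfl

theorem energy_eq (D : SpaceData N) (g : EuclideanSpace ℝ (Fin N) → ℝ → ℝ) (u : D.Space) :
    D.energy g u = (∫ x, nFun D.φ ‖grad u x‖) + (∫ x, nFun D.φ ‖fn u x‖ ∂D.wMeasure)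
      - ∫ x, ∫ t in (0 : ℝ)..fn u x, g x t := by
  rw [D.integral_wMeasure]
  rfl

/-- The energy is of class `C¹`, with the expected derivative. -/
theorem exists_hasFDerivAt_energy (P : Penalized D S f p w₀ ν θ τ q γ) :
    ∃ DJ : D.Space → D.Space →L[ℝ] ℝ,
      (∀ u v, DJ u v = (∫ x, inner ℝ (D.φ ‖grad u x‖ • grad u x) (grad v x))
        + (∫ x, inner ℝ (D.φ ‖fn u x‖ • fn u x) (fn v x) ∂D.wMeasure)
        - ∫ x, inner ℝ (gFun S f p x (fn u x)) (fn v x)) ∧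
      (∀ u, HasFDerivAt (D.energy (gFun S f p)) (DJ u) u) ∧ Continuous DJ := by
  obtain ⟨D₁, h₁, d₁, c₁, -⟩ := (D.hφ.nemytskiiData (μ := volume)).exists_hasFDerivAt
    D.hφ.youngPair P.modularMap_grad
  obtain ⟨D₂, h₂, d₂, c₂, -⟩ := (D.hφ.nemytskiiData (μ := D.wMeasure)).exists_hasFDerivAt
    D.hφ.youngPair P.modularMap_fn
  obtain ⟨D₃, h₃, d₃, c₃, -⟩ := P.nemytskiiData_primitive.exists_hasFDerivAt
    P.youngPair_q P.modularMap_fn_q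
  refine ⟨fun u => D₁ u + D₂ u - D₃ u, fun u v => ?_, fun u => ?_, (c₁.add c₂).sub c₃⟩
  · rw [sub_apply, add_apply, h₁, h₂, h₃]
  · refine (((d₁ u).add (d₂ u)).sub (d₃ u)).congr_of_eventuallyEq
      (Eventually.of_forall fun u => energy_eq D _ u)

/-- The Nehari functional is of class `C¹`, with the expected derivative. -/
theorem exists_hasFDerivAt_nehari (P : Penalized D S f p w₀ ν θ τ q γ) :
    ∃ DL : D.Space → D.Space →L[ℝ] ℝ,
      (∀ u v, DL u v
        = (∫ x, inner ℝ ((deriv D.φ ‖grad u x‖ * ‖grad u x‖ + 2 * D.φ ‖grad u x‖) • grad u x)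
            (grad v x))
        + (∫ x, inner ℝ ((deriv D.φ ‖fn u x‖ * ‖fn u x‖ + 2 * D.φ ‖fn u x‖) • fn u x)
            (fn v x) ∂D.wMeasure)
        - ∫ x, inner ℝ (gDer S f p x (fn u x) * fn u x + gFun S f p x (fn u x)) (fn v x)) ∧
      (∀ u, HasFDerivAt (fun u : D.Space => (∫ x, D.φ ‖grad u x‖ * ‖grad u x‖ ^ 2)
        + (∫ x, D.φ ‖fn u x‖ * ‖fn u x‖ ^ 2 ∂D.wMeasure)
        - ∫ x, gFun S f p x (fn u x) * fn u x) (DL u) u) ∧ Continuous DL ∧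
      ∀ R, ∃ K, ∀ u, ‖u‖ ≤ R → ‖DL u‖ ≤ K := by
  obtain ⟨D₁, h₁, d₁, c₁, b₁⟩ := (D.hφ.nemytskiiData_mul_sq (μ := volume)).exists_hasFDerivAt
    D.hφ.youngPair P.modularMap_grad
  obtain ⟨D₂, h₂, d₂, c₂, b₂⟩ := (D.hφ.nemytskiiData_mul_sq
    (μ := D.wMeasure)).exists_hasFDerivAt D.hφ.youngPair P.modularMap_fn
  obtain ⟨D₃, h₃, d₃, c₃, b₃⟩ := P.nemytskiiData_mul.exists_hasFDerivAt
    P.youngPair_q P.modularMap_fn_q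
  refine ⟨fun u => D₁ u + D₂ u - D₃ u, fun u v => ?_,
    fun u => ((d₁ u).add (d₂ u)).sub (d₃ u), (c₁.add c₂).sub c₃, fun R => ?_⟩
  · rw [sub_apply, add_apply, h₁, h₂, h₃]
  · obtain ⟨K₁, hK₁⟩ := b₁ R
    obtain ⟨K₂, hK₂⟩ := b₂ R
    obtain ⟨K₃, hK₃⟩ := b₃ R
    exact ⟨K₁ + K₂ + K₃, fun u hu => (norm_sub_le _ _).trans (add_le_add
      ((norm_add_le _ _).trans (add_le_add (hK₁ u hu) (hK₂ u hu))) (hK₃ u hu))⟩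

theorem fderiv_energy_apply (P : Penalized D S f p w₀ ν θ τ q γ) (u v : D.Space) :
    fderiv ℝ (D.energy (gFun S f p)) u v
      = (∫ x, inner ℝ (D.φ ‖grad u x‖ • grad u x) (grad v x))
        + (∫ x, inner ℝ (D.φ ‖fn u x‖ • fn u x) (fn v x) ∂D.wMeasure)
        - ∫ x, inner ℝ (gFun S f p x (fn u x)) (fn v x) := by
  obtain ⟨DJ, h, hd, -⟩ := P.exists_hasFDerivAt_energy
  rw [(hd u).fderiv, h]

theorem contDiff_energy (P : Penalized D S f p w₀ ν θ τ q γ) :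
    ContDiff ℝ 1 (D.energy (gFun S f p)) := by
  obtain ⟨DJ, -, hd, hc⟩ := P.exists_hasFDerivAt_energy
  rw [contDiff_one_iff_fderiv, funext fun u => (hd u).fderiv]
  exact ⟨fun u => (hd u).differentiableAt, hc⟩

theorem continuous_fderiv_energy (P : Penalized D S f p w₀ ν θ τ q γ) :
    Continuous (fderiv ℝ (D.energy (gFun S f p))) := P.contDiff_energy.continuous_fderiv one_ne_zero

theorem nehariFn_eq (P : Penalized D S f p w₀ ν θ τ q γ) (u : D.Space) :
    nehariFn (D.energy (gFun S f p)) u = (∫ x, D.φ ‖grad u x‖ * ‖grad u x‖ ^ 2)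
        + (∫ x, D.φ ‖fn u x‖ * ‖fn u x‖ ^ 2 ∂D.wMeasure)
        - ∫ x, gFun S f p x (fn u x) * fn u x := by
  rw [nehariFn, P.fderiv_energy_apply]
  have e1 : ∀ x, inner ℝ (D.φ ‖grad u x‖ • grad u x) (grad u x)
      = D.φ ‖grad u x‖ * ‖grad u x‖ ^ 2 := fun x => by
    rw [real_inner_smul_left, real_inner_self_eq_norm_sq]
  have e2 : ∀ x, inner ℝ (D.φ ‖fn u x‖ • fn u x) (fn u x)
      = D.φ ‖fn u x‖ * ‖fn u x‖ ^ 2 := fun x => by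
    rw [real_inner_smul_left, real_inner_self_eq_norm_sq]
  have e3 : ∀ x, inner ℝ (gFun S f p x (fn u x)) (fn u x) = gFun S f p x (fn u x) * fn u x :=
    fun x => by simp [mul_comm]
  simp only [e1, e2, e3]

theorem hasFDerivAt_nehariFn (P : Penalized D S f p w₀ ν θ τ q γ) :
    ∃ DL : D.Space → D.Space →L[ℝ] ℝ,
      (∀ u v, DL u v
        = (∫ x, inner ℝ ((deriv D.φ ‖grad u x‖ * ‖grad u x‖ + 2 * D.φ ‖grad u x‖) • grad u x)
            (grad v x))
        + (∫ x, inner ℝ ((deriv D.φ ‖fn u x‖ * ‖fn u x‖ + 2 * D.φ ‖fn u x‖) • fn u x)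
            (fn v x) ∂D.wMeasure)
        - ∫ x, inner ℝ (gDer S f p x (fn u x) * fn u x + gFun S f p x (fn u x)) (fn v x)) ∧
      (∀ u, HasFDerivAt (nehariFn (D.energy (gFun S f p))) (DL u) u) ∧ Continuous DL ∧
      ∀ R, ∃ K, ∀ u, ‖u‖ ≤ R → ‖DL u‖ ≤ K := by
  have h := P.exists_hasFDerivAt_nehari
  rwa [← funext P.nehariFn_eq] at h

theorem fderiv_nehariFn_apply (P : Penalized D S f p w₀ ν θ τ q γ) (u v : D.Space) :
    fderiv ℝ (nehariFn (D.energy (gFun S f p))) u v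
      = (∫ x, inner ℝ ((deriv D.φ ‖grad u x‖ * ‖grad u x‖ + 2 * D.φ ‖grad u x‖) • grad u x)
            (grad v x))
        + (∫ x, inner ℝ ((deriv D.φ ‖fn u x‖ * ‖fn u x‖ + 2 * D.φ ‖fn u x‖) • fn u x)
            (fn v x) ∂D.wMeasure)
        - ∫ x, inner ℝ (gDer S f p x (fn u x) * fn u x + gFun S f p x (fn u x)) (fn v x) := by
  obtain ⟨DL, h, hd, -, -⟩ := P.hasFDerivAt_nehariFn
  rw [(hd u).fderiv, h]

theorem contDiff_nehariFn (P : Penalized D S f p w₀ ν θ τ q γ) :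
    ContDiff ℝ 1 (nehariFn (D.energy (gFun S f p))) := by
  obtain ⟨DL, -, hd, hc, -⟩ := P.hasFDerivAt_nehariFn
  rw [contDiff_one_iff_fderiv, funext fun u => (hd u).fderiv]
  exact ⟨fun u => (hd u).differentiableAt, hc⟩

theorem exists_norm_fderiv_nehariFn_le (P : Penalized D S f p w₀ ν θ τ q γ) (R : ℝ) :
    ∃ K, ∀ u, ‖u‖ ≤ R → ‖fderiv ℝ (nehariFn (D.energy (gFun S f p))) u‖ ≤ K := by
  obtain ⟨DL, -, hd, -, hb⟩ := P.hasFDerivAt_nehariFn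
  rw [funext fun u => (hd u).fderiv]
  exact hb R

end Penalized
end OrliczNehari

namespace OrliczNehari

/-! ### Local compactness in L¹ by mollification -/

section Compactness

variable {N : ℕ}

/-- The fundamental theorem of calculus along the segment from `x` to `x - y`, followed by Tonelli's
theorem and translation invariance. -/
theorem lintegral_enorm_translate_sub_le {z : EuclideanSpace ℝ (Fin N) → ℝ}
    (hz : ContDiff ℝ 1 z) (y : EuclideanSpace ℝ (Fin N)) :
    ∫⁻ x, ‖z (x - y) - z x‖ₑ ≤ ‖y‖ₑ * ∫⁻ x, ‖gradient z x‖ₑ := by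
  have hgc : Continuous (gradient z) := continuous_gradient hz
  have hpt : ∀ x, ‖z (x - y) - z x‖ₑ
      ≤ ∫⁻ s in Ioc (0 : ℝ) 1, ‖y‖ₑ * ‖gradient z (x - s • y)‖ₑ := by
    intro x
    have hd : ∀ s : ℝ, HasDerivAt (fun s : ℝ => z (x - s • y))
        (inner ℝ (gradient z (x - s • y)) (-y)) s := by
      intro s
      have h1 : HasDerivAt (fun s : ℝ => x - s • y) (-y) s := by
        simpa using! ((hasDerivAt_id s).smul_const y).const_sub x
      have h2 := (hz.differentiable one_ne_zero (x - s • y)).hasFDerivAt.comp_hasDerivAt s h1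
      rwa [inner_gradient]
    have hc : Continuous fun s : ℝ => inner ℝ (gradient z (x - s • y)) (-y) := by fun_prop
    have hI := intervalIntegral.integral_eq_sub_of_hasDerivAt (a := 0) (b := 1)
      (fun s _ => hd s) (hc.intervalIntegrable _ _)
    rw [one_smul, zero_smul, sub_zero] at hI
    rw [← hI, intervalIntegral.integral_of_le zero_le_one]
    refine (enorm_integral_le_lintegral_enorm _).trans (lintegral_mono fun s => ?_)
    rw [← enorm_neg y, ← ofReal_norm, ← ofReal_norm, ← ofReal_norm,
      ← ENNReal.ofReal_mul (norm_nonneg _), mul_comm]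
    exact ENNReal.ofReal_le_ofReal (norm_inner_le_norm _ _)
  calc ∫⁻ x, ‖z (x - y) - z x‖ₑ
      ≤ ∫⁻ x, ∫⁻ s in Ioc (0 : ℝ) 1, ‖y‖ₑ * ‖gradient z (x - s • y)‖ₑ := lintegral_mono hpt
    _ = ∫⁻ s in Ioc (0 : ℝ) 1, ∫⁻ x, ‖y‖ₑ * ‖gradient z (x - s • y)‖ₑ := by
        refine lintegral_lintegral_swap (Measurable.aemeasurable ?_)
        have : Continuous fun w : EuclideanSpace ℝ (Fin N) × ℝ => gradient z (w.1 - w.2 • y) := by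
          fun_prop
        exact measurable_const.mul this.measurable.enorm
    _ = ∫⁻ _ in Ioc (0 : ℝ) 1, ‖y‖ₑ * ∫⁻ x, ‖gradient z x‖ₑ := by
        refine lintegral_congr fun s => ?_
        rw [lintegral_const_mul' _ _ enorm_ne_top,
          lintegral_sub_right_eq_self (fun x => ‖gradient z x‖ₑ) (s • y)]
    _ = _ := by simp

/-- A mollification is an average of translations by vectors shorter than `1 / (k + 1)`, so the
translation estimate applies under the average. -/
theorem lintegral_enorm_mollify_sub_le {z : EuclideanSpace ℝ (Fin N) → ℝ}
    (hz : ContDiff ℝ 1 z) (k : ℕ) :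
    ∫⁻ x, ‖mollify k z x - z x‖ₑ
      ≤ ENNReal.ofReal (1 / ((k : ℝ) + 1)) * ∫⁻ x, ‖gradient z x‖ₑ := by
  have hρc : Continuous (mollifier N k) := (contDiff_mollifier N k).continuous
  have hρi : Integrable (mollifier N k) :=
    hρc.integrable_of_hasCompactSupport (hasCompactSupport_mollifier N k)
  have hρ1 : ∫⁻ t, ‖mollifier N k t‖ₑ = 1 := by
    rw [← ofReal_integral_norm_eq_lintegral_enorm hρi]
    simp only [Real.norm_of_nonneg (mollifier_nonneg k _), integral_mollifier, ENNReal.ofReal_one]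
  have hpt : ∀ x, ‖mollify k z x - z x‖ₑ ≤ ∫⁻ t, ‖mollifier N k t‖ₑ * ‖z (x - t) - z x‖ₑ := by
    intro x
    have e1 : mollify k z x = ∫ t, mollifier N k t • z (x - t) := rfl
    have e2 : z x = ∫ t, mollifier N k t • z x := by
      rw [integral_smul_const, integral_mollifier, one_smul]
    have i1 : Integrable fun t => mollifier N k t • z (x - t) :=
      (hρc.smul (hz.continuous.comp (continuous_const.sub continuous_id))).integrable_of_hasCompactSupport
        (hasCompactSupport_mollifier N k).smul_right
    have e3 : mollify k z x - z x = ∫ t, mollifier N k t • (z (x - t) - z x) := by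
      conv_lhs => rw [e1, e2]
      rw [← integral_sub i1 (hρi.smul_const _)]
      simp only [smul_sub]
    rw [e3]
    refine (enorm_integral_le_lintegral_enorm _).trans (lintegral_mono fun t => ?_)
    rw [enorm_smul]
  calc ∫⁻ x, ‖mollify k z x - z x‖ₑ
      ≤ ∫⁻ x, ∫⁻ t, ‖mollifier N k t‖ₑ * ‖z (x - t) - z x‖ₑ := lintegral_mono hpt
    _ = ∫⁻ t, ∫⁻ x, ‖mollifier N k t‖ₑ * ‖z (x - t) - z x‖ₑ := by
        refine lintegral_lintegral_swap (Measurable.aemeasurable ?_)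
        have hzc := hz.continuous
        have h1 : Continuous fun w : EuclideanSpace ℝ (Fin N) × EuclideanSpace ℝ (Fin N) =>
          mollifier N k w.2 := by fun_prop
        have h2 : Continuous fun w : EuclideanSpace ℝ (Fin N) × EuclideanSpace ℝ (Fin N) =>
          z (w.1 - w.2) - z w.1 := by fun_prop
        exact h1.measurable.enorm.mul h2.measurable.enorm
    _ ≤ ∫⁻ t, ‖mollifier N k t‖ₑ *
          (ENNReal.ofReal (1 / ((k : ℝ) + 1)) * ∫⁻ x, ‖gradient z x‖ₑ) := by
        refine lintegral_mono fun t => ?_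
        rw [lintegral_const_mul' _ _ enorm_ne_top]
        rcases le_or_gt (1 / ((k : ℝ) + 1)) ‖t‖ with h | h
        · rw [mollifier_eq_zero h]; simp
        · refine mul_le_mul' le_rfl ((lintegral_enorm_translate_sub_le hz t).trans
            (mul_le_mul' ?_ le_rfl))
          rw [← ofReal_norm]
          exact ENNReal.ofReal_le_ofReal h.le
    _ = _ := by
        rw [lintegral_mul_const _ hρc.measurable.enorm, hρ1, one_mul]

/-- Mollifications of functions bounded in `L¹` are bounded and equi-Lipschitz. -/
theorem exists_mollify_bound (N k : ℕ) (A : NNReal) :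
    ∃ B, 0 ≤ B ∧ ∀ z : EuclideanSpace ℝ (Fin N) → ℝ, Continuous z → HasCompactSupport z →
      ∫⁻ x, ‖z x‖ₑ ≤ A → (∀ x, |mollify k z x| ≤ B) ∧
        ∀ x y, |mollify k z x - mollify k z y| ≤ B * ‖x - y‖ := by
  obtain ⟨C, hC⟩ := (hasCompactSupport_mollifier N k).exists_bound_of_continuous
    (contDiff_mollifier N k).continuous
  obtain ⟨L, hL⟩ := ((contDiff_mollifier N k).of_le
    (by exact_mod_cast le_top)).lipschitzWith_of_hasCompactSupport
    (hasCompactSupport_mollifier N k) (one_ne_zero (α := WithTop ℕ∞))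
  refine ⟨(|C| + L) * A, by positivity, fun z hz hzc hA => ?_⟩
  have hzi : Integrable z := hz.integrable_of_hasCompactSupport hzc
  have hzA : ∫ x, |z x| ≤ A := by
    have h1 : ∫ x, ‖z x‖ = (∫⁻ x, ‖z x‖ₑ).toReal := integral_norm_eq_lintegral_enorm hzi.1
    simp only [Real.norm_eq_abs] at h1
    rw [h1]
    exact ENNReal.toReal_le_coe_of_le_coe hA
  have hint : ∀ x, Integrable fun t => mollifier N k (x - t) • z t := fun x =>
    integrable_mollify hz.locallyIntegrable k x
  have hbd : ∀ (d : EuclideanSpace ℝ (Fin N) → ℝ) (c : ℝ), 0 ≤ c → (∀ t, |d t| ≤ c) →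
      |∫ t, d t • z t| ≤ c * A := by
    intro d c hc hd
    refine (norm_integral_le_integral_norm (fun t => d t • z t)).trans ?_
    calc ∫ t, ‖d t • z t‖ ≤ ∫ t, c * |z t| := by
          refine integral_mono_of_nonneg (Eventually.of_forall fun t => norm_nonneg _)
            (hzi.abs.const_mul c) (Eventually.of_forall fun t => ?_)
          dsimp only
          rw [norm_smul, Real.norm_eq_abs, Real.norm_eq_abs]
          exact mul_le_mul_of_nonneg_right (hd t) (abs_nonneg _)
      _ = c * ∫ t, |z t| := integral_const_mul _ _
      _ ≤ c * A := mul_le_mul_of_nonneg_left hzA hc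
  have hA0 : (0 : ℝ) ≤ A := A.2
  have hL0 : (0 : ℝ) ≤ L := L.2
  constructor
  · intro x
    rw [mollify_apply]
    refine (hbd _ |C| (abs_nonneg _) fun t => (hC _).trans (le_abs_self _)).trans ?_
    nlinarith
  · intro x y
    rw [mollify_apply, mollify_apply, ← integral_sub (hint x) (hint y)]
    simp only [← sub_smul]
    refine (hbd _ (L * ‖x - y‖) (by positivity) fun t => ?_).trans ?_
    · have := hL.dist_le_mul (x - t) (y - t)
      rw [Real.dist_eq, dist_eq_norm] at this
      simpa using this
    · have : 0 ≤ |C| * A * ‖x - y‖ := by positivity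
      nlinarith

theorem mollify_eq_zero {k : ℕ} {z : EuclideanSpace ℝ (Fin N) → ℝ} {ρ : ℝ}
    (hz : ∀ x, ρ ≤ ‖x‖ → z x = 0) {x : EuclideanSpace ℝ (Fin N)} (hx : ρ + 1 ≤ ‖x‖) :
    mollify k z x = 0 := by
  rw [mollify_apply]
  refine integral_eq_zero_of_ae (Eventually.of_forall fun t => ?_)
  rcases le_or_gt (1 / ((k : ℝ) + 1)) ‖x - t‖ with h | h
  · simp [mollifier_eq_zero h]
  · have h1 : 1 / ((k : ℝ) + 1) ≤ 1 := by
      rw [div_le_one (by positivity)]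
      linarith [Nat.cast_nonneg (α := ℝ) k]
    have h2 := norm_sub_norm_le x t
    simp [hz t (by linarith)]

/-- A sequence of smooth functions supported in a common ball with `L¹` bounds whose mollifications
converge pointwise is a Cauchy sequence in `L¹`. -/
theorem tendsto_lintegral_of_mollify {z : ℕ → EuclideanSpace ℝ (Fin N) → ℝ} {ρ : ℝ} {A : NNReal}
    (hz : ∀ n, ContDiff ℝ 1 (z n)) (hc : ∀ n, HasCompactSupport (z n))
    (hρ : ∀ n x, ρ ≤ ‖x‖ → z n x = 0) (hA : ∀ n, ∫⁻ x, ‖z n x‖ₑ ≤ A)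
    (hA' : ∀ n, ∫⁻ x, ‖gradient (z n) x‖ₑ ≤ A)
    (hlim : ∀ k x, Tendsto (fun i : ℕ × ℕ => mollify k (z i.1) x - mollify k (z i.2) x)
      atTop (𝓝 0)) :
    Tendsto (fun i : ℕ × ℕ => ∫⁻ x, ‖z i.1 x - z i.2 x‖ₑ) atTop (𝓝 0) := by
  have hmol : ∀ k, Tendsto (fun i : ℕ × ℕ =>
      ∫⁻ x, ‖mollify k (z i.1) x - mollify k (z i.2) x‖ₑ) atTop (𝓝 0) := by
    intro k
    obtain ⟨B, hB, hb⟩ := exists_mollify_bound N k A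
    rw [← lintegral_zero (α := EuclideanSpace ℝ (Fin N)) (μ := volume)]
    refine tendsto_lintegral_filter_of_dominated_convergence
      ((Metric.closedBall 0 (ρ + 1)).indicator fun _ => ENNReal.ofReal (B + B))
      (Eventually.of_forall fun i => ?_) (Eventually.of_forall fun i =>
        Eventually.of_forall fun x => ?_) ?_ (Eventually.of_forall fun x => ?_)
    · exact ((continuous_mollify (hz _).continuous.locallyIntegrable k).sub
        (continuous_mollify (hz _).continuous.locallyIntegrable k)).measurable.enorm
    · by_cases hx : x ∈ Metric.closedBall (0 : EuclideanSpace ℝ (Fin N)) (ρ + 1)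
      · rw [indicator_of_mem hx, ← ofReal_norm]
        refine ENNReal.ofReal_le_ofReal ((norm_sub_le _ _).trans (add_le_add ?_ ?_))
        · exact (hb (z i.1) (hz _).continuous (hc _) (hA _)).1 x
        · exact (hb (z i.2) (hz _).continuous (hc _) (hA _)).1 x
      · rw [mem_closedBall_zero_iff, not_le] at hx
        rw [mollify_eq_zero (hρ _) hx.le, mollify_eq_zero (hρ _) hx.le]
        simp
    · rw [lintegral_indicator Metric.isClosed_closedBall.measurableSet, setLIntegral_const]
      exact (ENNReal.mul_lt_top ENNReal.ofReal_lt_top measure_closedBall_lt_top).ne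
    · have := (hlim k x).enorm
      simpa using this
  rw [ENNReal.tendsto_nhds_zero]
  intro e he
  -- The gradient bound makes the mollification error small uniformly in the sequence, so `k` is
  -- fixed first. For that `k` the mollifications are Cauchy by dominated convergence on a fixed
  -- ball.
  obtain ⟨k, hk⟩ : ∃ k : ℕ, ENNReal.ofReal (1 / ((k : ℝ) + 1)) * A ≤ e / 3 := by
    have h1 : Tendsto (fun k : ℕ => ENNReal.ofReal (1 / ((k : ℝ) + 1)) * A) atTop (𝓝 0) := by
      have h2 := ENNReal.tendsto_ofReal (tendsto_one_div_add_atTop_nhds_zero_nat (𝕜 := ℝ))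
      simpa using ENNReal.Tendsto.mul_const h2 (Or.inr ENNReal.coe_ne_top)
    have h3 : (0 : ENNReal) < e / 3 := ENNReal.div_pos he.ne' (by simp)
    exact ((ENNReal.tendsto_nhds_zero.1 h1) _ h3).exists
  have h3 : (0 : ENNReal) < e / 3 := ENNReal.div_pos he.ne' (by simp)
  filter_upwards [(ENNReal.tendsto_nhds_zero.1 (hmol k)) _ h3] with i hi
  have hm : ∀ n, AEMeasurable (fun x => ‖mollify k (z n) x - z n x‖ₑ) := fun n =>
    ((continuous_mollify (hz _).continuous.locallyIntegrable k).sub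
      (hz _).continuous).measurable.enorm.aemeasurable
  have hmk : ∀ n, ∫⁻ x, ‖mollify k (z n) x - z n x‖ₑ ≤ e / 3 := fun n =>
    (lintegral_enorm_mollify_sub_le (hz n) k).trans ((mul_le_mul' le_rfl (hA' n)).trans hk)
  calc ∫⁻ x, ‖z i.1 x - z i.2 x‖ₑ
      ≤ ∫⁻ x, (‖mollify k (z i.1) x - z i.1 x‖ₑ + ‖mollify k (z i.2) x - z i.2 x‖ₑ
        + ‖mollify k (z i.1) x - mollify k (z i.2) x‖ₑ) := by
        refine lintegral_mono fun x => ?_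
        have e1 : z i.1 x - z i.2 x = -(mollify k (z i.1) x - z i.1 x)
          + (mollify k (z i.2) x - z i.2 x) + (mollify k (z i.1) x - mollify k (z i.2) x) := by
          ring
        dsimp only
        rw [e1]
        refine (enorm_add_le _ _).trans (add_le_add ((enorm_add_le _ _).trans ?_) le_rfl)
        rw [enorm_neg]
    _ = (∫⁻ x, ‖mollify k (z i.1) x - z i.1 x‖ₑ) + (∫⁻ x, ‖mollify k (z i.2) x - z i.2 x‖ₑ)
        + ∫⁻ x, ‖mollify k (z i.1) x - mollify k (z i.2) x‖ₑ := by
        rw [← lintegral_add_left' (hm _)]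
        exact lintegral_add_left' ((hm _).add (hm _)) _
    _ ≤ e / 3 + e / 3 + e / 3 := add_le_add (add_le_add (hmk _) (hmk _)) hi
    _ = e := ENNReal.add_thirds e

theorem exists_cutoff_mul_bound {v : ℕ → EuclideanSpace ℝ (Fin N) → ℝ}
    (hv : ∀ n, ContDiff ℝ (⊤ : ℕ∞) (v n)) {R : ℝ} (hR : 0 < R) {A : NNReal}
    (hA : ∀ n, ∫⁻ x in Metric.closedBall 0 (2 * R), ‖v n x‖ₑ ≤ A ∧
      ∫⁻ x in Metric.closedBall 0 (2 * R), ‖gradient (v n) x‖ₑ ≤ A) :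
    ∃ A' : NNReal, ∀ n, ∫⁻ x, ‖cutoff R x * v n x‖ₑ ≤ A' ∧
      ∫⁻ x, ‖gradient (fun y => cutoff R y * v n y) x‖ₑ ≤ A' := by
  obtain ⟨C, hC, hcut⟩ := exists_norm_gradient_cutoff_le N
  set c : NNReal := Real.toNNReal (C / R) with hc
  have hm : MeasurableSet (Metric.closedBall (0 : EuclideanSpace ℝ (Fin N)) (2 * R)) :=
    Metric.isClosed_closedBall.measurableSet
  have hout : ∀ n x, x ∉ Metric.closedBall (0 : EuclideanSpace ℝ (Fin N)) (2 * R) →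
      (fun y => cutoff R y * v n y) =ᶠ[𝓝 x] fun _ => 0 := fun n x hx => by
    filter_upwards [Metric.isClosed_closedBall.isOpen_compl.mem_nhds hx] with y hy
    rw [mem_compl_iff, mem_closedBall_zero_iff, not_le] at hy
    rw [cutoff_eq_zero hR hy.le, zero_mul]
  have hle : ∀ x : EuclideanSpace ℝ (Fin N), ‖cutoff R x‖ₑ ≤ 1 := fun x => by
    rw [← ofReal_norm, Real.norm_of_nonneg (cutoff_nonneg R x)]
    exact ENNReal.ofReal_le_one.2 (cutoff_le_one R x)
  refine ⟨A + c * A, fun n => ⟨?_, ?_⟩⟩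
  · have h1 : ∫⁻ x, ‖cutoff R x * v n x‖ₑ ≤ ∫⁻ x in Metric.closedBall 0 (2 * R), ‖v n x‖ₑ := by
      rw [← lintegral_indicator hm]
      refine lintegral_mono fun x => ?_
      by_cases hx : x ∈ Metric.closedBall (0 : EuclideanSpace ℝ (Fin N)) (2 * R)
      · rw [indicator_of_mem hx, enorm_mul]
        exact mul_le_of_le_one_left' (hle x)
      · have := (hout n x hx).self_of_nhds
        dsimp only at this
        rw [this]; simp
    refine h1.trans ((hA n).1.trans ?_)
    exact_mod_cast le_self_add
  · have h1 : ∫⁻ x, ‖gradient (fun y => cutoff R y * v n y) x‖ₑ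
        ≤ ∫⁻ x in Metric.closedBall 0 (2 * R), (‖gradient (v n) x‖ₑ + c * ‖v n x‖ₑ) := by
      rw [← lintegral_indicator hm]
      refine lintegral_mono fun x => ?_
      by_cases hx : x ∈ Metric.closedBall (0 : EuclideanSpace ℝ (Fin N)) (2 * R)
      · rw [indicator_of_mem hx, gradient_mul (contDiff_cutoff R) (hv n)]
        refine (enorm_add_le _ _).trans (add_le_add ?_ ?_)
        · rw [enorm_smul]
          exact mul_le_of_le_one_left' (hle x)
        · rw [enorm_smul, mul_comm]
          refine mul_le_mul' ?_ le_rfl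
          rw [← ofReal_norm]
          exact ENNReal.ofReal_le_ofReal (hcut R hR x)
      · have : gradient (fun y => cutoff R y * v n y) x = 0 := by
          rw [gradient, (hout n x hx).fderiv_eq]; simp
        rw [this]; simp
    refine h1.trans ?_
    rw [lintegral_add_left' (continuous_gradient ((hv n).of_le
      (by exact_mod_cast le_top))).measurable.enorm.aemeasurable,
      lintegral_const_mul' _ _ ENNReal.coe_ne_top]
    push_cast
    exact add_le_add (hA n).2 (mul_le_mul' le_rfl (hA n).1)

/-- An equi-Lipschitz sequence that converges on a dense set is pointwise a Cauchy sequence. -/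
theorem tendsto_sub_of_denseRange {E : Type*} [SeminormedAddCommGroup E] {m : ℕ → E → ℝ}
    {Q : ℕ → E} {B : ℝ} (hB : 0 ≤ B) (hL : ∀ n x y, |m n x - m n y| ≤ B * ‖x - y‖)
    (hQ : DenseRange Q) (hlim : ∀ j, ∃ c, Tendsto (fun n => m n (Q j)) atTop (𝓝 c)) (x : E) :
    Tendsto (fun i : ℕ × ℕ => m i.1 x - m i.2 x) atTop (𝓝 0) := by
  rw [Metric.tendsto_nhds]
  intro e he
  obtain ⟨j, hj⟩ := hQ.exists_dist_lt x (show 0 < e / (3 * (B + 1)) by positivity)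
  obtain ⟨c, h1⟩ := hlim j
  rw [← prod_atTop_atTop_eq]
  have h2 : Tendsto (fun i : ℕ × ℕ => m i.1 (Q j) - m i.2 (Q j)) (atTop ×ˢ atTop) (𝓝 (c - c)) :=
    (h1.comp tendsto_fst).sub (h1.comp tendsto_snd)
  rw [sub_self] at h2
  filter_upwards [Metric.tendsto_nhds.1 h2 (e / 3) (by linarith)] with n hn
  rw [dist_zero_right, Real.norm_eq_abs] at hn ⊢
  have hd' : B * ‖x - Q j‖ ≤ e / 3 := by
    rw [dist_eq_norm, lt_div_iff₀ (by positivity)] at hj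
    nlinarith [norm_nonneg (x - Q j)]
  have h4 := (abs_le.1 (hL n.1 x (Q j)))
  have h5 := (abs_le.1 (hL n.2 x (Q j)))
  rw [abs_lt] at hn ⊢
  constructor <;> linarith [h4.1, h4.2, h5.1, h5.2, hn.1, hn.2]

/-- Compactness of a single countable product of intervals replaces iterated diagonal extractions.
The coordinate `(i, k, j)` records the `k`-th mollification of the `i`-th sequence at the `j`-th
point of a dense set, and equi-Lipschitz continuity carries the convergence to all points. -/
theorem exists_subseq_mollify {z : ℕ → ℕ → EuclideanSpace ℝ (Fin N) → ℝ} {A : ℕ → NNReal}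
    (hz : ∀ i n, Continuous (z i n)) (hc : ∀ i n, HasCompactSupport (z i n))
    (hA : ∀ i n, ∫⁻ x, ‖z i n x‖ₑ ≤ A i) :
    ∃ σ : ℕ → ℕ, StrictMono σ ∧ ∀ i k x, Tendsto (fun j : ℕ × ℕ =>
      mollify k (z i (σ j.1)) x - mollify k (z i (σ j.2)) x) atTop (𝓝 0) := by
  choose B hB hBb using fun i k => exists_mollify_bound N k (A i)
  have hBz := fun i k n => hBb i k (z i n) (hz i n) (hc i n) (hA i n)
  set Q := TopologicalSpace.denseSeq (EuclideanSpace ℝ (Fin N)) with hQ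
  have hcomp : IsCompact (univ.pi fun j : ℕ × ℕ × ℕ => Icc (-B j.1 j.2.1) (B j.1 j.2.1)) :=
    isCompact_univ_pi fun j => isCompact_Icc
  have hmem : ∀ n : ℕ, (fun j : ℕ × ℕ × ℕ => mollify j.2.1 (z j.1 n) (Q j.2.2))
      ∈ univ.pi fun j : ℕ × ℕ × ℕ => Icc (-B j.1 j.2.1) (B j.1 j.2.1) :=
    fun n j _ => abs_le.1 ((hBz j.1 j.2.1 n).1 _)
  obtain ⟨y, -, σ, hσ, hy⟩ := hcomp.tendsto_subseq hmem
  rw [tendsto_pi_nhds] at hy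
  exact ⟨σ, hσ, fun i k x => tendsto_sub_of_denseRange (m := fun n => mollify k (z i (σ n)))
    (hB i k) (fun n => (hBz i k (σ n)).2) (TopologicalSpace.denseRange_denseSeq _)
    (fun j => ⟨_, hy (i, k, j)⟩) x⟩

/-- Local compactness in `L¹` of sequences of smooth functions with local `W^{1,1}` bounds. -/
theorem exists_subseq_cauchy_L1 {v : ℕ → EuclideanSpace ℝ (Fin N) → ℝ}
    (hv : ∀ n, ContDiff ℝ (⊤ : ℕ∞) (v n))
    (hb : ∀ R : ℝ, ∃ A : NNReal, ∀ n, ∫⁻ x in Metric.closedBall 0 R, ‖v n x‖ₑ ≤ A ∧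
      ∫⁻ x in Metric.closedBall 0 R, ‖gradient (v n) x‖ₑ ≤ A) :
    ∃ σ : ℕ → ℕ, StrictMono σ ∧ ∀ R : ℝ, Tendsto (fun i : ℕ × ℕ =>
      ∫⁻ x in Metric.closedBall 0 R, ‖v (σ i.1) x - v (σ i.2) x‖ₑ) atTop (𝓝 0) := by
  set z : ℕ → ℕ → EuclideanSpace ℝ (Fin N) → ℝ :=
    fun i n x => cutoff ((i : ℝ) + 1) x * v n x with hzdef
  have hi0 : ∀ i : ℕ, (0 : ℝ) < (i : ℝ) + 1 := fun i => by positivity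
  have hzs : ∀ i n, ContDiff ℝ (⊤ : ℕ∞) (z i n) := fun i n => (contDiff_cutoff _).mul (hv n)
  have hz1 : ∀ i n, ContDiff ℝ 1 (z i n) := fun i n => (hzs i n).of_le (by exact_mod_cast le_top)
  have hzc : ∀ i n, HasCompactSupport (z i n) := fun i n =>
    (hasCompactSupport_cutoff (hi0 i)).mul_right
  have hz0 : ∀ (i n : ℕ) x, 2 * ((i : ℝ) + 1) ≤ ‖x‖ → z i n x = 0 := fun i n x hx => by
    simp only [hzdef]
    rw [cutoff_eq_zero (hi0 i) hx, zero_mul]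
  have hbound : ∀ i, ∃ A : NNReal, ∀ n, ∫⁻ x, ‖z i n x‖ₑ ≤ A ∧
      ∫⁻ x, ‖gradient (z i n) x‖ₑ ≤ A := fun i =>
    exists_cutoff_mul_bound hv (hi0 i) (hb (2 * ((i : ℝ) + 1))).choose_spec
  choose A hA using hbound
  obtain ⟨σ, hσ, hy⟩ := exists_subseq_mollify (fun i n => (hz1 i n).continuous) hzc
    fun i n => (hA i n).1
  refine ⟨σ, hσ, fun R => ?_⟩
  obtain ⟨i, hi⟩ := exists_nat_ge R
  have hlim := tendsto_lintegral_of_mollify (z := fun n => z i (σ n)) (fun n => hz1 i _)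
    (fun n => hzc i _) (fun n => hz0 i _) (fun n => (hA i _).1) (fun n => (hA i _).2)
    (fun k x => hy i k x)
  refine tendsto_of_tendsto_of_tendsto_of_le_of_le tendsto_const_nhds hlim
    (fun _ => zero_le) fun n => ?_
  dsimp only
  refine le_trans (setLIntegral_mono' Metric.isClosed_closedBall.measurableSet fun x hx => ?_)
    (setLIntegral_le_lintegral (Metric.closedBall 0 R) _)
  rw [mem_closedBall_zero_iff] at hx
  simp only [hzdef]
  rw [cutoff_eq_one (hi0 i) (by linarith), one_mul, one_mul]

end Compactness
end OrliczNehari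

/-! ### Monotonicity of φ(|x|)x and its (S₊) property -/

namespace OrliczNehari

/-- The counterpart of `a_mul_le_eps` with the small coefficient on the argument of the density. The
threshold is `t = d s`, where `d q ≤ δ`. -/
theorem YoungPair.a_mul_le_eps' {a M : ℝ → ℝ} {p q : ℝ} (Y : YoungPair a M p q) {δ : ℝ}
    (hδ : 0 < δ) :
    ∃ K : ℝ, 0 ≤ K ∧ ∀ s t, 0 ≤ s → 0 ≤ t → a s * t ≤ δ * M s + K * M t := by
  have hq := Y.q_pos
  set d := min 1 (δ / q) with hd
  have hd0 : 0 < d := by positivity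
  have hd1 : 1 ≤ d⁻¹ := (one_le_inv₀ hd0).2 (min_le_left _ _)
  have hdq : d * q ≤ δ := by
    have := min_le_right 1 (δ / q)
    rwa [le_div_iff₀ hq] at this
  refine ⟨q * (d⁻¹) ^ q, by positivity, fun s t hs ht => ?_⟩
  have hMs := Y.nonneg hs
  have hMt := Y.nonneg ht
  rcases le_total t (d * s) with h | h
  · have h1 := mul_le_mul_of_nonneg_left h (Y.a_nonneg s hs)
    have h2 := mul_le_mul_of_nonneg_left (Y.upper s hs) hd0.le
    have h3 := mul_le_mul_of_nonneg_right hdq hMs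
    have h4 : 0 ≤ q * (d⁻¹) ^ q * M t := by positivity
    linarith
  · have hst : s ≤ d⁻¹ * t := by rw [le_inv_mul_iff₀ hd0]; exact h
    have ht' : 0 ≤ d⁻¹ * t := by positivity
    have h1 := mul_le_mul_of_nonneg_right (Y.a_mono hs ht' hst) ht
    have h2 : t ≤ d⁻¹ * t := le_mul_of_one_le_left ht hd1
    have h3 := mul_le_mul_of_nonneg_left h2 (Y.a_nonneg _ ht')
    have h4 := Y.upper _ ht'
    have h5 := mul_le_mul_of_nonneg_left (Y.scale_ge d⁻¹ t hd1 ht) hq.le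
    have h6 : 0 ≤ δ * M s := by positivity
    linarith

section Monotonicity

variable {N : ℕ} {φ : ℝ → ℝ} {l m : ℝ} {E : Type*} [NormedAddCommGroup E] [InnerProductSpace ℝ E]

/-- `(A x - A y) · (x - y)` for `A x = φ(|x|) x`. -/
noncomputable def monoGap (φ : ℝ → ℝ) (x y : E) : ℝ :=
  inner ℝ (φ ‖x‖ • x - φ ‖y‖ • y) (x - y)

namespace PhiAssumptions

theorem norm_smul_eq (h : PhiAssumptions N φ l m) (x : E) : ‖φ ‖x‖ • x‖ = mulExt φ ‖x‖ := by
  rcases eq_or_ne x 0 with rfl | hx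
  · simp [mulExt]
  · have h0 : 0 < ‖x‖ := norm_pos_iff.2 hx
    rw [norm_smul, Real.norm_eq_abs, abs_of_pos (h.pos _ h0), mulExt_of_pos h0]

theorem inner_smul_eq (φ : ℝ → ℝ) (x : E) :
    inner ℝ (φ ‖x‖ • x) x = mulExt φ ‖x‖ * ‖x‖ := by
  rcases eq_or_ne x 0 with rfl | hx
  · simp
  · have h0 : 0 < ‖x‖ := norm_pos_iff.2 hx
    rw [real_inner_smul_left, real_inner_self_eq_norm_sq, mulExt_of_pos h0]
    ring

theorem abs_inner_smul_le (h : PhiAssumptions N φ l m) (x y : E) :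
    |inner ℝ (φ ‖x‖ • x) y| ≤ mulExt φ ‖x‖ * ‖y‖ := by
  rw [← h.norm_smul_eq]
  exact abs_real_inner_le_norm _ _

/-- The diagonal terms depend on the norms only, and Cauchy–Schwarz bounds the two mixed terms; the
vector gap is thus at least the scalar one. -/
theorem mul_sub_mul_le_monoGap (h : PhiAssumptions N φ l m) (x y : E) :
    (mulExt φ ‖x‖ - mulExt φ ‖y‖) * (‖x‖ - ‖y‖) ≤ monoGap φ x y := by
  have h1 := (abs_le.1 (h.abs_inner_smul_le x y)).2
  have h2 := (abs_le.1 (h.abs_inner_smul_le y x)).2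
  rw [monoGap, inner_sub_left, inner_sub_right, inner_sub_right, inner_smul_eq,
    inner_smul_eq]
  linarith

theorem monoGap_nonneg (h : PhiAssumptions N φ l m) (x y : E) : 0 ≤ monoGap φ x y := by
  refine le_trans ?_ (h.mul_sub_mul_le_monoGap x y)
  rcases le_total ‖x‖ ‖y‖ with hxy | hxy
  · exact mul_nonneg_of_nonpos_of_nonpos (sub_nonpos.2 (h.mulExt_mono hxy)) (sub_nonpos.2 hxy)
  · exact mul_nonneg (sub_nonneg.2 (h.mulExt_mono hxy)) (sub_nonneg.2 hxy)

theorem mulExt_lt (h : PhiAssumptions N φ l m) {s t : ℝ} (hs : 0 ≤ s) (hst : s < t) :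
    mulExt φ s < mulExt φ t := by
  have ht : 0 < t := hs.trans_lt hst
  rcases hs.lt_or_eq with h0 | rfl
  · rw [mulExt_of_pos h0, mulExt_of_pos ht]
    exact h.strictMonoOn_mul (mem_Ioi.2 h0) (mem_Ioi.2 ht) hst
  · rw [mulExt_of_pos ht, mulExt_of_nonpos le_rfl]
    exact mul_pos (h.pos t ht) ht

/-- For different norms the density is strictly monotone; for equal norms the gap is `φ(‖x‖) ‖x -
y‖²`. -/
theorem monoGap_pos (h : PhiAssumptions N φ l m) {x y : E} (hxy : x ≠ y) :
    0 < monoGap φ x y := by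
  rcases lt_trichotomy ‖x‖ ‖y‖ with hlt | heq | hlt
  · refine lt_of_lt_of_le ?_ (h.mul_sub_mul_le_monoGap x y)
    exact mul_pos_of_neg_of_neg (sub_neg.2 (h.mulExt_lt (norm_nonneg _) hlt)) (sub_neg.2 hlt)
  · have h0 : 0 < ‖x‖ := by
      rcases (norm_nonneg x).lt_or_eq with h0 | h0
      · exact h0
      · rw [← h0] at heq
        exact absurd ((norm_eq_zero.1 h0.symm).trans (norm_eq_zero.1 heq.symm).symm) hxy
    rw [monoGap, ← heq, ← smul_sub, real_inner_smul_left, real_inner_self_eq_norm_sq]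
    exact mul_pos (h.pos _ h0) (pow_pos (norm_pos_iff.2 (sub_ne_zero.2 hxy)) 2)
  · refine lt_of_lt_of_le ?_ (h.mul_sub_mul_le_monoGap x y)
    exact mul_pos (sub_pos.2 (h.mulExt_lt (norm_nonneg _) hlt)) (sub_pos.2 hlt)

theorem continuous_smul (h : PhiAssumptions N φ l m) : Continuous fun x : E => φ ‖x‖ • x :=
  (h.nemytskiiData (α := Unit) (μ := Measure.dirac ())).cont ()

theorem exists_le_monoGap [FiniteDimensional ℝ E] (h : PhiAssumptions N φ l m) (K : ℝ) {δ : ℝ}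
    (hδ : 0 < δ) :
    ∃ κ > 0, ∀ x y : E, ‖x‖ ≤ K → ‖y‖ ≤ K → δ ≤ ‖x - y‖ → κ ≤ monoGap φ x y := by
  have : ProperSpace E := FiniteDimensional.proper ℝ E
  set T : Set (E × E) := (Metric.closedBall 0 K ×ˢ Metric.closedBall 0 K) ∩ {z | δ ≤ ‖z.1 - z.2‖}
    with hT
  have hTc : IsCompact T := ((isCompact_closedBall _ _).prod (isCompact_closedBall _ _)).inter_right
    (isClosed_le continuous_const (by fun_prop))
  have hc : Continuous fun z : E × E => monoGap φ z.1 z.2 := by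
    have h1 := h.continuous_smul (E := E)
    exact ((h1.comp continuous_fst).sub (h1.comp continuous_snd)).inner
      (continuous_fst.sub continuous_snd)
  obtain ⟨κ, hκ, hb⟩ := hTc.exists_forall_le' (a := 0) hc.continuousOn fun z hz => by
    refine h.monoGap_pos fun he => ?_
    have h1 : δ ≤ ‖z.1 - z.2‖ := hz.2
    rw [he, sub_self, norm_zero] at h1
    linarith
  exact ⟨κ, hκ, fun x y hx hy hxy => hb (x, y)
    ⟨⟨by simpa using hx, by simpa using hy⟩, hxy⟩⟩

/-- The mixed terms of the gap cost at most `Φ(‖x‖) / 4` each plus a multiple of `Φ(‖y‖)`, while the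
diagonal term is at least `l Φ(‖x‖) ≥ Φ(‖x‖)`. With `y` held fixed, a small gap makes `Φ(‖x‖)`
dominated up to a small error. -/
theorem exists_nFun_le_add_monoGap (h : PhiAssumptions N φ l m) :
    ∃ K, 0 ≤ K ∧ ∀ x y : E, nFun φ ‖x‖ ≤ K * nFun φ ‖y‖ + 2 * monoGap φ x y := by
  have Y := h.youngPair
  obtain ⟨K₁, hK₁, h₁⟩ := Y.a_mul_le_eps (δ := 1 / 4) (by norm_num)
  obtain ⟨K₂, hK₂, h₂⟩ := Y.a_mul_le_eps' (δ := 1 / 4) (by norm_num)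
  refine ⟨2 * (K₁ + K₂), by positivity, fun x y => ?_⟩
  have h3 := (abs_le.1 (h.abs_inner_smul_le x y)).2
  have h4 := (abs_le.1 (h.abs_inner_smul_le y x)).2
  have h5 := h₂ ‖x‖ ‖y‖ (norm_nonneg _) (norm_nonneg _)
  have h6 := h₁ ‖y‖ ‖x‖ (norm_nonneg _) (norm_nonneg _)
  have h7 := Y.lower ‖x‖ (norm_nonneg _)
  have h8 := mul_nonneg (h.mulExt_nonneg ‖y‖) (norm_nonneg y)
  have h9 := h.nFun_nonneg ‖x‖
  have h10 := h.one_lt_l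
  rw [monoGap, inner_sub_left, inner_sub_right, inner_sub_right, inner_smul_eq,
    inner_smul_eq]
  nlinarith

end PhiAssumptions

end Monotonicity

section Convergence

variable {α E : Type*} [MeasurableSpace α] {μ : Measure α}

/-- Here the dominating function may depend on the tolerance. This freedom is needed because it will
be built from one late member of the sequence. -/
theorem tendsto_lintegral_zero_of_forall {f : ℕ → α → ENNReal} (hf : ∀ n, AEMeasurable (f n) μ)
    (hlim : ∀ᵐ x ∂μ, Tendsto (fun n => f n x) atTop (𝓝 0))
    (hb : ∀ δ > 0, ∃ G : α → ENNReal, AEMeasurable G μ ∧ ∫⁻ x, G x ∂μ ≠ ⊤ ∧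
      ∀ᶠ n in atTop, ∃ e : α → ENNReal, (∀ᵐ x ∂μ, f n x ≤ G x + e x) ∧ ∫⁻ x, e x ∂μ ≤ δ) :
    Tendsto (fun n => ∫⁻ x, f n x ∂μ) atTop (𝓝 0) := by
  rw [ENNReal.tendsto_nhds_zero]
  intro δ hδ
  have hδ2 : 0 < δ / 2 := ENNReal.div_pos hδ.ne' (by simp)
  obtain ⟨G, hG, hGi, hev⟩ := hb (δ / 2) hδ2
  have h1 : Tendsto (fun n => ∫⁻ x, min (f n x) (G x) ∂μ) atTop (𝓝 0) := by
    rw [← lintegral_zero (α := α) (μ := μ)]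
    refine tendsto_lintegral_of_dominated_convergence' G (fun n => (hf n).min hG)
      (fun n => Eventually.of_forall fun x => min_le_right _ _) hGi ?_
    filter_upwards [hlim] with x hx
    exact tendsto_of_tendsto_of_tendsto_of_le_of_le tendsto_const_nhds hx
      (fun _ => zero_le) fun n => min_le_left _ _
  filter_upwards [hev, (ENNReal.tendsto_nhds_zero.1 h1) _ hδ2] with n hn hn'
  obtain ⟨e, he, hei⟩ := hn
  calc ∫⁻ x, f n x ∂μ ≤ ∫⁻ x, (min (f n x) (G x) + e x) ∂μ := by
        refine lintegral_mono_ae (he.mono fun x hx => ?_)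
        rcases le_total (f n x) (G x) with h | h
        · rw [min_eq_left h]; exact le_self_add
        · rwa [min_eq_right h]
    _ = (∫⁻ x, min (f n x) (G x) ∂μ) + ∫⁻ x, e x ∂μ := lintegral_add_left' ((hf n).min hG) _
    _ ≤ δ / 2 + δ / 2 := add_le_add hn' hei
    _ = δ := ENNReal.add_halves δ

variable [NormedAddCommGroup E]

/-- A sequence that is Cauchy in measure has an almost everywhere convergent subsequence. -/
theorem exists_subseq_ae_of_cauchy_measure [CompleteSpace E] {w : ℕ → α → E}
    (hw : ∀ n, AEStronglyMeasurable (w n) μ)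
    (hc : ∀ δ > 0, Tendsto (fun i : ℕ × ℕ => μ {x | δ ≤ ‖w i.1 x - w i.2 x‖}) atTop (𝓝 0)) :
    ∃ (σ : ℕ → ℕ) (z : α → E), StrictMono σ ∧ StronglyMeasurable z ∧
      ∀ᵐ x ∂μ, Tendsto (fun n => w (σ n) x) atTop (𝓝 (z x)) := by
  have hev : ∀ n : ℕ, ∀ᶠ k : ℕ in atTop, ∀ i ≥ k, ∀ j ≥ k,
      μ {x | (1 / 2 : ℝ) ^ n ≤ ‖w i x - w j x‖} ≤ (1 / 2 : ENNReal) ^ n := by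
    intro n
    have h1 := (ENNReal.tendsto_nhds_zero.1 (hc ((1 / 2 : ℝ) ^ n) (by positivity)))
      ((1 / 2 : ENNReal) ^ n) (ENNReal.pow_pos (by simp) n)
    obtain ⟨k, hk⟩ := eventually_atTop.1 h1
    filter_upwards [eventually_ge_atTop (max k.1 k.2)] with k' hk' i hi j hj
    exact hk (i, j) ⟨((le_max_left _ _).trans hk').trans hi, ((le_max_right _ _).trans hk').trans hj⟩
  -- The measures of the exceptional sets are summable along this subsequence. By Borel–Cantelli the
  -- successive differences decay geometrically almost everywhere.
  obtain ⟨σ, hσ, hs⟩ := extraction_forall_of_eventually hev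
  have hsum : ∑' n, μ {x | (1 / 2 : ℝ) ^ n ≤ ‖w (σ n) x - w (σ (n + 1)) x‖} ≠ ⊤ := by
    refine ne_top_of_le_ne_top ?_ (ENNReal.tsum_le_tsum fun n =>
      hs n _ le_rfl _ (hσ.monotone (Nat.le_succ n)))
    rw [ENNReal.tsum_geometric, ENNReal.inv_ne_top]
    simp
  have hae := ae_eventually_notMem hsum
  have hlim : ∀ᵐ x ∂μ, ∃ l, Tendsto (fun n => w (σ n) x) atTop (𝓝 l) := by
    filter_upwards [hae] with x hx
    obtain ⟨n₀, hn₀⟩ := eventually_atTop.1 hx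
    have hcs : CauchySeq fun n => w (σ (n + n₀)) x := by
      refine cauchySeq_of_le_geometric (1 / 2) 1 (by norm_num) fun n => ?_
      have := hn₀ (n + n₀) (Nat.le_add_left _ _)
      simp only [not_le] at this
      rw [dist_eq_norm, one_mul, show n + 1 + n₀ = n + n₀ + 1 by ring]
      exact this.le.trans (pow_le_pow_of_le_one (by norm_num) (by norm_num) (Nat.le_add_right _ _))
    obtain ⟨l, hl⟩ := cauchySeq_tendsto_of_complete hcs
    exact ⟨l, (tendsto_add_atTop_iff_nat n₀).1 hl⟩
  obtain ⟨z, hz, hzlim⟩ := exists_stronglyMeasurable_limit_of_tendsto_ae (fun n => hw (σ n)) hlim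
  exact ⟨σ, z, hσ, hz, hzlim⟩

variable [InnerProductSpace ℝ E] [FiniteDimensional ℝ E] {N : ℕ} {φ : ℝ → ℝ} {l m : ℝ}

/-- The operator `φ(|w|) w` is of type `(S₊)`. -/
theorem exists_subseq_modular_of_monoGap (h : PhiAssumptions N φ l m) {w : ℕ → α → E}
    (hw : ∀ n, AEStronglyMeasurable (w n) μ) {C : NNReal}
    (hC : ∀ n, modular (nFun φ) μ (w n) ≤ C)
    (hgap : Tendsto (fun i : ℕ × ℕ => ∫⁻ x, ENNReal.ofReal (monoGap φ (w i.1 x) (w i.2 x)) ∂μ)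
      atTop (𝓝 0)) :
    ∃ (σ : ℕ → ℕ) (z : α → E), StrictMono σ ∧ StronglyMeasurable z ∧
      modular (nFun φ) μ z ≤ C ∧
      Tendsto (fun n => modular (nFun φ) μ (w (σ n) - z)) atTop (𝓝 0) := by
  have Y := h.youngPair
  have : ProperSpace E := FiniteDimensional.proper ℝ E
  have hA := h.continuous_smul (E := E)
  have hgm : ∀ i j, AEStronglyMeasurable (fun x => monoGap φ (w i x) (w j x)) μ := fun i j =>
    ((hA.comp_aestronglyMeasurable (hw i)).sub (hA.comp_aestronglyMeasurable (hw j))).inner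
      ((hw i).sub (hw j))
  have hnm : ∀ u : α → E, AEStronglyMeasurable u μ →
      AEMeasurable (fun x => ENNReal.ofReal (nFun φ ‖u x‖)) μ := fun u hu =>
    (h.measurable_nFun.comp_aemeasurable hu.norm.aemeasurable).ennreal_ofReal
  -- Cauchy in measure: the modular bound makes `{‖w‖ ≥ K}` small, and where both terms are bounded
  -- by `K` but at distance at least `δ` the gap is at least some `κ > 0`, so Markov's inequality
  -- applies.
  have hcm : ∀ δ > 0, Tendsto (fun i : ℕ × ℕ => μ {x | δ ≤ ‖w i.1 x - w i.2 x‖}) atTop (𝓝 0) := by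
    intro δ hδ
    rw [ENNReal.tendsto_nhds_zero]
    intro e he
    have he3 : 0 < e / 3 := ENNReal.div_pos he.ne' (by simp)
    obtain ⟨K, hK1, hK⟩ : ∃ K : ℝ, 1 ≤ K ∧ C / ENNReal.ofReal (nFun φ K) ≤ e / 3 := by
      have h1 : Tendsto (fun K : ℝ => K * nFun φ 1) atTop atTop :=
        tendsto_id.atTop_mul_const (h.nFun_pos one_pos)
      have h2 : Tendsto (fun K : ℝ => (C : ENNReal) / ENNReal.ofReal (K * nFun φ 1)) atTop (𝓝 0) := by
        have h3 : Tendsto (fun K : ℝ => ENNReal.ofReal (K * nFun φ 1)) atTop (𝓝 ⊤) :=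
          ENNReal.tendsto_ofReal_atTop.comp h1
        have := ENNReal.Tendsto.const_div (a := (C : ENNReal)) h3 (Or.inr ENNReal.coe_ne_top)
        simpa using this
      obtain ⟨K, hK, hK1⟩ := (((ENNReal.tendsto_nhds_zero.1 h2) _ he3).and
        (eventually_ge_atTop 1)).exists
      refine ⟨K, hK1, (ENNReal.div_le_div_left (ENNReal.ofReal_le_ofReal ?_) _).trans hK⟩
      have hK0 : 0 < K := by linarith
      have h4 := Y.scale_le_mul (c := 1 / K) (t := K) (by positivity)
        (by rw [div_le_one hK0]; exact hK1) hK0.le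
      rw [one_div_mul_cancel hK0.ne', div_mul_eq_mul_div, one_mul, le_div_iff₀ hK0] at h4
      linarith
    obtain ⟨κ, hκ, hgapκ⟩ := h.exists_le_monoGap (E := E) K hδ
    have hK0 : 0 < nFun φ K := h.nFun_pos (by linarith)
    have hlarge : ∀ n, μ {x | K ≤ ‖w n x‖} ≤ e / 3 := by
      intro n
      refine le_trans ?_ hK
      refine le_trans (measure_mono fun x hx => ?_) ((meas_ge_le_lintegral_div (hnm _ (hw n))
        (ENNReal.ofReal_pos.2 hK0).ne' ENNReal.ofReal_ne_top).trans
        (ENNReal.div_le_div_right (hC n) _))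
      exact ENNReal.ofReal_le_ofReal (Y.mono (by simp; linarith) (norm_nonneg _) hx)
    have hκ3 : 0 < ENNReal.ofReal κ * (e / 3) :=
      ENNReal.mul_pos (ENNReal.ofReal_pos.2 hκ).ne' he3.ne'
    filter_upwards [(ENNReal.tendsto_nhds_zero.1 hgap) _ hκ3] with i hi
    have hmid : μ {x | ENNReal.ofReal κ ≤ ENNReal.ofReal (monoGap φ (w i.1 x) (w i.2 x))}
        ≤ e / 3 := by
      refine (meas_ge_le_lintegral_div (hgm _ _).aemeasurable.ennreal_ofReal
        (ENNReal.ofReal_pos.2 hκ).ne' ENNReal.ofReal_ne_top).trans ?_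
      refine ENNReal.div_le_of_le_mul ?_
      rw [mul_comm]
      exact hi
    calc μ {x | δ ≤ ‖w i.1 x - w i.2 x‖}
        ≤ μ ({x | K ≤ ‖w i.1 x‖} ∪ {x | K ≤ ‖w i.2 x‖} ∪
          {x | ENNReal.ofReal κ ≤ ENNReal.ofReal (monoGap φ (w i.1 x) (w i.2 x))}) := by
          refine measure_mono fun x hx => ?_
          by_cases h1 : K ≤ ‖w i.1 x‖
          · exact Or.inl (Or.inl h1)
          by_cases h2 : K ≤ ‖w i.2 x‖
          · exact Or.inl (Or.inr h2)
          · exact Or.inr (ENNReal.ofReal_le_ofReal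
              (hgapκ _ _ (not_le.1 h1).le (not_le.1 h2).le hx))
      _ ≤ e / 3 + e / 3 + e / 3 := (measure_union_le _ _).trans
          (add_le_add ((measure_union_le _ _).trans (add_le_add (hlarge _) (hlarge _))) hmid)
      _ = e := ENNReal.add_thirds e
  obtain ⟨σ, z, hσ, hz, hlim⟩ := exists_subseq_ae_of_cauchy_measure hw hcm
  have hcont : Continuous fun e : E => nFun φ ‖e‖ := by
    have := (h.nemytskiiData (E := E) (α := Unit) (μ := Measure.dirac ()))
    exact continuous_iff_continuousAt.2 fun e => (this.hasFDerivAt () e).continuousAt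
  have hzC : modular (nFun φ) μ z ≤ C := by
    have hF : ∫⁻ x, liminf (fun n => ENNReal.ofReal (nFun φ ‖w (σ n) x‖)) atTop ∂μ
        ≤ liminf (fun n => modular (nFun φ) μ (w (σ n))) atTop :=
      lintegral_liminf_le' fun n => hnm _ (hw _)
    refine (lintegral_mono_ae ?_).trans (hF.trans ?_)
    · filter_upwards [hlim] with x hx
      have h1 := ENNReal.tendsto_ofReal ((hcont.tendsto (z x)).comp hx)
      exact h1.liminf_eq.ge
    · exact (liminf_le_liminf (Eventually.of_forall fun n => hC (σ n))).trans
        (by rw [liminf_const])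
  refine ⟨σ, z, hσ, hz, hzC, ?_⟩
  obtain ⟨K, hK, hKb⟩ := h.exists_nFun_le_add_monoGap (E := E)
  have hgapσ : Tendsto (fun i : ℕ × ℕ =>
      ∫⁻ x, ENNReal.ofReal (monoGap φ (w (σ i.1) x) (w (σ i.2) x)) ∂μ) atTop (𝓝 0) := by
    refine hgap.comp (f := fun i : ℕ × ℕ => (σ i.1, σ i.2)) ?_
    rw [← prod_atTop_atTop_eq]
    exact (hσ.tendsto_atTop.comp tendsto_fst).prodMk (hσ.tendsto_atTop.comp tendsto_snd)
  refine tendsto_lintegral_zero_of_forall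
    (fun n => hnm _ ((hw _).sub hz.aestronglyMeasurable)) ?_ fun δ hδ => ?_
  · filter_upwards [hlim] with x hx
    have h1 : Tendsto (fun n => w (σ n) x - z x) atTop (𝓝 0) := by
      simpa using hx.sub_const (z x)
    have h2 := ENNReal.tendsto_ofReal ((hcont.tendsto 0).comp h1)
    simpa [PhiAssumptions.nFun_zero, Function.comp_def] using h2
  · set c := ENNReal.ofReal (2 ^ m * 2) with hc
    have hc0 : c ≠ 0 := (ENNReal.ofReal_pos.2 (by positivity)).ne'
    have hct : c ≠ ⊤ := ENNReal.ofReal_ne_top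
    have hδc : 0 < δ / c := ENNReal.div_pos hδ.ne' hct
    -- The late index `k.2` is frozen. Then `Φ(‖w_{σ n} - z‖)` is dominated by multiples of `Φ(‖w_{σ
    -- k.2}‖)` and `Φ(‖z‖)`, up to `c` times a gap whose integral is at most `δ / c` for all later
    -- `n`.
    obtain ⟨k, hk⟩ := eventually_atTop.1 ((ENNReal.tendsto_nhds_zero.1 hgapσ) _ hδc)
    refine ⟨fun x => ENNReal.ofReal (2 ^ m * K) * ENNReal.ofReal (nFun φ ‖w (σ k.2) x‖)
      + ENNReal.ofReal (2 ^ m) * ENNReal.ofReal (nFun φ ‖z x‖), ?_, ?_, ?_⟩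
    · exact ((hnm _ (hw _)).const_mul _).add ((hnm _ hz.aestronglyMeasurable).const_mul _)
    · rw [lintegral_add_left' ((hnm _ (hw _)).const_mul _),
        lintegral_const_mul' _ _ ENNReal.ofReal_ne_top,
        lintegral_const_mul' _ _ ENNReal.ofReal_ne_top]
      exact ENNReal.add_ne_top.2
        ⟨ENNReal.mul_ne_top ENNReal.ofReal_ne_top ((hC _).trans_lt ENNReal.coe_lt_top).ne,
        ENNReal.mul_ne_top ENNReal.ofReal_ne_top (hzC.trans_lt ENNReal.coe_lt_top).ne⟩
    · filter_upwards [eventually_ge_atTop k.1] with n hn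
      refine ⟨fun x => c * ENNReal.ofReal (monoGap φ (w (σ n) x) (w (σ k.2) x)),
        Eventually.of_forall fun x => ?_, ?_⟩
      · dsimp only
        rw [hc, ← ENNReal.ofReal_mul (by positivity), ← ENNReal.ofReal_mul (by positivity),
          ← ENNReal.ofReal_mul (by positivity),
          ← ENNReal.ofReal_add (mul_nonneg (by positivity) (h.nFun_nonneg _))
            (mul_nonneg (by positivity) (h.nFun_nonneg _)),
          ← ENNReal.ofReal_add (add_nonneg (mul_nonneg (by positivity) (h.nFun_nonneg _))
            (mul_nonneg (by positivity) (h.nFun_nonneg _)))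
            (mul_nonneg (by positivity) (h.monoGap_nonneg _ _))]
        refine ENNReal.ofReal_le_ofReal ?_
        have h1 : nFun φ ‖(w (σ n) - z) x‖ ≤ nFun φ (‖w (σ n) x‖ + ‖z x‖) :=
          Y.mono (norm_nonneg _) (add_nonneg (norm_nonneg _) (norm_nonneg _)) (norm_sub_le _ _)
        have h2 := Y.add_le (norm_nonneg (w (σ n) x)) (norm_nonneg (z x))
        have h3 := hKb (w (σ n) x) (w (σ k.2) x)
        have h4 : (0 : ℝ) ≤ 2 ^ m := by positivity
        have h5 := mul_le_mul_of_nonneg_left h3 h4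
        linarith
      · rw [lintegral_const_mul' _ _ hct]
        have := hk (n, k.2) ⟨hn, le_rfl⟩
        dsimp only at this
        calc c * _ ≤ c * (δ / c) := mul_le_mul' le_rfl this
          _ = δ := ENNReal.mul_div_cancel hc0 hct

end Convergence
end OrliczNehari

namespace OrliczNehari

/-! ### Modular limits in the Orlicz–Sobolev space -/

section LocalConvergence

variable {α E : Type*} [MeasurableSpace α] [NormedAddCommGroup E] {μ : Measure α}
  {a M : ℝ → ℝ} {p q : ℝ}

theorem YoungPair.setLIntegral_enorm_le (Y : YoungPair a M p q) {δ : ℝ} (hδ : 0 < δ) (w : α → E)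
    (K : Set α) :
    ∫⁻ x in K, ‖w x‖ₑ ∂μ
      ≤ ENNReal.ofReal δ * μ K + ENNReal.ofReal (δ / M δ) * modular M μ w := by
  have hM := Y.pos δ hδ
  calc ∫⁻ x in K, ‖w x‖ₑ ∂μ
      ≤ ∫⁻ x in K, (ENNReal.ofReal δ + ENNReal.ofReal (δ / M δ) * ENNReal.ofReal (M ‖w x‖)) ∂μ := by
        refine lintegral_mono fun x => ?_
        rw [← ofReal_norm, ← ENNReal.ofReal_mul (by positivity),
          ← ENNReal.ofReal_add hδ.le (mul_nonneg (by positivity) (Y.nonneg (norm_nonneg _)))]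
        exact ENNReal.ofReal_le_ofReal (Y.le_add_mul hδ (norm_nonneg _))
    _ = ENNReal.ofReal δ * μ K
        + ENNReal.ofReal (δ / M δ) * ∫⁻ x in K, ENNReal.ofReal (M ‖w x‖) ∂μ := by
        rw [lintegral_add_left measurable_const, setLIntegral_const,
          lintegral_const_mul' _ _ ENNReal.ofReal_ne_top]
    _ ≤ _ := by
        gcongr
        exact setLIntegral_le_lintegral _ _

theorem YoungPair.tendsto_setLIntegral_enorm (Y : YoungPair a M p q) {w : ℕ → α → E} {K : Set α}
    (hK : μ K ≠ ⊤) (hw : Tendsto (fun n => modular M μ (w n)) atTop (𝓝 0)) :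
    Tendsto (fun n => ∫⁻ x in K, ‖w n x‖ₑ ∂μ) atTop (𝓝 0) := by
  rw [ENNReal.tendsto_nhds_zero]
  intro e he
  have he2 : 0 < e / 2 := ENNReal.div_pos he.ne' (by simp)
  have h1 : Tendsto (fun δ : ℝ => ENNReal.ofReal δ * μ K) (𝓝[>] 0) (𝓝 0) := by
    have h2 : Tendsto (fun δ : ℝ => ENNReal.ofReal δ) (𝓝[>] 0) (𝓝 0) := by
      have := (ENNReal.continuous_ofReal.tendsto 0).mono_left (nhdsWithin_le_nhds (s := Ioi 0))
      rwa [ENNReal.ofReal_zero] at this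
    simpa using ENNReal.Tendsto.mul_const h2 (Or.inr hK)
  obtain ⟨δ, hδ1, hδ⟩ := (((ENNReal.tendsto_nhds_zero.1 h1) _ he2).and
    self_mem_nhdsWithin).exists
  have h3 : Tendsto (fun n => ENNReal.ofReal (δ / M δ) * modular M μ (w n)) atTop (𝓝 0) := by
    simpa using ENNReal.Tendsto.const_mul hw (Or.inr ENNReal.ofReal_ne_top)
  filter_upwards [(ENNReal.tendsto_nhds_zero.1 h3) _ he2] with n hn
  exact (Y.setLIntegral_enorm_le hδ (w n) K).trans
    ((add_le_add hδ1 hn).trans (ENNReal.add_halves e).le)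

theorem tendsto_integral_mul_of_setLIntegral {N : ℕ} {w : ℕ → EuclideanSpace ℝ (Fin N) → ℝ}
    {z χ : EuclideanSpace ℝ (Fin N) → ℝ} (hw : ∀ n, LocallyIntegrable (w n))
    (hz : LocallyIntegrable z) (hχ : Continuous χ) (hc : HasCompactSupport χ)
    (hlim : Tendsto (fun n => ∫⁻ x in tsupport χ, ‖w n x - z x‖ₑ) atTop (𝓝 0)) :
    Tendsto (fun n => ∫ x, w n x * χ x) atTop (𝓝 (∫ x, z x * χ x)) := by
  obtain ⟨C, hC⟩ := hc.exists_bound_of_continuous hχ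
  refine tendsto_integral_of_L1 _ (integrable_mul_test hz hχ hc).1
    (Eventually.of_forall fun n => integrable_mul_test (hw n) hχ hc) ?_
  have h1 : Tendsto (fun n => ENNReal.ofReal C * ∫⁻ x in tsupport χ, ‖w n x - z x‖ₑ) atTop
      (𝓝 0) := by
    simpa using ENNReal.Tendsto.const_mul hlim (Or.inr ENNReal.ofReal_ne_top)
  refine tendsto_of_tendsto_of_tendsto_of_le_of_le tendsto_const_nhds h1 (fun _ => zero_le)
    fun n => ?_
  dsimp only
  rw [← lintegral_const_mul' _ _ ENNReal.ofReal_ne_top,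
    ← lintegral_indicator (isClosed_tsupport χ).measurableSet]
  refine lintegral_mono fun x => ?_
  by_cases hx : x ∈ tsupport χ
  · rw [indicator_of_mem hx, ← sub_mul, enorm_mul, mul_comm]
    refine mul_le_mul' ?_ le_rfl
    rw [← ofReal_norm]
    exact ENNReal.ofReal_le_ofReal (hC x)
  · rw [image_eq_zero_of_notMem_tsupport hx]
    simp

end LocalConvergence

namespace SpaceData

variable {N : ℕ} {D : SpaceData N}

/-- Limits of functions and gradients with respect to the modulars define limits in the space. -/
theorem exists_tendsto_of_modular (hκ : D.κ = 1) {w₀ : ℝ} (hw₀ : 0 < w₀) (hw : ∀ x, w₀ ≤ D.w x)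
    {U : ℕ → D.Space} {u : EuclideanSpace ℝ (Fin N) → ℝ}
    {w : EuclideanSpace ℝ (Fin N) → EuclideanSpace ℝ (Fin N)}
    (hu : StronglyMeasurable u) (hwm : StronglyMeasurable w)
    (hfu : modular (nFun D.φ) D.wMeasure u < ⊤) (hfw : modular (nFun D.φ) volume w < ⊤)
    (h1 : Tendsto (fun n => modular (nFun D.φ) volume (grad (U n) - w)) atTop (𝓝 0))
    (h2 : Tendsto (fun n => modular (nFun D.φ) D.wMeasure (fn (U n) - u)) atTop (𝓝 0)) :
    ∃ V, Tendsto U atTop (𝓝 V) := by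
  have Y := D.hφ.youngPair
  have hu' : AEStronglyMeasurable u volume := hu.aestronglyMeasurable
  have hfu' : modular (nFun D.φ) volume u < ⊤ := (modular_volume_le hw₀ hw hu').trans_lt
    (ENNReal.mul_lt_top ENNReal.ofReal_lt_top hfu)
  have h2' : Tendsto (fun n => modular (nFun D.φ) volume (fn (U n) - u)) atTop (𝓝 0) := by
    have h3 : Tendsto (fun n => ENNReal.ofReal w₀⁻¹ *
        modular (nFun D.φ) D.wMeasure (fn (U n) - u)) atTop (𝓝 0) := by
      simpa using ENNReal.Tendsto.const_mul h2 (Or.inr ENNReal.ofReal_ne_top)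
    exact tendsto_of_tendsto_of_tendsto_of_le_of_le tendsto_const_nhds h3 (fun _ => zero_le)
      fun n => modular_volume_le hw₀ hw ((aesm_fn _).sub hu')
  have hlu : LocallyIntegrable u := Y.locallyIntegrable hu' hfu'
  have hlw : LocallyIntegrable w := Y.locallyIntegrable hwm.aestronglyMeasurable hfw
  -- Modular convergence gives `L¹` convergence on compact supports, which suffices to pass to the
  -- limit in the identity defining the weak gradient.
  have hgrad : HasWeakGradient u w := by
    refine ⟨hlu, hlw, fun ψ v hψ hc => ?_⟩
    have hd := continuous_fderiv_test hψ v
    have hdc : HasCompactSupport fun x => fderiv ℝ ψ x v := hc.fderiv_apply ℝ v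
    have l1 : Tendsto (fun n => ∫ x, fn (U n) x * fderiv ℝ ψ x v) atTop
        (𝓝 (∫ x, u x * fderiv ℝ ψ x v)) :=
      tendsto_integral_mul_of_setLIntegral (fun n => (hasWeakGradient (U n)).1) hlu hd hdc
        (Y.tendsto_setLIntegral_enorm hdc.isCompact.measure_lt_top.ne h2')
    have l2 : Tendsto (fun n => ∫ x, inner ℝ (grad (U n) x) v * ψ x) atTop
        (𝓝 (∫ x, inner ℝ (w x) v * ψ x)) := by
      refine tendsto_integral_mul_of_setLIntegral
        (fun n => locallyIntegrable_inner (hasWeakGradient (U n)).2.1 v)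
        (locallyIntegrable_inner hlw v) hψ.continuous hc ?_
      have h3 : Tendsto (fun n => ‖v‖ₑ * ∫⁻ x in tsupport ψ, ‖(grad (U n) - w) x‖ₑ) atTop
          (𝓝 0) := by
        simpa using ENNReal.Tendsto.const_mul
          (Y.tendsto_setLIntegral_enorm hc.isCompact.measure_lt_top.ne h1) (Or.inr enorm_ne_top)
      refine tendsto_of_tendsto_of_tendsto_of_le_of_le tendsto_const_nhds h3
        (fun _ => zero_le) fun n => ?_
      dsimp only
      rw [← lintegral_const_mul' _ _ enorm_ne_top]
      refine lintegral_mono fun x => ?_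
      rw [← inner_sub_left, ← ofReal_norm, ← ofReal_norm, ← ofReal_norm,
        ← ENNReal.ofReal_mul (norm_nonneg _), mul_comm]
      exact ENNReal.ofReal_le_ofReal (norm_inner_le_norm _ _)
    refine tendsto_nhds_unique l1 (l2.neg.congr fun n => ?_)
    exact ((hasWeakGradient (U n)).2.2 ψ v hψ hc).symm
  obtain ⟨V, hV1, hV2⟩ := exists_mk hw₀ hw hu' hwm.aestronglyMeasurable hgrad hfw hfu
  refine ⟨V, tendsto_of_modular hκ (h1.congr fun n => modular_congr ?_)
    (h2.congr fun n => modular_congr ?_)⟩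
  · exact (EventuallyEq.refl _ _).sub hV2.symm
  · exact (EventuallyEq.refl _ _).sub (hV1.symm.filter_mono D.wMeasure_ac.ae_le)

end SpaceData

/-! ### Boundedness of Palais–Smale sequences -/

namespace Penalized

open SpaceData

variable {N : ℕ} {D : SpaceData N} {S : Set (EuclideanSpace ℝ (Fin N))} {f p : ℝ → ℝ}
  {w₀ ν θ τ q γ : ℝ}

theorem integrable_inner_grad (_P : Penalized D S f p w₀ ν θ τ q γ) (u v : D.Space) :
    Integrable fun x => inner ℝ (D.φ ‖grad u x‖ • grad u x) (grad v x) :=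
  (D.hφ.nemytskiiData (μ := volume)).integrable_inner D.hφ.youngPair (aesm_grad u) (aesm_grad v)
    (modular_grad u) (modular_grad v)

theorem integrable_inner_fn (_P : Penalized D S f p w₀ ν θ τ q γ) (u v : D.Space) :
    Integrable (fun x => inner ℝ (D.φ ‖fn u x‖ • fn u x) (fn v x)) D.wMeasure :=
  (D.hφ.nemytskiiData (μ := D.wMeasure)).integrable_inner D.hφ.youngPair
    ((aesm_fn u).mono_ac D.wMeasure_ac) ((aesm_fn v).mono_ac D.wMeasure_ac)
    (modular_fn u) (modular_fn v)

theorem integrable_inner_g (P : Penalized D S f p w₀ ν θ τ q γ) (u v : D.Space) :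
    Integrable fun x => inner ℝ (gFun S f p x (fn u x)) (fn v x) :=
  P.nemytskiiData_primitive.integrable_inner P.youngPair_q (aesm_fn u) (aesm_fn v)
    (P.modularMap_fn_q.finite P.youngPair_q u) (P.modularMap_fn_q.finite P.youngPair_q v)

theorem modular_fn_volume_lt_top (P : Penalized D S f p w₀ ν θ τ q γ) (u : D.Space) :
    modular (nFun D.φ) volume (fn u) < ⊤ := P.modularMap_fn_volume.finite D.hφ.youngPair u

theorem integrable_nFun_grad (_P : Penalized D S f p w₀ ν θ τ q γ) (u : D.Space) :
    Integrable fun x => nFun D.φ ‖grad u x‖ :=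
  D.hφ.youngPair.integrable (aesm_grad u) (modular_grad u)

theorem integrable_nFun_fn (P : Penalized D S f p w₀ ν θ τ q γ) (u : D.Space) :
    Integrable fun x => nFun D.φ ‖fn u x‖ :=
  D.hφ.youngPair.integrable (aesm_fn u) (P.modular_fn_volume_lt_top u)

theorem integrable_nFun_fn_wMeasure (_P : Penalized D S f p w₀ ν θ τ q γ) (u : D.Space) :
    Integrable (fun x => nFun D.φ ‖fn u x‖) D.wMeasure :=
  D.hφ.youngPair.integrable ((aesm_fn u).mono_ac D.wMeasure_ac) (modular_fn u)

theorem integrable_wMeasure_iff (D : SpaceData N) {h : EuclideanSpace ℝ (Fin N) → ℝ} :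
    Integrable h D.wMeasure ↔ Integrable fun x => D.w x * h x := by
  rw [SpaceData.wMeasure, integrable_withDensity_iff_integrable_smul'
    D.w_cont.measurable.ennreal_ofReal (Eventually.of_forall fun _ => ENNReal.ofReal_lt_top)]
  refine integrable_congr (Eventually.of_forall fun x => ?_)
  dsimp only
  rw [ENNReal.toReal_ofReal (D.w_pos x).le, smul_eq_mul]

theorem mul_integral_le_wMeasure (P : Penalized D S f p w₀ ν θ τ q γ)
    {h : EuclideanSpace ℝ (Fin N) → ℝ} (h0 : ∀ x, 0 ≤ h x) (hi : Integrable h D.wMeasure) :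
    w₀ * ∫ x, h x ≤ ∫ x, h x ∂D.wMeasure := by
  rw [D.integral_wMeasure, ← integral_const_mul]
  exact integral_mono_of_nonneg (Eventually.of_forall fun x => mul_nonneg P.w₀_pos.le (h0 x))
    ((integrable_wMeasure_iff D).1 hi)
    (Eventually.of_forall fun x => mul_le_mul_of_nonneg_right (P.le_w x) (h0 x))

theorem θ_pos (P : Penalized D S f p w₀ ν θ τ q γ) : 0 < θ := by
  linarith [P.m_lt_θ, D.hφ.one_lt_l, D.hφ.l_le_m]

theorem primitive_eq_zero {g : ℝ → ℝ} (hg : ∀ s ≤ 0, g s = 0) {s : ℝ} (hs : s ≤ 0) :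
    ∫ t in (0 : ℝ)..s, g t = 0 := by
  rw [intervalIntegral.integral_congr (g := fun _ => 0) fun t ht => ?_]
  · simp
  · rw [uIcc_of_ge hs] at ht
    exact hg t ht.2

/-- `G(x, s) - g(x, s) s / θ` is controlled by `Φ`. -/
theorem primitive_sub_le (P : Penalized D S f p w₀ ν θ τ q γ) (x : EuclideanSpace ℝ (Fin N))
    (s : ℝ) :
    (∫ t in (0 : ℝ)..s, gFun S f p x t) - θ⁻¹ * (gFun S f p x s * s)
      ≤ (D.l⁻¹ - θ⁻¹) * (ν * (D.m * nFun D.φ ‖s‖)) := by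
  have hl : 0 < D.l := by linarith [D.hφ.one_lt_l]
  have hθ := P.θ_pos
  have hm : 0 < D.m := by linarith [D.hφ.l_le_m]
  have hlθ : θ⁻¹ ≤ D.l⁻¹ := inv_anti₀ hl (by linarith [P.m_lt_θ, D.hφ.l_le_m])
  have hc : 0 ≤ (D.l⁻¹ - θ⁻¹) * (ν * (D.m * nFun D.φ ‖s‖)) :=
    mul_nonneg (by linarith) (mul_nonneg P.ν_nonneg (mul_nonneg hm.le (D.hφ.nFun_nonneg _)))
  rcases le_or_gt s 0 with hs | hs
  · have h1 : ∀ t ≤ 0, gFun S f p x t = 0 := fun t ht => by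
      simp only [gFun, P.adm_f.zero t ht, P.adm_p.zero t ht, ite_self]
    rw [primitive_eq_zero h1 hs, h1 s hs]
    simpa using hc
  -- Inside `S` superlinearity with exponent `θ` makes the left side nonpositive. Outside only the
  -- exponent `l` is available, and the excess `1/l - 1/θ` is charged to `p ≤ ν φ(s) s`.
  · by_cases hx : x ∈ S
    · simp only [gFun, hx, if_true]
      have h1 := P.superlinear s hs
      have h2 : (∫ t in (0 : ℝ)..s, f t) ≤ θ⁻¹ * (f s * s) := by
        rw [le_inv_mul_iff₀ hθ]; exact h1
      linarith
    · simp only [gFun, hx, if_false]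
      have h1 : (∫ t in (0 : ℝ)..s, p t) ≤ D.l⁻¹ * (p s * s) := by
        rw [le_inv_mul_iff₀ hl]; exact P.p_integral s hs
      have h2 : p s * s ≤ ν * (D.m * nFun D.φ ‖s‖) := by
        have h3 := mul_le_mul_of_nonneg_right (P.p_le s hs) hs.le
        have h4 := mul_le_mul_of_nonneg_left (D.hφ.le_m_mul hs) P.ν_nonneg
        rw [Real.norm_of_nonneg hs.le]
        linarith
      have h3 := mul_le_mul_of_nonneg_left h2 (by linarith : 0 ≤ D.l⁻¹ - θ⁻¹)
      linarith

/-- The Ambrosetti–Rabinowitz estimate. -/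
theorem exists_mul_norm_le (P : Penalized D S f p w₀ ν θ τ q γ) :
    ∃ c > 0, ∀ u : D.Space, c * (‖u‖ - 2) ≤ D.energy (gFun S f p) u
      - θ⁻¹ * nehariFn (D.energy (gFun S f p)) u := by
  have hl : 0 < D.l := by linarith [D.hφ.one_lt_l]
  have hθ := P.θ_pos
  have hw₀ := P.w₀_pos
  set c₁ := (D.l⁻¹ - θ⁻¹) * (ν * D.m) / w₀ with hc₁
  have hc₁0 : 0 ≤ c₁ := by
    have hlθ : θ⁻¹ ≤ D.l⁻¹ := inv_anti₀ hl (by linarith [P.m_lt_θ, D.hφ.l_le_m])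
    have hm : 0 < D.m := by linarith [D.hφ.l_le_m]
    exact div_nonneg (mul_nonneg (by linarith) (mul_nonneg P.ν_nonneg hm.le)) hw₀.le
  -- The share of the modulars that survives: `m / θ` is lost to `L / θ`, and `c₁` to the
  -- nonlinearity outside `S`. Its positivity is exactly `ν_small`.
  set c := 1 - θ⁻¹ * D.m - c₁ with hc
  have hcpos : 0 < c := by
    have e : c * (θ * D.l * w₀) = (θ - D.m) * D.l * w₀ - (θ - D.l) * D.m * ν := by
      rw [hc, hc₁]; field_simp
    have h1 : 0 < c * (θ * D.l * w₀) := by rw [e]; linarith [P.ν_small]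
    exact (pos_iff_pos_of_mul_pos h1).2 (by positivity)
  refine ⟨c, hcpos, fun u => ?_⟩
  have Y := D.hφ.youngPair
  set ρ₁ := ∫ x, nFun D.φ ‖grad u x‖ with hρ₁
  set ρ₂ := ∫ x, nFun D.φ ‖fn u x‖ ∂D.wMeasure with hρ₂
  have hρ₁0 : 0 ≤ ρ₁ := integral_nonneg fun x => D.hφ.nFun_nonneg _
  have hρ₂0 : 0 ≤ ρ₂ := integral_nonneg fun x => D.hφ.nFun_nonneg _
  have hnorm : ‖u‖ - 2 ≤ ρ₁ + ρ₂ := by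
    have := norm_le_two_add P.κ_eq u
    rw [hρ₁, hρ₂, Y.integral_eq (aesm_grad u), Y.integral_eq ((aesm_fn u).mono_ac D.wMeasure_ac)]
    linarith
  have i1 : (∫ x, inner ℝ (D.φ ‖grad u x‖ • grad u x) (grad u x)) ≤ D.m * ρ₁ := by
    rw [hρ₁, ← integral_const_mul]
    refine integral_mono (P.integrable_inner_grad u u) ((P.integrable_nFun_grad u).const_mul _)
      fun x => ?_
    dsimp only
    rw [PhiAssumptions.inner_smul_eq]
    exact Y.upper _ (norm_nonneg _)
  have i2 : (∫ x, inner ℝ (D.φ ‖fn u x‖ • fn u x) (fn u x) ∂D.wMeasure) ≤ D.m * ρ₂ := by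
    rw [hρ₂, ← integral_const_mul]
    refine integral_mono (P.integrable_inner_fn u u)
      ((P.integrable_nFun_fn_wMeasure u).const_mul _) fun x => ?_
    dsimp only
    rw [PhiAssumptions.inner_smul_eq]
    exact Y.upper _ (norm_nonneg _)
  have hprim : Integrable fun x => ∫ t in (0 : ℝ)..fn u x, gFun S f p x t :=
    P.nemytskiiData_primitive.integrable P.youngPair_q (aesm_fn u)
      (P.modularMap_fn_q.finite P.youngPair_q u)
  have hw := P.mul_integral_le_wMeasure (fun x => D.hφ.nFun_nonneg ‖fn u x‖)
    (P.integrable_nFun_fn_wMeasure u)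
  have i3 : (∫ x, ∫ t in (0 : ℝ)..fn u x, gFun S f p x t)
      - θ⁻¹ * (∫ x, inner ℝ (gFun S f p x (fn u x)) (fn u x)) ≤ c₁ * ρ₂ := by
    rw [← integral_const_mul, ← integral_sub hprim ((P.integrable_inner_g u u).const_mul _)]
    have h1 : (∫ x, ((∫ t in (0 : ℝ)..fn u x, gFun S f p x t)
        - θ⁻¹ * inner ℝ (gFun S f p x (fn u x)) (fn u x)))
        ≤ ∫ x, (D.l⁻¹ - θ⁻¹) * (ν * D.m) * nFun D.φ ‖fn u x‖ := by
      refine integral_mono (hprim.sub ((P.integrable_inner_g u u).const_mul _))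
        ((P.integrable_nFun_fn u).const_mul _) fun x => ?_
      have := P.primitive_sub_le x (fn u x)
      simp only [RCLike.inner_apply, conj_trivial, mul_comm (fn u x)]
      linarith
    rw [integral_const_mul] at h1
    refine h1.trans ?_
    have h2 := mul_le_mul_of_nonneg_left hw hc₁0
    refine le_trans (le_of_eq ?_) h2
    rw [hc₁]
    field_simp
  have hfin : D.energy (gFun S f p) u - θ⁻¹ * nehariFn (D.energy (gFun S f p)) u
      = ρ₁ + ρ₂ - θ⁻¹ * (∫ x, inner ℝ (D.φ ‖grad u x‖ • grad u x) (grad u x))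
        - θ⁻¹ * (∫ x, inner ℝ (D.φ ‖fn u x‖ • fn u x) (fn u x) ∂D.wMeasure)
        - ((∫ x, ∫ t in (0 : ℝ)..fn u x, gFun S f p x t)
      - θ⁻¹ * (∫ x, inner ℝ (gFun S f p x (fn u x)) (fn u x))) := by
    rw [energy_eq, nehariFn, P.fderiv_energy_apply]
    ring
  rw [hfin]
  have h1 := mul_le_mul_of_nonneg_left i1 (inv_nonneg.2 hθ.le)
  have h2 := mul_le_mul_of_nonneg_left i2 (inv_nonneg.2 hθ.le)
  have h3 := mul_le_mul_of_nonneg_left hnorm hcpos.le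
  have h4 := mul_nonneg hc₁0 hρ₁0
  have h5 : c * (ρ₁ + ρ₂) = ρ₁ + ρ₂ - θ⁻¹ * (D.m * ρ₁) - θ⁻¹ * (D.m * ρ₂) - c₁ * ρ₂ - c₁ * ρ₁ := by
    rw [hc]; ring
  linarith

/-- Palais–Smale sequences are bounded. -/
theorem bounded_of_tendsto (P : Penalized D S f p w₀ ν θ τ q γ) {U : ℕ → D.Space} {c : ℝ}
    (hJ : Tendsto (fun n => D.energy (gFun S f p) (U n)) atTop (𝓝 c))
    (hL : ∀ δ > 0, ∀ᶠ n in atTop, |nehariFn (D.energy (gFun S f p)) (U n)| ≤ δ * ‖U n‖) :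
    ∃ R, ∀ n, ‖U n‖ ≤ R := by
  obtain ⟨c₀, hc₀, hb⟩ := P.exists_mul_norm_le
  have hθ := P.θ_pos
  have h1 : ∀ᶠ n in atTop, D.energy (gFun S f p) (U n) < c + 1 :=
    hJ.eventually (gt_mem_nhds (by linarith))
  -- With this choice of `δ`, the term `|L| / θ` absorbs only half of the linear lower bound `c₀
  -- ‖u‖`.
  obtain ⟨n₀, hn₀⟩ := eventually_atTop.1 (h1.and (hL (θ * (c₀ / 2)) (by positivity)))
  have h2 : ∀ n ≥ n₀, ‖U n‖ ≤ 2 / c₀ * (c + 1 + 2 * c₀) := by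
    intro n hn
    obtain ⟨h3, h4⟩ := hn₀ n hn
    have h5 := hb (U n)
    have h6 := mul_le_mul_of_nonneg_left (neg_le_abs (nehariFn (D.energy (gFun S f p)) (U n)))
      (inv_nonneg.2 hθ.le)
    have h7 := mul_le_mul_of_nonneg_left h4 (inv_nonneg.2 hθ.le)
    rw [← mul_assoc, ← mul_assoc, inv_mul_cancel₀ hθ.ne', one_mul] at h7
    rw [div_mul_eq_mul_div, le_div_iff₀ hc₀]
    linarith
  refine ⟨max (2 / c₀ * (c + 1 + 2 * c₀)) (∑ i ∈ Finset.range n₀, ‖U i‖), fun n => ?_⟩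
  rcases le_or_gt n₀ n with hn | hn
  · exact (h2 n hn).trans (le_max_left _ _)
  · exact (Finset.single_le_sum (f := fun i => ‖U i‖) (fun i _ => norm_nonneg _)
      (Finset.mem_range.2 hn)).trans (le_max_right _ _)

end Penalized
end OrliczNehari

/-! ### Local compactness and tails of almost critical sequences -/

namespace OrliczNehari

namespace Penalized

open SpaceData PhiAssumptions

variable {N : ℕ} {D : SpaceData N} {S : Set (EuclideanSpace ℝ (Fin N))} {f p : ℝ → ℝ}
  {w₀ ν θ τ q γ : ℝ}

/-- Local compactness of bounded sequences of test functions in the Orlicz class of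
`Φ(t) + t ^ q`. -/
theorem exists_subseq_cauchy (P : Penalized D S f p w₀ ν θ τ q γ) {U : ℕ → D.Space}
    {v : ℕ → EuclideanSpace ℝ (Fin N) → ℝ} {R : ℝ} (hR : ∀ n, ‖U n‖ ≤ R)
    (hT : ∀ n, IsTest (U n) (v n)) :
    ∃ σ : ℕ → ℕ, StrictMono σ ∧ ∀ ρ : ℝ, Tendsto (fun i : ℕ × ℕ =>
      ∫⁻ x in Metric.closedBall 0 ρ, ENNReal.ofReal
        (nFun D.φ ‖fn (U (σ i.1)) x - fn (U (σ i.2)) x‖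
          + ‖fn (U (σ i.1)) x - fn (U (σ i.2)) x‖ ^ q)) atTop (𝓝 0) := by
  have Y := D.hφ.youngPair
  obtain ⟨A₁, hA₁⟩ := P.modularMap_fn_volume.bounded Y R
  obtain ⟨A₂, hA₂⟩ := P.modularMap_grad.bounded Y R
  obtain ⟨σ, hσ, hlim⟩ := exists_subseq_cauchy_L1 (fun n => (hT n).contDiff) fun ρ => by
    have hfin : volume (Metric.closedBall (0 : EuclideanSpace ℝ (Fin N)) ρ) ≠ ⊤ :=
      measure_closedBall_lt_top.ne
    set b := ENNReal.ofReal 1 * volume (Metric.closedBall (0 : EuclideanSpace ℝ (Fin N)) ρ)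
      + ENNReal.ofReal (1 / nFun D.φ 1) * (max A₁ A₂ : NNReal) with hb
    have hbt : b ≠ ⊤ := ENNReal.add_ne_top.2 ⟨ENNReal.mul_ne_top ENNReal.ofReal_ne_top hfin,
      ENNReal.mul_ne_top ENNReal.ofReal_ne_top ENNReal.coe_ne_top⟩
    refine ⟨b.toNNReal, fun n => ?_⟩
    rw [ENNReal.coe_toNNReal hbt]
    constructor
    · refine (Y.setLIntegral_enorm_le one_pos (v n) _).trans (add_le_add le_rfl
        (mul_le_mul' le_rfl ?_))
      rw [← modular_congr (hT n).fn_eq]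
      exact (hA₁ _ (hR n)).trans (by exact_mod_cast le_max_left _ _)
    · refine (Y.setLIntegral_enorm_le one_pos (gradient (v n)) _).trans (add_le_add le_rfl
        (mul_le_mul' le_rfl ?_))
      rw [← modular_congr (hT n).grad_eq]
      exact (hA₂ _ (hR n)).trans (by exact_mod_cast le_max_right _ _)
  refine ⟨σ, hσ, fun ρ => ?_⟩
  -- Differences of members lie in the ball of radius `R + R`, so their truncated critical integrals
  -- are bounded by `K₀`. Interpolating between linear growth and the critical power then upgrades
  -- the `L¹` Cauchy property.
  obtain ⟨K₀, hK₀⟩ := exists_lintegral_truncId_fn_le P.κ_eq P.w₀_pos P.le_w P.one_le_γ P.γ_lt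
    P.rpow_γ (R + R)
  rw [ENNReal.tendsto_nhds_zero]
  intro e he
  have he2 : 0 < e / 2 := ENNReal.div_pos he.ne' (by simp)
  have h1 : Tendsto (fun δ : ℝ => ENNReal.ofReal δ * K₀) (𝓝[>] 0) (𝓝 0) := by
    have h2 : Tendsto (fun δ : ℝ => ENNReal.ofReal δ) (𝓝[>] 0) (𝓝 0) := by
      have := (ENNReal.continuous_ofReal.tendsto 0).mono_left (nhdsWithin_le_nhds (s := Ioi 0))
      rwa [ENNReal.ofReal_zero] at this
    simpa using ENNReal.Tendsto.mul_const h2 (Or.inr ENNReal.coe_ne_top)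
  obtain ⟨δ, hδ1, hδ⟩ := (((ENNReal.tendsto_nhds_zero.1 h1) _ he2).and
    self_mem_nhdsWithin).exists
  have hδ0 : 0 < δ := hδ
  obtain ⟨K, hK, hint⟩ := exists_le_truncId_add_mul D.hφ P.m_le_q P.q_lt hδ0
  have h3 : Tendsto (fun i : ℕ × ℕ => ENNReal.ofReal K *
      ∫⁻ x in Metric.closedBall 0 ρ, ‖v (σ i.1) x - v (σ i.2) x‖ₑ) atTop (𝓝 0) := by
    simpa using ENNReal.Tendsto.const_mul (hlim ρ) (Or.inr ENNReal.ofReal_ne_top)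
  filter_upwards [(ENNReal.tendsto_nhds_zero.1 h3) _ he2] with i hi
  set Z := U (σ i.1) - U (σ i.2) with hZ
  have hZR : ‖Z‖ ≤ R + R := (norm_sub_le _ _).trans (add_le_add (hR _) (hR _))
  have hZe : fn Z =ᵐ[volume] fun x => fn (U (σ i.1)) x - fn (U (σ i.2)) x :=
    P.modularMap_fn_volume.map_sub _ _
  have hZv : fn Z =ᵐ[volume] fun x => v (σ i.1) x - v (σ i.2) x := by
    filter_upwards [hZe, (hT (σ i.1)).fn_eq, (hT (σ i.2)).fn_eq] with x h1 h2 h3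
    rw [h1, h2, h3]
  calc ∫⁻ x in Metric.closedBall 0 ρ, ENNReal.ofReal
        (nFun D.φ ‖fn (U (σ i.1)) x - fn (U (σ i.2)) x‖
          + ‖fn (U (σ i.1)) x - fn (U (σ i.2)) x‖ ^ q)
      ≤ ∫⁻ x in Metric.closedBall 0 ρ, (ENNReal.ofReal δ *
          ENNReal.ofReal (|truncId (fn Z x)| ^ (N * γ / (N - γ)))
          + ENNReal.ofReal K * ‖v (σ i.1) x - v (σ i.2) x‖ₑ) := by
        refine lintegral_mono_ae (ae_restrict_of_ae ?_)
        filter_upwards [hZe, hZv] with x h1 h2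
        rw [← h2, ← h1, ← ofReal_norm, ← ENNReal.ofReal_mul hδ0.le, ← ENNReal.ofReal_mul hK,
          ← ENNReal.ofReal_add (mul_nonneg hδ0.le (Real.rpow_nonneg (abs_nonneg _) _))
            (mul_nonneg hK (norm_nonneg _))]
        exact ENNReal.ofReal_le_ofReal (hint (fn Z x))
    _ = ENNReal.ofReal δ * (∫⁻ x in Metric.closedBall 0 ρ,
          ENNReal.ofReal (|truncId (fn Z x)| ^ (N * γ / (N - γ))))
        + ENNReal.ofReal K * ∫⁻ x in Metric.closedBall 0 ρ, ‖v (σ i.1) x - v (σ i.2) x‖ₑ := by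
        rw [lintegral_add_right, lintegral_const_mul' _ _ ENNReal.ofReal_ne_top,
          lintegral_const_mul' _ _ ENNReal.ofReal_ne_top]
        exact (((hT _).contDiff.continuous.sub
          (hT _).contDiff.continuous).measurable.enorm).const_mul _
    _ ≤ ENNReal.ofReal δ * K₀ + e / 2 := by
        refine add_le_add (mul_le_mul' le_rfl ?_) hi
        exact (setLIntegral_le_lintegral _ _).trans (hK₀ Z hZR)
    _ ≤ e / 2 + e / 2 := add_le_add hδ1 le_rfl
    _ = e := ENNReal.add_halves e

/-- The derivative of the energy as a single integral. -/
theorem integral_fderiv_energy (P : Penalized D S f p w₀ ν θ τ q γ) (u v : D.Space) :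
    Integrable (fun x => inner ℝ (D.φ ‖grad u x‖ • grad u x) (grad v x)
      + D.w x * inner ℝ (D.φ ‖fn u x‖ • fn u x) (fn v x)
      - inner ℝ (gFun S f p x (fn u x)) (fn v x)) ∧
    fderiv ℝ (D.energy (gFun S f p)) u v
      = ∫ x, (inner ℝ (D.φ ‖grad u x‖ • grad u x) (grad v x)
      + D.w x * inner ℝ (D.φ ‖fn u x‖ • fn u x) (fn v x)
      - inner ℝ (gFun S f p x (fn u x)) (fn v x)) := by
  have i1 := P.integrable_inner_grad u v
  have i2 := (integrable_wMeasure_iff D).1 (P.integrable_inner_fn u v)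
  have i3 := P.integrable_inner_g u v
  have i12 : Integrable fun x => inner ℝ (D.φ ‖grad u x‖ • grad u x) (grad v x)
      + D.w x * inner ℝ (D.φ ‖fn u x‖ • fn u x) (fn v x) := i1.add i2
  refine ⟨i12.sub i3, ?_⟩
  rw [P.fderiv_energy_apply, D.integral_wMeasure, ← integral_add i1 i2, ← integral_sub i12 i3]

theorem gFun_mul_le (P : Penalized D S f p w₀ ν θ τ q γ) {x : EuclideanSpace ℝ (Fin N)}
    (hx : x ∉ S) (s : ℝ) : gFun S f p x s * s ≤ ν * (mulExt D.φ ‖s‖ * ‖s‖) := by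
  have h0 := mul_nonneg P.ν_nonneg (mul_nonneg (D.hφ.mulExt_nonneg ‖s‖) (norm_nonneg s))
  simp only [gFun, hx, if_false]
  rcases le_or_gt s 0 with hs | hs
  · rwa [P.adm_p.zero s hs, zero_mul]
  · rw [Real.norm_of_nonneg hs.le, mulExt_of_pos hs, ← mul_assoc]
    exact mul_le_mul_of_nonneg_right (P.p_le s hs) hs.le

theorem abs_gFun_le (P : Penalized D S f p w₀ ν θ τ q γ) {x : EuclideanSpace ℝ (Fin N)}
    (hx : x ∉ S) (s : ℝ) : |gFun S f p x s| ≤ ν * mulExt D.φ ‖s‖ := by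
  have h0 := mul_nonneg P.ν_nonneg (D.hφ.mulExt_nonneg ‖s‖)
  simp only [gFun, hx, if_false]
  rcases le_or_gt s 0 with hs | hs
  · rwa [P.adm_p.zero s hs, abs_zero]
  · rw [Real.norm_of_nonneg hs.le, mulExt_of_pos hs, abs_of_nonneg (P.p_nonneg s)]
    exact P.p_le s hs

/-- Multiplication of a test function by a cutoff function. -/
theorem exists_cutoff (P : Penalized D S f p w₀ ν θ τ q γ) {U : D.Space}
    {v : EuclideanSpace ℝ (Fin N) → ℝ} (hT : IsTest U v) {ρ : ℝ} (hρ : 0 < ρ) :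
    ∃ W : D.Space, (fn W =ᵐ[volume] fun x => cutoff ρ x * fn U x) ∧
      grad W =ᵐ[volume] fun x => cutoff ρ x • grad U x + fn U x • gradient (cutoff ρ) x := by
  obtain ⟨W, hW⟩ := exists_isTest P.w₀_pos P.le_w ((contDiff_cutoff ρ).mul hT.contDiff)
    ((hasCompactSupport_cutoff hρ).mul_right)
  refine ⟨W, ?_, ?_⟩
  · filter_upwards [hW.fn_eq, hT.fn_eq] with x h1 h2
    rw [h1, h2]
  · filter_upwards [hW.grad_eq, hT.fn_eq, hT.grad_eq] with x h1 h2 h3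
    rw [h1, h2, h3]
    exact gradient_mul (contDiff_cutoff ρ) hT.contDiff x

/-- Almost critical test functions have small tails. -/
theorem exists_integral_tail_le (P : Penalized D S f p w₀ ν θ τ q γ) (R : ℝ) :
    ∃ C ρ₀ : ℝ, 0 ≤ C ∧ 0 < ρ₀ ∧ ∀ (U : D.Space) (v : EuclideanSpace ℝ (Fin N) → ℝ),
      IsTest U v → ‖U‖ ≤ R → ∀ ρ ≥ ρ₀,
      ∫ x in (Metric.closedBall 0 (2 * ρ))ᶜ, nFun D.φ ‖fn U x‖
        ≤ C * (‖fderiv ℝ (D.energy (gFun S f p)) U‖ + 1 / ρ) := by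
  have Y := D.hφ.youngPair
  have hl : 0 < D.l := by linarith [D.hφ.one_lt_l]
  have hm : 0 < D.m := by linarith [D.hφ.l_le_m]
  have hν : 0 < w₀ - ν := by linarith [P.ν_lt]
  obtain ⟨A₁, hA₁⟩ := P.modularMap_fn_volume.bounded Y R
  obtain ⟨A₂, hA₂⟩ := P.modularMap_grad.bounded Y R
  obtain ⟨A₃, hA₃⟩ := P.modularMap_fn.bounded Y R
  obtain ⟨Cg, hCg, hgrad⟩ := exists_norm_gradient_cutoff_le N
  obtain ⟨r, hr⟩ := P.isBounded.subset_closedBall 0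
  set A := 2 + (ENNReal.ofReal (2 ^ D.m) * (A₂ + A₁)).toReal + (A₃ : ℝ) with hA
  have hA0 : 0 ≤ A := by positivity
  have hR0 : 0 ≤ |R| := abs_nonneg R
  refine ⟨((w₀ - ν) * D.l)⁻¹ * ((|R| + A) + Cg * D.m * (A₂ + A₁)), max (max r Cg) 1,
    by positivity, by positivity, fun U v hT hU ρ hρ => ?_⟩
  -- The cutoff equals one on `S` once `ρ ≥ r`. The condition `ρ ≥ Cg` makes its gradient at most
  -- one, so that the norm of the truncated function is bounded independently of `ρ`.
  have hρr : r ≤ ρ := ((le_max_left _ _).trans (le_max_left _ _)).trans hρ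
  have hρC : Cg ≤ ρ := ((le_max_right _ _).trans (le_max_left _ _)).trans hρ
  have hρ1 : 1 ≤ ρ := (le_max_right _ _).trans hρ
  have hρ0 : 0 < ρ := by linarith
  obtain ⟨W, hW1, hW2⟩ := P.exists_cutoff hT hρ0
  have hg1 : ∀ x : EuclideanSpace ℝ (Fin N), ‖gradient (cutoff ρ) x‖ ≤ 1 := fun x =>
    (hgrad ρ hρ0 x).trans ((div_le_one hρ0).2 hρC)
  have hWn : ‖W‖ ≤ A := by
    have h1 : modular (nFun D.φ) volume (grad W) ≤ ENNReal.ofReal (2 ^ D.m) * (A₂ + A₁) := by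
      have h2 : modular (nFun D.φ) volume (grad W) ≤ modular (nFun D.φ) volume
          ((fun x => ‖grad U x‖) + fun x => ‖fn U x‖) := by
        refine Y.modular_mono ?_
        filter_upwards [hW2] with x hx
        rw [hx, Pi.add_apply, Real.norm_of_nonneg (by positivity)]
        refine (norm_add_le _ _).trans (add_le_add ?_ ?_)
        · rw [norm_smul, Real.norm_of_nonneg (cutoff_nonneg ρ x)]
          exact mul_le_of_le_one_left (norm_nonneg _) (cutoff_le_one ρ x)
        · rw [norm_smul]
          exact mul_le_of_le_one_right (norm_nonneg _) (hg1 x)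
      refine h2.trans ((Y.modular_add_le (aesm_grad U).norm).trans (mul_le_mul' le_rfl
        (add_le_add ?_ ?_)))
      · exact (Y.modular_mono (Eventually.of_forall fun x => by simp)).trans (hA₂ U hU)
      · exact (Y.modular_mono (Eventually.of_forall fun x => by simp)).trans (hA₁ U hU)
    have h3 : modular (nFun D.φ) D.wMeasure (fn W) ≤ A₃ := by
      refine (Y.modular_mono ?_).trans (hA₃ U hU)
      filter_upwards [hW1.filter_mono D.wMeasure_ac.ae_le] with x hx
      rw [hx, norm_mul, Real.norm_of_nonneg (cutoff_nonneg ρ x)]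
      exact mul_le_of_le_one_left (norm_nonneg _) (cutoff_le_one ρ x)
    have h4 := norm_le_two_add P.κ_eq W
    have h5 := ENNReal.toReal_mono (by finiteness) h1
    have h6 := ENNReal.toReal_mono ENNReal.coe_ne_top h3
    rw [ENNReal.coe_toReal] at h6
    rw [hA]
    linarith
  have hS : ∀ x ∈ S, cutoff ρ x = 1 := fun x hx => by
    have := hr hx
    rw [mem_closedBall_zero_iff] at this
    exact cutoff_eq_one hρ0 (this.trans hρr)
  obtain ⟨hi, heq⟩ := P.integral_fderiv_energy U (U - W)
  have i1 := P.integrable_nFun_grad U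
  have i2 := P.integrable_nFun_fn U
  have i12 : Integrable fun x => nFun D.φ ‖grad U x‖ + nFun D.φ ‖fn U x‖ := i1.add i2
  have hms : MeasurableSet ((Metric.closedBall (0 : EuclideanSpace ℝ (Fin N)) (2 * ρ))ᶜ) :=
    Metric.isClosed_closedBall.measurableSet.compl
  -- The derivative is tested with `(1 - η) U`, which vanishes on `S`. Elsewhere the potential
  -- absorbs the nonlinearity and leaves `(w₀ - ν) l Φ(|U|)` beyond radius `2ρ`; the gradient of the
  -- cutoff costs only a multiple of `1 / ρ`.
  have hlow : (∫ x, ((w₀ - ν) * D.l * indicator (Metric.closedBall 0 (2 * ρ))ᶜ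
      (fun x => nFun D.φ ‖fn U x‖) x - Cg / ρ * D.m * (nFun D.φ ‖grad U x‖ + nFun D.φ ‖fn U x‖)))
      ≤ fderiv ℝ (D.energy (gFun S f p)) U (U - W) := by
    rw [heq]
    refine integral_mono_ae (((i2.indicator hms).const_mul _).sub (i12.const_mul _)) hi ?_
    filter_upwards [hW1, hW2, P.modularMap_fn_volume.map_sub U W,
      P.modularMap_grad.map_sub U W] with x h1 h2 h3 h4
    rw [h3, h4, Pi.sub_apply, Pi.sub_apply, h1, h2]
    set η := cutoff ρ x with hη
    have hη0 : 0 ≤ 1 - η := by linarith [cutoff_le_one ρ x]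
    have e1 : grad U x - (η • grad U x + fn U x • gradient (cutoff ρ) x)
        = (1 - η) • grad U x - fn U x • gradient (cutoff ρ) x := by module
    have e2 : fn U x - η * fn U x = (1 - η) * fn U x := by ring
    have g1 : -(Cg / ρ * D.m * (nFun D.φ ‖grad U x‖ + nFun D.φ ‖fn U x‖))
        ≤ inner ℝ (D.φ ‖grad U x‖ • grad U x)
          ((1 - η) • grad U x - fn U x • gradient (cutoff ρ) x) := by
      rw [inner_sub_right, real_inner_smul_right, PhiAssumptions.inner_smul_eq]
      have t1 := mul_nonneg hη0 (mul_nonneg (D.hφ.mulExt_nonneg ‖grad U x‖)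
        (norm_nonneg (grad U x)))
      have t2 := (abs_le.1 (D.hφ.abs_inner_smul_le (grad U x)
        (fn U x • gradient (cutoff ρ) x))).2
      have t3 : mulExt D.φ ‖grad U x‖ * ‖fn U x • gradient (cutoff ρ) x‖
          ≤ Cg / ρ * (mulExt D.φ ‖grad U x‖ * ‖fn U x‖) := by
        rw [norm_smul]
        have := mul_le_mul_of_nonneg_left (hgrad ρ hρ0 x)
          (mul_nonneg (D.hφ.mulExt_nonneg ‖grad U x‖) (norm_nonneg (fn U x)))
        linarith
      have t4 := mul_le_mul_of_nonneg_left
        (Y.a_mul_le (norm_nonneg (grad U x)) (norm_nonneg (fn U x)))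
        (by positivity : 0 ≤ Cg / ρ)
      linarith
    have g2 : (w₀ - ν) * D.l * indicator (Metric.closedBall 0 (2 * ρ))ᶜ
        (fun x => nFun D.φ ‖fn U x‖) x
        ≤ D.w x * inner ℝ (D.φ ‖fn U x‖ • fn U x) ((1 - η) * fn U x)
          - inner ℝ (gFun S f p x (fn U x)) ((1 - η) * fn U x) := by
      have e3 : inner ℝ (D.φ ‖fn U x‖ • fn U x) ((1 - η) * fn U x)
          = (1 - η) * (mulExt D.φ ‖fn U x‖ * ‖fn U x‖) := by
        rw [← smul_eq_mul (1 - η), real_inner_smul_right, PhiAssumptions.inner_smul_eq]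
      have e4 : inner ℝ (gFun S f p x (fn U x)) ((1 - η) * fn U x)
          = (1 - η) * (gFun S f p x (fn U x) * fn U x) := by
        simp only [RCLike.inner_apply, conj_trivial]
        ring
      rw [e3, e4]
      have hlow := Y.lower _ (norm_nonneg (fn U x))
      have hΦ := D.hφ.nFun_nonneg ‖fn U x‖
      by_cases hx : x ∈ S
      · have hη1 : η = 1 := hS x hx
        have hx2 : x ∉ (Metric.closedBall (0 : EuclideanSpace ℝ (Fin N)) (2 * ρ))ᶜ := by
          rw [notMem_compl_iff]
          exact Metric.closedBall_subset_closedBall (by linarith) (hr hx)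
        rw [indicator_of_notMem hx2, hη1]
        simp
      · have t1 := P.gFun_mul_le hx (fn U x)
        have t2 := P.le_w x
        have t3 : (w₀ - ν) * (mulExt D.φ ‖fn U x‖ * ‖fn U x‖)
            ≤ D.w x * (mulExt D.φ ‖fn U x‖ * ‖fn U x‖) - gFun S f p x (fn U x) * fn U x := by
          have := mul_le_mul_of_nonneg_right t2 (mul_nonneg (D.hφ.mulExt_nonneg ‖fn U x‖)
            (norm_nonneg (fn U x)))
          linarith
        have t4 := mul_le_mul_of_nonneg_left t3 hη0
        have t5 : (w₀ - ν) * D.l * indicator (Metric.closedBall 0 (2 * ρ))ᶜ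
            (fun x => nFun D.φ ‖fn U x‖) x
            ≤ (1 - η) * ((w₀ - ν) * (mulExt D.φ ‖fn U x‖ * ‖fn U x‖)) := by
          by_cases hx3 : x ∈ (Metric.closedBall (0 : EuclideanSpace ℝ (Fin N)) (2 * ρ))ᶜ
          · rw [indicator_of_mem hx3]
            have hη1 : η = 0 := by
              rw [mem_compl_iff, mem_closedBall_zero_iff, not_le] at hx3
              exact cutoff_eq_zero hρ0 hx3.le
            rw [hη1]
            have := mul_le_mul_of_nonneg_left hlow hν.le
            linarith
          · rw [indicator_of_notMem hx3, mul_zero]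
            exact mul_nonneg hη0 (mul_nonneg hν.le (mul_nonneg (D.hφ.mulExt_nonneg _)
              (norm_nonneg _)))
        linarith
    rw [e1, e2]
    linarith
  rw [integral_sub ((i2.indicator hms).const_mul _) (i12.const_mul _),
    integral_const_mul, integral_const_mul, integral_indicator hms, integral_add i1 i2] at hlow
  have b1 : (∫ x, nFun D.φ ‖grad U x‖) ≤ A₂ := by
    rw [Y.integral_eq (aesm_grad U)]
    exact ENNReal.toReal_le_coe_of_le_coe (hA₂ U hU)
  have b2 : (∫ x, nFun D.φ ‖fn U x‖) ≤ A₁ := by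
    rw [Y.integral_eq (aesm_fn U)]
    exact ENNReal.toReal_le_coe_of_le_coe (hA₁ U hU)
  set j := ‖fderiv ℝ (D.energy (gFun S f p)) U‖ with hj
  have hj0 : 0 ≤ j := norm_nonneg _
  have b3 : fderiv ℝ (D.energy (gFun S f p)) U (U - W) ≤ j * (|R| + A) := by
    refine (Real.le_norm_self _).trans ((ContinuousLinearMap.le_opNorm _ _).trans ?_)
    refine mul_le_mul_of_nonneg_left ((norm_sub_le _ _).trans (add_le_add ?_ hWn)) hj0
    exact hU.trans (le_abs_self R)
  have b4 : Cg / ρ * D.m * ((∫ x, nFun D.φ ‖grad U x‖) + ∫ x, nFun D.φ ‖fn U x‖)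
      ≤ Cg / ρ * D.m * (A₂ + A₁) :=
    mul_le_mul_of_nonneg_left (add_le_add b1 b2) (by positivity)
  have hpos : 0 < (w₀ - ν) * D.l := mul_pos hν hl
  rw [mul_assoc, le_inv_mul_iff₀ hpos]
  have b5 : 0 ≤ (|R| + A) * (1 / ρ) := by positivity
  have b6 : 0 ≤ Cg * D.m * (A₂ + A₁) * j := by positivity
  have b7 : Cg / ρ * D.m * ((A₂ : ℝ) + A₁) = Cg * D.m * (A₂ + A₁) * (1 / ρ) := by ring
  rw [b7] at b4
  nlinarith

end Penalized
end OrliczNehari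

/-! ### Strong convergence of almost critical sequences -/

namespace OrliczNehari

namespace Penalized

open SpaceData PhiAssumptions

variable {N : ℕ} {D : SpaceData N} {S : Set (EuclideanSpace ℝ (Fin N))} {f p : ℝ → ℝ}
  {w₀ ν θ τ q γ : ℝ}

theorem exists_abs_gFun_le (P : Penalized D S f p w₀ ν θ τ q γ) :
    ∃ C, 0 ≤ C ∧ ∀ x s, |gFun S f p x s| ≤ C * sumDensity D.φ q ‖s‖ := by
  obtain ⟨C, hC, hb⟩ := P.nemytskiiData_primitive.bound
  exact ⟨C, hC, hb⟩

/-- The difference of the nonlinear terms at two functions. -/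
noncomputable def gGap (S : Set (EuclideanSpace ℝ (Fin N))) (f p : ℝ → ℝ)
    (x : EuclideanSpace ℝ (Fin N)) (s t : ℝ) : ℝ :=
  inner ℝ (gFun S f p x s - gFun S f p x t) (s - t)

/-- The growth of `g` is combined with `a_mul_le_eps'`, so that the bounded modulars of `s` and `t`
carry the small coefficient and only the difference carries the large one. -/
theorem enorm_gGap_le (P : Penalized D S f p w₀ ν θ τ q γ) {δ : ℝ} (hδ : 0 < δ) :
    ∃ K, 0 ≤ K ∧ ∀ x s t, |gGap S f p x s t|
      ≤ δ * ((nFun D.φ ‖s‖ + ‖s‖ ^ q) + (nFun D.φ ‖t‖ + ‖t‖ ^ q))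
        + K * (nFun D.φ ‖s - t‖ + ‖s - t‖ ^ q) := by
  obtain ⟨C, hC, hb⟩ := P.exists_abs_gFun_le
  obtain ⟨K, hK, hKb⟩ := P.youngPair_q.a_mul_le_eps' (δ := δ / (C + 1)) (by positivity)
  refine ⟨C * (2 * K), by positivity, fun x s t => ?_⟩
  have h1 := hKb _ _ (norm_nonneg s) (norm_nonneg (s - t))
  have h2 := hKb _ _ (norm_nonneg t) (norm_nonneg (s - t))
  have h0 : ∀ s : ℝ, 0 ≤ nFun D.φ ‖s‖ + ‖s‖ ^ q := fun s =>
    P.youngPair_q.nonneg (norm_nonneg s)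
  have hCδ : C * (δ / (C + 1)) ≤ δ := by
    rw [mul_div_assoc', div_le_iff₀ (by positivity)]
    nlinarith
  have h3 : |gGap S f p x s t|
      ≤ (C * sumDensity D.φ q ‖s‖ + C * sumDensity D.φ q ‖t‖) * ‖s - t‖ := by
    refine (abs_real_inner_le_norm _ _).trans (mul_le_mul_of_nonneg_right ?_ (norm_nonneg _))
    exact (norm_sub_le _ _).trans (add_le_add (hb x s) (hb x t))
  have h4 := mul_le_mul_of_nonneg_left (add_le_add h1 h2) hC
  have h5 := mul_le_mul_of_nonneg_right hCδ (add_nonneg (h0 s) (h0 t))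
  linarith

/-- Outside `S` the truncated nonlinearity grows no faster than the density of `Φ`, without the
power `q`; hence small tails of `Φ` suffice there. -/
theorem abs_gGap_le (P : Penalized D S f p w₀ ν θ τ q γ) {x : EuclideanSpace ℝ (Fin N)}
    (hx : x ∉ S) (s t : ℝ) :
    |gGap S f p x s t| ≤ ν * (4 * D.m) * (nFun D.φ ‖s‖ + nFun D.φ ‖t‖) := by
  have Y := D.hφ.youngPair
  have h3 : |gGap S f p x s t|
      ≤ (ν * mulExt D.φ ‖s‖ + ν * mulExt D.φ ‖t‖) * (‖s‖ + ‖t‖) := by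
    refine (abs_real_inner_le_norm _ _).trans (mul_le_mul ?_ (norm_sub_le _ _) (norm_nonneg _) ?_)
    · exact (norm_sub_le _ _).trans (add_le_add (P.abs_gFun_le hx s) (P.abs_gFun_le hx t))
    · exact add_nonneg (mul_nonneg P.ν_nonneg (D.hφ.mulExt_nonneg _))
        (mul_nonneg P.ν_nonneg (D.hφ.mulExt_nonneg _))
  have h1 := Y.a_mul_le (norm_nonneg s) (norm_nonneg s)
  have h2 := Y.a_mul_le (norm_nonneg s) (norm_nonneg t)
  have h4 := Y.a_mul_le (norm_nonneg t) (norm_nonneg s)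
  have h5 := Y.a_mul_le (norm_nonneg t) (norm_nonneg t)
  have h6 := mul_le_mul_of_nonneg_left (add_le_add (add_le_add h1 h2) (add_le_add h4 h5))
    P.ν_nonneg
  linarith

/-- The nonlinear term is compact along almost critical sequences. -/
theorem tendsto_integral_gGap (P : Penalized D S f p w₀ ν θ τ q γ) {U : ℕ → D.Space} {R : ℝ}
    (hR : ∀ n, ‖U n‖ ≤ R)
    (hloc : ∀ ρ : ℝ, Tendsto (fun i : ℕ × ℕ =>
      ∫⁻ x in Metric.closedBall 0 ρ, ENNReal.ofReal
        (nFun D.φ ‖fn (U i.1) x - fn (U i.2) x‖ + ‖fn (U i.1) x - fn (U i.2) x‖ ^ q)) atTop (𝓝 0))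
    (htail : ∀ e > 0, ∃ ρ, ∀ᶠ n in atTop,
      ∫⁻ x in (Metric.closedBall 0 ρ)ᶜ, ENNReal.ofReal (nFun D.φ ‖fn (U n) x‖) ≤ e) :
    Tendsto (fun i : ℕ × ℕ => ∫ x, gGap S f p x (fn (U i.1) x) (fn (U i.2) x)) atTop (𝓝 0) := by
  have Yq := P.youngPair_q
  have hm : 0 < D.m := by linarith [D.hφ.one_lt_l, D.hφ.l_le_m]
  obtain ⟨A, hA⟩ := P.modularMap_fn_q.bounded Yq R
  obtain ⟨r, hr⟩ := P.isBounded.subset_closedBall 0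
  have hmono : ∀ {ρ ρ' : ℝ}, ρ ≤ ρ' → ∀ h : EuclideanSpace ℝ (Fin N) → ENNReal,
      ∫⁻ x in (Metric.closedBall 0 ρ')ᶜ, h x ≤ ∫⁻ x in (Metric.closedBall 0 ρ)ᶜ, h x :=
    fun hρ h => lintegral_mono_set (compl_subset_compl.2 (Metric.closedBall_subset_closedBall hρ))
  suffices hkey : Tendsto (fun i : ℕ × ℕ =>
      ∫⁻ x, ‖gGap S f p x (fn (U i.1) x) (fn (U i.2) x)‖ₑ) atTop (𝓝 0) by
    rw [tendsto_zero_iff_enorm_tendsto_zero]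
    exact tendsto_of_tendsto_of_tendsto_of_le_of_le tendsto_const_nhds hkey (fun _ => zero_le)
      fun i => enorm_integral_le_lintegral_enorm _
  have hgt : ∀ {B e : ENNReal}, B ≠ ⊤ → 0 < e → ∃ δ : ℝ, 0 < δ ∧ ENNReal.ofReal δ * B ≤ e := by
    intro B e hB he
    have h1 : Tendsto (fun δ : ℝ => ENNReal.ofReal δ * B) (𝓝[>] 0) (𝓝 0) := by
      have h2 : Tendsto (fun δ : ℝ => ENNReal.ofReal δ) (𝓝[>] 0) (𝓝 0) := by
        have := (ENNReal.continuous_ofReal.tendsto 0).mono_left (nhdsWithin_le_nhds (s := Ioi 0))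
        rwa [ENNReal.ofReal_zero] at this
      simpa using ENNReal.Tendsto.mul_const h2 (Or.inr hB)
    obtain ⟨δ, hδ1, hδ⟩ := (((ENNReal.tendsto_nhds_zero.1 h1) _ he).and self_mem_nhdsWithin).exists
    exact ⟨δ, hδ, hδ1⟩
  rw [ENNReal.tendsto_nhds_zero]
  intro e he
  have he2 : 0 < e / 2 := ENNReal.div_pos he.ne' (by simp)
  have he4 : 0 < e / 2 / 2 := ENNReal.div_pos he2.ne' (by simp)
  obtain ⟨δ, hδ, hδe⟩ := hgt (B := A + A) (by finiteness) he4
  obtain ⟨K, hK, hKb⟩ := P.enorm_gGap_le hδ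
  set c := ENNReal.ofReal (ν * (4 * D.m)) with hc
  obtain ⟨ε, hε, hεe⟩ := hgt (B := c * 2) (by finiteness) he2
  obtain ⟨ρ₁, hρ₁⟩ := htail (ENNReal.ofReal ε) (ENNReal.ofReal_pos.2 hε)
  -- Inside this ball, which contains `S`, local compactness is used; outside it the tail estimate
  -- for `Φ`.
  set ρ := max r ρ₁ with hρ
  have hSρ : S ⊆ Metric.closedBall 0 ρ :=
    hr.trans (Metric.closedBall_subset_closedBall (le_max_left _ _))
  have h3 : Tendsto (fun i : ℕ × ℕ => ENNReal.ofReal K *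
      ∫⁻ x in Metric.closedBall 0 ρ, ENNReal.ofReal
        (nFun D.φ ‖fn (U i.1) x - fn (U i.2) x‖ + ‖fn (U i.1) x - fn (U i.2) x‖ ^ q)) atTop
      (𝓝 0) := by
    simpa using ENNReal.Tendsto.const_mul (hloc ρ) (Or.inr ENNReal.ofReal_ne_top)
  have htl : ∀ᶠ i : ℕ × ℕ in atTop,
      (∫⁻ x in (Metric.closedBall 0 ρ)ᶜ, ENNReal.ofReal (nFun D.φ ‖fn (U i.1) x‖)
        ≤ ENNReal.ofReal ε) ∧
      ∫⁻ x in (Metric.closedBall 0 ρ)ᶜ, ENNReal.ofReal (nFun D.φ ‖fn (U i.2) x‖)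
        ≤ ENNReal.ofReal ε := by
    rw [← prod_atTop_atTop_eq]
    exact (tendsto_fst.eventually (hρ₁.mono fun n hn =>
      (hmono (le_max_right _ _) _).trans hn)).and (tendsto_snd.eventually (hρ₁.mono fun n hn =>
      (hmono (le_max_right _ _) _).trans hn))
  filter_upwards [(ENNReal.tendsto_nhds_zero.1 h3) _ he4, htl] with i hi hti
  have hmes : ∀ n, AEMeasurable (fun x => ENNReal.ofReal
      (nFun D.φ ‖fn (U n) x‖ + ‖fn (U n) x‖ ^ q)) volume := fun n => Yq.aemeasurable (aesm_fn _)
  rw [← lintegral_add_compl _ (Metric.isClosed_closedBall (x := (0 : EuclideanSpace ℝ (Fin N)))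
    (ε := ρ)).measurableSet]
  have hin : ∫⁻ x in Metric.closedBall 0 ρ, ‖gGap S f p x (fn (U i.1) x) (fn (U i.2) x)‖ₑ
      ≤ e / 2 := by
    calc ∫⁻ x in Metric.closedBall 0 ρ, ‖gGap S f p x (fn (U i.1) x) (fn (U i.2) x)‖ₑ
        ≤ ∫⁻ x in Metric.closedBall 0 ρ, (ENNReal.ofReal δ *
            (ENNReal.ofReal (nFun D.φ ‖fn (U i.1) x‖ + ‖fn (U i.1) x‖ ^ q)
            + ENNReal.ofReal (nFun D.φ ‖fn (U i.2) x‖ + ‖fn (U i.2) x‖ ^ q))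
            + ENNReal.ofReal K * ENNReal.ofReal
        (nFun D.φ ‖fn (U i.1) x - fn (U i.2) x‖ + ‖fn (U i.1) x - fn (U i.2) x‖ ^ q)) := by
          refine lintegral_mono fun x => ?_
          have n1 := Yq.nonneg (norm_nonneg (fn (U i.1) x))
          have n2 := Yq.nonneg (norm_nonneg (fn (U i.2) x))
          have n3 := Yq.nonneg (norm_nonneg (fn (U i.1) x - fn (U i.2) x))
          rw [← ENNReal.ofReal_add n1 n2, ← ENNReal.ofReal_mul hδ.le, ← ENNReal.ofReal_mul hK,
            ← ENNReal.ofReal_add (by positivity) (by positivity), ← ofReal_norm]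
          exact ENNReal.ofReal_le_ofReal (hKb x _ _)
      _ = ENNReal.ofReal δ * ((∫⁻ x in Metric.closedBall 0 ρ,
            ENNReal.ofReal (nFun D.φ ‖fn (U i.1) x‖ + ‖fn (U i.1) x‖ ^ q))
            + ∫⁻ x in Metric.closedBall 0 ρ,
              ENNReal.ofReal (nFun D.φ ‖fn (U i.2) x‖ + ‖fn (U i.2) x‖ ^ q))
          + ENNReal.ofReal K * ∫⁻ x in Metric.closedBall 0 ρ, ENNReal.ofReal
        (nFun D.φ ‖fn (U i.1) x - fn (U i.2) x‖ + ‖fn (U i.1) x - fn (U i.2) x‖ ^ q) := by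
          rw [lintegral_add_left', lintegral_const_mul' _ _ ENNReal.ofReal_ne_top,
            lintegral_const_mul' _ _ ENNReal.ofReal_ne_top, lintegral_add_left']
          · exact (hmes _).restrict
          · exact ((hmes _).restrict.add (hmes _).restrict).const_mul _
      _ ≤ ENNReal.ofReal δ * (A + A) + e / 2 / 2 := by
          refine add_le_add (mul_le_mul' le_rfl (add_le_add ?_ ?_)) hi
          · exact (setLIntegral_le_lintegral _ _).trans (hA _ (hR _))
          · exact (setLIntegral_le_lintegral _ _).trans (hA _ (hR _))
      _ ≤ e / 2 / 2 + e / 2 / 2 := add_le_add hδe le_rfl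
      _ = e / 2 := ENNReal.add_halves _
  have hout : ∫⁻ x in (Metric.closedBall 0 ρ)ᶜ,
      ‖gGap S f p x (fn (U i.1) x) (fn (U i.2) x)‖ₑ ≤ e / 2 := by
    have hpos : 0 ≤ ν * (4 * D.m) := mul_nonneg P.ν_nonneg (by positivity)
    calc ∫⁻ x in (Metric.closedBall 0 ρ)ᶜ, ‖gGap S f p x (fn (U i.1) x) (fn (U i.2) x)‖ₑ
        ≤ ∫⁻ x in (Metric.closedBall 0 ρ)ᶜ, c * (ENNReal.ofReal (nFun D.φ ‖fn (U i.1) x‖)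
            + ENNReal.ofReal (nFun D.φ ‖fn (U i.2) x‖)) := by
          refine setLIntegral_mono' Metric.isClosed_closedBall.measurableSet.compl fun x hx => ?_
          have n1 := D.hφ.nFun_nonneg ‖fn (U i.1) x‖
          have n2 := D.hφ.nFun_nonneg ‖fn (U i.2) x‖
          rw [hc, ← ENNReal.ofReal_add n1 n2, ← ENNReal.ofReal_mul hpos, ← ofReal_norm]
          exact ENNReal.ofReal_le_ofReal (P.abs_gGap_le (fun h => hx (hSρ h)) _ _)
      _ = c * ((∫⁻ x in (Metric.closedBall 0 ρ)ᶜ, ENNReal.ofReal (nFun D.φ ‖fn (U i.1) x‖))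
            + ∫⁻ x in (Metric.closedBall 0 ρ)ᶜ, ENNReal.ofReal (nFun D.φ ‖fn (U i.2) x‖)) := by
          rw [lintegral_const_mul' _ _ ENNReal.ofReal_ne_top, lintegral_add_left']
          exact (D.hφ.youngPair.aemeasurable (aesm_fn _)).restrict
      _ ≤ c * (ENNReal.ofReal ε + ENNReal.ofReal ε) :=
          mul_le_mul' le_rfl (add_le_add hti.1 hti.2)
      _ = ENNReal.ofReal ε * (c * 2) := by ring
      _ ≤ e / 2 := hεe
  exact (add_le_add hin hout).trans (ENNReal.add_halves e).le

theorem monoGap_eq (φ : ℝ → ℝ) {E : Type*} [NormedAddCommGroup E] [InnerProductSpace ℝ E]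
    (x y : E) : monoGap φ x y
      = inner ℝ (φ ‖x‖ • x) (x - y) - inner ℝ (φ ‖y‖ • y) (x - y) := inner_sub_left _ _ _

/-- The monotonicity identity for the derivative of the energy. -/
theorem fderiv_energy_sub (P : Penalized D S f p w₀ ν θ τ q γ) (u v : D.Space) :
    (∫ x, monoGap D.φ (grad u x) (grad v x)) + (∫ x, monoGap D.φ (fn u x) (fn v x) ∂D.wMeasure)
      = (fderiv ℝ (D.energy (gFun S f p)) u - fderiv ℝ (D.energy (gFun S f p)) v) (u - v)
        + ∫ x, gGap S f p x (fn u x) (fn v x) := by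
  rw [sub_apply, P.fderiv_energy_apply, P.fderiv_energy_apply]
  have e1 : (∫ x, monoGap D.φ (grad u x) (grad v x))
      = (∫ x, inner ℝ (D.φ ‖grad u x‖ • grad u x) (grad (u - v) x))
        - ∫ x, inner ℝ (D.φ ‖grad v x‖ • grad v x) (grad (u - v) x) := by
    rw [← integral_sub (P.integrable_inner_grad u _) (P.integrable_inner_grad v _)]
    refine integral_congr_ae ((P.modularMap_grad.map_sub u v).mono fun x hx => ?_)
    dsimp only
    rw [hx, monoGap_eq, Pi.sub_apply]
  have e2 : (∫ x, monoGap D.φ (fn u x) (fn v x) ∂D.wMeasure)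
      = (∫ x, inner ℝ (D.φ ‖fn u x‖ • fn u x) (fn (u - v) x) ∂D.wMeasure)
        - ∫ x, inner ℝ (D.φ ‖fn v x‖ • fn v x) (fn (u - v) x) ∂D.wMeasure := by
    rw [← integral_sub (P.integrable_inner_fn u _) (P.integrable_inner_fn v _)]
    refine integral_congr_ae ((P.modularMap_fn.map_sub u v).mono fun x hx => ?_)
    dsimp only
    rw [hx, monoGap_eq, Pi.sub_apply]
  have e3 : (∫ x, gGap S f p x (fn u x) (fn v x))
      = (∫ x, inner ℝ (gFun S f p x (fn u x)) (fn (u - v) x))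
        - ∫ x, inner ℝ (gFun S f p x (fn v x)) (fn (u - v) x) := by
    rw [← integral_sub (P.integrable_inner_g u _) (P.integrable_inner_g v _)]
    refine integral_congr_ae ((P.modularMap_fn_volume.map_sub u v).mono fun x hx => ?_)
    dsimp only
    rw [hx, gGap, inner_sub_left, Pi.sub_apply]
  rw [e1, e2, e3]
  ring

theorem integrable_monoGap_grad (P : Penalized D S f p w₀ ν θ τ q γ) (u v : D.Space) :
    Integrable fun x => monoGap D.φ (grad u x) (grad v x) := by
  refine ((P.integrable_inner_grad u (u - v)).sub (P.integrable_inner_grad v (u - v))).congr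
    ((P.modularMap_grad.map_sub u v).mono fun x hx => ?_)
  simp only [Pi.sub_apply, hx, monoGap_eq]

theorem integrable_monoGap_fn (P : Penalized D S f p w₀ ν θ τ q γ) (u v : D.Space) :
    Integrable (fun x => monoGap D.φ (fn u x) (fn v x)) D.wMeasure := by
  refine ((P.integrable_inner_fn u (u - v)).sub (P.integrable_inner_fn v (u - v))).congr
    ((P.modularMap_fn.map_sub u v).mono fun x hx => ?_)
  simp only [Pi.sub_apply, hx, monoGap_eq]

theorem eventually_tail_le (P : Penalized D S f p w₀ ν θ τ q γ) {U : ℕ → D.Space}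
    {v : ℕ → EuclideanSpace ℝ (Fin N) → ℝ} {R : ℝ} (hR : ∀ n, ‖U n‖ ≤ R)
    (hT : ∀ n, IsTest (U n) (v n))
    (hJ : Tendsto (fun n => ‖fderiv ℝ (D.energy (gFun S f p)) (U n)‖) atTop (𝓝 0)) :
    ∀ e > 0, ∃ ρ, ∀ᶠ n in atTop,
      ∫⁻ x in (Metric.closedBall 0 ρ)ᶜ, ENNReal.ofReal (nFun D.φ ‖fn (U n) x‖) ≤ e := by
  intro e he
  obtain ⟨C, ρ₀, hC, hρ₀, hb⟩ := P.exists_integral_tail_le R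
  obtain ⟨d, hd0, hde⟩ : ∃ d : ℝ, 0 < d ∧ ENNReal.ofReal d ≤ e := by
    rcases eq_or_ne e ⊤ with rfl | h
    · exact ⟨1, one_pos, le_top⟩
    · exact ⟨e.toReal, ENNReal.toReal_pos he.ne' h, (ENNReal.ofReal_toReal h).le⟩
  set ρ := max ρ₀ (2 * (C + 1) / d) with hρ
  have hρ0 : 0 < ρ := hρ₀.trans_le (le_max_left _ _)
  refine ⟨2 * ρ, ?_⟩
  filter_upwards [hJ.eventually (gt_mem_nhds (by positivity : 0 < d / (2 * (C + 1))))] with n hn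
  have h1 := hb _ _ (hT n) (hR _) ρ (le_max_left _ _)
  have h2 : 1 / ρ ≤ d / (2 * (C + 1)) := by
    rw [div_le_div_iff₀ hρ0 (by positivity), one_mul, mul_comm d, ← div_le_iff₀ hd0]
    exact le_max_right _ _
  have h3 : C * (‖fderiv ℝ (D.energy (gFun S f p)) (U n)‖ + 1 / ρ) ≤ d := by
    have h4 : ‖fderiv ℝ (D.energy (gFun S f p)) (U n)‖ + 1 / ρ ≤ d / (C + 1) := by
      have : d / (C + 1) = d / (2 * (C + 1)) + d / (2 * (C + 1)) := by field_simp; ring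
      rw [this]
      exact add_le_add hn.le h2
    refine (mul_le_mul_of_nonneg_left h4 hC).trans ?_
    rw [mul_div_assoc', div_le_iff₀ (by positivity)]
    nlinarith
  rw [← ofReal_integral_eq_lintegral_ofReal (P.integrable_nFun_fn _).integrableOn
    (Eventually.of_forall fun x => D.hφ.nFun_nonneg _)]
  exact (ENNReal.ofReal_le_ofReal (h1.trans h3)).trans hde

/-- The sum of the two gap integrals is given by `fderiv_energy_sub` and tends to zero, since the
derivatives tend to zero and are paired with bounded differences. As both integrals are nonnegative,
each tends to zero. -/
theorem tendsto_monoGap (P : Penalized D S f p w₀ ν θ τ q γ) {U : ℕ → D.Space} {R : ℝ}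
    (hR : ∀ n, ‖U n‖ ≤ R)
    (hJ : Tendsto (fun n => ‖fderiv ℝ (D.energy (gFun S f p)) (U n)‖) atTop (𝓝 0))
    (hg : Tendsto (fun i : ℕ × ℕ => ∫ x, gGap S f p x (fn (U i.1) x) (fn (U i.2) x)) atTop
      (𝓝 0)) :
    Tendsto (fun i : ℕ × ℕ => ∫⁻ x,
      ENNReal.ofReal (monoGap D.φ (grad (U i.1) x) (grad (U i.2) x))) atTop (𝓝 0) ∧
    Tendsto (fun i : ℕ × ℕ => ∫⁻ x,
      ENNReal.ofReal (monoGap D.φ (fn (U i.1) x) (fn (U i.2) x)) ∂D.wMeasure) atTop (𝓝 0) := by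
  have hsum : Tendsto (fun i : ℕ × ℕ =>
      (fderiv ℝ (D.energy (gFun S f p)) (U i.1) - fderiv ℝ (D.energy (gFun S f p)) (U i.2))
        (U i.1 - U i.2)) atTop (𝓝 0) := by
    have h1 : Tendsto (fun i : ℕ × ℕ => (‖fderiv ℝ (D.energy (gFun S f p)) (U i.1)‖
        + ‖fderiv ℝ (D.energy (gFun S f p)) (U i.2)‖) * (R + R)) atTop (𝓝 0) := by
      rw [← prod_atTop_atTop_eq]
      have := ((hJ.comp tendsto_fst).add (hJ.comp (tendsto_snd (f := atTop (α := ℕ))))).mul_const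
        (R + R)
      simpa using this
    refine squeeze_zero_norm (fun i => (ContinuousLinearMap.le_opNorm _ _).trans ?_) h1
    exact mul_le_mul (norm_sub_le _ _) ((norm_sub_le _ _).trans (add_le_add (hR _) (hR _)))
      (norm_nonneg _) (add_nonneg (norm_nonneg _) (norm_nonneg _))
  have hgap : Tendsto (fun i : ℕ × ℕ =>
      (∫ x, monoGap D.φ (grad (U i.1) x) (grad (U i.2) x))
        + ∫ x, monoGap D.φ (fn (U i.1) x) (fn (U i.2) x) ∂D.wMeasure) atTop (𝓝 0) := by
    have := hsum.add hg
    rw [add_zero] at this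
    exact this.congr fun i => (P.fderiv_energy_sub _ _).symm
  have hn1 : ∀ u v : D.Space, 0 ≤ ∫ x, monoGap D.φ (grad u x) (grad v x) := fun u v =>
    integral_nonneg fun x => D.hφ.monoGap_nonneg _ _
  have hn2 : ∀ u v : D.Space, 0 ≤ ∫ x, monoGap D.φ (fn u x) (fn v x) ∂D.wMeasure := fun u v =>
    integral_nonneg fun x => D.hφ.monoGap_nonneg _ _
  constructor
  · have := ENNReal.tendsto_ofReal (squeeze_zero (fun i => hn1 _ _)
      (fun i => le_add_of_nonneg_right (hn2 _ _)) hgap)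
    rw [ENNReal.ofReal_zero] at this
    exact this.congr fun i => ofReal_integral_eq_lintegral_ofReal (P.integrable_monoGap_grad _ _)
      (Eventually.of_forall fun x => D.hφ.monoGap_nonneg _ _)
  · have := ENNReal.tendsto_ofReal (squeeze_zero (fun i => hn2 _ _)
      (fun i => le_add_of_nonneg_left (hn1 _ _)) hgap)
    rw [ENNReal.ofReal_zero] at this
    exact this.congr fun i => ofReal_integral_eq_lintegral_ofReal (P.integrable_monoGap_fn _ _)
      (Eventually.of_forall fun x => D.hφ.monoGap_nonneg _ _)

theorem exists_subseq_fn (P : Penalized D S f p w₀ ν θ τ q γ) {U : ℕ → D.Space}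
    {R : ℝ} (hR : ∀ n, ‖U n‖ ≤ R)
    (t2 : Tendsto (fun i : ℕ × ℕ => ∫⁻ x,
      ENNReal.ofReal (monoGap D.φ (fn (U i.1) x) (fn (U i.2) x)) ∂D.wMeasure) atTop (𝓝 0)) :
    ∃ (σ : ℕ → ℕ) (z : EuclideanSpace ℝ (Fin N) → ℝ), StrictMono σ ∧ StronglyMeasurable z ∧
      modular (nFun D.φ) D.wMeasure z < ⊤ ∧
      Tendsto (fun n => modular (nFun D.φ) D.wMeasure (fn (U (σ n)) - z)) atTop (𝓝 0) := by
  obtain ⟨C, hC⟩ := P.modularMap_fn.bounded D.hφ.youngPair R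
  have hm : ∀ n, AEStronglyMeasurable (fn (U n)) D.wMeasure := fun n =>
    (aesm_fn (U n)).mono_ac D.wMeasure_ac
  obtain ⟨σ, z, h1, h2, h3, h4⟩ := exists_subseq_modular_of_monoGap D.hφ
    (w := fun n => fn (U n)) hm (fun n => hC _ (hR n)) t2
  exact ⟨σ, z, h1, h2, h3.trans_lt ENNReal.coe_lt_top, h4⟩

/-- The `(S₊)` property is applied to the gradients and then, along the subsequence, to the
functions in the weighted measure. That the two limits form a function and its weak gradient is
`exists_tendsto_of_modular`. -/
theorem exists_tendsto_of_monoGap (P : Penalized D S f p w₀ ν θ τ q γ) {U : ℕ → D.Space}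
    {R : ℝ} (hR : ∀ n, ‖U n‖ ≤ R)
    (t1 : Tendsto (fun i : ℕ × ℕ => ∫⁻ x,
      ENNReal.ofReal (monoGap D.φ (grad (U i.1) x) (grad (U i.2) x))) atTop (𝓝 0))
    (t2 : Tendsto (fun i : ℕ × ℕ => ∫⁻ x,
      ENNReal.ofReal (monoGap D.φ (fn (U i.1) x) (fn (U i.2) x)) ∂D.wMeasure) atTop (𝓝 0)) :
    ∃ (σ : ℕ → ℕ) (V : D.Space), StrictMono σ ∧ Tendsto (fun n => U (σ n)) atTop (𝓝 V) := by
  have Y := D.hφ.youngPair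
  obtain ⟨C₁, hC₁⟩ := P.modularMap_grad.bounded Y R
  obtain ⟨σ₁, z₁, hσ₁, hz₁, hzC₁, hlim₁⟩ := exists_subseq_modular_of_monoGap D.hφ
    (w := fun n => grad (U n)) (fun n => aesm_grad (U n)) (fun n => hC₁ _ (hR n)) t1
  have t3 : Tendsto (fun i : ℕ × ℕ => ∫⁻ x, ENNReal.ofReal
      (monoGap D.φ (fn (U (σ₁ i.1)) x) (fn (U (σ₁ i.2)) x)) ∂D.wMeasure) atTop (𝓝 0) := by
    have h1 : Tendsto (Prod.map σ₁ σ₁) atTop atTop := by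
      rw [← prod_atTop_atTop_eq]
      exact hσ₁.tendsto_atTop.prodMap hσ₁.tendsto_atTop
    simpa only [Function.comp_def, Prod.map_fst, Prod.map_snd] using t2.comp h1
  have hRσ : ∀ n, ‖U (σ₁ n)‖ ≤ R := fun n => hR _
  obtain ⟨σ₂, z₂, hσ₂, hz₂, hzC₂, hlim₂⟩ := P.exists_subseq_fn (U := fun n => U (σ₁ n)) hRσ t3
  obtain ⟨V, hV⟩ := exists_tendsto_of_modular P.κ_eq P.w₀_pos P.le_w
    (U := fun n => U (σ₁ (σ₂ n))) hz₂ hz₁ hzC₂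
    (hzC₁.trans_lt ENNReal.coe_lt_top) (hlim₁.comp hσ₂.tendsto_atTop) hlim₂
  exact ⟨fun n => σ₁ (σ₂ n), V, hσ₁.comp hσ₂, hV⟩

/-- Bounded almost critical sequences of test functions have convergent subsequences. -/
theorem exists_tendsto_of_isTest (P : Penalized D S f p w₀ ν θ τ q γ) {U : ℕ → D.Space}
    {v : ℕ → EuclideanSpace ℝ (Fin N) → ℝ} {R : ℝ} (hR : ∀ n, ‖U n‖ ≤ R)
    (hT : ∀ n, IsTest (U n) (v n))
    (hJ : Tendsto (fun n => ‖fderiv ℝ (D.energy (gFun S f p)) (U n)‖) atTop (𝓝 0)) :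
    ∃ (σ : ℕ → ℕ) (V : D.Space), StrictMono σ ∧ Tendsto (fun n => U (σ n)) atTop (𝓝 V) := by
  obtain ⟨σ, hσ, hloc⟩ := P.exists_subseq_cauchy hR hT
  have hJσ := hJ.comp hσ.tendsto_atTop
  have hRσ : ∀ n, ‖U (σ n)‖ ≤ R := fun n => hR _
  have hg := P.tendsto_integral_gGap (U := fun n => U (σ n)) hRσ hloc
    (P.eventually_tail_le (U := fun n => U (σ n)) hRσ (fun n => hT (σ n)) hJσ)
  obtain ⟨t1, t2⟩ := P.tendsto_monoGap (U := fun n => U (σ n)) hRσ hJσ hg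
  obtain ⟨σ', V, hσ', hV⟩ := P.exists_tendsto_of_monoGap (U := fun n => U (σ n)) hRσ t1 t2
  exact ⟨fun n => σ (σ' n), V, hσ.comp hσ', hV⟩

/-- Approximation of a sequence by test functions along which a continuous map is controlled. -/
theorem exists_isTest_seq (P : Penalized D S f p w₀ ν θ τ q γ) {F : Type*}
    [PseudoMetricSpace F] {h : D.Space → F} (hh : Continuous h) (U : ℕ → D.Space) :
    ∃ (V : ℕ → D.Space) (v : ℕ → EuclideanSpace ℝ (Fin N) → ℝ), (∀ n, IsTest (V n) (v n)) ∧
      (∀ n, dist (V n) (U n) < 1) ∧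
      Tendsto (fun n => dist (V n) (U n)) atTop (𝓝 0) ∧
      Tendsto (fun n => dist (h (V n)) (h (U n))) atTop (𝓝 0) := by
  have hpos : ∀ n : ℕ, (0 : ℝ) < 1 / (n + 1) := fun n => Nat.one_div_pos_of_nat
  have h1 : ∀ n : ℕ, ∃ (V : D.Space) (v : EuclideanSpace ℝ (Fin N) → ℝ), IsTest V v ∧
      dist V (U n) < 1 / (n + 1) ∧ dist (h V) (h (U n)) < 1 / (n + 1) := by
    intro n
    obtain ⟨V, hV, v, hv⟩ := exists_test_approx P.κ_eq P.w₀_pos P.le_w (U n)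
      (inter_mem (Metric.ball_mem_nhds (U n) (hpos n))
        (hh.continuousAt.preimage_mem_nhds (Metric.ball_mem_nhds (h (U n)) (hpos n))))
    exact ⟨V, v, hv, hV.1, hV.2⟩
  choose V v hv hV1 hV2 using h1
  refine ⟨V, v, hv, fun n => (hV1 n).trans_le ?_, ?_, ?_⟩
  · rw [div_le_one (by positivity)]
    linarith [Nat.cast_nonneg (α := ℝ) n]
  · exact squeeze_zero (fun n => dist_nonneg) (fun n => (hV1 n).le)
      tendsto_one_div_add_atTop_nhds_zero_nat
  · exact squeeze_zero (fun n => dist_nonneg) (fun n => (hV2 n).le)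
      tendsto_one_div_add_atTop_nhds_zero_nat

/-- Bounded almost critical sequences have convergent subsequences. -/
theorem exists_tendsto_of_fderiv (P : Penalized D S f p w₀ ν θ τ q γ) {U : ℕ → D.Space}
    {R : ℝ} (hR : ∀ n, ‖U n‖ ≤ R)
    (hJ : Tendsto (fun n => ‖fderiv ℝ (D.energy (gFun S f p)) (U n)‖) atTop (𝓝 0)) :
    ∃ (σ : ℕ → ℕ) (V : D.Space), StrictMono σ ∧ Tendsto (fun n => U (σ n)) atTop (𝓝 V) := by
  -- Nearby test functions remain almost critical because the derivative is continuous, and their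
  -- limit is also the limit of the original subsequence.
  obtain ⟨V, v, hv, hd1, hd, hdJ⟩ := P.exists_isTest_seq P.continuous_fderiv_energy U
  have hVR : ∀ n, ‖V n‖ ≤ 1 + R := fun n => by
    have h1 := norm_le_norm_add_norm_sub' (V n) (U n)
    rw [← dist_eq_norm] at h1
    linarith [hR n, hd1 n]
  have hJV : Tendsto (fun n => ‖fderiv ℝ (D.energy (gFun S f p)) (V n)‖) atTop (𝓝 0) := by
    have h1 := hJ.add hdJ
    rw [add_zero] at h1
    refine squeeze_zero (fun n => norm_nonneg _) (fun n => ?_) h1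
    rw [dist_eq_norm]
    exact norm_le_norm_add_norm_sub' _ _
  obtain ⟨σ, W, hσ, hW⟩ := P.exists_tendsto_of_isTest hVR hv hJV
  refine ⟨σ, W, hσ, ?_⟩
  have h2 := hd.comp hσ.tendsto_atTop
  rw [tendsto_iff_dist_tendsto_zero] at hW ⊢
  have h3 := h2.add hW
  rw [add_zero] at h3
  refine squeeze_zero (fun n => dist_nonneg) (fun n => ?_) h3
  rw [Function.comp_apply, dist_comm (V (σ n))]
  exact dist_triangle _ _ _

end Penalized
end OrliczNehari

/-! ### Nondegeneracy of the Nehari constraint -/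

namespace OrliczNehari

section SmallSets

variable {α E : Type*} [MeasurableSpace α] [NormedAddCommGroup E] {μ : Measure α}
  {a M : ℝ → ℝ} {p q : ℝ}

/-- Superlinear growth in the form `t / M(t) ≤ t^{1-p} / M(1)` for `t ≥ 1`; this is the de la
Vallée-Poussin criterion behind the uniform integrability below. -/
theorem YoungPair.tendsto_div (Y : YoungPair a M p q) :
    Tendsto (fun t => t / M t) atTop (𝓝 0) := by
  have hM := Y.pos 1 one_pos
  have h1 := (tendsto_rpow_neg_atTop (y := p - 1) (by linarith [Y.one_lt])).const_mul (M 1)⁻¹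
  rw [mul_zero] at h1
  refine squeeze_zero' ?_ ?_ h1
  · filter_upwards [eventually_gt_atTop 0] with t ht using div_nonneg ht.le (Y.pos t ht).le
  · filter_upwards [eventually_ge_atTop 1] with t ht
    have ht0 : 0 < t := by linarith
    have h2 := Y.scale_le t⁻¹ t (by positivity) (inv_le_one_of_one_le₀ ht) ht0.le
    rw [inv_mul_cancel₀ ht0.ne'] at h2
    rw [div_le_iff₀ (Y.pos t ht0)]
    have e : t ^ (-(p - 1)) = t⁻¹ ^ p * t := by
      rw [Real.inv_rpow ht0.le, ← Real.rpow_neg ht0.le, ← Real.rpow_add_one ht0.ne']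
      congr 1
      ring
    rw [e]
    calc t = (M 1)⁻¹ * (M 1 * t) := by field_simp
      _ ≤ (M 1)⁻¹ * (t⁻¹ ^ p * M t * t) := by gcongr
      _ = _ := by ring

/-- Functions of bounded modular are uniformly integrable. -/
theorem YoungPair.tendsto_setLIntegral_of_measure (Y : YoungPair a M p q) {w : ℕ → α → E}
    {K : ℕ → Set α} {C : NNReal} (hw : ∀ n, modular M μ (w n) ≤ C)
    (hK : Tendsto (fun n => μ (K n)) atTop (𝓝 0)) :
    Tendsto (fun n => ∫⁻ x in K n, ‖w n x‖ₑ ∂μ) atTop (𝓝 0) := by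
  rw [ENNReal.tendsto_nhds_zero]
  intro e he
  have he2 : 0 < e / 2 := ENNReal.div_pos he.ne' (by simp)
  have h1 : Tendsto (fun δ : ℝ => ENNReal.ofReal (δ / M δ) * C) atTop (𝓝 0) := by
    have h2 := ENNReal.tendsto_ofReal Y.tendsto_div
    rw [ENNReal.ofReal_zero] at h2
    simpa using ENNReal.Tendsto.mul_const h2 (Or.inr ENNReal.coe_ne_top)
  -- Here `δ` is a large level: the part above it is controlled by `δ / M δ` times the modular
  -- bound, and the part below by `δ` times the measure of the set.
  obtain ⟨δ, hδ1, hδ⟩ := (((ENNReal.tendsto_nhds_zero.1 h1) _ he2).and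
    (eventually_gt_atTop 0)).exists
  have h3 : Tendsto (fun n => ENNReal.ofReal δ * μ (K n)) atTop (𝓝 0) := by
    simpa using ENNReal.Tendsto.const_mul hK (Or.inr ENNReal.ofReal_ne_top)
  filter_upwards [(ENNReal.tendsto_nhds_zero.1 h3) _ he2] with n hn
  exact (Y.setLIntegral_enorm_le hδ (w n) (K n)).trans
    ((add_le_add hn ((mul_le_mul' le_rfl (hw n)).trans hδ1)).trans (ENNReal.add_halves e).le)

end SmallSets

/-- A smooth step function, zero below `x` and one above `y`. -/
theorem exists_step {x y : ℝ} (hx : 0 < x) (hxy : x < y) :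
    ∃ χ : ℝ → ℝ, ContDiff ℝ 1 χ ∧ χ 0 = 0 ∧ (∀ s, y ≤ s → χ s = 1) ∧
      ∃ C, 0 ≤ C ∧ ∀ s, |deriv χ s| ≤ indicator (Icc x y) (fun _ => C) s := by
  have hd : 0 < y - x := by linarith
  set χ : ℝ → ℝ := fun s => Real.smoothTransition ((s - x) / (y - x)) with hχ
  have hχd : ContDiff ℝ 1 χ :=
    Real.smoothTransition.contDiff.comp ((contDiff_id.sub contDiff_const).div_const _)
  have h0 : ∀ s ≤ x, χ s = 0 := fun s hs =>
    Real.smoothTransition.zero_of_nonpos (div_nonpos_of_nonpos_of_nonneg (by linarith) hd.le)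
  have h1 : ∀ s, y ≤ s → χ s = 1 := fun s hs =>
    Real.smoothTransition.one_of_one_le ((one_le_div hd).2 (by linarith))
  obtain ⟨C, hC⟩ := (isCompact_Icc (a := x) (b := y)).exists_bound_of_continuousOn
    (hχd.continuous_deriv le_rfl).continuousOn
  refine ⟨χ, hχd, h0 0 hx.le, h1, C, (norm_nonneg _).trans (hC x ⟨le_rfl, hxy.le⟩), fun s => ?_⟩
  by_cases hs : s ∈ Icc x y
  · rw [indicator_of_mem hs]
    exact hC s hs
  · rw [indicator_of_notMem hs]
    rw [mem_Icc, not_and_or, not_le, not_le] at hs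
    rcases hs with hs | hs
    · have : χ =ᶠ[𝓝 s] fun _ => 0 := by
        filter_upwards [Iio_mem_nhds hs] with t ht using h0 t (le_of_lt ht)
      rw [this.deriv_eq, deriv_const, abs_zero]
    · have : χ =ᶠ[𝓝 s] fun _ => 1 := by
        filter_upwards [Ioi_mem_nhds hs] with t ht using h1 t (le_of_lt ht)
      rw [this.deriv_eq, deriv_const, abs_zero]

/-- If the sets where the functions are between two levels are small, then so are the sets
above the upper level. -/
theorem tendsto_measure_superlevel {N : ℕ} (hN : 1 < N) {a M : ℝ → ℝ} {p q : ℝ}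
    (Y : YoungPair a M p q)
    {v : ℕ → EuclideanSpace ℝ (Fin N) → ℝ} (hv : ∀ n, ContDiff ℝ 1 (v n))
    (hc : ∀ n, HasCompactSupport (v n)) {C : NNReal}
    (hC : ∀ n, modular M volume (gradient (v n)) ≤ C) {x y : ℝ} (hx : 0 < x) (hxy : x < y)
    (hlim : Tendsto (fun n => volume {t | v n t ∈ Icc x y}) atTop (𝓝 0)) :
    Tendsto (fun n => volume {t | y ≤ v n t}) atTop (𝓝 0) := by
  -- The gradient of `χ(v_n)` lives on the slab `{x ≤ v_n ≤ y}`, so by uniform integrability its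
  -- `L¹` norm tends to zero. The `W^{1,1}` Sobolev inequality then bounds the integral of a power
  -- of `χ(v_n)`, which is at least the measure of `{v_n ≥ y}`.
  obtain ⟨χ, hχ, hχ0, hχ1, B, hB, hder⟩ := exists_step hx hxy
  set z : ℕ → EuclideanSpace ℝ (Fin N) → ℝ := fun n t => χ (v n t) with hz
  have hz1 : ∀ n, ContDiff ℝ 1 (z n) := fun n => hχ.comp (hv n)
  have hzc : ∀ n, HasCompactSupport (z n) := fun n => (hc n).comp_left hχ0
  have hmeas : ∀ n, MeasurableSet {t | v n t ∈ Icc x y} := fun n =>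
    (hv n).continuous.measurable measurableSet_Icc
  have hgrad : ∀ n, ∫⁻ t, ‖fderiv ℝ (z n) t‖ₑ
      ≤ ENNReal.ofReal B * ∫⁻ t in {t | v n t ∈ Icc x y}, ‖gradient (v n) t‖ₑ := by
    intro n
    rw [← lintegral_const_mul' _ _ ENNReal.ofReal_ne_top, ← lintegral_indicator (hmeas n)]
    refine lintegral_mono fun t => ?_
    have h1 : HasFDerivAt (z n) (deriv χ (v n t) • fderiv ℝ (v n) t) t :=
      ((hχ.differentiable one_ne_zero _).hasDerivAt).comp_hasFDerivAt t
        ((hv n).differentiable one_ne_zero t).hasFDerivAt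
    rw [h1.fderiv]
    have h2 := hder (v n t)
    by_cases ht : t ∈ {t | v n t ∈ Icc x y}
    · rw [indicator_of_mem ht, ← ofReal_norm, ← ofReal_norm, ← ENNReal.ofReal_mul hB,
        norm_smul, norm_gradient]
      rw [indicator_of_mem (by exact ht)] at h2
      exact ENNReal.ofReal_le_ofReal (mul_le_mul_of_nonneg_right h2 (norm_nonneg _))
    · rw [indicator_of_notMem (by exact ht)] at h2
      rw [abs_nonpos_iff.1 h2, zero_smul, ← ofReal_norm, norm_zero, ENNReal.ofReal_zero]
      exact zero_le
  have hlim1 : Tendsto (fun n => ∫⁻ t, ‖fderiv ℝ (z n) t‖ₑ) atTop (𝓝 0) := by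
    have h1 : Tendsto (fun n => ENNReal.ofReal B *
        ∫⁻ t in {t | v n t ∈ Icc x y}, ‖gradient (v n) t‖ₑ) atTop (𝓝 0) := by
      simpa using ENNReal.Tendsto.const_mul
        (Y.tendsto_setLIntegral_of_measure hC hlim) (Or.inr ENNReal.ofReal_ne_top)
    exact tendsto_of_tendsto_of_tendsto_of_le_of_le tendsto_const_nhds h1 (fun _ => zero_le) hgrad
  have hN' : (1 : ℝ) < N := by exact_mod_cast hN
  have hconj := Real.HolderConjugate.conjExponent hN'
  set s := Real.conjExponent (N : ℝ) with hs
  have hs0 : 0 < s := hconj.symm.pos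
  set c := lintegralPowLePowLIntegralFDerivConst (volume : Measure (EuclideanSpace ℝ (Fin N))) s
  have hlim2 : Tendsto (fun n => (c : ENNReal) * (∫⁻ t, ‖fderiv ℝ (z n) t‖ₑ) ^ s) atTop (𝓝 0) := by
    have h1 := (ENNReal.continuous_rpow_const (y := s)).tendsto 0 |>.comp hlim1
    rw [ENNReal.zero_rpow_of_pos hs0] at h1
    simpa using ENNReal.Tendsto.const_mul h1 (Or.inr ENNReal.coe_ne_top)
  refine tendsto_of_tendsto_of_tendsto_of_le_of_le tendsto_const_nhds hlim2 (fun _ => zero_le)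
    fun n => ?_
  have hgns := lintegral_pow_le_pow_lintegral_fderiv (volume : Measure (EuclideanSpace ℝ (Fin N)))
    (hz1 n) (hzc n) (p := s) (by rw [finrank_euclideanSpace_fin]; exact hconj)
  refine le_trans ?_ hgns
  have hmy : MeasurableSet {t | y ≤ v n t} :=
    measurableSet_le measurable_const (hv n).continuous.measurable
  rw [← setLIntegral_one]
  refine le_trans (setLIntegral_mono' hmy fun t ht => ?_) (setLIntegral_le_lintegral _ _)
  rw [hz]
  dsimp only
  rw [hχ1 _ ht]
  simp

namespace Penalized

open SpaceData PhiAssumptions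

variable {N : ℕ} {D : SpaceData N} {S : Set (EuclideanSpace ℝ (Fin N))} {f p : ℝ → ℝ}
  {w₀ ν θ τ q γ : ℝ}

theorem stronglyMeasurable_fn (u : D.Space) : StronglyMeasurable (fn u) :=
  AEEqFun.stronglyMeasurable _

/-- Because `q` is subcritical, the integrand is at most a small multiple of the bounded truncated
critical power plus a multiple of `|u|`, and `|u|` is uniformly integrable. -/
theorem tendsto_setLIntegral_q (P : Penalized D S f p w₀ ν θ τ q γ) {U : ℕ → D.Space} {R : ℝ}
    (hR : ∀ n, ‖U n‖ ≤ R) {A : ℕ → Set (EuclideanSpace ℝ (Fin N))}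
    (hA : Tendsto (fun n => volume (A n)) atTop (𝓝 0)) :
    Tendsto (fun n => ∫⁻ x in A n, ENNReal.ofReal
      (nFun D.φ ‖fn (U n) x‖ + ‖fn (U n) x‖ ^ q)) atTop (𝓝 0) := by
  obtain ⟨K₀, hK₀⟩ := exists_lintegral_truncId_fn_le P.κ_eq P.w₀_pos P.le_w P.one_le_γ P.γ_lt
    P.rpow_γ R
  obtain ⟨C, hC⟩ := P.modularMap_fn_volume.bounded D.hφ.youngPair R
  rw [ENNReal.tendsto_nhds_zero]
  intro e he
  have he2 : 0 < e / 2 := ENNReal.div_pos he.ne' (by simp)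
  have h1 : Tendsto (fun δ : ℝ => ENNReal.ofReal δ * K₀) (𝓝[>] 0) (𝓝 0) := by
    have h2 : Tendsto (fun δ : ℝ => ENNReal.ofReal δ) (𝓝[>] 0) (𝓝 0) := by
      have := (ENNReal.continuous_ofReal.tendsto 0).mono_left (nhdsWithin_le_nhds (s := Ioi 0))
      rwa [ENNReal.ofReal_zero] at this
    simpa using ENNReal.Tendsto.mul_const h2 (Or.inr ENNReal.coe_ne_top)
  obtain ⟨δ, hδ1, hδ⟩ := (((ENNReal.tendsto_nhds_zero.1 h1) _ he2).and
    self_mem_nhdsWithin).exists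
  have hδ0 : 0 < δ := hδ
  obtain ⟨K, hK, hint⟩ := exists_le_truncId_add_mul D.hφ P.m_le_q P.q_lt hδ0
  have h3 : Tendsto (fun n => ENNReal.ofReal K * ∫⁻ x in A n, ‖fn (U n) x‖ₑ) atTop (𝓝 0) := by
    simpa using ENNReal.Tendsto.const_mul (D.hφ.youngPair.tendsto_setLIntegral_of_measure
      (fun n => hC _ (hR n)) hA) (Or.inr ENNReal.ofReal_ne_top)
  filter_upwards [(ENNReal.tendsto_nhds_zero.1 h3) _ he2] with n hn
  calc ∫⁻ x in A n, ENNReal.ofReal (nFun D.φ ‖fn (U n) x‖ + ‖fn (U n) x‖ ^ q)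
      ≤ ∫⁻ x in A n, (ENNReal.ofReal δ *
          ENNReal.ofReal (|truncId (fn (U n) x)| ^ (N * γ / (N - γ)))
          + ENNReal.ofReal K * ‖fn (U n) x‖ₑ) := by
        refine lintegral_mono fun x => ?_
        rw [← ofReal_norm, ← ENNReal.ofReal_mul hδ0.le, ← ENNReal.ofReal_mul hK,
          ← ENNReal.ofReal_add (mul_nonneg hδ0.le (Real.rpow_nonneg (abs_nonneg _) _))
            (mul_nonneg hK (norm_nonneg _))]
        exact ENNReal.ofReal_le_ofReal (hint (fn (U n) x))
    _ = ENNReal.ofReal δ * (∫⁻ x in A n,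
          ENNReal.ofReal (|truncId (fn (U n) x)| ^ (N * γ / (N - γ))))
        + ENNReal.ofReal K * ∫⁻ x in A n, ‖fn (U n) x‖ₑ := by
        rw [lintegral_add_right, lintegral_const_mul' _ _ ENNReal.ofReal_ne_top,
          lintegral_const_mul' _ _ ENNReal.ofReal_ne_top]
        exact ((stronglyMeasurable_fn (U n)).measurable.enorm).const_mul _
    _ ≤ ENNReal.ofReal δ * K₀ + e / 2 :=
        add_le_add (mul_le_mul' le_rfl ((setLIntegral_le_lintegral _ _).trans (hK₀ _ (hR n)))) hn
    _ ≤ e / 2 + e / 2 := add_le_add hδ1 le_rfl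
    _ = e := ENNReal.add_halves e

theorem gFun_of_le (P : Penalized D S f p w₀ ν θ τ q γ) (x : EuclideanSpace ℝ (Fin N)) {s : ℝ}
    (hs : s ≤ τ) : gFun S f p x s = p s := by
  unfold gFun
  split_ifs
  exacts [(P.p_eq s hs).symm, rfl]

theorem gFun_mul_le_of_le (P : Penalized D S f p w₀ ν θ τ q γ) (x : EuclideanSpace ℝ (Fin N))
    {s : ℝ} (hs : s ≤ τ) : gFun S f p x s * s ≤ ν * (mulExt D.φ ‖s‖ * ‖s‖) := by
  by_cases hx : x ∈ S
  · have h0 := mul_nonneg P.ν_nonneg (mul_nonneg (D.hφ.mulExt_nonneg ‖s‖) (norm_nonneg s))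
    rw [P.gFun_of_le x hs]
    rcases le_or_gt s 0 with h | h
    · rwa [P.adm_p.zero s h, zero_mul]
    · rw [Real.norm_of_nonneg h.le, mulExt_of_pos h, ← mul_assoc]
      exact mul_le_mul_of_nonneg_right (P.p_le s h) h.le
  · exact P.gFun_mul_le hx s

/-- The Nehari functional controls the modulars, up to the part above the level `τ`. -/
theorem exists_mul_modular_le (P : Penalized D S f p w₀ ν θ τ q γ) :
    ∃ c C : ℝ, 0 < c ∧ 0 ≤ C ∧ ∀ u : D.Space,
      c * ((∫ x, nFun D.φ ‖grad u x‖) + ∫ x, nFun D.φ ‖fn u x‖ ∂D.wMeasure)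
        ≤ nehariFn (D.energy (gFun S f p)) u
          + C * ∫ x in {x | τ < fn u x}, (nFun D.φ ‖fn u x‖ + ‖fn u x‖ ^ q) := by
  have Y := D.hφ.youngPair
  have hw₀ := P.w₀_pos
  have hl : 0 < D.l := by linarith [D.hφ.one_lt_l]
  obtain ⟨C, hC, hb⟩ := P.exists_abs_gFun_le
  -- Up to the level `τ`, at every point `x`, the nonlinear term is at most the fraction `ν / w₀` of
  -- the potential term; this is the remaining share.
  have hfrac : 0 < 1 - ν / w₀ := by
    rw [sub_pos, div_lt_one hw₀]; exact P.ν_lt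
  have hfrac1 : 1 - ν / w₀ ≤ 1 := by linarith [div_nonneg P.ν_nonneg hw₀.le]
  refine ⟨D.l * (1 - ν / w₀), C * max D.m q, by positivity,
    mul_nonneg hC (le_max_of_le_left (by linarith [D.hφ.l_le_m])), fun u => ?_⟩
  obtain ⟨hi, heq⟩ := P.integral_fderiv_energy u u
  have i1 := P.integrable_nFun_grad u
  have i2 := (integrable_wMeasure_iff D).1 (P.integrable_nFun_fn_wMeasure u)
  have i3 : Integrable fun x => nFun D.φ ‖fn u x‖ + ‖fn u x‖ ^ q :=
    P.youngPair_q.integrable (aesm_fn u) (P.modularMap_fn_q.finite P.youngPair_q u)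
  have hms : MeasurableSet {x | τ < fn u x} :=
    measurableSet_lt measurable_const (stronglyMeasurable_fn u).measurable
  have i12 : Integrable fun x => nFun D.φ ‖grad u x‖ + D.w x * nFun D.φ ‖fn u x‖ := i1.add i2
  rw [← integral_indicator hms, D.integral_wMeasure, ← integral_add i1 i2, nehariFn, heq,
    ← integral_const_mul, ← integral_const_mul,
    ← integral_add hi ((i3.indicator hms).const_mul _)]
  refine integral_mono (i12.const_mul _) (hi.add ((i3.indicator hms).const_mul _)) fun x => ?_
  dsimp only
  have e3 : inner ℝ (gFun S f p x (fn u x)) (fn u x) = gFun S f p x (fn u x) * fn u x := by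
    simp only [RCLike.inner_apply, conj_trivial]
    ring
  rw [e3, inner_smul_eq, inner_smul_eq]
  have n1 := D.hφ.nFun_nonneg ‖grad u x‖
  have n2 := D.hφ.nFun_nonneg ‖fn u x‖
  have l1 := Y.lower _ (norm_nonneg (grad u x))
  have l2 := Y.lower _ (norm_nonneg (fn u x))
  have hwx := P.le_w x
  have hw0 := (D.w_pos x).le
  set E := mulExt D.φ ‖fn u x‖ * ‖fn u x‖ with hE
  have hE0 : 0 ≤ E := mul_nonneg (D.hφ.mulExt_nonneg _) (norm_nonneg _)
  have l3 : D.l * (1 - ν / w₀) * nFun D.φ ‖grad u x‖ ≤ mulExt D.φ ‖grad u x‖ * ‖grad u x‖ := by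
    refine le_trans ?_ l1
    rw [mul_right_comm]
    exact mul_le_of_le_one_right (mul_nonneg hl.le n1) hfrac1
  have l4 : D.l * (1 - ν / w₀) * (D.w x * nFun D.φ ‖fn u x‖) ≤ (1 - ν / w₀) * (D.w x * E) := by
    have := mul_le_mul_of_nonneg_left l2 (mul_nonneg hfrac.le hw0)
    linarith
  have l5 : ν * E ≤ ν / w₀ * (D.w x * E) := by
    have h1 : ν = ν / w₀ * w₀ := by field_simp
    have h2 := mul_le_mul_of_nonneg_left (mul_le_mul_of_nonneg_right hwx hE0)
      (div_nonneg P.ν_nonneg hw₀.le)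
    calc ν * E = ν / w₀ * w₀ * E := by rw [← h1]
      _ ≤ _ := by linarith
  by_cases hx : τ < fn u x
  · rw [indicator_of_mem (by exact hx)]
    have g1 : gFun S f p x (fn u x) * fn u x
        ≤ C * max D.m q * (nFun D.φ ‖fn u x‖ + ‖fn u x‖ ^ q) := by
      have h1 : gFun S f p x (fn u x) * fn u x
          ≤ C * sumDensity D.φ q ‖fn u x‖ * ‖fn u x‖ := by
        refine (le_abs_self _).trans ?_
        rw [abs_mul]
        exact mul_le_mul_of_nonneg_right (hb x _) (abs_nonneg _)
      have h2 := mul_le_mul_of_nonneg_left (P.youngPair_q.upper _ (norm_nonneg (fn u x))) hC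
      linarith
    have h3 : 0 ≤ ν * E := mul_nonneg P.ν_nonneg hE0
    linarith
  · rw [indicator_of_notMem (by exact hx)]
    have := P.gFun_mul_le_of_le x (not_lt.1 hx)
    linarith

/-- The integrand of `m L(u) - L'(u) u`. -/
noncomputable def nehariGap (D : SpaceData N) (S : Set (EuclideanSpace ℝ (Fin N))) (f p : ℝ → ℝ)
    (x : EuclideanSpace ℝ (Fin N)) (t s : ℝ) : ℝ :=
  ((D.m - 2) * D.φ t - deriv D.φ t * t) * t ^ 2
    + D.w x * (((D.m - 2) * D.φ ‖s‖ - deriv D.φ ‖s‖ * ‖s‖) * ‖s‖ ^ 2)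
    + (gDer S f p x s * s ^ 2 - (D.m - 1) * (gFun S f p x s * s))

theorem deficit_nonneg (D : SpaceData N) {t : ℝ} (ht : 0 ≤ t) :
    0 ≤ ((D.m - 2) * D.φ t - deriv D.φ t * t) * t ^ 2 := by
  rcases ht.lt_or_eq with h | rfl
  · exact mul_nonneg (by linarith [D.hφ.deriv_mul_le h]) (sq_nonneg t)
  · simp

/-- On `S` the inequality `(m - 1) f ≤ f' s` makes both summands nonnegative. Off `S` it may fail
for `p`, but monotonicity of `p / (φ s)` limits the failure: `p' s - (m - 1) p ≥ -p b / φ` with `b =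
(m - 2) φ - φ' s ≥ 0`. Since `p ≤ w φ(s) s`, the contribution `w b s²` of the potential compensates
for it. -/
theorem nehariGap_fn_nonneg (P : Penalized D S f p w₀ ν θ τ q γ) (x : EuclideanSpace ℝ (Fin N))
    (s : ℝ) : 0 ≤ D.w x * (((D.m - 2) * D.φ ‖s‖ - deriv D.φ ‖s‖ * ‖s‖) * ‖s‖ ^ 2)
      + (gDer S f p x s * s ^ 2 - (D.m - 1) * (gFun S f p x s * s)) := by
  have h0 := mul_nonneg (D.w_pos x).le (deficit_nonneg D (norm_nonneg s))
  rcases lt_trichotomy s 0 with hs | rfl | hs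
  · have e1 : gFun S f p x s = 0 := by
      simp only [gFun, P.adm_f.zero s hs.le, P.adm_p.zero s hs.le, ite_self]
    have e2 : gDer S f p x s = 0 := by
      simp only [gDer, gFun, P.adm_f.deriv_eq_zero hs, P.adm_p.deriv_eq_zero hs, ite_self]
    rw [e1, e2]
    linarith
  · simp
  · rw [Real.norm_of_nonneg hs.le] at h0 ⊢
    by_cases hx : x ∈ S
    · simp only [gDer, gFun, hx, if_true]
      have := mul_le_mul_of_nonneg_right (P.f_deriv s hs) hs.le
      nlinarith
    · simp only [gDer, gFun, hx, if_false]
      have hφ := D.hφ.pos s hs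
      have h1 := P.p_deriv s hs
      have h2 := P.p_le s hs
      have h3 := D.hφ.deriv_mul_le hs
      set b := (D.m - 2) * D.φ s - deriv D.φ s * s with hb
      have hb0 : 0 ≤ b := by rw [hb]; linarith
      have h4 : -(p s * b) * s ≤ D.φ s * (deriv p s * s ^ 2 - (D.m - 1) * (p s * s)) := by
        have h5 := mul_le_mul_of_nonneg_right h1 hs.le
        rw [hb]
        linarith
      have h5 : p s * b * s ≤ D.φ s * (D.w x * (b * s ^ 2)) := by
        have h6 : p s ≤ D.w x * (D.φ s * s) := h2.trans (mul_le_mul_of_nonneg_right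
          (P.ν_lt.le.trans (P.le_w x)) (by positivity))
        have h7 := mul_le_mul_of_nonneg_right h6 (mul_nonneg hb0 hs.le)
        linarith
      have h6 : 0 ≤ D.φ s * (D.w x * (b * s ^ 2) + (deriv p s * s ^ 2 - (D.m - 1) * (p s * s))) := by
        linarith
      exact nonneg_of_mul_nonneg_right h6 hφ

theorem nehariGap_nonneg (P : Penalized D S f p w₀ ν θ τ q γ) (x : EuclideanSpace ℝ (Fin N))
    {t : ℝ} (ht : 0 ≤ t) (s : ℝ) : 0 ≤ nehariGap D S f p x t s := by
  have h1 := deficit_nonneg D ht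
  have h2 := P.nehariGap_fn_nonneg x s
  rw [nehariGap]
  linarith

theorem gDer_of_lt (P : Penalized D S f p w₀ ν θ τ q γ) (x : EuclideanSpace ℝ (Fin N)) {s : ℝ}
    (hs : s < τ) : gDer S f p x s = deriv f s := by
  have : p =ᶠ[𝓝 s] f := by
    filter_upwards [Iio_mem_nhds hs] with t ht using P.p_eq t (le_of_lt ht)
  rw [gDer, gFun, this.deriv_eq, ite_self]

/-- Below `τ` the nonlinearity coincides with `f` on the whole space, so the quantitative strictness
of `f` is available at every `x`, inside and outside `S`. -/
theorem le_nehariGap (P : Penalized D S f p w₀ ν θ τ q γ) {s κ : ℝ} (hs : s < τ)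
    (hκ : κ ≤ deriv f s * s ^ 2 - (D.m - 1) * f s * s) (x : EuclideanSpace ℝ (Fin N))
    {t : ℝ} (ht : 0 ≤ t) : κ ≤ nehariGap D S f p x t s := by
  have h1 := deficit_nonneg D ht
  have h2 := mul_nonneg (D.w_pos x).le (deficit_nonneg D (norm_nonneg s))
  rw [nehariGap, P.gDer_of_lt x hs, P.gFun_of_le x hs.le, P.p_eq s hs.le]
  linarith

/-- `m L(u) - L'(u) u` is the integral of a nonnegative function. -/
theorem integral_nehariGap (P : Penalized D S f p w₀ ν θ τ q γ) (u : D.Space) :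
    Integrable (fun x => nehariGap D S f p x ‖grad u x‖ (fn u x)) ∧
    D.m * nehariFn (D.energy (gFun S f p)) u - fderiv ℝ (nehariFn (D.energy (gFun S f p))) u u
      = ∫ x, nehariGap D S f p x ‖grad u x‖ (fn u x) := by
  have Y := D.hφ.youngPair
  have a1 : Integrable fun x => D.φ ‖grad u x‖ * ‖grad u x‖ ^ 2 :=
    (D.hφ.nemytskiiData_mul_sq (μ := volume)).integrable Y (aesm_grad u) (modular_grad u)
  have a2 : Integrable (fun x => D.φ ‖fn u x‖ * ‖fn u x‖ ^ 2) D.wMeasure :=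
    (D.hφ.nemytskiiData_mul_sq (μ := D.wMeasure)).integrable Y
      ((aesm_fn u).mono_ac D.wMeasure_ac) (modular_fn u)
  have a3 : Integrable fun x => gFun S f p x (fn u x) * fn u x :=
    P.nemytskiiData_mul.integrable P.youngPair_q (aesm_fn u)
      (P.modularMap_fn_q.finite P.youngPair_q u)
  have b1 := (D.hφ.nemytskiiData_mul_sq (μ := volume)).integrable_inner Y (aesm_grad u)
    (aesm_grad u) (modular_grad u) (modular_grad u)
  have b2 := (D.hφ.nemytskiiData_mul_sq (μ := D.wMeasure)).integrable_inner Y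
    ((aesm_fn u).mono_ac D.wMeasure_ac) ((aesm_fn u).mono_ac D.wMeasure_ac)
    (modular_fn u) (modular_fn u)
  have b3 := P.nemytskiiData_mul.integrable_inner P.youngPair_q (aesm_fn u) (aesm_fn u)
    (P.modularMap_fn_q.finite P.youngPair_q u) (P.modularMap_fn_q.finite P.youngPair_q u)
  have a2' := (integrable_wMeasure_iff D).1 a2
  have b2' := (integrable_wMeasure_iff D).1 b2
  have c1 := (a1.const_mul D.m).sub b1
  have c2 := (a2'.const_mul D.m).sub b2'
  have c3 := (a3.const_mul D.m).sub b3
  have hpt : ∀ x, nehariGap D S f p x ‖grad u x‖ (fn u x) =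
      (D.m * (D.φ ‖grad u x‖ * ‖grad u x‖ ^ 2) - inner ℝ
        ((deriv D.φ ‖grad u x‖ * ‖grad u x‖ + 2 * D.φ ‖grad u x‖) • grad u x) (grad u x))
      + (D.m * (D.w x * (D.φ ‖fn u x‖ * ‖fn u x‖ ^ 2)) - D.w x * inner ℝ
        ((deriv D.φ ‖fn u x‖ * ‖fn u x‖ + 2 * D.φ ‖fn u x‖) • fn u x) (fn u x))
      - (D.m * (gFun S f p x (fn u x) * fn u x) - inner ℝ
        (gDer S f p x (fn u x) * fn u x + gFun S f p x (fn u x)) (fn u x)) := by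
    intro x
    rw [real_inner_smul_left, real_inner_smul_left, real_inner_self_eq_norm_sq,
      real_inner_self_eq_norm_sq, nehariGap]
    simp only [RCLike.inner_apply, conj_trivial]
    ring
  have c12 := c1.add c2
  refine ⟨(c12.sub c3).congr (Eventually.of_forall fun x => (hpt x).symm), ?_⟩
  rw [integral_congr_ae (Eventually.of_forall hpt)]
  have e1 := integral_sub c12 c3
  have e2 := integral_add c1 c2
  have e3 := integral_sub (a1.const_mul D.m) b1
  have e4 := integral_sub (a2'.const_mul D.m) b2'
  have e5 := integral_sub (a3.const_mul D.m) b3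
  rw [integral_const_mul] at e3 e4 e5
  simp only [Pi.add_apply, Pi.sub_apply] at e1 e2 e3 e4 e5
  rw [e1, e2, e3, e4, e5, P.nehariFn_eq, P.fderiv_nehariFn_apply, D.integral_wMeasure,
    D.integral_wMeasure]
  ring

/-- Markov's inequality for the nonnegative integrand of `m L(u) - L'(u)u`, which is at least `κ`
where `u` takes values in `[x, y]`. -/
theorem exists_measure_le (P : Penalized D S f p w₀ ν θ τ q γ) :
    ∃ x y κ : ℝ, 0 < x ∧ x < y ∧ y < τ ∧ 0 < κ ∧ ∀ u : D.Space,
      ENNReal.ofReal κ * volume {t | fn u t ∈ Icc x y} ≤ ENNReal.ofReal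
        (D.m * nehariFn (D.energy (gFun S f p)) u
          - fderiv ℝ (nehariFn (D.energy (gFun S f p))) u u) := by
  obtain ⟨x, y, κ, hx, hxy, hy, hκ, hb⟩ := P.strict
  refine ⟨x, y, κ, hx, hxy, hy, hκ, fun u => ?_⟩
  obtain ⟨hi, heq⟩ := P.integral_nehariGap u
  rw [heq, ofReal_integral_eq_lintegral_ofReal hi
    (Eventually.of_forall fun t => P.nehariGap_nonneg t (norm_nonneg _) _), ← setLIntegral_const]
  have hms : MeasurableSet {t | fn u t ∈ Icc x y} :=
    (stronglyMeasurable_fn u).measurable measurableSet_Icc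
  refine le_trans (setLIntegral_mono' hms fun t ht => ?_) (setLIntegral_le_lintegral _ _)
  exact ENNReal.ofReal_le_ofReal (P.le_nehariGap (ht.2.trans_lt hy) (hb _ ht) t (norm_nonneg _))

end Penalized
end OrliczNehari

namespace OrliczNehari

namespace Penalized

open SpaceData PhiAssumptions

variable {N : ℕ} {D : SpaceData N} {S : Set (EuclideanSpace ℝ (Fin N))} {f p : ℝ → ℝ}
  {w₀ ν θ τ q γ : ℝ}

/-- The Nehari functional controls both modulars up to an integral over `{u > τ}`; that integral
vanishes in the limit since these sets shrink in measure and the growth is subcritical. -/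
theorem tendsto_zero_of_measure (P : Penalized D S f p w₀ ν θ τ q γ) {U : ℕ → D.Space} {R : ℝ}
    (hR : ∀ n, ‖U n‖ ≤ R)
    (hL : Tendsto (fun n => nehariFn (D.energy (gFun S f p)) (U n)) atTop (𝓝 0))
    (hτ : Tendsto (fun n => volume {x | τ < fn (U n) x}) atTop (𝓝 0)) :
    Tendsto U atTop (𝓝 0) := by
  have Y := D.hφ.youngPair
  obtain ⟨c, C, hc, hC, hb⟩ := P.exists_mul_modular_le
  have hq := P.tendsto_setLIntegral_q hR hτ
  have hq' : Tendsto (fun n => ∫ x in {x | τ < fn (U n) x},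
      (nFun D.φ ‖fn (U n) x‖ + ‖fn (U n) x‖ ^ q)) atTop (𝓝 0) := by
    have h1 := (ENNReal.tendsto_toReal ENNReal.zero_ne_top).comp hq
    rw [ENNReal.toReal_zero] at h1
    refine h1.congr fun n => ?_
    rw [Function.comp_apply, integral_eq_lintegral_of_nonneg_ae
      (Eventually.of_forall fun x => P.youngPair_q.nonneg (norm_nonneg _))]
    exact (P.youngPair_q.measurable.comp_aemeasurable
      (aesm_fn (U n)).norm.aemeasurable).aestronglyMeasurable.restrict
  have hsum : Tendsto (fun n => c⁻¹ * (nehariFn (D.energy (gFun S f p)) (U n)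
      + C * ∫ x in {x | τ < fn (U n) x}, (nFun D.φ ‖fn (U n) x‖ + ‖fn (U n) x‖ ^ q)))
      atTop (𝓝 0) := by
    simpa using (hL.add (hq'.const_mul C)).const_mul c⁻¹
  have hle : ∀ n, (∫ x, nFun D.φ ‖grad (U n) x‖)
      + ∫ x, nFun D.φ ‖fn (U n) x‖ ∂D.wMeasure
      ≤ c⁻¹ * (nehariFn (D.energy (gFun S f p)) (U n)
      + C * ∫ x in {x | τ < fn (U n) x}, (nFun D.φ ‖fn (U n) x‖ + ‖fn (U n) x‖ ^ q)) := fun n => by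
    rw [le_inv_mul_iff₀ hc]
    exact hb _
  have n1 : ∀ n, 0 ≤ ∫ x, nFun D.φ ‖grad (U n) x‖ := fun n =>
    integral_nonneg fun x => D.hφ.nFun_nonneg _
  have n2 : ∀ n, 0 ≤ ∫ x, nFun D.φ ‖fn (U n) x‖ ∂D.wMeasure := fun n =>
    integral_nonneg fun x => D.hφ.nFun_nonneg _
  refine tendsto_norm_zero P.κ_eq ?_ ?_
  · have h1 := ENNReal.tendsto_ofReal (squeeze_zero n1
      (fun n => (le_add_of_nonneg_right (n2 n)).trans (hle n)) hsum)
    rw [ENNReal.ofReal_zero] at h1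
    refine h1.congr fun n => ?_
    rw [Y.integral_eq (aesm_grad _), ENNReal.ofReal_toReal (modular_grad _).ne]
  · have h1 := ENNReal.tendsto_ofReal (squeeze_zero n2
      (fun n => (le_add_of_nonneg_left (n1 n)).trans (hle n)) hsum)
    rw [ENNReal.ofReal_zero] at h1
    refine h1.congr fun n => ?_
    rw [Y.integral_eq ((aesm_fn _).mono_ac D.wMeasure_ac),
      ENNReal.ofReal_toReal (modular_fn _).ne]

/-- As `m L(u) - L'(u)u` tends to zero, the slabs between the levels `x` and `y` shrink in measure;
then so do the sets above `y`, and in particular those above `τ > y`. Smoothness and compact support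
are needed to apply the Sobolev inequality to the functions themselves. -/
theorem tendsto_zero_of_isTest (P : Penalized D S f p w₀ ν θ τ q γ) {U : ℕ → D.Space}
    {v : ℕ → EuclideanSpace ℝ (Fin N) → ℝ} {R : ℝ} (hR : ∀ n, ‖U n‖ ≤ R)
    (hT : ∀ n, IsTest (U n) (v n))
    (hL : Tendsto (fun n => nehariFn (D.energy (gFun S f p)) (U n)) atTop (𝓝 0))
    (hL' : Tendsto (fun n => fderiv ℝ (nehariFn (D.energy (gFun S f p))) (U n) (U n)) atTop
      (𝓝 0)) :
    Tendsto U atTop (𝓝 0) := by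
  obtain ⟨x, y, κ, hx, hxy, hy, hκ, hb⟩ := P.exists_measure_le
  obtain ⟨C, hC⟩ := P.modularMap_grad.bounded D.hφ.youngPair R
  have hN : 1 < N := by
    have : (1 : ℝ) < N := by linarith [D.hφ.one_lt_l, D.hφ.l_le_m, D.hφ.m_lt_dim]
    exact_mod_cast this
  have hcongr : ∀ (n : ℕ) (A : Set ℝ), volume {t | fn (U n) t ∈ A} = volume {t | v n t ∈ A} :=
    fun n A => measure_congr (eventuallyEq_set.2 ((hT n).fn_eq.mono fun t ht => by
      rw [mem_ofPred_eq, mem_ofPred_eq, ht]))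
  have hmid : Tendsto (fun n => volume {t | v n t ∈ Icc x y}) atTop (𝓝 0) := by
    have h1 := ENNReal.tendsto_ofReal ((hL.const_mul D.m).sub hL')
    rw [mul_zero, sub_zero, ENNReal.ofReal_zero] at h1
    have h2 : Tendsto (fun n => (ENNReal.ofReal κ)⁻¹ * ENNReal.ofReal
        (D.m * nehariFn (D.energy (gFun S f p)) (U n)
          - fderiv ℝ (nehariFn (D.energy (gFun S f p))) (U n) (U n))) atTop (𝓝 0) := by
      simpa using ENNReal.Tendsto.const_mul h1
        (Or.inr (ENNReal.inv_ne_top.2 (ENNReal.ofReal_pos.2 hκ).ne'))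
    refine tendsto_of_tendsto_of_tendsto_of_le_of_le tendsto_const_nhds h2 (fun _ => zero_le)
      fun n => ?_
    dsimp only
    rw [← hcongr, ← ENNReal.mul_le_iff_le_inv (ENNReal.ofReal_pos.2 hκ).ne' ENNReal.ofReal_ne_top]
    exact hb _
  have hup := tendsto_measure_superlevel hN D.hφ.youngPair
    (fun n => (hT n).contDiff.of_le (by exact_mod_cast le_top)) (fun n => (hT n).hasCompactSupport)
    (fun n => (modular_congr (hT n).grad_eq).symm.trans_le (hC _ (hR n))) hx hxy hmid
  refine P.tendsto_zero_of_measure hR hL (tendsto_of_tendsto_of_tendsto_of_le_of_le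
    tendsto_const_nhds hup (fun _ => zero_le) fun n => ?_)
  exact (hcongr n (Ioi τ)).trans_le (measure_mono fun t ht => hy.le.trans (le_of_lt ht))

/-- A bounded sequence along which `L` and `L'(u) u` tend to zero tends to zero. -/
theorem tendsto_zero_of_nehari (P : Penalized D S f p w₀ ν θ τ q γ) {U : ℕ → D.Space}
    {R : ℝ} (hR : ∀ n, ‖U n‖ ≤ R)
    (hL : Tendsto (fun n => nehariFn (D.energy (gFun S f p)) (U n)) atTop (𝓝 0))
    (hL' : Tendsto (fun n => fderiv ℝ (nehariFn (D.energy (gFun S f p))) (U n) (U n)) atTop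
      (𝓝 0)) :
    Tendsto U atTop (𝓝 0) := by
  set L := nehariFn (D.energy (gFun S f p)) with hLdef
  have hcont : Continuous fun u : D.Space => (L u, fderiv ℝ L u u) :=
    P.contDiff_nehariFn.continuous.prodMk
      ((P.contDiff_nehariFn.continuous_fderiv one_ne_zero).clm_apply continuous_id)
  obtain ⟨V, v, hv, hd1, hd, hdh⟩ := P.exists_isTest_seq hcont U
  have hVR : ∀ n, ‖V n‖ ≤ 1 + R := fun n => by
    have h1 := norm_le_norm_add_norm_sub' (V n) (U n)
    rw [← dist_eq_norm] at h1
    linarith [hR n, hd1 n]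
  have hpair : Tendsto (fun n => (L (V n), fderiv ℝ L (V n) (V n))) atTop (𝓝 (0, 0)) := by
    have h1 := hL.prodMk_nhds hL'
    rw [tendsto_iff_dist_tendsto_zero] at h1 ⊢
    have h2 := hdh.add h1
    rw [add_zero] at h2
    exact squeeze_zero (fun n => dist_nonneg) (fun n => dist_triangle _ _ _) h2
  have hV := P.tendsto_zero_of_isTest hVR hv
    ((continuous_fst.tendsto _).comp hpair) ((continuous_snd.tendsto _).comp hpair)
  rw [tendsto_iff_dist_tendsto_zero] at hV ⊢
  have h3 := hd.add hV
  rw [add_zero] at h3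
  refine squeeze_zero (fun n => dist_nonneg) (fun n => ?_) h3
  rw [dist_comm (V n)]
  exact dist_triangle _ _ _

/-- If `L'(u)u = 0`, the constant sequence `u` satisfies the hypotheses of `tendsto_zero_of_nehari`,
which forces `u = 0`. -/
theorem fderiv_nehariFn_self_ne_zero (P : Penalized D S f p w₀ ν θ τ q γ) {u : D.Space}
    (hu : u ∈ nehari (D.energy (gFun S f p))) :
    fderiv ℝ (nehariFn (D.energy (gFun S f p))) u u ≠ 0 := by
  intro h0
  have h1 := P.tendsto_zero_of_nehari (U := fun _ => u) (R := ‖u‖) (fun _ => le_rfl)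
    (by simp only [hu.2]; exact tendsto_const_nhds) (by simp only [h0]; exact tendsto_const_nhds)
  exact hu.1 (tendsto_nhds_unique tendsto_const_nhds h1)

theorem palaisSmaleAt (P : Penalized D S f p w₀ ν θ τ q γ) (c : ℝ) :
    PalaisSmaleAt (D.energy (gFun S f p)) c := by
  intro U hJ hJ'
  obtain ⟨R, hR⟩ := P.bounded_of_tendsto hJ fun δ hδ => by
    filter_upwards [hJ'.eventually (gt_mem_nhds hδ)] with n hn
    rw [nehariFn, ← Real.norm_eq_abs]
    exact (ContinuousLinearMap.le_opNorm _ _).trans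
      (mul_le_mul_of_nonneg_right hn.le (norm_nonneg _))
  obtain ⟨σ, V, hσ, hV⟩ := P.exists_tendsto_of_fderiv hR hJ'
  exact ⟨V, σ, hσ, hV⟩

end Penalized

/-! ### From the tangential derivative to the full derivative -/

section Nehari

variable {X : Type*} [NormedAddCommGroup X] [NormedSpace ℝ X] {J : X → ℝ}

theorem norm_apply_le_tangentialDeriv {u v : X}
    (hv : fderiv ℝ (nehariFn J) u v = 0) :
    ‖fderiv ℝ J u v‖ ≤ ‖tangentialDeriv J u‖ * ‖v‖ :=
  (tangentialDeriv J u).le_opNorm ⟨v, hv⟩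

/-- On the Nehari manifold the full derivative is controlled by the tangential derivative. -/
theorem norm_fderiv_le_of_nehari {u : X} (hu : nehariFn J u = 0) {α K R : ℝ} (hα : 0 < α)
    (ha : α ≤ |fderiv ℝ (nehariFn J) u u|) (hK : ‖fderiv ℝ (nehariFn J) u‖ ≤ K) (hR : ‖u‖ ≤ R) :
    ‖fderiv ℝ J u‖ ≤ ‖tangentialDeriv J u‖ * (1 + K / α * R) := by
  have hK0 : 0 ≤ K := (norm_nonneg _).trans hK
  have hR0 : 0 ≤ R := (norm_nonneg _).trans hR
  refine ContinuousLinearMap.opNorm_le_bound _ (by positivity) fun v => ?_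
  set b := fderiv ℝ (nehariFn J) u u with hb
  have hb0 : b ≠ 0 := abs_pos.1 (hα.trans_le ha)
  -- With this `t` the vector `v - t u` is tangent, and `J'(u)u = 0` means that removing `t u` does
  -- not change `J'(u)v`.
  set t := fderiv ℝ (nehariFn J) u v / b with ht
  have h1 : fderiv ℝ (nehariFn J) u (v - t • u) = 0 := by
    rw [map_sub, map_smul, smul_eq_mul, ← hb, ht, div_mul_cancel₀ _ hb0, sub_self]
  have h2 : fderiv ℝ J u (v - t • u) = fderiv ℝ J u v := by
    have : fderiv ℝ J u u = 0 := hu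
    rw [map_sub, map_smul, this, smul_zero, sub_zero]
  have h3 : |t| ≤ K / α * ‖v‖ := by
    rw [ht, abs_div, div_mul_eq_mul_div]
    have h4 : |fderiv ℝ (nehariFn J) u v| ≤ K * ‖v‖ :=
      (ContinuousLinearMap.le_opNorm _ v).trans (mul_le_mul_of_nonneg_right hK (norm_nonneg _))
    exact div_le_div₀ (by positivity) h4 hα ha
  rw [← h2]
  refine (norm_apply_le_tangentialDeriv h1).trans ?_
  rw [mul_assoc]
  refine mul_le_mul_of_nonneg_left ?_ (ContinuousLinearMap.opNorm_nonneg _)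
  refine (norm_sub_le _ _).trans ?_
  rw [norm_smul, Real.norm_eq_abs, add_mul, one_mul]
  have h5 := mul_le_mul h3 hR (norm_nonneg _) (by positivity)
  linarith

theorem fderiv_eq_zero_of_tangentialDeriv {u : X} (hu : nehariFn J u = 0)
    (ha : fderiv ℝ (nehariFn J) u u ≠ 0) (h0 : tangentialDeriv J u = 0) : fderiv ℝ J u = 0 := by
  have := norm_fderiv_le_of_nehari hu (abs_pos.2 ha) le_rfl le_rfl le_rfl
  rw [h0, ContinuousLinearMap.opNorm_zero, zero_mul] at this
  exact norm_le_zero_iff.1 this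

end Nehari

namespace Penalized

open SpaceData PhiAssumptions

variable {N : ℕ} {D : SpaceData N} {S : Set (EuclideanSpace ℝ (Fin N))} {f p : ℝ → ℝ}
  {w₀ ν θ τ q γ : ℝ}

theorem energy_zero (P : Penalized D S f p w₀ ν θ τ q γ) :
    D.energy (gFun S f p) 0 = 0 := by
  have e1 : (∫ x, nFun D.φ ‖grad (0 : D.Space) x‖) = 0 :=
    integral_eq_zero_of_ae (P.modularMap_grad.map_zero.mono fun x hx => by
      simp [hx, nFun_zero])
  have e2 : (∫ x, D.w x * nFun D.φ |fn (0 : D.Space) x|) = 0 :=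
    integral_eq_zero_of_ae (P.modularMap_fn_volume.map_zero.mono fun x hx => by
      simp [hx, nFun_zero])
  have e3 : (∫ x, ∫ t in (0 : ℝ)..fn (0 : D.Space) x, gFun S f p x t) = 0 :=
    integral_eq_zero_of_ae (P.modularMap_fn_volume.map_zero.mono fun x hx => by
      simp [hx])
  rw [SpaceData.energy, e1, e2, e3]
  ring

/-- Along bounded sequences on the Nehari manifold with positive energy, `L'(u) u` stays away
from zero. -/
theorem exists_le_abs_fderiv_nehariFn (P : Penalized D S f p w₀ ν θ τ q γ) {U : ℕ → D.Space}
    {R c : ℝ} (hc : 0 < c) (hR : ∀ n, ‖U n‖ ≤ R) (hU : ∀ n, U n ∈ nehari (D.energy (gFun S f p)))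
    (hJ : Tendsto (fun n => D.energy (gFun S f p) (U n)) atTop (𝓝 c)) :
    ∃ α > 0, ∀ᶠ n in atTop, α ≤ |fderiv ℝ (nehariFn (D.energy (gFun S f p))) (U n) (U n)| := by
  -- Otherwise `L'(u)u → 0` along a subsequence, which then tends to zero, so its energy tends to
  -- `J(0) = 0` instead of `c > 0`.
  by_contra! hcon
  have hpos : ∀ k : ℕ, (0 : ℝ) < 1 / ((k : ℝ) + 1) := fun k => Nat.one_div_pos_of_nat
  obtain ⟨σ, hσ, hlim⟩ := extraction_forall_of_frequently fun k => hcon _ (hpos k)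
  have hz := P.tendsto_zero_of_nehari (U := fun n => U (σ n)) (fun n => hR _)
    (by simp only [(hU _).2]; exact tendsto_const_nhds)
    (squeeze_zero_norm (fun n => (hlim n).le) tendsto_one_div_add_atTop_nhds_zero_nat)
  have h1 := (P.contDiff_energy.continuous.tendsto 0).comp hz
  rw [P.energy_zero] at h1
  exact hc.ne (tendsto_nhds_unique h1 (hJ.comp hσ.tendsto_atTop))

/-- The lower bound on `|L'(u_n)u_n|` makes the sequence almost critical for the unconstrained
functional. The limit lies on the manifold: `L` is continuous, and the positive level keeps the
limit away from the origin. -/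
theorem nehariPalaisSmaleAt (P : Penalized D S f p w₀ ν θ τ q γ) {c : ℝ} (hc : 0 < c) :
    NehariPalaisSmaleAt (D.energy (gFun S f p)) c := by
  intro U hU hJ ht
  obtain ⟨R, hR⟩ := P.bounded_of_tendsto hJ fun δ hδ => Eventually.of_forall fun n => by
    rw [(hU n).2, abs_zero]
    positivity
  obtain ⟨α, hα, hev⟩ := P.exists_le_abs_fderiv_nehariFn hc hR hU hJ
  obtain ⟨K, hK⟩ := P.exists_norm_fderiv_nehariFn_le R
  have hJ' : Tendsto (fun n => ‖fderiv ℝ (D.energy (gFun S f p)) (U n)‖) atTop (𝓝 0) := by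
    have h1 := ht.mul_const (1 + K / α * R)
    rw [zero_mul] at h1
    refine squeeze_zero' (Eventually.of_forall fun n => norm_nonneg _) ?_ h1
    filter_upwards [hev] with n hn
    exact norm_fderiv_le_of_nehari (hU n).2 hα hn (hK _ (hR n)) (hR n)
  obtain ⟨σ, V, hσ, hV⟩ := P.exists_tendsto_of_fderiv hR hJ'
  refine ⟨V, ⟨?_, ?_⟩, σ, hσ, hV⟩
  · rintro rfl
    have h1 := (P.contDiff_energy.continuous.tendsto 0).comp hV
    rw [P.energy_zero] at h1
    exact hc.ne (tendsto_nhds_unique h1 (hJ.comp hσ.tendsto_atTop))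
  · have h1 := (P.contDiff_nehariFn.continuous.tendsto V).comp hV
    refine tendsto_nhds_unique h1 (tendsto_const_nhds.congr fun n => ?_)
    exact (hU (σ n)).2.symm

end Penalized
end OrliczNehari

/-! ### Application to the rescaled problem -/

namespace OrliczNehari

variable {N : ℕ} {φ : ℝ → ℝ} {l m : ℝ} {r b f : ℝ → ℝ} {θ : ℝ}
  {V : EuclideanSpace ℝ (Fin N) → ℝ} {V₀ : ℝ} {Ω : Set (EuclideanSpace ℝ (Fin N))}
  {k a t₀ t₁ : ℝ} {η : ℝ → ℝ}

/-- The rescaled problem is a penalized problem. -/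
theorem exists_penalized (hφ : PhiAssumptions N φ l m) (hr : RAssumptions N φ r)
    (hb : BAssumptions N φ l m b) (hf : FAssumptions r b m f θ)
    (hV : PotentialAssumptions V V₀ Ω)
    (hη : PenalizationAssumptions φ f l m θ V₀ k a t₀ t₁ η) {ε : ℝ} (hε : 0 < ε) :
    ∃ q, Penalized (xData hφ hV ε) {x | ε • x ∈ Ω} f (fTilde φ f V₀ k a t₀ t₁ η) V₀ (V₀ / k) θ t₀
      q (gammaExp φ l m) := by
  obtain ⟨q, hmq, hq, hadm⟩ := hf.exists_growth hφ hr hb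
  have hk := hη.one_lt_k hφ hf.m_lt_theta
  have hk0 : 0 < k := one_pos.trans hk
  have hl : 0 < l := by linarith [hφ.one_lt_l]
  have hθm : 0 < θ - m := sub_pos.2 hf.m_lt_theta
  refine ⟨q, ?_⟩
  exact
    { κ_eq := rfl
      w₀_pos := hV.pos
      le_w := fun x => hV.isGLB.1 (mem_range_self _)
      measurableSet := (hV.isOpen.preimage (continuous_const_smul ε)).measurableSet
      isBounded := by
        obtain ⟨R, hR⟩ := hV.isBounded.subset_closedBall 0
        refine (Metric.isBounded_closedBall (x := 0) (r := R / ε)).subset fun x hx => ?_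
        have h1 := hR hx
        rw [mem_closedBall_zero_iff, norm_smul, Real.norm_of_nonneg hε.le] at h1
        rw [mem_closedBall_zero_iff, le_div_iff₀ hε]
        linarith
      one_le_γ := (one_lt_gammaExp hφ).le
      γ_lt := gammaExp_lt hφ
      rpow_γ := rpow_gammaExp_le hφ
      m_le_q := hmq
      q_lt := hq
      adm_f := hadm
      adm_p := hη.isAdmissible_fTilde hφ hf hV.pos hmq hadm
      m_lt_θ := hf.m_lt_theta
      p_nonneg := hη.fTilde_nonneg hφ hf
      superlinear := hf.superlinear
      f_deriv := fun s hs => hf.mul_le_deriv_mul hs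
      ν_nonneg := (div_pos hV.pos hk0).le
      ν_lt := div_lt_self hV.pos hk
      ν_small := by
        -- With `w₀ = V₀` and `ν = V₀ / k`, the required inequality is the lower bound on `k` with
        -- denominators cleared.
        have h1 := hη.k_large
        have h2 : (θ - l) * m < (θ - m) * l * k := by
          rw [div_mul_div_comm, div_lt_iff₀ (mul_pos hθm hl)] at h1
          linarith
        change (θ - l) * m * (V₀ / k) < (θ - m) * l * V₀
        rw [mul_div_assoc', div_lt_iff₀ hk0]
        have := mul_lt_mul_of_pos_right h2 hV.pos
        linarith
      p_le := fun s hs => hη.fTilde_le hφ hf hs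
      p_deriv := fun s hs => hη.fTilde_mul_le_deriv hφ hf hs
      p_integral := fun s hs => hη.integral_fTilde_le hφ hf hs
      p_eq := fun s hs => hη.fTilde_of_le hs
      strict := hf.exists_Icc_strict hη.t₀_pos }

theorem energyJ_eq (hφ : PhiAssumptions N φ l m) (hV : PotentialAssumptions V V₀ Ω) (ε : ℝ) :
    energyJ hφ hV ε (gPen Ω φ f V₀ k a t₀ t₁ η)
      = (xData hφ hV ε).energy (gFun {x | ε • x ∈ Ω} f (fTilde φ f V₀ k a t₀ t₁ η)) := rfl

end OrliczNehari

theorem proposition2p1 {N : ℕ} (hN : 2 ≤ N) {φ : ℝ → ℝ} {l m : ℝ}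
    (hφ : OrliczNehari.PhiAssumptions N φ l m)
    {r : ℝ → ℝ} (hr : OrliczNehari.RAssumptions N φ r)
    {b : ℝ → ℝ} (hb : OrliczNehari.BAssumptions N φ l m b)
    {f : ℝ → ℝ} {θ : ℝ} (hf : OrliczNehari.FAssumptions r b m f θ)
    {V : EuclideanSpace ℝ (Fin N) → ℝ} {V₀ : ℝ} {Ω : Set (EuclideanSpace ℝ (Fin N))}
    (hV : OrliczNehari.PotentialAssumptions V V₀ Ω)
    {k a t₀ t₁ : ℝ} {η : ℝ → ℝ}
    (hη : OrliczNehari.PenalizationAssumptions φ f l m θ V₀ k a t₀ t₁ η)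
    {ε : ℝ} (hε : 0 < ε) :
    let J : (OrliczNehari.xData hφ hV ε).Space → ℝ :=
      OrliczNehari.energyJ hφ hV ε (OrliczNehari.gPen Ω φ f V₀ k a t₀ t₁ η)
    let d₀ : ℝ := OrliczNehari.mountainPassLevel (OrliczNehari.energyE₀ hφ hV f)
    -- `J` and `L(u) = J'(u) u` are `C¹` and `L' ≠ 0` on the Nehari manifold, so that
    -- derivatives and tangent spaces have their proper meaning
    (ContDiff ℝ 1 J ∧ ContDiff ℝ 1 (OrliczNehari.nehariFn J) ∧
      ∀ u ∈ OrliczNehari.nehari J, fderiv ℝ (OrliczNehari.nehariFn J) u ≠ 0) ∧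
    (∀ c : ℝ, OrliczNehari.PalaisSmaleAt J c) ∧
    (∀ c ∈ Set.Ioo 0 (d₀ + 1), OrliczNehari.NehariPalaisSmaleAt J c) ∧
    (∀ u ∈ OrliczNehari.nehari J, OrliczNehari.tangentialDeriv J u = 0 → fderiv ℝ J u = 0) := by
  obtain ⟨q, P⟩ := OrliczNehari.exists_penalized hφ hr hb hf hV hη hε
  intro J d₀
  have hJ : J = (OrliczNehari.xData hφ hV ε).energy (OrliczNehari.gFun {x | ε • x ∈ Ω} f
      (OrliczNehari.fTilde φ f V₀ k a t₀ t₁ η)) := OrliczNehari.energyJ_eq hφ hV ε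
  rw [hJ]
  refine ⟨⟨P.contDiff_energy, P.contDiff_nehariFn, fun u hu h0 => ?_⟩, P.palaisSmaleAt,
    fun c hc => P.nehariPalaisSmaleAt hc.1, fun u hu h0 => ?_⟩
  · exact P.fderiv_nehariFn_self_ne_zero hu (by rw [h0, zero_apply])
  · exact OrliczNehari.fderiv_eq_zero_of_tangentialDeriv hu.2
      (P.fderiv_nehariFn_self_ne_zero hu) h0
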